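/- Conventions. All manifolds are smooth. Let $n\ge 0$, let $N$ be a closed manifold of dimension $2n+3$, and let $\mathbb D^2\subset\mathbb C$ be the open unit disk. An open book $(B,\theta)$ on $N$ consists of a closed codimension-$2$ submanifold $B\subset N$ (the binding) with trivial normal bundle and a smooth locally trivial fibre bundle $\theta\colon N\setminus B\to S^1$ (whose fibres are the pages), together with a trivialization $\mathbb D^2\times B\subset N$ of a neighbourhood of $B=\{0\}\times B$ in which $\theta(z,b)=z/|z|$. A contact form $\alpha$ on $N$ (i.e. $\alpha\wedge(d\alpha)^{n+1}\neq0$ everywhere) is adapted to $(B,\theta)$ if $\alpha|_{TB}$ is a contact form on $B$, $d\alpha$ is symplectic on every page $P$, and the orientation of $B$ given by $\alpha|_{TB}$ is its orientation as boundary of $(\overline P,d\alpha)$. The contact structure $\ker\alpha$ is supported by $(B,\theta)$ if it is the kernel of an adapted contact form. For a diffeomorphism $\Phi$ of a manifold $P$, the mapping torus $P_\Phi$ is $\mathbb R\times P$ modulo $(t,p)\sim(t+1,\Phi(p))$, with the projection $[t,p]\mapsto e^{2\pi i t}$ to $S^1$. A $k$-fold cyclic covering branched over $B$ is a smooth surjection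 $f\colon M\to N$ that over $N\setminus B$ is a smooth $k$-fold covering on whose fibres the group $\mathbb Z/k$ generated by a diffeomorphism $\tau$ of $M$ with $f\circ\tau=f$ acts simply transitively, and that near each point of $f^{-1}(B)$ is $(z,y)\mapsto(z^k,y)$ in suitable coordinates of $M$ and $N$ with values in $\mathbb C\times\mathbb R^{2n+1}$, where $B=\{z=0\}$. Statement. Let $k\ge1$, and let $\alpha$ be a contact form on $N$ whose contact structure is supported by an open book $(B,\theta)$. Then $N\setminus B$ is, compatibly with $\theta$, diffeomorphic to a mapping torus $P_\Phi$, and there exist a closed manifold $M$ and a $k$-fold cyclic covering $f\colon M\to N$ branched over $B$ with the following properties. 1. There is a smooth map $\theta'=\sqrt[k]{\theta\circ f}\colon M\setminus f^{-1}(B)\to S^1$ with $(\theta')^k=\theta\circ f$ such that $(f^{-1}(B),\theta')$ is an open book on $M$, with a neighbourhood $\mathbb D^2\times B$ of its binding on which $f(re^{i\phi},b)=(g(r)e^{ik\phi},b)$, where $g$ is a smooth function, strictly increasing on $[0,\infty)$, that equals $r^k$ for $r\ge 0$ close to $0$ and equals $r$ for $r>\delta$, for some $\delta<1$. 2. Whenever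 $N\setminus B\cong P_\Phi$ compatibly with $\theta$, one has $M\setminus f^{-1}(B)\cong P_{\Phi^k}$ compatibly with $\theta'$, in such a way that $f([t,p])=[kt,p]$; and $\mathbb D^2\times B$ is glued to $P_{\Phi^k}$ correspondingly: if $p\in P$, $b\in B$ and $0<r<1$ are such that $[t,p]=(g(r)e^{2\pi i t},b)$ in $N$ for all $t$, then $[t,p]=(re^{2\pi it},b)$ in $M$ for all $t$. 3. There are a smooth $1$-form $\gamma$ on $M$ with $d\gamma|_{\ker df}>0$ along $f^{-1}(B)$ (where $\ker df$ has the orientation that together with the orientation of $f^{-1}(B)$ by $f^*\alpha$ gives the orientation of $M$ by $f^*\alpha$) and an $\epsilon_0>0$ such that for all $0<\epsilon<\epsilon_0$ the form $f^*\alpha+\epsilon\gamma$ is a contact form on $M$, so that its kernel is the contact structure of the contact branched covering, and this contact structure is supported by the open book $(f^{-1}(B),\theta')$. If $\alpha$ itself is adapted to $(B,\theta)$, then $f^*\alpha+\epsilon\gamma$ is adapted to $(f^{-1}(B),\theta')$. -/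

import Mathlib

open scoped Manifold ContDiff Topology
open Set Filter

universe u

noncomputable section

namespace ContactOpenBook

/-! ### Exterior algebra at a point

For a 1-form `a` and a 2-form `w` on a vector space `V`, the two functions below are `a ∧ wⁿ` and
`wⁿ`, evaluated on tuples of vectors, in the convention
`(a ∧ b)(u, v) = a u * b v - a v * b u`. -/

/-- `(a ∧ wⁿ)(v₀, …, v₂ₙ)`. -/
def wedgePow {V : Type*} (n : ℕ) (a : V → ℝ) (w : V → V → ℝ) (v : Fin (2 * n + 1) → V) : ℝ :=
  (2 ^ n : ℝ)⁻¹ * ∑ σ : Equiv.Perm (Fin (2 * n + 1)), ((Equiv.Perm.sign σ : ℤ) : ℝ) *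
    (a (v (σ 0)) *
      ∏ i : Fin n, w (v (σ ⟨2 * i + 1, by omega⟩)) (v (σ ⟨2 * i + 2, by omega⟩)))

/-- `(wⁿ)(v₀, …, v₂ₙ₋₁)`. -/
def pow2Form {V : Type*} (n : ℕ) (w : V → V → ℝ) (v : Fin (2 * n) → V) : ℝ :=
  (2 ^ n : ℝ)⁻¹ * ∑ σ : Equiv.Perm (Fin (2 * n)), ((Equiv.Perm.sign σ : ℤ) : ℝ) *
    ∏ i : Fin n, w (v (σ ⟨2 * i, by omega⟩)) (v (σ ⟨2 * i + 1, by omega⟩))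

/-! ### Smooth 1-forms on manifolds without boundary -/

/-- A (not necessarily smooth) 1-form on a `d`-dimensional manifold. -/
abbrev OneForm (d : ℕ) (X : Type*) [TopologicalSpace X]
    [ChartedSpace (EuclideanSpace ℝ (Fin d)) X] : Type _ :=
  ∀ x : X, TangentSpace (𝓡 d) x →L[ℝ] ℝ

section OneForm

variable {d d' : ℕ} {X Y : Type*}
  [TopologicalSpace X] [ChartedSpace (EuclideanSpace ℝ (Fin d)) X]
  [TopologicalSpace Y] [ChartedSpace (EuclideanSpace ℝ (Fin d')) Y]

/-- The differential at `y` of the inverse of the preferred chart at `x₀`. It sends a constant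
vector field in this chart to its value at `y`. -/
def chartVec (x₀ y : X) : EuclideanSpace ℝ (Fin d) →L[ℝ] TangentSpace (𝓡 d) y :=
  mfderiv 𝓘(ℝ, EuclideanSpace ℝ (Fin d)) (𝓡 d) (extChartAt (𝓡 d) x₀).symm
    (extChartAt (𝓡 d) x₀ y)

/-- The coordinate expression of a 1-form in the preferred chart at `x₀`, i.e. its pull-back
under the inverse of that chart. -/
def OneForm.inChart (α : OneForm d X) (x₀ : X) :
    EuclideanSpace ℝ (Fin d) → EuclideanSpace ℝ (Fin d) →L[ℝ] ℝ :=
  fun y => (α ((extChartAt (𝓡 d) x₀).symm y)).comp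
    (mfderiv 𝓘(ℝ, EuclideanSpace ℝ (Fin d)) (𝓡 d) (extChartAt (𝓡 d) x₀).symm y)

/-- A 1-form is smooth if its coordinate expressions are. -/
def OneForm.Smooth (α : OneForm d X) : Prop :=
  ∀ x₀ : X, ContDiffOn ℝ ∞ (OneForm.inChart α x₀) (extChartAt (𝓡 d) x₀).target

/-- The exterior derivative of a 1-form at `x`, computed in the preferred chart at `x`, with
respect to which the tangent space at `x` is identified with the model space. -/
def OneForm.extD (α : OneForm d X) (x : X) (u v : TangentSpace (𝓡 d) x) : ℝ :=
  fderiv ℝ (OneForm.inChart α x) (extChartAt (𝓡 d) x x) u v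
    - fderiv ℝ (OneForm.inChart α x) (extChartAt (𝓡 d) x x) v u

/-- The pull-back `f^*α`. -/
def OneForm.pullback (f : X → Y) (α : OneForm d' Y) : OneForm d X :=
  fun x => (α (f x)).comp (mfderiv (𝓡 d) (𝓡 d') f x)

end OneForm

section Contact

variable {X : Type*} [TopologicalSpace X] (n : ℕ)
  [ChartedSpace (EuclideanSpace ℝ (Fin (2 * n + 1))) X]

/-- `(α ∧ (dα)ⁿ)_x(v₀, …, v₂ₙ)`. -/
def contactVol (α : OneForm (2 * n + 1) X) (x : X)
    (v : Fin (2 * n + 1) → TangentSpace (𝓡 (2 * n + 1)) x) : ℝ :=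
  wedgePow n (fun u => α x u) (OneForm.extD α x) v

/-- A contact form on a `(2n+1)`-dimensional manifold: a smooth 1-form `α` such that
`α ∧ (dα)ⁿ` vanishes nowhere. -/
structure IsContactForm (α : OneForm (2 * n + 1) X) : Prop where
  smooth : OneForm.Smooth α
  vol_ne_zero : ∀ x : X, ∃ v, contactVol n α x v ≠ 0

end Contact

/-! ### Open books

The ambient manifold has dimension `2(n+1)+1`, the pages have dimension `2(n+1)` and the
binding has dimension `2n+1`. -/

/-- An open book on `N` whose binding is (a copy of) the manifold `B`. The value of `θ` on the
binding is irrelevant. -/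
structure OpenBook (n : ℕ) (N B : Type u)
    [TopologicalSpace N] [ChartedSpace (EuclideanSpace ℝ (Fin (2 * (n + 1) + 1))) N]
    [TopologicalSpace B] [ChartedSpace (EuclideanSpace ℝ (Fin (2 * n + 1))) B] where
  /-- the trivialized neighbourhood `𝔻² × B` of the binding, which is `{0} × B` -/
  tube : PartialDiffeomorph (𝓘(ℝ, ℂ).prod (𝓡 (2 * n + 1))) (𝓡 (2 * (n + 1) + 1)) (ℂ × B) N ∞
  tube_source : tube.source = Metric.ball (0 : ℂ) 1 ×ˢ (univ : Set B)
  /-- the projection to the circle -/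
  θ : N → Circle
  θ_smooth : ContMDiffOn (𝓡 (2 * (n + 1) + 1)) (𝓡 1) ∞ θ (range fun b : B => tube (0, b))ᶜ
  /-- off the binding, `θ` is a smooth (locally trivial) fibre bundle over the circle -/
  θ_bundle : ∀ s : Circle, ∃ (P : Type u) (_ : TopologicalSpace P)
    (_ : ChartedSpace (EuclideanSpace ℝ (Fin (2 * (n + 1)))) P)
    (_ : IsManifold (𝓡 (2 * (n + 1))) ∞ P)
    (T : PartialDiffeomorph ((𝓡 1).prod (𝓡 (2 * (n + 1)))) (𝓡 (2 * (n + 1) + 1))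
      (Circle × P) N ∞) (V : Set Circle),
    IsOpen V ∧ s ∈ V ∧ T.source = V ×ˢ (univ : Set P) ∧
      T.target = {x | x ∉ range (fun b : B => tube (0, b)) ∧ θ x ∈ V} ∧
      ∀ q ∈ T.source, θ (T q) = q.1
  /-- in the neighbourhood of the binding, `θ` is the angular coordinate of the disk -/
  θ_tube : ∀ (z : ℂ) (b : B), z ≠ 0 → ‖z‖ < 1 → (θ (tube (z, b)) : ℂ) = z / (‖z‖ : ℂ)

namespace OpenBook

variable {n : ℕ} {N B : Type u}
  [TopologicalSpace N] [ChartedSpace (EuclideanSpace ℝ (Fin (2 * (n + 1) + 1))) N]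
  [TopologicalSpace B] [ChartedSpace (EuclideanSpace ℝ (Fin (2 * n + 1))) B]

/-- The embedding of the binding. -/
def incl (ob : OpenBook n N B) (b : B) : N := ob.tube (0, b)

/-- The binding as a subset. -/
def binding (ob : OpenBook n N B) : Set N := range ob.incl

/-- The image under the differential of `𝔻² × B → N`, at `(z, b)`, of the vector `(w, e)`. -/
def tubeVec (ob : OpenBook n N B) (z : ℂ) (b : B) (w : ℂ) (e : TangentSpace (𝓡 (2 * n + 1)) b) :
    TangentSpace (𝓡 (2 * (n + 1) + 1)) (ob.tube (z, b)) :=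
  mfderiv (𝓘(ℝ, ℂ).prod (𝓡 (2 * n + 1))) (𝓡 (2 * (n + 1) + 1)) ob.tube (z, b)
    ((w, e) : ℂ × EuclideanSpace ℝ (Fin (2 * n + 1)))

/-- The contact form `α` is adapted to the open book.

The tangent space of the page through `x` is the kernel of the differential of `θ`. In the
neighbourhood `𝔻² × B`, the page over `s` is `{r s | 0 < r < 1} × B`, and the direction pointing out
of its closure along the boundary `{0} × B` is that of `-s ∈ ℂ`. The form `(dα)ⁿ⁺¹` degenerates on
the closed page along `B`, so that its orientation is read off in the interior of the collar. -/
structure IsAdapted (ob : OpenBook n N B) (α : OneForm (2 * (n + 1) + 1) N) : Prop where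
  contact : IsContactForm (n + 1) α
  binding_contact : IsContactForm n (OneForm.pullback ob.incl α : OneForm (2 * n + 1) B)
  page_symplectic : ∀ x ∉ ob.binding, ∀ u : TangentSpace (𝓡 (2 * (n + 1) + 1)) x,
    mfderiv (𝓡 (2 * (n + 1) + 1)) (𝓡 1) ob.θ x u = 0 → u ≠ 0 →
      ∃ v : TangentSpace (𝓡 (2 * (n + 1) + 1)) x,
        mfderiv (𝓡 (2 * (n + 1) + 1)) (𝓡 1) ob.θ x v = 0 ∧ OneForm.extD α x u v ≠ 0
  boundary_orientation : ∀ (b : B) (e : Fin (2 * n + 1) → TangentSpace (𝓡 (2 * n + 1)) b),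
    0 < contactVol n (OneForm.pullback ob.incl α : OneForm (2 * n + 1) B) b e →
      ∀ (s : Circle) (r : ℝ), 0 < r → r < 1 →
        0 < pow2Form (n + 1) (OneForm.extD α (ob.tube ((r : ℂ) * (s : ℂ), b)))
          (Fin.cons (ob.tubeVec ((r : ℂ) * (s : ℂ)) b (-(s : ℂ)) 0)
            (fun i => ob.tubeVec ((r : ℂ) * (s : ℂ)) b 0 (e i)) : Fin (2 * n + 1 + 1) → _)

/-- The contact structure `ker α` is supported by the open book: it is the kernel of an adapted
contact form. -/
def Supports (ob : OpenBook n N B) (α : OneForm (2 * (n + 1) + 1) N) : Prop :=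
  ∃ α' : OneForm (2 * (n + 1) + 1) N, ob.IsAdapted α' ∧
    ∀ (x : N) (v : TangentSpace (𝓡 (2 * (n + 1) + 1)) x), α' x v = 0 ↔ α x v = 0

/-- The map `q : ℝ × P → N` exhibits the complement of the binding, with its projection `θ`, as the
mapping torus `(ℝ × P) / ((t, p) ∼ (t + 1, Φ p))` of the diffeomorphism `Φ` of `P`, with the
projection `[t, p] ↦ exp (2πit)`. -/
structure IsMappingTorus (ob : OpenBook n N B) {P : Type u} [TopologicalSpace P]
    [ChartedSpace (EuclideanSpace ℝ (Fin (2 * (n + 1)))) P]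
    (Φ : Equiv.Perm P) (q : ℝ × P → N) : Prop where
  smooth : ContMDiff (𝓡 (2 * (n + 1))) (𝓡 (2 * (n + 1))) ∞ Φ
  smooth_symm : ContMDiff (𝓡 (2 * (n + 1))) (𝓡 (2 * (n + 1))) ∞ Φ.symm
  localDiffeo : IsLocalDiffeomorph (𝓘(ℝ, ℝ).prod (𝓡 (2 * (n + 1)))) (𝓡 (2 * (n + 1) + 1)) ∞ q
  range_eq : range q = ob.bindingᶜ
  eq_iff : ∀ (t t' : ℝ) (p p' : P),
    q (t, p) = q (t', p') ↔ ∃ m : ℤ, t' = t + m ∧ p' = (Φ ^ m) p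
  θ_eq : ∀ (t : ℝ) (p : P), ob.θ (q (t, p)) = Circle.exp (2 * Real.pi * t)

end OpenBook

/-! ### Branched coverings -/

section Branched

/-- `f : M → N` is a `k`-fold cyclic covering branched over the codimension-2 submanifold
`A ⊆ N`: a smooth surjection, which is a smooth covering with deck group `ℤ/k`, acting simply
transitively on the fibres, over the complement of `A`, and which has the form
`(z, y) ↦ (zᵏ, y)` in suitable local coordinates at every point of `f⁻¹(A)`, where `A` is given by
the vanishing of the first coordinate. -/
structure IsCyclicBranchedCover (n k : ℕ) {M N : Type u}
    [TopologicalSpace M] [ChartedSpace (EuclideanSpace ℝ (Fin (2 * (n + 1) + 1))) M]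
    [TopologicalSpace N] [ChartedSpace (EuclideanSpace ℝ (Fin (2 * (n + 1) + 1))) N]
    (f : M → N) (A : Set N) : Prop where
  smooth : ContMDiff (𝓡 (2 * (n + 1) + 1)) (𝓡 (2 * (n + 1) + 1)) ∞ f
  surjective : Function.Surjective f
  covering : IsCoveringMapOn f Aᶜ
  localDiffeo :
    IsLocalDiffeomorphOn (𝓡 (2 * (n + 1) + 1)) (𝓡 (2 * (n + 1) + 1)) ∞ f (f ⁻¹' A)ᶜ
  cyclic : ∃ τ : Equiv.Perm M,
    ContMDiff (𝓡 (2 * (n + 1) + 1)) (𝓡 (2 * (n + 1) + 1)) ∞ τ ∧ τ ^ k = 1 ∧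
    (∀ x, f (τ x) = f x) ∧
    (∀ x, f x ∉ A → ∀ j : ℕ, (τ ^ j) x = x → k ∣ j) ∧
    (∀ x y, f x ∉ A → f x = f y → ∃ j : ℕ, y = (τ ^ j) x)
  branching : ∀ x, f x ∈ A → ∃
    (φ : PartialDiffeomorph (𝓡 (2 * (n + 1) + 1)) 𝓘(ℝ, ℂ × EuclideanSpace ℝ (Fin (2 * n + 1))) M
      (ℂ × EuclideanSpace ℝ (Fin (2 * n + 1))) ∞)
    (ψ : PartialDiffeomorph (𝓡 (2 * (n + 1) + 1)) 𝓘(ℝ, ℂ × EuclideanSpace ℝ (Fin (2 * n + 1))) N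
      (ℂ × EuclideanSpace ℝ (Fin (2 * n + 1))) ∞),
    x ∈ φ.source ∧ MapsTo f φ.source ψ.source ∧
    (∀ y ∈ ψ.source, y ∈ A ↔ (ψ y).1 = 0) ∧
    ∀ y ∈ φ.source, ψ (f y) = ((φ y).1 ^ k, (φ y).2)

variable {n : ℕ} {M N : Type u}
  [TopologicalSpace M] [ChartedSpace (EuclideanSpace ℝ (Fin (2 * (n + 1) + 1))) M]
  [TopologicalSpace N] [ChartedSpace (EuclideanSpace ℝ (Fin (2 * (n + 1) + 1))) N]

/-- A frame `v` of the tangent space at `x` is positive for the orientation that the form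
`β ∧ (dβ)ⁿ` defines on the complement of the set `A`. Here `x` may lie in `A`: the orientation is
extended by continuity, moving `v` to nearby points by a chart at `x`. -/
def IsPositiveFrame (β : OneForm (2 * (n + 1) + 1) M) (A : Set M) (x : M)
    (v : Fin (2 * (n + 1) + 1) → TangentSpace (𝓡 (2 * (n + 1) + 1)) x) : Prop :=
  ∀ᶠ y in 𝓝[Aᶜ] x, 0 < contactVol (n + 1) β y (fun i => chartVec x y (v i))

/-- `dγ` is positive on `ker df` along `f⁻¹(binding)`. The orientation of `ker df` is the one that,
followed by the orientation of the branching locus by `f^*α`, gives the orientation of `M` by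
`f^*α`. -/
def IsPositiveOnKer {B : Type u}
    [TopologicalSpace B] [ChartedSpace (EuclideanSpace ℝ (Fin (2 * n + 1))) B]
    (f : M → N) (α : OneForm (2 * (n + 1) + 1) N) (obM : OpenBook n M B)
    (γ : OneForm (2 * (n + 1) + 1) M) : Prop :=
  ∀ (b : B) (u v : TangentSpace (𝓡 (2 * (n + 1) + 1)) (obM.incl b))
    (e : Fin (2 * n + 1) → TangentSpace (𝓡 (2 * n + 1)) b),
    mfderiv (𝓡 (2 * (n + 1) + 1)) (𝓡 (2 * (n + 1) + 1)) f (obM.incl b) u = 0 →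
    mfderiv (𝓡 (2 * (n + 1) + 1)) (𝓡 (2 * (n + 1) + 1)) f (obM.incl b) v = 0 →
    0 < contactVol n
      (OneForm.pullback obM.incl (OneForm.pullback f α : OneForm (2 * (n + 1) + 1) M) :
        OneForm (2 * n + 1) B) b e →
    IsPositiveFrame (OneForm.pullback f α : OneForm (2 * (n + 1) + 1) M) obM.binding (obM.incl b)
      (Fin.cons u (Fin.cons v fun i =>
        mfderiv (𝓡 (2 * n + 1)) (𝓡 (2 * (n + 1) + 1)) obM.incl b (e i)) :
        Fin (2 * n + 1 + 1 + 1) → _) →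
    0 < OneForm.extD γ (obM.incl b) u v

end Branched

end ContactOpenBook

end

noncomputable section

namespace ContactOpenBook

/-! ### Multilinear algebra of `a ∧ wⁿ` -/

section LinearAlgebra

variable {V : Type*} [AddCommGroup V] [Module ℝ V]

/-! The covering is explicit. Let `proj` be the disk coordinate of the tube around the binding,
continued by `θ` outside the tube, and let `planeMap k` be the map `r exp(iφ) ↦ g(r) exp(ikφ)` of
the plane. `Cover` is the fibre product of `N` and `ℂ` over these two maps: a point of `N` together
with a root of its disk coordinate. Where the root is small, (root, `b`) are coordinates; away from
`0` the plane map is a local diffeomorphism (`isLocalDiffeomorphAt_planeMap`), so there the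
projection itself is a chart. The modulus of the root is determined by the base point, so off the
binding a point is a pair of `x` and an angle `s` with `sᵏ = θ(x)`, and this angle is `θ'`. In these
polar coordinates the topological claims can be read off: trivializations of `θ` pull back under `s
↦ sᵏ`, the deck group rotates the root, and `[t, p] ↦ ([kt, p], exp(2πit))` presents the complement
of the binding as the mapping torus of `Φᵏ`. That `N` minus the binding is a mapping torus at all
follows by gluing trivializations over intervals of the line (`IsTriv.glue`).

For the contact condition, `f^*α` is a contact form off the binding, but for `k ≥ 2` its volume form
vanishes along it. Put `γ = κ (x dy - y dx)`, where `x + iy` is the root, cut off, and `κ` extends a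
function on `B`. Along the binding, `df` kills the normal disk and `dγ` kills the vectors tangent to
the binding, so `wedgePow_split` computes the volume of `f^*α + εγ` as `(n + 1) ε dγ(∂x, ∂y)` times
the volume of the binding. Near the binding, the volume of `f^*α` is `|k zᵏ⁻¹|²` times that of `α`,
so it has a constant sign where it does not vanish. If `κ` is chosen such that the `ε`-derivative at
the binding has this same sign (`exists_orientation`), then the volume is nonzero nearby for all
small `ε > 0` (`exists_contact_near_binding`), and compactness gives a uniform bound
(`exists_isContactForm_cover`). Positivity of `dγ` on `ker df` then follows by a limit from points
off the binding (`extDBil_rotForm_pos`).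

For adaptedness, the root stays on a ray along each page, so `dγ` vanishes on pages
(`extDBil_rotForm_page`), and `γ` vanishes at the binding. Hence the conditions on pages and binding
are those of `f^*α`, and they transfer from `α` since `f` respects pages and is a local
diffeomorphism off the binding (`IsAdapted.cover`). This works for every coefficient `κ`. If only
`ker α` is supported, then `α = h α'` with `α'` adapted, and division by `h ∘ f` turns `f^*α + εγ`
into the analogous form for `α'` with coefficient `κ / h` (`Supports.cover`). -/

theorem prod_pair_update_left {ι κ W : Type*} [DecidableEq ι] [Fintype κ] [DecidableEq κ]
    (l r : κ → ι) (hl : Function.Injective l) (hlr : ∀ i j, l i ≠ r j)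
    (w : W → W → ℝ) (v : ι → W) (i₀ : κ) (t : W) :
    ∏ i, w (Function.update v (l i₀) t (l i)) (Function.update v (l i₀) t (r i)) =
      w t (v (r i₀)) * ∏ i ∈ Finset.univ.erase i₀, w (v (l i)) (v (r i)) := by
  rw [← Finset.mul_prod_erase _ _ (Finset.mem_univ i₀)]
  congr 1
  · rw [Function.update_self, Function.update_of_ne (hlr _ _).symm]
  · refine Finset.prod_congr rfl fun i hi => ?_
    rw [Function.update_of_ne (hl.ne (Finset.ne_of_mem_erase hi)),
      Function.update_of_ne (hlr _ _).symm]

theorem prod_pair_update_right {ι κ W : Type*} [DecidableEq ι] [Fintype κ] [DecidableEq κ]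
    (l r : κ → ι) (hr : Function.Injective r) (hlr : ∀ i j, l i ≠ r j)
    (w : W → W → ℝ) (v : ι → W) (i₀ : κ) (t : W) :
    ∏ i, w (Function.update v (r i₀) t (l i)) (Function.update v (r i₀) t (r i)) =
      w (v (l i₀)) t * ∏ i ∈ Finset.univ.erase i₀, w (v (l i)) (v (r i)) := by
  rw [← Finset.mul_prod_erase _ _ (Finset.mem_univ i₀)]
  congr 1
  · rw [Function.update_self, Function.update_of_ne (hlr _ _)]
  · refine Finset.prod_congr rfl fun i hi => ?_
    rw [Function.update_of_ne (hr.ne (Finset.ne_of_mem_erase hi)),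
      Function.update_of_ne (hlr _ _)]

/-- A function of tuples which is linear in each entry is multilinear. -/
def multilinearOfUpdate {m : ℕ} (F : (Fin m → V) → ℝ)
    (hF : ∀ (v : Fin m → V) (j : Fin m), ∃ ℓ : V →ₗ[ℝ] ℝ,
      ∀ t, F (Function.update v j t) = ℓ t) :
    MultilinearMap ℝ (fun _ : Fin m => V) ℝ where
  toFun := F
  map_update_add' := by
    intro inst v j x y
    rw [Subsingleton.elim inst (instDecidableEqFin m)]
    obtain ⟨ℓ, hℓ⟩ := hF v j
    simp only [hℓ, map_add]
  map_update_smul' := by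
    intro inst v j c x
    rw [Subsingleton.elim inst (instDecidableEqFin m)]
    obtain ⟨ℓ, hℓ⟩ := hF v j
    simp only [hℓ, map_smul]

/-- The left slot of the `i`-th pair in `a ∧ wⁿ`. -/
def slotL {n : ℕ} (i : Fin n) : Fin (2 * n + 1) := ⟨2 * i + 1, by omega⟩

/-- The right slot of the `i`-th pair in `a ∧ wⁿ`. -/
def slotR {n : ℕ} (i : Fin n) : Fin (2 * n + 1) := ⟨2 * i + 2, by omega⟩

theorem slotL_injective {n : ℕ} : Function.Injective (slotL (n := n)) := by
  intro i j h
  simp only [slotL, Fin.mk.injEq] at h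
  omega

theorem slotR_injective {n : ℕ} : Function.Injective (slotR (n := n)) := by
  intro i j h
  simp only [slotR, Fin.mk.injEq] at h
  omega

theorem slotL_ne_slotR {n : ℕ} (i j : Fin n) : slotL i ≠ slotR j := by
  intro h
  simp only [slotL, slotR, Fin.mk.injEq] at h
  omega

theorem slotL_ne_zero {n : ℕ} (i : Fin n) : slotL i ≠ 0 := by
  intro h
  simp [slotL, Fin.ext_iff] at h

theorem slotR_ne_zero {n : ℕ} (i : Fin n) : slotR i ≠ 0 := by
  intro h
  simp [slotR, Fin.ext_iff] at h

theorem slot_cases {n : ℕ} (j : Fin (2 * n + 1)) :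
    j = 0 ∨ (∃ i, j = slotL i) ∨ ∃ i, j = slotR i := by
  obtain ⟨j, hj⟩ := j
  rcases Nat.eq_zero_or_pos j with h | h
  · left; ext; simpa using h
  · right
    rcases Nat.even_or_odd' j with ⟨c, hc | hc⟩
    · right
      exact ⟨⟨c - 1, by omega⟩, by ext; simp only [slotR]; omega⟩
    · left
      exact ⟨⟨c, by omega⟩, by ext; simp only [slotL]; omega⟩

/-- `v ↦ a (v₀) w(v₁, v₂) ⋯ w(v₂ₙ₋₁, v₂ₙ)`. -/
def wedgeTerm {W : Type*} (n : ℕ) (a : W → ℝ) (w : W → W → ℝ) (v : Fin (2 * n + 1) → W) : ℝ :=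
  a (v 0) * ∏ i : Fin n, w (v (slotL i)) (v (slotR i))

theorem wedgePow_eq {W : Type*} (n : ℕ) (a : W → ℝ) (w : W → W → ℝ) (v : Fin (2 * n + 1) → W) :
    wedgePow n a w v = (2 ^ n : ℝ)⁻¹ * ∑ σ : Equiv.Perm (Fin (2 * n + 1)),
      ((Equiv.Perm.sign σ : ℤ) : ℝ) * wedgeTerm n a w (v ∘ σ) := rfl

/-- Every slot occurs in exactly one factor of the product, so with the other entries fixed the term
is a scalar multiple of `a`, of `w.flip y` or of `w y`. -/
theorem wedgeTerm_update (n : ℕ) (a : V →ₗ[ℝ] ℝ) (w : V →ₗ[ℝ] V →ₗ[ℝ] ℝ)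
    (v : Fin (2 * n + 1) → V) (j : Fin (2 * n + 1)) : ∃ ℓ : V →ₗ[ℝ] ℝ,
      ∀ t, wedgeTerm n (fun x => a x) (fun x y => w x y) (Function.update v j t) = ℓ t := by
  rcases slot_cases j with rfl | ⟨i, rfl⟩ | ⟨i, rfl⟩
  · refine ⟨(∏ i : Fin n, w (v (slotL i)) (v (slotR i))) • a, fun t => ?_⟩
    simp only [wedgeTerm, Function.update_self, Function.update_of_ne (slotL_ne_zero _),
      Function.update_of_ne (slotR_ne_zero _), LinearMap.smul_apply, smul_eq_mul]
    ring
  · refine ⟨(a (v 0) * ∏ i' ∈ Finset.univ.erase i, w (v (slotL i')) (v (slotR i'))) •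
      w.flip (v (slotR i)), fun t => ?_⟩
    rw [wedgeTerm, prod_pair_update_left _ _ slotL_injective slotL_ne_slotR (fun x y => w x y),
      Function.update_of_ne (slotL_ne_zero _).symm]
    simp only [LinearMap.smul_apply, smul_eq_mul, LinearMap.flip_apply]
    ring
  · refine ⟨(a (v 0) * ∏ i' ∈ Finset.univ.erase i, w (v (slotL i')) (v (slotR i'))) •
      w (v (slotL i)), fun t => ?_⟩
    rw [wedgeTerm, prod_pair_update_right _ _ slotR_injective slotL_ne_slotR (fun x y => w x y),
      Function.update_of_ne (slotR_ne_zero _).symm]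
    simp only [LinearMap.smul_apply, smul_eq_mul]
    ring

/-- `a ∧ wⁿ` as an alternating map. -/
def wedgePowAlt (n : ℕ) (a : V →ₗ[ℝ] ℝ) (w : V →ₗ[ℝ] V →ₗ[ℝ] ℝ) :
    V [⋀^Fin (2 * n + 1)]→ₗ[ℝ] ℝ :=
  (2 ^ n : ℝ)⁻¹ • MultilinearMap.alternatization
    (multilinearOfUpdate (wedgeTerm n (fun x => a x) (fun x y => w x y)) (wedgeTerm_update n a w))

theorem wedgePowAlt_apply (n : ℕ) (a : V →ₗ[ℝ] ℝ) (w : V →ₗ[ℝ] V →ₗ[ℝ] ℝ)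
    (v : Fin (2 * n + 1) → V) :
    wedgePowAlt n a w v = wedgePow n (fun x => a x) (fun x y => w x y) v := by
  rw [wedgePow_eq, wedgePowAlt, AlternatingMap.smul_apply, MultilinearMap.alternatization_apply,
    smul_eq_mul]
  congr 1
  refine Finset.sum_congr rfl fun σ _ => ?_
  rw [Units.smul_def, zsmul_eq_mul]
  rfl

/-- `(wⁿ)(c v₀, v₁, …) = c (wⁿ)(v₀, v₁, …)`. -/
theorem pow2Form_smul_head (n : ℕ) (w : V →ₗ[ℝ] V →ₗ[ℝ] ℝ) (c : ℝ) (u : V)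
    (e : Fin (2 * n + 1) → V) :
    pow2Form (n + 1) (fun x y => w x y) (Fin.cons (c • u) e : Fin (2 * n + 1 + 1) → V) =
      c * pow2Form (n + 1) (fun x y => w x y) (Fin.cons u e : Fin (2 * n + 1 + 1) → V) := by
  set v : Fin (2 * (n + 1)) → V := (Fin.cons u e : Fin (2 * n + 1 + 1) → V)
  have hv : (Fin.cons (c • u) e : Fin (2 * n + 1 + 1) → V) =
      Function.update v (0 : Fin (2 * n + 1 + 1)) (c • u) := by
    funext j
    refine Fin.cases ?_ (fun j => ?_) j
    · rw [Function.update_self, Fin.cons_zero]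
    · rw [Function.update_of_ne (Fin.succ_ne_zero j), Fin.cons_succ]
      rfl
  rw [show pow2Form (n + 1) (fun x y => w x y) (Fin.cons (c • u) e : Fin (2 * n + 1 + 1) → V) =
    pow2Form (n + 1) (fun x y => w x y) (Function.update v (0 : Fin (2 * n + 1 + 1)) (c • u)) from
    congrArg _ hv]
  have hv0 : v (0 : Fin (2 * n + 1 + 1)) = u := rfl
  unfold pow2Form
  rw [mul_left_comm c]
  congr 1
  rw [Finset.mul_sum]
  refine Finset.sum_congr rfl fun σ _ => ?_
  rw [mul_left_comm c]
  congr 1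
  let l : Fin (n + 1) → Fin (2 * (n + 1)) := fun i => σ ⟨2 * i, by omega⟩
  let r : Fin (n + 1) → Fin (2 * (n + 1)) := fun i => σ ⟨2 * i + 1, by omega⟩
  have hl : Function.Injective l := by
    intro i j h
    have := σ.injective h
    simp only [Fin.mk.injEq] at this
    omega
  have hr : Function.Injective r := by
    intro i j h
    have := σ.injective h
    simp only [Fin.mk.injEq] at this
    omega
  have hlr : ∀ i j, l i ≠ r j := by
    intro i j h
    have := σ.injective h
    simp only [Fin.mk.injEq] at this
    omega
  -- The first vector sits at an even or at an odd position of the permuted tuple, hence in exactly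
  -- one factor, and `c` comes out once.
  have hcover : (∃ i, (0 : Fin (2 * n + 1 + 1)) = l i) ∨ ∃ i, (0 : Fin (2 * n + 1 + 1)) = r i := by
    obtain ⟨j, hj⟩ := σ.surjective (0 : Fin (2 * n + 1 + 1))
    rcases Nat.even_or_odd' j.1 with ⟨d, hd | hd⟩
    · exact Or.inl ⟨⟨d, by omega⟩, by rw [← hj]; exact congrArg σ (Fin.ext hd)⟩
    · exact Or.inr ⟨⟨d, by omega⟩, by rw [← hj]; exact congrArg σ (Fin.ext hd)⟩
  change ∏ i, w (Function.update v _ (c • u) (l i)) (Function.update v _ (c • u) (r i)) =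
    c * ∏ i, w (v (l i)) (v (r i))
  rcases hcover with ⟨i, hi⟩ | ⟨i, hi⟩
  · rw [← Finset.mul_prod_erase _ (fun i => w (v (l i)) (v (r i))) (Finset.mem_univ i), hi,
      prod_pair_update_left l r hl hlr (fun x y => w x y), ← hi, hv0]
    simp only [map_smul, LinearMap.smul_apply, smul_eq_mul]
    ring
  · rw [← Finset.mul_prod_erase _ (fun i => w (v (l i)) (v (r i))) (Finset.mem_univ i), hi,
      prod_pair_update_right l r hr hlr (fun x y => w x y), ← hi, hv0]
    simp only [map_smul, smul_eq_mul]
    ring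

theorem wedgePow_ne_zero_linearIndependent (n : ℕ) (a : V →ₗ[ℝ] ℝ) (w : V →ₗ[ℝ] V →ₗ[ℝ] ℝ)
    (v : Fin (2 * n + 1) → V) (h : wedgePow n (fun x => a x) (fun x y => w x y) v ≠ 0) :
    LinearIndependent ℝ v := by
  by_contra hv
  rw [← wedgePowAlt_apply] at h
  exact h (AlternatingMap.map_linearDependent _ _ hv)

/-- In top degree a nonzero alternating form is nonzero on every basis, so the contact condition can
be tested on any convenient frame. -/
theorem wedgePow_ne_zero_of_linearIndependent [FiniteDimensional ℝ V] (n : ℕ)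
    (hdim : Module.finrank ℝ V = 2 * n + 1) (a : V →ₗ[ℝ] ℝ) (w : V →ₗ[ℝ] V →ₗ[ℝ] ℝ)
    (h : ∃ v, wedgePow n (fun x => a x) (fun x y => w x y) v ≠ 0)
    (v : Fin (2 * n + 1) → V) (hv : LinearIndependent ℝ v) :
    wedgePow n (fun x => a x) (fun x y => w x y) v ≠ 0 := by
  obtain ⟨v', hv'⟩ := h
  rw [← wedgePowAlt_apply] at hv' ⊢
  have hne : wedgePowAlt n a w ≠ 0 := by
    intro h0
    rw [h0] at hv'
    exact hv' rfl
  have := (AlternatingMap.map_basis_ne_zero_iff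
    (basisOfLinearIndependentOfCardEqFinrank hv (by simp [hdim])) (wedgePowAlt n a w)).2 hne
  rwa [coe_basisOfLinearIndependentOfCardEqFinrank] at this

/-- Two alternating maps of top degree are proportional. -/
theorem alternating_top_mul_comm {m : ℕ} [FiniteDimensional ℝ V] [NeZero m]
    (hdim : Module.finrank ℝ V = m) (A A' : V [⋀^Fin m]→ₗ[ℝ] ℝ) (v v' : Fin m → V) :
    A v * A' v' = A v' * A' v := by
  have b : Module.Basis (Fin m) ℝ V := Module.finBasisOfFinrankEq ℝ V hdim
  rw [A.eq_smul_basis_det b, A'.eq_smul_basis_det b]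
  simp only [AlternatingMap.smul_apply, smul_eq_mul]
  ring

/-- If `a ∧ wⁿ ≠ 0` and `w'` agrees with `h w` on `ker a`, then `(h a) ∧ w'ⁿ ≠ 0`. -/
theorem wedgePow_conformal [FiniteDimensional ℝ V] (n : ℕ)
    (hdim : Module.finrank ℝ V = 2 * n + 1) (a a' : V →ₗ[ℝ] ℝ) (w w' : V →ₗ[ℝ] V →ₗ[ℝ] ℝ)
    (c : ℝ) (hc : c ≠ 0) (ha : ∀ x, a' x = c * a x)
    (hw : ∀ x y, a x = 0 → a y = 0 → w' x y = c * w x y)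
    (h : ∃ v, wedgePow n (fun x => a x) (fun x y => w x y) v ≠ 0) :
    ∃ v, wedgePow n (fun x => a' x) (fun x y => w' x y) v ≠ 0 := by
  have ha0 : a ≠ 0 := by
    rintro rfl
    obtain ⟨v, hv⟩ := h
    apply hv
    simp [wedgePow_eq, wedgeTerm]
  obtain ⟨x₀, hx₀⟩ : ∃ x, a x ≠ 0 := by
    by_contra hcon
    push Not at hcon
    exact ha0 (LinearMap.ext hcon)
  have hker : Module.finrank ℝ (LinearMap.ker a) = 2 * n := by
    have h1 := LinearMap.finrank_range_add_finrank_ker a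
    have h2 : LinearMap.range a = ⊤ := LinearMap.range_eq_top.2 (LinearMap.surjective ha0)
    rw [h2, finrank_top, Module.finrank_self, hdim] at h1
    omega
  let bk : Module.Basis (Fin (2 * n)) ℝ (LinearMap.ker a) := Module.finBasisOfFinrankEq ℝ _ hker
  -- A frame adapted to `ker a`: only permutations fixing `0` survive in the alternating sum, so the
  -- 2-forms are evaluated on `ker a` only, where they are proportional.
  let v : Fin (2 * n + 1) → V := Fin.cons x₀ fun i => (bk i : V)
  have hv : LinearIndependent ℝ v := by
    refine LinearIndependent.finCons (bk.linearIndependent.map' (LinearMap.ker a).subtype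
      (Submodule.ker_subtype _)) ?_
    intro hmem
    have hsub : Submodule.span ℝ (range fun i => (bk i : V)) ≤ LinearMap.ker a := by
      rw [Submodule.span_le]
      rintro _ ⟨i, rfl⟩
      exact (bk i).2
    exact hx₀ (LinearMap.mem_ker.1 (hsub hmem))
  have hv0 := wedgePow_ne_zero_of_linearIndependent n hdim a w h v hv
  refine ⟨v, ?_⟩
  -- One factor `c` comes from `a'` and one from each of the `n` pairs.
  have hterm : ∀ σ : Equiv.Perm (Fin (2 * n + 1)),
      wedgeTerm n (fun x => a' x) (fun x y => w' x y) (v ∘ σ) =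
        c ^ (n + 1) * wedgeTerm n (fun x => a x) (fun x y => w x y) (v ∘ σ) := by
    intro σ
    have hmem : ∀ j, j ≠ 0 → a (v j) = 0 := by
      intro j hj
      obtain ⟨i, rfl⟩ := Fin.exists_succ_eq_of_ne_zero hj
      exact (bk i).2
    by_cases h0 : σ 0 = 0
    · have hne : ∀ j, j ≠ 0 → a (v (σ j)) = 0 := fun j hj =>
        hmem _ (fun hj' => hj (σ.injective (hj'.trans h0.symm)))
      simp only [wedgeTerm, Function.comp_apply, ha]
      rw [Finset.prod_congr rfl fun i _ => hw _ _ (hne _ (slotL_ne_zero i)) (hne _ (slotR_ne_zero i)),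
        Finset.prod_mul_distrib]
      simp only [Finset.prod_const, Finset.card_univ, Fintype.card_fin]
      ring
    · simp [wedgeTerm, ha, hmem _ h0]
  rw [wedgePow_eq] at hv0 ⊢
  have : ∑ σ : Equiv.Perm (Fin (2 * n + 1)), ((Equiv.Perm.sign σ : ℤ) : ℝ) *
      wedgeTerm n (fun x => a' x) (fun x y => w' x y) (v ∘ σ) =
      c ^ (n + 1) * ∑ σ : Equiv.Perm (Fin (2 * n + 1)), ((Equiv.Perm.sign σ : ℤ) : ℝ) *
      wedgeTerm n (fun x => a x) (fun x y => w x y) (v ∘ σ) := by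
    rw [Finset.mul_sum]
    refine Finset.sum_congr rfl fun σ _ => ?_
    rw [hterm]; ring
  rw [this, mul_left_comm]
  exact mul_ne_zero (pow_ne_zero _ hc) hv0

end LinearAlgebra

/-! ### Splitting a plane off `a ∧ wⁿ⁺¹`. -/

section Split

/-- Exchanging whole pairs permutes the factors of the product. The permutation is even
(`sign_swap_pairs`), so the signed terms are preserved as well; this moves any pair to the first
one. -/
theorem wedgeTerm_comp_swap_pairs {W : Type*} (n : ℕ) (a : W → ℝ) (w : W → W → ℝ)
    (v : Fin (2 * (n + 1) + 1) → W) (i : Fin (n + 1)) :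
    wedgeTerm (n + 1) a w (v ∘ (Equiv.swap (slotL 0) (slotL i) * Equiv.swap (slotR 0) (slotR i) :
      Equiv.Perm (Fin (2 * (n + 1) + 1)))) = wedgeTerm (n + 1) a w v := by
  have h0 : (Equiv.swap (slotL 0) (slotL i) * Equiv.swap (slotR 0) (slotR i) :
      Equiv.Perm (Fin (2 * (n + 1) + 1))) 0 = 0 := by
    rw [Equiv.Perm.mul_apply, Equiv.swap_apply_of_ne_of_ne (slotR_ne_zero _).symm
      (slotR_ne_zero _).symm, Equiv.swap_apply_of_ne_of_ne (slotL_ne_zero _).symm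
      (slotL_ne_zero _).symm]
  have hL : ∀ j, (Equiv.swap (slotL 0) (slotL i) * Equiv.swap (slotR 0) (slotR i) :
      Equiv.Perm (Fin (2 * (n + 1) + 1))) (slotL j) = slotL (Equiv.swap 0 i j) := by
    intro j
    rw [Equiv.Perm.mul_apply, Equiv.swap_apply_of_ne_of_ne (slotL_ne_slotR _ _)
      (slotL_ne_slotR _ _), slotL_injective.swap_apply]
  have hR : ∀ j, (Equiv.swap (slotL 0) (slotL i) * Equiv.swap (slotR 0) (slotR i) :
      Equiv.Perm (Fin (2 * (n + 1) + 1))) (slotR j) = slotR (Equiv.swap 0 i j) := by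
    intro j
    rw [Equiv.Perm.mul_apply, slotR_injective.swap_apply,
      Equiv.swap_apply_of_ne_of_ne (slotL_ne_slotR _ _).symm (slotL_ne_slotR _ _).symm]
  simp only [wedgeTerm, Function.comp_apply, h0, hL, hR]
  congr 1
  exact Equiv.prod_comp (Equiv.swap 0 i) fun j => w (v (slotL j)) (v (slotR j))

theorem sign_swap_pairs (n : ℕ) (i : Fin (n + 1)) :
    Equiv.Perm.sign (Equiv.swap (slotL 0) (slotL i) * Equiv.swap (slotR 0) (slotR i) :
      Equiv.Perm (Fin (2 * (n + 1) + 1))) = 1 := by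
  rw [Equiv.Perm.sign_mul, Equiv.Perm.sign_swap', Equiv.Perm.sign_swap']
  simp only [slotL_injective.eq_iff, slotR_injective.eq_iff]
  split_ifs <;> simp

theorem wedgeTerm_comp_swap_first {W : Type*} (n : ℕ) (a : W → ℝ) (w : W → W → ℝ)
    (hw : ∀ x y, w x y = -w y x) (v : Fin (2 * (n + 1) + 1) → W) :
    wedgeTerm (n + 1) a w (v ∘ (Equiv.swap (slotL 0) (slotR 0) :
      Equiv.Perm (Fin (2 * (n + 1) + 1)))) = -wedgeTerm (n + 1) a w v := by
  simp only [wedgeTerm, Function.comp_apply]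
  rw [Fin.prod_univ_succ, Fin.prod_univ_succ, Equiv.swap_apply_left, Equiv.swap_apply_right,
    Equiv.swap_apply_of_ne_of_ne (slotL_ne_zero _).symm (slotR_ne_zero _).symm,
    hw (v (slotR 0))]
  have : ∀ i : Fin n, w (v ((Equiv.swap (slotL 0) (slotR 0)) (slotL i.succ)))
      (v ((Equiv.swap (slotL 0) (slotR 0)) (slotR i.succ))) =
      w (v (slotL i.succ)) (v (slotR i.succ)) := by
    intro i
    rw [Equiv.swap_apply_of_ne_of_ne (slotL_injective.ne (Fin.succ_ne_zero i))
      (slotL_ne_slotR _ _), Equiv.swap_apply_of_ne_of_ne (slotL_ne_slotR _ _).symm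
      (slotR_injective.ne (Fin.succ_ne_zero i))]
  rw [Finset.prod_congr rfl fun i _ => this i]
  ring

/-- `decomposeFin` encodes a permutation by the image of `0` and a permutation of the remaining
indices; the summands on the left are those whose first component is `0`. -/
theorem sum_perm_fix_zero {m : ℕ} (F : Equiv.Perm (Fin (m + 1)) → ℝ) :
    (∑ σ, if σ 0 = 0 then F σ else 0) =
      ∑ π : Equiv.Perm (Fin m), F (Equiv.Perm.decomposeFin.symm (0, π)) := by
  rw [← Equiv.sum_comp Equiv.Perm.decomposeFin.symm, Fintype.sum_prod_type,
    Finset.sum_eq_single 0]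
  · simp
  · intro p _ hp
    refine Finset.sum_eq_zero fun π _ => ?_
    rw [Equiv.Perm.decomposeFin_symm_apply_zero, if_neg hp]
  · simp

/-- If `u`, `v` are `w`-orthogonal to the vectors `e` and lie in the kernel of `a`, then
`(a ∧ wⁿ⁺¹)(u, v, e) = (n + 1) w(u, v) (a ∧ wⁿ)(e)`. -/
theorem wedgePow_split {W : Type*} (n : ℕ) (a : W → ℝ) (w : W → W → ℝ)
    (hw : ∀ x y, w x y = -w y x) (u v : W) (e : Fin (2 * n + 1) → W)
    (hau : a u = 0) (hu : ∀ i, w u (e i) = 0) :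
    wedgePow (n + 1) a w (Fin.cons u (Fin.cons v e) : Fin (2 * n + 1 + 1 + 1) → W) =
      (n + 1) * (w u v * wedgePow n a w e) := by
  set x : Fin (2 * (n + 1) + 1) → W := (Fin.cons u (Fin.cons v e) : Fin (2 * n + 1 + 1 + 1) → W)
  set f : Equiv.Perm (Fin (2 * (n + 1) + 1)) → ℝ := fun σ =>
    ((Equiv.Perm.sign σ : ℤ) : ℝ) * wedgeTerm (n + 1) a w (x ∘ σ) with hf
  have hinv₁ : ∀ i σ, f (σ * (Equiv.swap (slotL 0) (slotL i) * Equiv.swap (slotR 0) (slotR i))) =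
      f σ := by
    intro i σ
    simp only [hf]
    rw [Equiv.Perm.sign_mul, sign_swap_pairs, mul_one, Equiv.Perm.coe_mul, ← Function.comp_assoc,
      wedgeTerm_comp_swap_pairs]
  have hinv₂ : ∀ σ, f (σ * Equiv.swap (slotL 0) (slotR 0)) = f σ := by
    intro σ
    simp only [hf]
    rw [Equiv.Perm.sign_mul, Equiv.Perm.sign_swap (slotL_ne_slotR _ _), Equiv.Perm.coe_mul,
      ← Function.comp_assoc, wedgeTerm_comp_swap_first n a w hw]
    push_cast
    ring
  -- The contribution of the permutations that place `u` in the left slot of the first pair.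
  set T : ℝ := ∑ σ, if σ (slotL 0) = 0 then f σ else 0 with hT
  have hmove : ∀ (ρ : Equiv.Perm (Fin (2 * (n + 1) + 1))), (∀ σ, f (σ * ρ) = f σ) → ∀ j,
      ρ j = slotL 0 → (∑ σ, if σ j = 0 then f σ else 0) = T := by
    intro ρ hρ j hj
    rw [hT, ← Equiv.sum_comp (Equiv.mulRight ρ)]
    refine Finset.sum_congr rfl fun σ _ => ?_
    simp only [Equiv.coe_mulRight, Equiv.Perm.mul_apply, hρ, hj]
  have hpos : ∀ j, j ≠ 0 → (∑ σ, if σ j = 0 then f σ else 0) = T := by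
    intro j hj
    rcases slot_cases j with h | ⟨i, rfl⟩ | ⟨i, rfl⟩
    · exact absurd h hj
    · refine hmove _ (hinv₁ i) _ ?_
      rw [Equiv.Perm.mul_apply, Equiv.swap_apply_of_ne_of_ne (slotL_ne_slotR _ _)
        (slotL_ne_slotR _ _), Equiv.swap_apply_right]
    · refine hmove (Equiv.swap (slotL 0) (slotR 0) *
        (Equiv.swap (slotL 0) (slotL i) * Equiv.swap (slotR 0) (slotR i))) ?_ _ ?_
      · intro σ
        rw [← mul_assoc, hinv₁, hinv₂]
      · rw [Equiv.Perm.mul_apply, Equiv.Perm.mul_apply, Equiv.swap_apply_right,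
          Equiv.swap_apply_of_ne_of_ne (slotL_ne_slotR _ _).symm (slotL_ne_slotR _ _).symm,
          Equiv.swap_apply_right]
  have hx0 : x 0 = u := rfl
  -- `u` contributes nothing in slot `0`, as `a u = 0`; by the symmetries above, each of the other
  -- `2 (n + 1)` slots contributes `T`.
  have hsum : ∑ σ, f σ = 2 * (n + 1) * T := by
    have h1 : ∀ σ, f σ = ∑ j, if σ j = 0 then f σ else 0 := by
      intro σ
      rw [Finset.sum_eq_single (σ.symm 0)]
      · simp
      · intro j _ hj
        rw [if_neg]
        intro h
        exact hj (by rw [← h, Equiv.symm_apply_apply])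
      · simp
    rw [Finset.sum_congr rfl fun σ _ => h1 σ, Finset.sum_comm, Fin.sum_univ_succ,
      Finset.sum_congr rfl fun j _ => hpos _ (Fin.succ_ne_zero j)]
    rw [Finset.sum_eq_zero, Finset.sum_const, Finset.card_univ, Fintype.card_fin]
    · simp
    · intro σ _
      split_ifs with h
      · simp only [hf, wedgeTerm, Function.comp_apply, h, hx0, hau, zero_mul, mul_zero]
      · rfl
  -- An even 3-cycle that carries the first pair to the positions `0` and `1`, so that
  -- `decomposeFin` can be applied once for `u` and once for its partner.
  set c : Equiv.Perm (Fin (2 * (n + 1) + 1)) :=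
    Equiv.swap (slotL 0) (slotR 0) * Equiv.swap 0 (slotL 0) with hc
  have hc0 : c 0 = slotR 0 := by
    rw [hc, Equiv.Perm.mul_apply, Equiv.swap_apply_left, Equiv.swap_apply_left]
  have hcL : c (slotL 0) = 0 := by
    rw [hc, Equiv.Perm.mul_apply, Equiv.swap_apply_right,
      Equiv.swap_apply_of_ne_of_ne (slotL_ne_zero _).symm (slotR_ne_zero _).symm]
  have hcR : c (slotR 0) = slotL 0 := by
    rw [hc, Equiv.Perm.mul_apply, Equiv.swap_apply_of_ne_of_ne (slotR_ne_zero _)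
      (slotL_ne_slotR _ _).symm, Equiv.swap_apply_right]
  have hcs : Equiv.Perm.sign c = 1 := by
    rw [hc, Equiv.Perm.sign_mul, Equiv.Perm.sign_swap (slotL_ne_slotR _ _),
      Equiv.Perm.sign_swap (slotL_ne_zero _).symm]
    rfl
  have hfc : ∀ σ, f (σ * c) = ((Equiv.Perm.sign σ : ℤ) : ℝ) * (a (x (σ (slotR 0))) *
      (w (x (σ 0)) (x (σ (slotL 0))) *
        ∏ i : Fin n, w (x (σ (slotL i.succ))) (x (σ (slotR i.succ))))) := by
    intro σ
    simp only [hf]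
    rw [Equiv.Perm.sign_mul, hcs, mul_one]
    simp only [wedgeTerm, Function.comp_apply, Equiv.Perm.mul_apply]
    rw [Fin.prod_univ_succ, hc0, hcL, hcR]
    congr 3
  have hTval : T = w u v * ∑ π : Equiv.Perm (Fin (2 * n + 1)),
      ((Equiv.Perm.sign π : ℤ) : ℝ) * wedgeTerm n a w (e ∘ π) := by
    rw [hT, ← Equiv.sum_comp (Equiv.mulRight c)]
    simp only [Equiv.coe_mulRight, Equiv.Perm.mul_apply, hcL, hfc]
    rw [sum_perm_fix_zero (m := 2 * (n + 1))]
    -- The partner of `u` must be `v`: any other partner is some `e j`, and `w u (e j) = 0`. So `π`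
    -- fixes its own first index, and a permutation of the entries of `e` remains.
    have key : ∀ π : Equiv.Perm (Fin (2 * (n + 1))),
        ((Equiv.Perm.sign (Equiv.Perm.decomposeFin.symm (0, π)) : ℤ) : ℝ) *
          (a (x (Equiv.Perm.decomposeFin.symm (0, π) (slotR 0))) *
          (w (x (Equiv.Perm.decomposeFin.symm (0, π) 0))
            (x (Equiv.Perm.decomposeFin.symm (0, π) (slotL 0))) *
          ∏ i : Fin n, w (x (Equiv.Perm.decomposeFin.symm (0, π) (slotL i.succ)))
            (x (Equiv.Perm.decomposeFin.symm (0, π) (slotR i.succ))))) =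
        if (show Equiv.Perm (Fin (2 * n + 1 + 1)) from π) 0 = 0 then
          ((Equiv.Perm.sign π : ℤ) : ℝ) * (a (x (π (1 : Fin (2 * n + 1 + 1))).succ) * (w u v *
            ∏ i : Fin n, w (x (π (slotL i).succ).succ) (x (π (slotR i).succ).succ))) else 0 := by
      intro π
      have hsucc : ∀ j : Fin (2 * (n + 1)),
          Equiv.Perm.decomposeFin.symm ((0 : Fin (2 * (n + 1) + 1)), π) j.succ = (π j).succ := by
        intro j
        rw [Equiv.Perm.decomposeFin_symm_apply_succ, Equiv.swap_self, Equiv.refl_apply]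
      have e1 : (slotR 0 : Fin (2 * (n + 1) + 1)) =
        ((1 : Fin (2 * n + 1 + 1)) : Fin (2 * (n + 1))).succ := by
        ext; simp [slotR]; exact (Nat.mod_eq_of_lt (by omega)).symm
      have e2 : (slotL 0 : Fin (2 * (n + 1) + 1)) =
        ((0 : Fin (2 * n + 1 + 1)) : Fin (2 * (n + 1))).succ := by ext; simp [slotL]
      have e3 : ∀ i : Fin n, (slotL i.succ : Fin (2 * (n + 1) + 1)) =
        ((slotL i).succ : Fin (2 * n + 1 + 1)).succ := by
        intro i; ext; simp [slotL]; ring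
      have e4 : ∀ i : Fin n, (slotR i.succ : Fin (2 * (n + 1) + 1)) =
        ((slotR i).succ : Fin (2 * n + 1 + 1)).succ := by
        intro i; ext; simp [slotR]; ring
      rw [Equiv.Perm.decomposeFin.symm_sign, if_pos rfl, one_mul,
        Equiv.Perm.decomposeFin_symm_apply_zero, hx0, e1, e2, hsucc, hsucc]
      rw [Finset.prod_congr rfl fun i _ => by rw [e3 i, e4 i, hsucc, hsucc]]
      split_ifs with h
      · have : x (π (0 : Fin (2 * n + 1 + 1))).succ = v := by
          rw [show π (0 : Fin (2 * n + 1 + 1)) = (0 : Fin (2 * n + 1 + 1)) from h]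
          rfl
        rw [this]
      · obtain ⟨j, hj⟩ := Fin.exists_succ_eq_of_ne_zero h
        have : x (π (0 : Fin (2 * n + 1 + 1))).succ = e j := by
          rw [show π (0 : Fin (2 * n + 1 + 1)) = (j.succ : Fin (2 * n + 1 + 1)) from hj.symm]
          rfl
        rw [this, hu]
        ring
    rw [Finset.sum_congr rfl fun π _ => key π]
    refine (sum_perm_fix_zero (m := 2 * n + 1) fun π => ((Equiv.Perm.sign π : ℤ) : ℝ) *
      (a (x (Fin.succ (π 1))) * (w u v * ∏ i : Fin n,
        w (x (Fin.succ (π (slotL i).succ))) (x (Fin.succ (π (slotR i).succ)))))).trans ?_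
    rw [Finset.mul_sum]
    refine Finset.sum_congr rfl fun π _ => ?_
    have hsucc : ∀ j : Fin (2 * n + 1),
        x (Fin.succ (Equiv.Perm.decomposeFin.symm ((0 : Fin (2 * n + 1 + 1)), π) j.succ)) =
          e (π j) := by
      intro j
      rw [Equiv.Perm.decomposeFin_symm_apply_succ, Equiv.swap_self, Equiv.refl_apply]
      rfl
    have h1 : (1 : Fin (2 * n + 1 + 1)) = Fin.succ 0 := rfl
    rw [Equiv.Perm.decomposeFin.symm_sign, if_pos rfl, one_mul, h1, hsucc,
      Finset.prod_congr rfl fun i _ => by rw [hsucc, hsucc]]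
    simp only [wedgeTerm, Function.comp_apply]
    ring
  rw [wedgePow_eq, wedgePow_eq]
  change _ * ∑ σ, f σ = _
  rw [hsum, hTval]
  field_simp
  ring

end Split

/-! ### Differentials between model spaces -/

section Differential

variable {E E' E'' : Type*} [NormedAddCommGroup E] [NormedSpace ℝ E]
  [NormedAddCommGroup E'] [NormedSpace ℝ E'] [NormedAddCommGroup E''] [NormedSpace ℝ E'']
  {H H' H'' : Type*} [TopologicalSpace H] [TopologicalSpace H'] [TopologicalSpace H'']
  (I : ModelWithCorners ℝ E H) (J : ModelWithCorners ℝ E' H') (K : ModelWithCorners ℝ E'' H'')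
  {X X' X'' : Type*} [TopologicalSpace X'] [ChartedSpace H' X']
  [TopologicalSpace X''] [ChartedSpace H'' X''] [TopologicalSpace X] [ChartedSpace H X]

/-- The differential of a map of manifolds, as a map of the model vector spaces. -/
def mfd (f : X → X') (x : X) : E →L[ℝ] E' := mfderiv I J f x

variable {I J K}

/-- The chain rule on model spaces. The types of the differentials do not depend on base points
here, so that equal points can be rewritten. -/
theorem mfd_comp {f : X → X'} {g : X' → X''} {x : X} (hg : MDifferentiableAt J K g (f x))
    (hf : MDifferentiableAt I J f x) :
    mfd I K (fun z => g (f z)) x = (mfd J K g (f x)).comp (mfd I J f x) :=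
  mfderiv_comp x hg hf

theorem mfd_congr {f g : X → X'} {x : X} (h : f =ᶠ[𝓝 x] g) : mfd I J f x = mfd I J g x :=
  h.mfderiv_eq

theorem mfd_eq_fderiv (f : E → E') (x : E) : mfd 𝓘(ℝ, E) 𝓘(ℝ, E') f x = fderiv ℝ f x :=
  mfderiv_eq_fderiv

theorem mfd_id (x : X) : mfd I I (fun z : X => z) x = ContinuousLinearMap.id ℝ E :=
  mfderiv_id

end Differential

/-! ### Calculus of 1-forms -/

section Forms

variable {d d' : ℕ} {X Y : Type*}
  [TopologicalSpace X] [ChartedSpace (EuclideanSpace ℝ (Fin d)) X]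
  [TopologicalSpace Y] [ChartedSpace (EuclideanSpace ℝ (Fin d')) Y]
  {E : Type*} [NormedAddCommGroup E] [NormedSpace ℝ E]

/-- The value of a 1-form, as a form on the model space. -/
def OneForm.val (α : OneForm d X) (x : X) : EuclideanSpace ℝ (Fin d) →L[ℝ] ℝ := α x

/-- The exterior derivative of a 1-form, as a bilinear form on the model space. -/
def OneForm.extDBil (α : OneForm d X) (x : X) :
    EuclideanSpace ℝ (Fin d) →ₗ[ℝ] EuclideanSpace ℝ (Fin d) →ₗ[ℝ] ℝ :=
  LinearMap.mk₂ ℝ (fun u v => fderiv ℝ (OneForm.inChart α x) (extChartAt (𝓡 d) x x) u v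
      - fderiv ℝ (OneForm.inChart α x) (extChartAt (𝓡 d) x x) v u)
    (by intros; simp only [map_add, add_apply]; ring)
    (by intros; simp only [map_smul, smul_apply, smul_eq_mul]; ring)
    (by intros; simp only [map_add, add_apply]; ring)
    (by intros; simp only [map_smul, smul_apply, smul_eq_mul]; ring)

theorem extDBil_swap (α : OneForm d X) (x : X) (u v : EuclideanSpace ℝ (Fin d)) :
    OneForm.extDBil α x u v = -OneForm.extDBil α x v u := by
  simp [OneForm.extDBil]

/-- The pull-back of a 1-form to a normed space. -/
def pullVec (α : OneForm d X) (p : E → X) : E → E →L[ℝ] ℝ :=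
  fun y => (α.val (p y)).comp (mfd 𝓘(ℝ, E) (𝓡 d) p y)

/-- The exterior derivative of a 1-form on a normed space. -/
def extDVec (a : E → E →L[ℝ] ℝ) (y u v : E) : ℝ := fderiv ℝ a y u v - fderiv ℝ a y v u

theorem inChart_eq_pullVec (α : OneForm d X) (x : X) :
    OneForm.inChart α x = pullVec α (extChartAt (𝓡 d) x).symm := rfl

theorem extDBil_eq_extDVec (α : OneForm d X) (x : X) (u v : EuclideanSpace ℝ (Fin d)) :
    OneForm.extDBil α x u v =
      extDVec (pullVec α (extChartAt (𝓡 d) x).symm) (extChartAt (𝓡 d) x x) u v := rfl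

theorem val_pullback (f : X → Y) (α : OneForm d' Y) (x : X) :
    (OneForm.pullback f α : OneForm d X).val x = (α.val (f x)).comp (mfd (𝓡 d) (𝓡 d') f x) := rfl

theorem extDVec_congr {a b : E → E →L[ℝ] ℝ} {y : E} (h : a =ᶠ[𝓝 y] b) (u v : E) :
    extDVec a y u v = extDVec b y u v := by
  unfold extDVec
  rw [h.fderiv_eq]

theorem pullVec_congr (α : OneForm d X) {p q : E → X} {y : E} (h : p =ᶠ[𝓝 y] q) :
    pullVec α p y = pullVec α q y := by
  unfold pullVec
  rw [mfd_congr h, h.eq_of_nhds]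

theorem pullVec_comp {E' : Type*} [NormedAddCommGroup E'] [NormedSpace ℝ E']
    (α : OneForm d X) {q : E' → X} {P : E → E'} {y : E}
    (hq : MDifferentiableAt 𝓘(ℝ, E') (𝓡 d) q (P y)) (hP : DifferentiableAt ℝ P y) :
    pullVec α (fun z => q (P z)) y = (pullVec α q (P y)).comp (fderiv ℝ P y) := by
  unfold pullVec
  rw [mfd_comp hq hP.mdifferentiableAt, mfd_eq_fderiv]
  rfl

theorem pullVec_pullback (α : OneForm d' Y) {f : X → Y} {p : E → X} {y : E}
    (hf : MDifferentiableAt (𝓡 d) (𝓡 d') f (p y))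
    (hp : MDifferentiableAt 𝓘(ℝ, E) (𝓡 d) p y) :
    pullVec (OneForm.pullback f α : OneForm d X) p y = pullVec α (fun z => f (p z)) y := by
  unfold pullVec
  rw [mfd_comp hf hp, val_pullback]
  rfl

theorem OneForm.Smooth.contDiffAt_inChart {α : OneForm d X} (hα : α.Smooth) (x : X)
    {y : EuclideanSpace ℝ (Fin d)} (hy : y ∈ (extChartAt (𝓡 d) x).target) :
    ContDiffAt ℝ ∞ (OneForm.inChart α x) y :=
  (hα x).contDiffAt ((isOpen_extChartAt_target x).mem_nhds hy)

/-- The chart at the image point is the one by which the differential of `p` is defined. -/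
theorem fderiv_extChartAt_comp {p : E → X} {y : E}
    (hp : MDifferentiableAt 𝓘(ℝ, E) (𝓡 d) p y) :
    fderiv ℝ (fun z => extChartAt (𝓡 d) (p y) (p z)) y = mfd 𝓘(ℝ, E) (𝓡 d) p y := by
  unfold mfd
  rw [hp.mfderiv]
  simp only [mfld_simps, fderivWithin_univ]
  rfl

/-! ### Naturality of smoothness and of the exterior derivative. -/

section Smooth

variable [IsManifold (𝓡 d) ∞ X] [IsManifold (𝓡 d') ∞ Y]

theorem contMDiffAt_extChartAt_symm (x : X) {y : EuclideanSpace ℝ (Fin d)}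
    (hy : y ∈ (extChartAt (𝓡 d) x).target) :
    ContMDiffAt 𝓘(ℝ, EuclideanSpace ℝ (Fin d)) (𝓡 d) ∞ (extChartAt (𝓡 d) x).symm y :=
  (contMDiffOn_extChartAt_symm (n := ∞) x).contMDiffAt ((isOpen_extChartAt_target x).mem_nhds hy)

theorem mdifferentiableAt_extChartAt_symm (x : X) {y : EuclideanSpace ℝ (Fin d)}
    (hy : y ∈ (extChartAt (𝓡 d) x).target) :
    MDifferentiableAt 𝓘(ℝ, EuclideanSpace ℝ (Fin d)) (𝓡 d) (extChartAt (𝓡 d) x).symm y :=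
  (contMDiffAt_extChartAt_symm x hy).mdifferentiableAt (by simp)

/-- Near `y` the map `p` factors through the chart at `x`, so the pull-back is that of the
coordinate expression under a map of normed spaces. This reduces smoothness and exterior derivatives
to ordinary calculus. -/
theorem pullVec_eventuallyEq_chart (α : OneForm d X) {p : E → X} {y : E} (x : X)
    (hp : ContMDiffAt 𝓘(ℝ, E) (𝓡 d) ∞ p y)
    (hx : p y ∈ (chartAt (EuclideanSpace ℝ (Fin d)) x).source) :
    pullVec α p =ᶠ[𝓝 y] fun z => (OneForm.inChart α x (extChartAt (𝓡 d) x (p z))).comp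
      (fderiv ℝ (fun z => extChartAt (𝓡 d) x (p z)) z) := by
  have hsrc : ∀ᶠ z in 𝓝 y, p z ∈ (extChartAt (𝓡 d) x).source := by
    rw [extChartAt_source]
    exact hp.continuousAt.eventually ((chartAt _ x).open_source.mem_nhds hx)
  have hpe : ∀ᶠ z in 𝓝 y, ContMDiffAt 𝓘(ℝ, E) (𝓡 d) 1 p z :=
    (contMDiffAt_iff_contMDiffAt_nhds (by simp)).1 (hp.of_le (by exact_mod_cast le_top))
  filter_upwards [hsrc.eventually_nhds, hpe] with z hz hpz
  have h1 : p =ᶠ[𝓝 z] fun t => (extChartAt (𝓡 d) x).symm (extChartAt (𝓡 d) x (p t)) := by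
    filter_upwards [hz] with t ht
    exact ((extChartAt (𝓡 d) x).left_inv ht).symm
  have hz' := hz.self_of_nhds
  rw [pullVec_congr α h1, pullVec_comp α (q := (extChartAt (𝓡 d) x).symm)]
  · rfl
  · exact mdifferentiableAt_extChartAt_symm x ((extChartAt (𝓡 d) x).map_source hz')
  · rw [← mdifferentiableAt_iff_differentiableAt]
    refine MDifferentiableAt.comp z ?_ (hpz.mdifferentiableAt one_ne_zero)
    refine mdifferentiableAt_extChartAt (I := 𝓡 d) ?_
    rwa [extChartAt_source] at hz'

theorem contDiffAt_extChartAt_comp {p : E → X} {y : E} (x : X)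
    (hp : ContMDiffAt 𝓘(ℝ, E) (𝓡 d) ∞ p y)
    (hx : p y ∈ (chartAt (EuclideanSpace ℝ (Fin d)) x).source) :
    ContDiffAt ℝ ∞ (fun z => extChartAt (𝓡 d) x (p z)) y := by
  rw [← contMDiffAt_iff_contDiffAt]
  exact (contMDiffAt_extChartAt' hx).comp y hp

theorem OneForm.Smooth.contDiffAt_pullVec {α : OneForm d X} (hα : α.Smooth) {p : E → X} {y : E}
    (hp : ContMDiffAt 𝓘(ℝ, E) (𝓡 d) ∞ p y) : ContDiffAt ℝ ∞ (pullVec α p) y := by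
  have hx := mem_chart_source (EuclideanSpace ℝ (Fin d)) (p y)
  refine ContDiffAt.congr_of_eventuallyEq ?_ (pullVec_eventuallyEq_chart α (p y) hp hx)
  have h1 := contDiffAt_extChartAt_comp (p y) hp hx
  refine ContDiffAt.clm_comp ?_ (h1.fderiv_right (m := ∞) (by simp))
  exact (hα.contDiffAt_inChart (p y) (mem_extChartAt_target (p y))).comp y h1

/-- The exterior derivative is natural for parametrizations by normed spaces. -/
theorem extDVec_pullVec {α : OneForm d X} (hα : α.Smooth) {p : E → X} {y : E}
    (hp : ContMDiffAt 𝓘(ℝ, E) (𝓡 d) ∞ p y) (u v : E) :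
    extDVec (pullVec α p) y u v = OneForm.extDBil α (p y)
      (mfd 𝓘(ℝ, E) (𝓡 d) p y u) (mfd 𝓘(ℝ, E) (𝓡 d) p y v) := by
  have hx := mem_chart_source (EuclideanSpace ℝ (Fin d)) (p y)
  have h1 := contDiffAt_extChartAt_comp (p y) hp hx
  have hA := hα.contDiffAt_inChart (p y) (mem_extChartAt_target (I := 𝓡 d) (p y))
  have hA' : HasFDerivAt (OneForm.inChart α (p y))
      (fderiv ℝ (OneForm.inChart α (p y)) (extChartAt (𝓡 d) (p y) (p y)))
      (extChartAt (𝓡 d) (p y) (p y)) :=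
    (hA.differentiableAt (by simp)).hasFDerivAt
  have hP := (h1.differentiableAt (by simp)).hasFDerivAt
  have hP2 : HasFDerivAt (fderiv ℝ (fun z => extChartAt (𝓡 d) (p y) (p z)))
      (fderiv ℝ (fderiv ℝ (fun z => extChartAt (𝓡 d) (p y) (p z))) y) y :=
    ((h1.fderiv_right (m := ∞) (by simp)).differentiableAt (by simp)).hasFDerivAt
  -- The second derivative of the coordinate map enters `d(p^*α)` symmetrically and cancels.
  have hsymm : IsSymmSndFDerivAt ℝ (fun z => extChartAt (𝓡 d) (p y) (p z)) y :=
    h1.isSymmSndFDerivAt (by simpa using ENat.LEInfty.out)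
  have hD := (HasFDerivAt.comp (f := fun z => extChartAt (𝓡 d) (p y) (p z)) y hA' hP).clm_comp hP2
  have hF : fderiv ℝ (pullVec α p) y = _ :=
    ((pullVec_eventuallyEq_chart α (p y) hp hx).fderiv_eq).trans hD.fderiv
  have hmf := fderiv_extChartAt_comp (hp.mdifferentiableAt (by simp))
  unfold extDVec
  simp only [OneForm.extDBil, LinearMap.mk₂_apply]
  rw [hF]
  simp only [add_apply, ContinuousLinearMap.comp_apply,
    ContinuousLinearMap.compL_apply, hmf, Function.comp_apply]
  rw [hsymm u v]
  ring_nf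
  rfl

/-- The tangent space at `x` is identified with the model space by the preferred chart at `x`; in
these terms the chart is its own linearization. -/
theorem mfd_extChartAt_symm_self (x : X) :
    mfd 𝓘(ℝ, EuclideanSpace ℝ (Fin d)) (𝓡 d) (extChartAt (𝓡 d) x).symm
      (extChartAt (𝓡 d) x x) = ContinuousLinearMap.id ℝ _ := by
  have hx := mem_extChartAt_target (I := 𝓡 d) x
  unfold mfd
  rw [(mdifferentiableAt_extChartAt_symm x hx).mfderiv]
  have h : writtenInExtChartAt 𝓘(ℝ, EuclideanSpace ℝ (Fin d)) (𝓡 d) (extChartAt (𝓡 d) x x)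
      (extChartAt (𝓡 d) x).symm =ᶠ[𝓝 (extChartAt (𝓡 d) x x)] id := by
    filter_upwards [(isOpen_extChartAt_target x).mem_nhds hx] with z hz
    simp only [writtenInExtChartAt, extChartAt_model_space_eq_id, PartialEquiv.refl_symm,
      PartialEquiv.refl_coe, Function.comp_apply, id, extChartAt_to_inv]
    exact (extChartAt (𝓡 d) x).right_inv hz
  simp only [extChartAt_model_space_eq_id, PartialEquiv.refl_coe, id, modelWithCornersSelf_coe,
    range_id, fderivWithin_univ]
  rw [h.fderiv_eq, fderiv_id]

theorem ContMDiffAt.eventually_mdifferentiableAt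
    {E' H' : Type*} [NormedAddCommGroup E'] [NormedSpace ℝ E'] [TopologicalSpace H']
    {J : ModelWithCorners ℝ E' H'} {Z : Type*} [TopologicalSpace Z] [ChartedSpace H' Z]
    [IsManifold J ∞ Z] {f : X → Z} {x : X} (hf : ContMDiffAt (𝓡 d) J ∞ f x) :
    ∀ᶠ z in 𝓝 x, MDifferentiableAt (𝓡 d) J f z := by
  have : IsManifold J 1 Z := IsManifold.of_le (n := ∞) (by exact_mod_cast le_top)
  exact ((contMDiffAt_iff_contMDiffAt_nhds (by simp)).1
    (hf.of_le (m := 1) (by exact_mod_cast le_top))).mono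
      fun z hz => hz.mdifferentiableAt one_ne_zero

theorem inChart_pullback_eventuallyEq {α : OneForm d' Y} {f : X → Y} {x₀ : X}
    {y : EuclideanSpace ℝ (Fin d)} (hy : y ∈ (extChartAt (𝓡 d) x₀).target)
    (hf : ContMDiffAt (𝓡 d) (𝓡 d') ∞ f ((extChartAt (𝓡 d) x₀).symm y)) :
    OneForm.inChart (OneForm.pullback f α : OneForm d X) x₀ =ᶠ[𝓝 y]
      pullVec α fun z => f ((extChartAt (𝓡 d) x₀).symm z) := by
  filter_upwards [(contMDiffAt_extChartAt_symm x₀ hy).continuousAt.eventually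
    (ContMDiffAt.eventually_mdifferentiableAt hf),
    (isOpen_extChartAt_target x₀).mem_nhds hy] with z hz hzt
  exact pullVec_pullback α hz (mdifferentiableAt_extChartAt_symm x₀ hzt)

theorem OneForm.Smooth.pullback {α : OneForm d' Y} (hα : α.Smooth) {f : X → Y}
    (hf : ContMDiff (𝓡 d) (𝓡 d') ∞ f) : (OneForm.pullback f α : OneForm d X).Smooth := by
  intro x₀ y hy
  refine ContDiffAt.contDiffWithinAt ?_
  refine ContDiffAt.congr_of_eventuallyEq ?_ (inChart_pullback_eventuallyEq hy (hf _))
  exact hα.contDiffAt_pullVec ((hf _).comp y (contMDiffAt_extChartAt_symm x₀ hy))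

/-- Naturality for the parametrization `f ∘ chart⁻¹`, whose differential at the base point is that
of `f` by `mfd_extChartAt_symm_self`. -/
theorem extDBil_pullback {α : OneForm d' Y} (hα : α.Smooth) {f : X → Y} {x : X}
    (hf : ContMDiffAt (𝓡 d) (𝓡 d') ∞ f x) (u v : EuclideanSpace ℝ (Fin d)) :
    OneForm.extDBil (OneForm.pullback f α : OneForm d X) x u v =
      OneForm.extDBil α (f x) (mfd (𝓡 d) (𝓡 d') f x u) (mfd (𝓡 d) (𝓡 d') f x v) := by
  have hx := mem_extChartAt_target (I := 𝓡 d) x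
  have hxy : (extChartAt (𝓡 d) x).symm (extChartAt (𝓡 d) x x) = x := extChartAt_to_inv x
  have hf' : ContMDiffAt (𝓡 d) (𝓡 d') ∞ f ((extChartAt (𝓡 d) x).symm (extChartAt (𝓡 d) x x)) := by
    rwa [hxy]
  rw [extDBil_eq_extDVec, ← inChart_eq_pullVec, extDVec_congr (inChart_pullback_eventuallyEq hx hf'),
    extDVec_pullVec hα (p := fun z => f ((extChartAt (𝓡 d) x).symm z))
      (hf'.comp _ (contMDiffAt_extChartAt_symm x hx)),
    mfd_comp (hf'.mdifferentiableAt (by simp)) (mdifferentiableAt_extChartAt_symm x hx),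
    mfd_extChartAt_symm_self, hxy]
  rfl

end Smooth

/-! ### Algebraic operations on 1-forms -/

section Operations

variable {α β : OneForm d X} {x : X}

theorem inChart_add_smul (α β : OneForm d X) (c : ℝ) (x : X) :
    OneForm.inChart (fun x => α x + c • β x) x =
      fun y => OneForm.inChart α x y + c • OneForm.inChart β x y := rfl

theorem OneForm.Smooth.add_smul (hα : α.Smooth) (hβ : β.Smooth) (c : ℝ) :
    OneForm.Smooth (fun x => α x + c • β x) := by
  intro x₀
  rw [inChart_add_smul]
  exact (hα x₀).add ((hβ x₀).const_smul c)

theorem extDBil_add_smul (hα : α.Smooth) (hβ : β.Smooth) (c : ℝ) (x : X)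
    (u v : EuclideanSpace ℝ (Fin d)) :
    OneForm.extDBil (fun x => α x + c • β x) x u v =
      OneForm.extDBil α x u v + c * OneForm.extDBil β x u v := by
  have hx := mem_extChartAt_target (I := 𝓡 d) x
  have h1 := (hα.contDiffAt_inChart x hx).differentiableAt (by simp)
  have h2 := (hβ.contDiffAt_inChart x hx).differentiableAt (by simp)
  simp only [OneForm.extDBil, LinearMap.mk₂_apply]
  rw [inChart_add_smul, (h1.hasFDerivAt.fun_add (h2.hasFDerivAt.fun_const_smul c)).fderiv]
  simp only [add_apply, smul_apply, smul_eq_mul]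
  ring

theorem contDiffAt_comp_extChartAt_symm [IsManifold (𝓡 d) ∞ X] {h : X → ℝ}
    (hh : ContMDiff (𝓡 d) 𝓘(ℝ, ℝ) ∞ h) (x₀ : X) {y : EuclideanSpace ℝ (Fin d)}
    (hy : y ∈ (extChartAt (𝓡 d) x₀).target) :
    ContDiffAt ℝ ∞ (fun z => h ((extChartAt (𝓡 d) x₀).symm z)) y := by
  rw [← contMDiffAt_iff_contDiffAt]
  exact (hh _).comp y (contMDiffAt_extChartAt_symm x₀ hy)

theorem fderiv_comp_extChartAt_symm [IsManifold (𝓡 d) ∞ X] {h : X → ℝ}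
    (hh : ContMDiff (𝓡 d) 𝓘(ℝ, ℝ) ∞ h) (x : X) :
    fderiv ℝ (fun z => h ((extChartAt (𝓡 d) x).symm z)) (extChartAt (𝓡 d) x x) =
      mfd (𝓡 d) 𝓘(ℝ, ℝ) h x := by
  rw [← mfd_eq_fderiv, mfd_comp ((hh _).mdifferentiableAt (by simp))
    (mdifferentiableAt_extChartAt_symm x (mem_extChartAt_target x)), mfd_extChartAt_symm_self,
    extChartAt_to_inv]
  rfl

theorem OneForm.Smooth.smul [IsManifold (𝓡 d) ∞ X] (hα : α.Smooth) {h : X → ℝ}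
    (hh : ContMDiff (𝓡 d) 𝓘(ℝ, ℝ) ∞ h) : OneForm.Smooth (fun x => h x • α x) := by
  intro x₀
  change ContDiffOn ℝ ∞ (fun y => h ((extChartAt (𝓡 d) x₀).symm y) • OneForm.inChart α x₀ y) _
  exact ContDiffOn.smul (fun y hy => (contDiffAt_comp_extChartAt_symm hh x₀ hy).contDiffWithinAt)
    (hα x₀)

/-- The Leibniz rule `d(hα) = h dα + dh ∧ α`. The second term vanishes on `ker α`, which is why
conformal factors preserve the contact condition. -/
theorem extDBil_smul [IsManifold (𝓡 d) ∞ X] (hα : α.Smooth) {h : X → ℝ}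
    (hh : ContMDiff (𝓡 d) 𝓘(ℝ, ℝ) ∞ h) (x : X) (u v : EuclideanSpace ℝ (Fin d)) :
    OneForm.extDBil (fun x => h x • α x) x u v =
      h x * OneForm.extDBil α x u v + (mfd (𝓡 d) 𝓘(ℝ, ℝ) h x u * α.val x v -
        mfd (𝓡 d) 𝓘(ℝ, ℝ) h x v * α.val x u) := by
  have hx := mem_extChartAt_target (I := 𝓡 d) x
  have h1 := (hα.contDiffAt_inChart x hx).differentiableAt (by simp)
  have h2 := (contDiffAt_comp_extChartAt_symm hh x hx).differentiableAt (by simp)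
  have h3 : OneForm.inChart α x (extChartAt (𝓡 d) x x) = α.val x := by
    rw [inChart_eq_pullVec, pullVec, mfd_extChartAt_symm_self, extChartAt_to_inv]
    rfl
  have h4 : OneForm.inChart (fun x => h x • α x) x =
    fun y => h ((extChartAt (𝓡 d) x).symm y) • OneForm.inChart α x y := rfl
  simp only [OneForm.extDBil, LinearMap.mk₂_apply]
  rw [h4, fderiv_fun_smul h2 h1, fderiv_comp_extChartAt_symm hh, extChartAt_to_inv, h3]
  simp only [add_apply, smul_apply, smul_eq_mul, ContinuousLinearMap.smulRight_apply]
  ring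

/-- The 1-form `φ dψ`. -/
def funDiff (φ ψ : X → ℝ) : OneForm d X := fun x => φ x • mfd (𝓡 d) 𝓘(ℝ, ℝ) ψ x

theorem val_funDiff (φ ψ : X → ℝ) (x : X) :
    (funDiff φ ψ : OneForm d X).val x = φ x • mfd (𝓡 d) 𝓘(ℝ, ℝ) ψ x := rfl

theorem inChart_funDiff [IsManifold (𝓡 d) ∞ X] {φ ψ : X → ℝ}
    (hψ : ContMDiff (𝓡 d) 𝓘(ℝ, ℝ) ∞ ψ) (x₀ : X) {y : EuclideanSpace ℝ (Fin d)}
    (hy : y ∈ (extChartAt (𝓡 d) x₀).target) :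
    OneForm.inChart (funDiff φ ψ : OneForm d X) x₀ y = φ ((extChartAt (𝓡 d) x₀).symm y) •
      fderiv ℝ (fun z => ψ ((extChartAt (𝓡 d) x₀).symm z)) y := by
  rw [inChart_eq_pullVec, pullVec, val_funDiff, ← mfd_eq_fderiv,
    mfd_comp ((hψ _).mdifferentiableAt (by simp)) (mdifferentiableAt_extChartAt_symm x₀ hy)]
  rfl

theorem smooth_funDiff [IsManifold (𝓡 d) ∞ X] {φ ψ : X → ℝ}
    (hφ : ContMDiff (𝓡 d) 𝓘(ℝ, ℝ) ∞ φ) (hψ : ContMDiff (𝓡 d) 𝓘(ℝ, ℝ) ∞ ψ) :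
    (funDiff φ ψ : OneForm d X).Smooth := by
  intro x₀
  refine ContDiffOn.congr ?_ (fun y hy => inChart_funDiff hψ x₀ hy)
  intro y hy
  exact ((contDiffAt_comp_extChartAt_symm hφ x₀ hy).smul
    ((contDiffAt_comp_extChartAt_symm hψ x₀ hy).fderiv_right (m := ∞) (by simp))).contDiffWithinAt

/-- The second derivative of `ψ` is symmetric and drops out of `d(φ dψ)`. -/
theorem extDBil_funDiff [IsManifold (𝓡 d) ∞ X] {φ ψ : X → ℝ}
    (hφ : ContMDiff (𝓡 d) 𝓘(ℝ, ℝ) ∞ φ) (hψ : ContMDiff (𝓡 d) 𝓘(ℝ, ℝ) ∞ ψ) (x : X)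
    (u v : EuclideanSpace ℝ (Fin d)) :
    OneForm.extDBil (funDiff φ ψ : OneForm d X) x u v =
      mfd (𝓡 d) 𝓘(ℝ, ℝ) φ x u * mfd (𝓡 d) 𝓘(ℝ, ℝ) ψ x v -
        mfd (𝓡 d) 𝓘(ℝ, ℝ) φ x v * mfd (𝓡 d) 𝓘(ℝ, ℝ) ψ x u := by
  have hx := mem_extChartAt_target (I := 𝓡 d) x
  have h1 := contDiffAt_comp_extChartAt_symm hφ x hx
  have h2 := contDiffAt_comp_extChartAt_symm hψ x hx
  have h3 := (h2.fderiv_right (m := ∞) (by simp)).differentiableAt (by simp)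
  have hsymm : IsSymmSndFDerivAt ℝ (fun z => ψ ((extChartAt (𝓡 d) x).symm z))
    (extChartAt (𝓡 d) x x) := h2.isSymmSndFDerivAt (by simpa using ENat.LEInfty.out)
  have h4 : OneForm.inChart (funDiff φ ψ : OneForm d X) x =ᶠ[𝓝 (extChartAt (𝓡 d) x x)]
      fun y => φ ((extChartAt (𝓡 d) x).symm y) •
        fderiv ℝ (fun z => ψ ((extChartAt (𝓡 d) x).symm z)) y := by
    filter_upwards [(isOpen_extChartAt_target x).mem_nhds hx] with y hy
    exact inChart_funDiff hψ x hy
  simp only [OneForm.extDBil, LinearMap.mk₂_apply]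
  rw [h4.fderiv_eq, fderiv_fun_smul (h1.differentiableAt (by simp)) h3,
    fderiv_comp_extChartAt_symm hφ, fderiv_comp_extChartAt_symm hψ]
  simp only [add_apply, smul_apply, smul_eq_mul, ContinuousLinearMap.smulRight_apply]
  rw [hsymm u v]
  ring

/-- A conformal factor does not affect the contact condition. -/
theorem IsContactForm.smul {n : ℕ} {Z : Type*} [TopologicalSpace Z]
    [ChartedSpace (EuclideanSpace ℝ (Fin (2 * n + 1))) Z] [IsManifold (𝓡 (2 * n + 1)) ∞ Z]
    {α : OneForm (2 * n + 1) Z} (hα : IsContactForm n α) {h : Z → ℝ}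
    (hh : ContMDiff (𝓡 (2 * n + 1)) 𝓘(ℝ, ℝ) ∞ h) (h0 : ∀ x, h x ≠ 0) :
    IsContactForm n (fun x => h x • α x) where
  smooth := hα.smooth.smul hh
  vol_ne_zero x := by
    refine wedgePow_conformal (V := EuclideanSpace ℝ (Fin (2 * n + 1))) n (by simp)
      (α.val x).toLinearMap (h x • (α.val x)).toLinearMap (OneForm.extDBil α x)
      (OneForm.extDBil (fun x => h x • α x) x) (h x) (h0 x) (fun _ => rfl) ?_ (hα.vol_ne_zero x)
    intro u v hu hv
    rw [extDBil_smul hα.smooth hh]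
    simp only [ContinuousLinearMap.coe_coe] at hu hv
    rw [hu, hv]
    ring

end Operations

end Forms

/-! ### Local diffeomorphisms -/

section LocalDiffeo

variable {E E' E'' : Type*} [NormedAddCommGroup E] [NormedSpace ℝ E]
  [NormedAddCommGroup E'] [NormedSpace ℝ E'] [NormedAddCommGroup E''] [NormedSpace ℝ E'']
  {H H' H'' : Type*} [TopologicalSpace H] [TopologicalSpace H'] [TopologicalSpace H'']
  {I : ModelWithCorners ℝ E H} {J : ModelWithCorners ℝ E' H'} {K : ModelWithCorners ℝ E'' H''}
  {X X' X'' : Type*} [TopologicalSpace X'] [ChartedSpace H' X']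
  [TopologicalSpace X''] [ChartedSpace H'' X''] [TopologicalSpace X] [ChartedSpace H X]

/-- A partial diffeomorphism from mutually inverse smooth maps of open sets. -/
def partialDiffeoMk (f : X → X') (g : X' → X) (U : Set X) (V : Set X') (hU : IsOpen U)
    (hV : IsOpen V) (hUV : ∀ x ∈ U, f x ∈ V) (hVU : ∀ y ∈ V, g y ∈ U) (hgf : ∀ x ∈ U, g (f x) = x)
    (hfg : ∀ y ∈ V, f (g y) = y) (hf : ContMDiffOn I J ∞ f U) (hg : ContMDiffOn J I ∞ g V) :
    PartialDiffeomorph I J X X' ∞ where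
  toFun := f
  invFun := g
  source := U
  target := V
  map_source' := hUV
  map_target' := hVU
  left_inv' := hgf
  right_inv' := hfg
  open_source := hU
  open_target := hV
  contMDiffOn_toFun := hf
  contMDiffOn_invFun := hg

theorem isLocalDiffeomorphAt_of_inverse {f : X → X'} {g : X' → X} {U : Set X} {V : Set X'} {x : X}
    (hx : x ∈ U) (hU : IsOpen U)
    (hV : IsOpen V) (hUV : ∀ x ∈ U, f x ∈ V) (hVU : ∀ y ∈ V, g y ∈ U) (hgf : ∀ x ∈ U, g (f x) = x)
    (hfg : ∀ y ∈ V, f (g y) = y) (hf : ContMDiffOn I J ∞ f U) (hg : ContMDiffOn J I ∞ g V) :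
    IsLocalDiffeomorphAt I J ∞ f x :=
  ⟨partialDiffeoMk f g U V hU hV hUV hVU hgf hfg hf hg, hx, fun _ _ => rfl⟩

theorem isLocalDiffeomorphAt_congr {f f' : X → X'} {x : X} (hf : IsLocalDiffeomorphAt I J ∞ f x)
    (h : f' =ᶠ[𝓝 x] f) : IsLocalDiffeomorphAt I J ∞ f' x := by
  obtain ⟨Φ, hx, hΦ⟩ := hf
  obtain ⟨W, hW, hWo, hxW⟩ := eventually_nhds_iff.1 h
  refine ⟨partialDiffeoMk Φ Φ.symm (Φ.source ∩ W) (Φ.target ∩ Φ.symm ⁻¹' W)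
    (Φ.open_source.inter hWo)
    (Φ.contMDiffOn_invFun.continuousOn.isOpen_inter_preimage Φ.open_target hWo)
    ?_ ?_ (fun x hx => Φ.left_inv' hx.1) (fun x hx => Φ.right_inv' hx.1)
    (Φ.contMDiffOn_toFun.mono inter_subset_left) (Φ.contMDiffOn_invFun.mono inter_subset_left),
    ⟨hx, hxW⟩, fun y hy => (hW y hy.2).trans (hΦ hy.1)⟩
  · intro y hy
    refine ⟨Φ.map_source' hy.1, ?_⟩
    change Φ.invFun (Φ.toFun y) ∈ W
    rw [Φ.left_inv' hy.1]
    exact hy.2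
  · intro y hy
    exact ⟨Φ.map_target' hy.1, hy.2⟩

/-- If `f` is a local diffeomorphism at `h a`, then a continuous map `h` is smooth at `a` if
`f ∘ h` is. -/
theorem contMDiffAt_of_comp {f : X' → X''} {h : X → X'} {a : X}
    (hf : IsLocalDiffeomorphAt J K ∞ f (h a)) (hc : ContinuousAt h a)
    (hfh : ContMDiffAt I K ∞ (fun z => f (h z)) a) : ContMDiffAt I J ∞ h a := by
  obtain ⟨Φ, hx, hΦ⟩ := hf
  have h1 : h =ᶠ[𝓝 a] fun z => Φ.symm (f (h z)) := by
    filter_upwards [hc.eventually (Φ.open_source.mem_nhds hx)] with z hz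
    rw [hΦ hz]
    exact (Φ.left_inv' hz).symm
  refine ContMDiffAt.congr_of_eventuallyEq ?_ h1
  have hmem : f (h a) ∈ Φ.target := by
    rw [hΦ hx]
    exact Φ.map_source' hx
  exact ContMDiffAt.comp a (Φ.contMDiffOn_invFun.contMDiffAt (Φ.open_target.mem_nhds hmem)) hfh

/-- If `f` is a local diffeomorphism at `h a` and `f ∘ h` is a local diffeomorphism at `a`, then
so is the continuous map `h`. -/
theorem isLocalDiffeomorphAt_of_comp {f : X' → X''} {h : X → X'} {a : X}
    (hf : IsLocalDiffeomorphAt J K ∞ f (h a)) (hc : ContinuousAt h a)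
    (hfh : IsLocalDiffeomorphAt I K ∞ (fun z => f (h z)) a) : IsLocalDiffeomorphAt I J ∞ h a := by
  obtain ⟨Φ, hx, hΦ⟩ := hf
  have h1 : h =ᶠ[𝓝 a] Φ.symm ∘ (fun z => f (h z)) := by
    filter_upwards [hc.eventually (Φ.open_source.mem_nhds hx)] with z hz
    change _ = Φ.symm (f (h z))
    rw [hΦ hz]
    exact (Φ.left_inv' hz).symm
  refine isLocalDiffeomorphAt_congr ?_ h1
  have hmem : f (h a) ∈ Φ.target := by
    rw [hΦ hx]
    exact Φ.map_source' hx
  exact hfh.comp _ _ (PartialDiffeomorph.isLocalDiffeomorphAt _ _ _ Φ.symm hmem)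

theorem isLocalDiffeomorphAt_prodMk_id {Z G : Type*} [TopologicalSpace G]
    [TopologicalSpace Z] [ChartedSpace G Z] {F : Type*} [NormedAddCommGroup F] [NormedSpace ℝ F]
    {L : ModelWithCorners ℝ F G} {f : X → X'} {a : X} (z : Z)
    (hf : IsLocalDiffeomorphAt I J ∞ f a) :
    IsLocalDiffeomorphAt (I.prod L) (J.prod L) ∞ (fun w : X × Z => (f w.1, w.2)) (a, z) := by
  obtain ⟨Φ, hx, hΦ⟩ := hf
  refine isLocalDiffeomorphAt_of_inverse (g := fun w : X' × Z => (Φ.symm w.1, w.2))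
    (U := Φ.source ×ˢ univ) (V := Φ.target ×ˢ univ) ⟨hx, mem_univ _⟩
    (Φ.open_source.prod isOpen_univ) (Φ.open_target.prod isOpen_univ) ?_ ?_ ?_ ?_ ?_ ?_
  · intro w hw
    refine ⟨?_, mem_univ _⟩
    dsimp only
    rw [hΦ hw.1]
    exact Φ.map_source' hw.1
  · intro w hw
    exact ⟨Φ.map_target' hw.1, mem_univ _⟩
  · intro w hw
    refine Prod.ext ?_ rfl
    dsimp only
    rw [hΦ hw.1]
    exact Φ.left_inv' hw.1
  · intro w hw
    refine Prod.ext ?_ rfl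
    exact (hΦ (Φ.map_target' hw.1)).trans (Φ.right_inv' hw.1)
  · refine ContMDiffOn.prodMk ?_ contMDiffOn_snd
    exact (Φ.contMDiffOn_toFun.congr hΦ).comp contMDiffOn_fst fun w hw => hw.1
  · refine ContMDiffOn.prodMk ?_ contMDiffOn_snd
    exact Φ.contMDiffOn_invFun.comp contMDiffOn_fst fun w hw => hw.1

end LocalDiffeo

/-! ### The circle -/

section Circle

theorem contMDiff_coe_circle : ContMDiff (𝓡 1) 𝓘(ℝ, ℂ) ∞ (fun s : Circle => (s : ℂ)) :=
  haveI := finrank_real_complex_fact'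
  contMDiff_coe_sphere (E := ℂ) (n := 1)

theorem contMDiffAt_arg {c : Circle} (hc : (c : ℂ) ∈ Complex.slitPlane) :
    ContMDiffAt (𝓡 1) 𝓘(ℝ, ℝ) ∞ (fun s : Circle => Complex.arg s) c := by
  have h0 : ContDiffAt ℝ ∞ (fun z : ℂ => (Complex.log z).im) (c : ℂ) :=
    Complex.imCLM.contDiff.contDiffAt.comp _
      ((Complex.contDiffAt_log hc).restrict_scalars ℝ)
  have h1 : ContDiffAt ℝ ∞ (fun z : ℂ => Complex.arg z) (c : ℂ) := by
    simpa only [Complex.log_im] using h0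
  exact h1.contMDiffAt.comp c contMDiff_coe_circle.contMDiffAt

theorem contMDiff_circle_mul_left (s : Circle) :
    ContMDiff (𝓡 1) (𝓡 1) ∞ (fun c : Circle => s * c) :=
  haveI : LieGroup (𝓡 1) ∞ Circle := LieGroup.of_le (n := ω) le_top
  contMDiff_const.mul contMDiff_id

/-- A local inverse is the argument measured from `t₀`, on the circle without the antipode of `exp(i
t₀)`. -/
theorem isLocalDiffeomorphAt_circleExp (t₀ : ℝ) :
    IsLocalDiffeomorphAt 𝓘(ℝ, ℝ) (𝓡 1) ∞ (fun t : ℝ => Circle.exp t) t₀ := by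
  refine isLocalDiffeomorphAt_of_inverse
    (g := fun c : Circle => t₀ + Complex.arg ((Circle.exp t₀)⁻¹ * c : Circle))
    (U := Ioo (t₀ - Real.pi) (t₀ + Real.pi))
    (V := (fun c : Circle => (((Circle.exp t₀)⁻¹ * c : Circle) : ℂ)) ⁻¹' Complex.slitPlane)
    ⟨by linarith [Real.pi_pos], by linarith [Real.pi_pos]⟩ isOpen_Ioo ?_ ?_ ?_ ?_ ?_ ?_ ?_
  · exact Complex.isOpen_slitPlane.preimage (by fun_prop)
  · intro t ht
    change (((Circle.exp t₀)⁻¹ * Circle.exp t : Circle) : ℂ) ∈ Complex.slitPlane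
    rw [← Circle.exp_neg, ← Circle.exp_add, Complex.mem_slitPlane_iff_arg, Circle.arg_exp]
    · refine ⟨?_, by simp⟩
      rintro h
      linarith [ht.2]
    · linarith [ht.1]
    · linarith [ht.2]
  · intro c hc
    have h1 := (Complex.mem_slitPlane_iff_arg.1 hc).1
    have h2 := Complex.arg_mem_Ioc (((Circle.exp t₀)⁻¹ * c : Circle) : ℂ)
    have h3 := lt_of_le_of_ne h2.2 h1
    exact ⟨by linarith [h2.1], by linarith⟩
  · intro t ht
    rw [← Circle.exp_neg, ← Circle.exp_add, Circle.arg_exp]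
    · ring
    · linarith [ht.1]
    · linarith [ht.2]
  · intro c _
    rw [Circle.exp_add, Circle.exp_arg]
    simp
  · exact contMDiff_circleExp.contMDiffOn
  · intro c hc
    refine ContMDiffAt.contMDiffWithinAt ?_
    exact contMDiffAt_const.add ((contMDiffAt_arg hc).comp c
      (contMDiff_circle_mul_left _).contMDiffAt)

theorem isLocalDiffeomorphAt_mul_const (c : ℝ) (hc : c ≠ 0) (t₀ : ℝ) :
    IsLocalDiffeomorphAt 𝓘(ℝ, ℝ) 𝓘(ℝ, ℝ) ∞ (fun t : ℝ => c * t) t₀ :=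
  isLocalDiffeomorphAt_of_inverse (g := fun t : ℝ => c⁻¹ * t) (U := univ) (V := univ)
    (mem_univ _) isOpen_univ isOpen_univ (fun _ _ => mem_univ _) (fun _ _ => mem_univ _)
    (fun t _ => by field_simp) (fun t _ => by field_simp)
    (contDiff_const.mul contDiff_id).contMDiff.contMDiffOn
    (contDiff_const.mul contDiff_id).contMDiff.contMDiffOn

/-- The point of the circle with angle `2πt`. -/
def circ (t : ℝ) : Circle := Circle.exp (2 * Real.pi * t)

theorem isLocalDiffeomorphAt_circ (t₀ : ℝ) :
    IsLocalDiffeomorphAt 𝓘(ℝ, ℝ) (𝓡 1) ∞ circ t₀ :=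
  (isLocalDiffeomorphAt_mul_const (2 * Real.pi) (by positivity) t₀).comp _ _
    (isLocalDiffeomorphAt_circleExp _)

theorem continuous_circ : Continuous circ := by unfold circ; fun_prop

theorem circ_add (s t : ℝ) : circ (s + t) = circ s * circ t := by
  unfold circ; rw [mul_add, Circle.exp_add]

theorem circ_int (m : ℤ) : circ m = 1 := by
  unfold circ
  rw [Circle.exp_eq_one]
  exact ⟨m, by ring⟩

theorem circ_eq_iff {s t : ℝ} : circ s = circ t ↔ ∃ m : ℤ, t = s + m := by
  unfold circ
  rw [Circle.exp_eq_exp]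
  constructor
  · rintro ⟨m, hm⟩
    refine ⟨-m, ?_⟩
    have : 2 * Real.pi * (s - t - m) = 0 := by linarith
    have h2 : s - t - m = 0 := by
      rcases mul_eq_zero.1 this with h | h
      · exact absurd h (by positivity)
      · exact h
    push_cast
    linarith
  · rintro ⟨m, rfl⟩
    exact ⟨-m, by push_cast; ring⟩

theorem circ_pow (k : ℕ) (t : ℝ) : circ t ^ k = circ (k * t) := by
  unfold circ
  rw [← Circle.exp_nsmul, nsmul_eq_mul]
  congr 1
  ring

end Circle

/-! ### Fibre bundles over the circle are mapping tori -/

section MappingTorus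

variable {n : ℕ} {N B : Type u}
  [TopologicalSpace N] [ChartedSpace (EuclideanSpace ℝ (Fin (2 * (n + 1) + 1))) N]
  [TopologicalSpace B] [ChartedSpace (EuclideanSpace ℝ (Fin (2 * n + 1))) B]

/-- A trivialization, over an interval, of the pull-back of the complement of the binding to the
universal covering of the circle. -/
structure IsTriv (ob : OpenBook n N B) {P : Type u} [TopologicalSpace P]
    [ChartedSpace (EuclideanSpace ℝ (Fin (2 * (n + 1)))) P] (a b : ℝ) (T : ℝ × P → N) : Prop where
  localDiffeo : ∀ t ∈ Ioo a b, ∀ p, IsLocalDiffeomorphAt (𝓘(ℝ, ℝ).prod (𝓡 (2 * (n + 1))))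
    (𝓡 (2 * (n + 1) + 1)) ∞ T (t, p)
  notMem : ∀ t ∈ Ioo a b, ∀ p, T (t, p) ∉ ob.binding
  θ_eq : ∀ t ∈ Ioo a b, ∀ p, ob.θ (T (t, p)) = circ t
  inj : ∀ t ∈ Ioo a b, ∀ p p', T (t, p) = T (t, p') → p = p'
  surj : ∀ t ∈ Ioo a b, ∀ x ∉ ob.binding, ob.θ x = circ t → ∃ p, T (t, p) = x

variable {ob : OpenBook n N B} {P P₁ P₂ : Type u}
  [TopologicalSpace P] [ChartedSpace (EuclideanSpace ℝ (Fin (2 * (n + 1)))) P]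
  [TopologicalSpace P₁] [ChartedSpace (EuclideanSpace ℝ (Fin (2 * (n + 1)))) P₁]
  [TopologicalSpace P₂] [ChartedSpace (EuclideanSpace ℝ (Fin (2 * (n + 1)))) P₂]

theorem IsTriv.mono {a b a' b' : ℝ} {T : ℝ × P → N} (h : IsTriv ob a b T)
    (hab : Ioo a' b' ⊆ Ioo a b) : IsTriv ob a' b' T where
  localDiffeo t ht := h.localDiffeo t (hab ht)
  notMem t ht := h.notMem t (hab ht)
  θ_eq t ht := h.θ_eq t (hab ht)
  inj t ht := h.inj t (hab ht)
  surj t ht := h.surj t (hab ht)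

/-- The change of trivialization. -/
theorem IsTriv.transition {a b : ℝ} {T₁ : ℝ × P₁ → N} {T₂ : ℝ × P₂ → N} (hab : a < b)
    (h₁ : IsTriv ob a b T₁) (h₂ : IsTriv ob a b T₂) :
    ∃ h : ℝ × P₁ → P₂, (∀ t ∈ Ioo a b, ∀ p, T₂ (t, h (t, p)) = T₁ (t, p)) ∧
      ContMDiffOn (𝓘(ℝ, ℝ).prod (𝓡 (2 * (n + 1)))) (𝓡 (2 * (n + 1))) ∞ h
        (Ioo a b ×ˢ (univ : Set P₁)) := by
  classical
  have hex : ∀ w : ℝ × P₁, ∃ p₂ : P₂, w.1 ∈ Ioo a b → T₂ (w.1, p₂) = T₁ w := by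
    rintro ⟨t, p⟩
    by_cases ht : t ∈ Ioo a b
    · obtain ⟨p₂, hp₂⟩ := h₂.surj t ht _ (h₁.notMem t ht p) (h₁.θ_eq t ht p)
      exact ⟨p₂, fun _ => hp₂⟩
    -- Outside the interval any point of `P₂` will do; one exists since `T₂` reaches the point `T₁
    -- (·, p)` over the midpoint.
    · have hm : (a + b) / 2 ∈ Ioo a b := ⟨by linarith, by linarith⟩
      obtain ⟨p₂, -⟩ := h₂.surj _ hm _ (h₁.notMem _ hm p) (h₁.θ_eq _ hm p)
      exact ⟨p₂, fun h => absurd h ht⟩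
  choose h hh using hex
  have hh' : ∀ t ∈ Ioo a b, ∀ p, T₂ (t, h (t, p)) = T₁ (t, p) := fun t ht p => hh (t, p) ht
  refine ⟨h, hh', ?_⟩
  rintro ⟨t₀, p₀⟩ ⟨ht₀, -⟩
  refine ContMDiffAt.contMDiffWithinAt ?_
  have hld := h₂.localDiffeo t₀ ht₀ (h (t₀, p₀))
  obtain ⟨Φ, hx, hΦ⟩ := hld
  have hmem : T₁ (t₀, p₀) ∈ Φ.target := by
    rw [← hh' t₀ ht₀ p₀, hΦ hx]
    exact Φ.map_source' hx
  have hval : Φ.symm (T₁ (t₀, p₀)) = (t₀, h (t₀, p₀)) := by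
    rw [← hh' t₀ ht₀ p₀, hΦ hx]
    exact Φ.left_inv' hx
  have hT₁ := (h₁.localDiffeo t₀ ht₀ p₀).contMDiffAt
  have hc : ContMDiffAt (𝓘(ℝ, ℝ).prod (𝓡 (2 * (n + 1)))) (𝓘(ℝ, ℝ).prod (𝓡 (2 * (n + 1)))) ∞
      (fun w => Φ.symm (T₁ w)) (t₀, p₀) :=
    ContMDiffAt.comp (t₀, p₀) (Φ.contMDiffOn_invFun.contMDiffAt (Φ.open_target.mem_nhds hmem)) hT₁
  -- A local inverse of `T₂` recovers the time only modulo integers; close to `t₀` the discrepancy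
  -- is smaller than `1` and hence zero.
  have hev : h =ᶠ[𝓝 (t₀, p₀)] fun w => (Φ.symm (T₁ w)).2 := by
    have hfst : ContinuousAt (fun w : ℝ × P₁ => (Φ.symm (T₁ w)).1 - w.1) (t₀, p₀) :=
      (continuousAt_fst.comp hc.continuousAt).sub continuousAt_fst
    have e1 : ∀ᶠ w : ℝ × P₁ in 𝓝 (t₀, p₀), (Φ.symm (T₁ w)).1 - w.1 ∈ Ioo (-1 : ℝ) 1 := by
      refine hfst.eventually (isOpen_Ioo.mem_nhds ?_)
      change (Φ.symm (T₁ (t₀, p₀))).1 - t₀ ∈ _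
      rw [hval]
      simp
    have e2 : ∀ᶠ w : ℝ × P₁ in 𝓝 (t₀, p₀), (Φ.symm (T₁ w)).1 ∈ Ioo a b := by
      refine (continuousAt_fst.comp hc.continuousAt).eventually (isOpen_Ioo.mem_nhds ?_)
      change (Φ.symm (T₁ (t₀, p₀))).1 ∈ _
      rw [hval]
      exact ht₀
    have e3 : ∀ᶠ w : ℝ × P₁ in 𝓝 (t₀, p₀), w.1 ∈ Ioo a b :=
      continuousAt_fst.eventually (isOpen_Ioo.mem_nhds ht₀)
    have e4 : ∀ᶠ w : ℝ × P₁ in 𝓝 (t₀, p₀), T₁ w ∈ Φ.target :=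
      hT₁.continuousAt.eventually (Φ.open_target.mem_nhds hmem)
    filter_upwards [e1, e2, e3, e4] with w w1 w2 w3 w4
    have hT : T₂ (Φ.symm (T₁ w)) = T₁ w := (hΦ (Φ.map_target' w4)).trans (Φ.right_inv' w4)
    have hθ : circ (Φ.symm (T₁ w)).1 = circ w.1 := by
      rw [← h₂.θ_eq _ w2 (Φ.symm (T₁ w)).2, ← h₁.θ_eq _ w3 w.2]
      exact congrArg ob.θ hT
    obtain ⟨m, hm⟩ := circ_eq_iff.1 hθ
    have hm0 : m = 0 := by
      have l1 : (-1 : ℝ) < m := by linarith [w1.2]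
      have l2 : (m : ℝ) < 1 := by linarith [w1.1]
      have l3 : (-1 : ℤ) < m := by exact_mod_cast l1
      have l4 : m < (1 : ℤ) := by exact_mod_cast l2
      omega
    rw [hm0, Int.cast_zero, add_zero] at hm
    refine h₂.inj w.1 w3 _ _ ?_
    rw [hh' w.1 w3 w.2]
    change T₁ w = _
    rw [hm]
    exact hT.symm
  refine ContMDiffAt.congr_of_eventuallyEq ?_ hev
  exact contMDiffAt_snd.comp _ hc

/-- Precomposing a trivialization with a family of diffeomorphisms of the fibre. -/
theorem IsTriv.reparam {a b : ℝ} {T : ℝ × P₂ → N} (hT : IsTriv ob a b T)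
    {h : ℝ × P₁ → P₂} {h' : ℝ × P₂ → P₁}
    (hh : ContMDiffOn (𝓘(ℝ, ℝ).prod (𝓡 (2 * (n + 1)))) (𝓡 (2 * (n + 1))) ∞ h
        (Ioo a b ×ˢ (univ : Set P₁)))
    (hh' : ContMDiffOn (𝓘(ℝ, ℝ).prod (𝓡 (2 * (n + 1)))) (𝓡 (2 * (n + 1))) ∞ h'
        (Ioo a b ×ˢ (univ : Set P₂)))
    (hl : ∀ t ∈ Ioo a b, ∀ p, h' (t, h (t, p)) = p)
    (hr : ∀ t ∈ Ioo a b, ∀ p, h (t, h' (t, p)) = p) :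
    IsTriv ob a b (fun w : ℝ × P₁ => T (w.1, h w)) where
  localDiffeo t ht p := by
    have h1 : IsLocalDiffeomorphAt (𝓘(ℝ, ℝ).prod (𝓡 (2 * (n + 1))))
        (𝓘(ℝ, ℝ).prod (𝓡 (2 * (n + 1)))) ∞ (fun w : ℝ × P₁ => (w.1, h w)) (t, p) := by
      refine isLocalDiffeomorphAt_of_inverse (g := fun w : ℝ × P₂ => (w.1, h' w))
        (U := Ioo a b ×ˢ univ) (V := Ioo a b ×ˢ univ) ⟨ht, mem_univ _⟩
        (isOpen_Ioo.prod isOpen_univ) (isOpen_Ioo.prod isOpen_univ)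
        (fun w hw => ⟨hw.1, mem_univ _⟩) (fun w hw => ⟨hw.1, mem_univ _⟩)
        (fun w hw => Prod.ext rfl (hl _ hw.1 _)) (fun w hw => Prod.ext rfl (hr _ hw.1 _))
        (contMDiffOn_fst.prodMk hh) (contMDiffOn_fst.prodMk hh')
    exact h1.comp _ _ (hT.localDiffeo t ht (h (t, p)))
  notMem t ht p := hT.notMem t ht _
  θ_eq t ht p := hT.θ_eq t ht _
  inj t ht p p' hp := by
    have := hT.inj t ht _ _ hp
    rw [← hl t ht p, ← hl t ht p', this]
  surj t ht x hx hθ := by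
    obtain ⟨p, hp⟩ := hT.surj t ht x hx hθ
    exact ⟨h' (t, p), by dsimp only; rw [hr t ht, hp]⟩

/-- `circ` has period `c` as soon as `circ c = 1`, so translating the time does not disturb the
projection. -/
theorem IsTriv.shift {a b c : ℝ} (hc : circ c = 1) {T : ℝ × P → N} (hT : IsTriv ob a b T) :
    IsTriv ob (a + c) (b + c) (fun w : ℝ × P => T (w.1 - c, w.2)) := by
  have hmem : ∀ t ∈ Ioo (a + c) (b + c), t - c ∈ Ioo a b := fun t ht =>
    ⟨by linarith [ht.1], by linarith [ht.2]⟩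
  have hcirc : ∀ t, circ (t - c) = circ t := by
    intro t
    have := circ_add (t - c) c
    rw [sub_add_cancel, hc, mul_one] at this
    exact this.symm
  refine ⟨fun t ht p => ?_, fun t ht p => hT.notMem _ (hmem t ht) p, fun t ht p => ?_,
    fun t ht p p' hp => hT.inj _ (hmem t ht) p p' hp, fun t ht x hx hθ => ?_⟩
  · have h1 : IsLocalDiffeomorphAt 𝓘(ℝ, ℝ) 𝓘(ℝ, ℝ) ∞ (fun s : ℝ => s - c) t :=
      isLocalDiffeomorphAt_of_inverse (g := fun s : ℝ => s + c) (U := univ) (V := univ)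
        (mem_univ _) isOpen_univ isOpen_univ (fun _ _ => mem_univ _) (fun _ _ => mem_univ _)
        (fun s _ => by ring) (fun s _ => by ring)
        (contDiff_id.sub contDiff_const).contMDiff.contMDiffOn
        (contDiff_id.add contDiff_const).contMDiff.contMDiffOn
    exact (isLocalDiffeomorphAt_prodMk_id p h1).comp _ _ (hT.localDiffeo _ (hmem t ht) p)
  · dsimp only
    rw [hT.θ_eq _ (hmem t ht) p, hcirc]
  · exact hT.surj _ (hmem t ht) x hx (by rw [hθ, hcirc])

/-- A smooth function which is the identity on the left and constant on the right. -/
theorem exists_freeze {c b : ℝ} (hcb : c < b) : ∃ (χ : ℝ → ℝ) (c₁ c₂ m : ℝ), ContDiff ℝ ∞ χ ∧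
    c < c₁ ∧ c₁ < c₂ ∧ c₂ < b ∧ m ∈ Ioo c b ∧ (∀ t ≤ c₁, χ t = t) ∧ (∀ t, c₂ ≤ t → χ t = m) ∧
    ∀ t, c < t → χ t ∈ Ioo c b := by
  set w := (b - c) / 4
  have hw : 0 < w := by simp only [w]; linarith
  have hw' : c + 4 * w = b := by simp only [w]; ring
  -- Interpolation between `t` and the midpoint `c + 2w` while `t` runs through `[c + w, c + 2w]`.
  -- Before the midpoint is reached the value is a convex combination of the two, so it stays in the
  -- interval.
  refine ⟨fun t => t + Real.smoothTransition ((t - (c + w)) / w) * ((c + 2 * w) - t),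
    c + w, c + 2 * w, c + 2 * w, ?_, by linarith, by linarith, by linarith,
    ⟨by linarith, by linarith⟩, ?_, ?_, ?_⟩
  · refine contDiff_id.add (ContDiff.mul (Real.smoothTransition.contDiff.comp ?_)
      (contDiff_const.sub contDiff_id))
    exact (contDiff_id.sub contDiff_const).div_const _
  · intro t ht
    dsimp only
    rw [Real.smoothTransition.zero_of_nonpos (div_nonpos_of_nonpos_of_nonneg (by linarith) hw.le)]
    ring
  · intro t ht
    dsimp only
    rw [Real.smoothTransition.one_of_one_le ((one_le_div hw).2 (by linarith))]
    ring
  · intro t ht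
    dsimp only
    set s := Real.smoothTransition ((t - (c + w)) / w) with hs
    have hs0 : 0 ≤ s := Real.smoothTransition.nonneg _
    have hs1 : s ≤ 1 := Real.smoothTransition.le_one _
    rcases le_or_gt (c + 2 * w) t with h | h
    · have : s = 1 := Real.smoothTransition.one_of_one_le ((one_le_div hw).2 (by linarith))
      rw [this]
      exact ⟨by linarith, by linarith⟩
    · have h2 : 0 ≤ s * (c + 2 * w - t) := mul_nonneg hs0 (by linarith)
      have h3 : s * (c + 2 * w - t) ≤ 1 * (c + 2 * w - t) :=
        mul_le_mul_of_nonneg_right hs1 (by linarith)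
      exact ⟨by linarith, by linarith⟩

/-- Trivializations over overlapping intervals can be glued. -/
theorem IsTriv.glue {a b c d : ℝ} (hac : a ≤ c) (hcb : c < b) (hbd : b ≤ d)
    {T₁ : ℝ × P₁ → N} {T₂ : ℝ × P₂ → N}
    (h₁ : IsTriv ob a b T₁) (h₂ : IsTriv ob c d T₂) :
    ∃ T : ℝ × P₁ → N, IsTriv ob a d T ∧ ∃ c₁ c₂ : ℝ, c < c₁ ∧ c₁ < c₂ ∧ c₂ < b ∧
      (∀ t ≤ c₁, ∀ p, T (t, p) = T₁ (t, p)) ∧ ∃ φ : P₁ ≃ P₂,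
        ContMDiff (𝓡 (2 * (n + 1))) (𝓡 (2 * (n + 1))) ∞ φ ∧
        ContMDiff (𝓡 (2 * (n + 1))) (𝓡 (2 * (n + 1))) ∞ φ.symm ∧
        ∀ t, c₂ ≤ t → ∀ p, T (t, p) = T₂ (t, φ p) := by
  classical
  have h₁' : IsTriv ob c b T₁ := h₁.mono (Ioo_subset_Ioo hac le_rfl)
  have h₂' : IsTriv ob c b T₂ := h₂.mono (Ioo_subset_Ioo le_rfl hbd)
  obtain ⟨h, hh, hhs⟩ := h₁'.transition hcb h₂'
  obtain ⟨k, hk, hks⟩ := h₂'.transition hcb h₁'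
  obtain ⟨χ, c₁, c₂, m, hχ, hc₁, hc₁₂, hc₂, hm, hχ₁, hχ₂, hχm⟩ := exists_freeze hcb
  have hkh : ∀ t ∈ Ioo c b, ∀ p, k (t, h (t, p)) = p := fun t ht p =>
    h₁'.inj t ht _ _ (by rw [hk t ht, hh t ht])
  have hhk : ∀ t ∈ Ioo c b, ∀ p, h (t, k (t, p)) = p := fun t ht p =>
    h₂'.inj t ht _ _ (by rw [hh t ht, hk t ht])
  have hχs : ∀ {Q : Type u} [TopologicalSpace Q]
      [ChartedSpace (EuclideanSpace ℝ (Fin (2 * (n + 1)))) Q],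
      ContMDiff (𝓘(ℝ, ℝ).prod (𝓡 (2 * (n + 1)))) (𝓘(ℝ, ℝ).prod (𝓡 (2 * (n + 1)))) ∞
        (fun w : ℝ × Q => (χ w.1, w.2)) := fun {Q} _ _ =>
    (hχ.contMDiff.comp contMDiff_fst).prodMk contMDiff_snd
  -- With the time in the transition map frozen by `χ`, this trivialization agrees with `T₁` on the
  -- left, while on the right it is `T₂` with fibres identified by the single diffeomorphism `h (m,
  -- ·)`.
  have hT : IsTriv ob c d (fun w : ℝ × P₁ => T₂ (w.1, h (χ w.1, w.2))) := by
    refine h₂.reparam (h := fun w : ℝ × P₁ => h (χ w.1, w.2))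
      (h' := fun w : ℝ × P₂ => k (χ w.1, w.2)) ?_ ?_ ?_ ?_
    · exact hhs.comp hχs.contMDiffOn fun w hw => ⟨hχm _ hw.1.1, mem_univ _⟩
    · exact hks.comp hχs.contMDiffOn fun w hw => ⟨hχm _ hw.1.1, mem_univ _⟩
    · exact fun t ht p => hkh _ (hχm _ ht.1) p
    · exact fun t ht p => hhk _ (hχm _ ht.1) p
  set T : ℝ × P₁ → N := fun w => if w.1 ≤ c₁ then T₁ w else T₂ (w.1, h (χ w.1, w.2)) with hTdef
  have hTl : ∀ w : ℝ × P₁, w.1 ≤ c₁ → T w = T₁ w := fun w hw => if_pos hw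
  have hTr : ∀ w : ℝ × P₁, c < w.1 → T w = T₂ (w.1, h (χ w.1, w.2)) := by
    intro w hw
    by_cases hwc : w.1 ≤ c₁
    · rw [hTl w hwc, hχ₁ _ hwc, hh _ ⟨hw, by linarith⟩]
    · exact if_neg hwc
  refine ⟨T, ⟨?_, ?_, ?_, ?_, ?_⟩, c₁, c₂, hc₁, hc₁₂, hc₂, fun t ht p => hTl (t, p) ht,
    ⟨fun p => h (m, p), fun p => k (m, p), hkh m hm, hhk m hm⟩, ?_, ?_, ?_⟩
  · intro t ht p
    rcases lt_or_ge t c₁ with htc | htc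
    · refine isLocalDiffeomorphAt_congr (h₁.localDiffeo t ⟨ht.1, by linarith⟩ p) ?_
      have : ∀ᶠ w : ℝ × P₁ in 𝓝 (t, p), w.1 < c₁ :=
        continuousAt_fst.eventually (isOpen_Iio.mem_nhds (by exact htc))
      filter_upwards [this] with w hw
      exact hTl w hw.le
    · refine isLocalDiffeomorphAt_congr (hT.localDiffeo t ⟨by linarith, ht.2⟩ p) ?_
      have : ∀ᶠ w : ℝ × P₁ in 𝓝 (t, p), c < w.1 :=
        continuousAt_fst.eventually (isOpen_Ioi.mem_nhds (by change c < t; linarith))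
      filter_upwards [this] with w hw
      exact hTr w hw
  · intro t ht p
    rcases lt_or_ge t c₁ with htc | htc
    · rw [hTl (t, p) htc.le]
      exact h₁.notMem t ⟨ht.1, by linarith⟩ p
    · rw [hTr (t, p) (by change c < t; linarith)]
      exact hT.notMem t ⟨by linarith, ht.2⟩ p
  · intro t ht p
    rcases lt_or_ge t c₁ with htc | htc
    · rw [hTl (t, p) htc.le]
      exact h₁.θ_eq t ⟨ht.1, by linarith⟩ p
    · rw [hTr (t, p) (by change c < t; linarith)]
      exact hT.θ_eq t ⟨by linarith, ht.2⟩ p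
  · intro t ht p p' hp
    rcases lt_or_ge t c₁ with htc | htc
    · rw [hTl (t, p) htc.le, hTl (t, p') htc.le] at hp
      exact h₁.inj t ⟨ht.1, by linarith⟩ p p' hp
    · rw [hTr (t, p) (by change c < t; linarith), hTr (t, p') (by change c < t; linarith)] at hp
      exact hT.inj t ⟨by linarith, ht.2⟩ p p' hp
  · intro t ht x hx hθ
    rcases lt_or_ge t c₁ with htc | htc
    · obtain ⟨p, hp⟩ := h₁.surj t ⟨ht.1, by linarith⟩ x hx hθ
      exact ⟨p, (hTl (t, p) htc.le).trans hp⟩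
    · obtain ⟨p, hp⟩ := hT.surj t ⟨by linarith, ht.2⟩ x hx hθ
      exact ⟨p, (hTr (t, p) (by change c < t; linarith)).trans hp⟩
  · exact contMDiffOn_univ.1 (hhs.comp (contMDiff_const.prodMk contMDiff_id).contMDiffOn
      fun p _ => ⟨hm, mem_univ _⟩)
  · exact contMDiffOn_univ.1 (hks.comp (contMDiff_const.prodMk contMDiff_id).contMDiffOn
      fun p _ => ⟨hm, mem_univ _⟩)
  · intro t ht p
    rw [hTr (t, p) (by change c < t; linarith)]
    dsimp only
    rw [hχ₂ t ht]
    rfl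

/-- Local existence of trivializations. -/
theorem exists_isTriv (ob : OpenBook n N B) (t₀ : ℝ) : ∃ δ > 0, ∃ (P : Type u)
    (_ : TopologicalSpace P) (_ : ChartedSpace (EuclideanSpace ℝ (Fin (2 * (n + 1)))) P)
    (_ : IsManifold (𝓡 (2 * (n + 1))) ∞ P) (T : ℝ × P → N),
    IsTriv ob (t₀ - δ) (t₀ + δ) T := by
  obtain ⟨P, iT, iC, iM, T, V, hVo, hsV, hTs, hTt, hθ⟩ := ob.θ_bundle (circ t₀)
  obtain ⟨δ, hδ, hball⟩ := Metric.mem_nhds_iff.1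
    (continuous_circ.continuousAt.preimage_mem_nhds (hVo.mem_nhds hsV))
  have hV : ∀ t ∈ Ioo (t₀ - δ) (t₀ + δ), circ t ∈ V := by
    intro t ht
    exact hball (by rw [Real.ball_eq_Ioo]; exact ht)
  have hsrc : ∀ t ∈ Ioo (t₀ - δ) (t₀ + δ), ∀ p : P, (circ t, p) ∈ T.source := by
    intro t ht p
    rw [hTs]
    exact ⟨hV t ht, mem_univ _⟩
  refine ⟨δ, hδ, P, iT, iC, iM, fun w => T (circ w.1, w.2), ⟨?_, ?_, ?_, ?_, ?_⟩⟩
  · intro t ht p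
    exact (isLocalDiffeomorphAt_prodMk_id p (isLocalDiffeomorphAt_circ t)).comp _ _
      (T.isLocalDiffeomorphAt _ _ _ (hsrc t ht p))
  · intro t ht p
    have := T.map_source' (hsrc t ht p)
    change T (circ t, p) ∈ T.target at this
    rw [hTt] at this
    exact this.1
  · exact fun t ht p => hθ _ (hsrc t ht p)
  · intro t ht p p' hp
    have := T.injOn (hsrc t ht p) (hsrc t ht p') hp
    exact (Prod.ext_iff.1 this).2
  · intro t ht x hx hxθ
    have hxt : x ∈ T.target := by
      rw [hTt]
      exact ⟨hx, by rw [hxθ]; exact hV t ht⟩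
    have h1 := T.map_target' hxt
    have h2 : T (T.symm x) = x := T.right_inv' hxt
    have h3 := hθ _ h1
    refine ⟨(T.symm x).2, ?_⟩
    have h4 : (T.symm x).1 = circ t := by
      rw [← hxθ]
      exact h3.symm.trans (congrArg ob.θ h2)
    dsimp only
    rw [← h4, h2]

end MappingTorus

/-! ### The monodromy and the mapping torus. -/

section MappingTorusExistence

variable {n : ℕ} {N B : Type u}
  [TopologicalSpace N] [ChartedSpace (EuclideanSpace ℝ (Fin (2 * (n + 1) + 1))) N]
  [TopologicalSpace B] [ChartedSpace (EuclideanSpace ℝ (Fin (2 * n + 1))) B]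

/-- A trivialization over an interval of length more than `1`. -/
theorem exists_isTriv_long (ob : OpenBook n N B) : ∃ (P : Type u)
    (_ : TopologicalSpace P) (_ : ChartedSpace (EuclideanSpace ℝ (Fin (2 * (n + 1)))) P)
    (_ : IsManifold (𝓡 (2 * (n + 1))) ∞ P) (T : ℝ × P → N) (δ : ℝ), 0 < δ ∧ δ ≤ 1 / 4 ∧
    IsTriv ob (-δ) (1 + δ) T := by
  choose ρ hρ Q iT iC iM S hS using exists_isTriv ob
  -- A common radius for trivialized intervals around the points of `[0, 2]`.
  obtain ⟨δ, hδ, hleb⟩ := lebesgue_number_lemma_of_metric (isCompact_Icc (a := (0 : ℝ)) (b := 2))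
    (c := fun t : ℝ => Ioo (t - ρ t) (t + ρ t)) (fun _ => isOpen_Ioo)
    (fun t _ => mem_iUnion.2 ⟨t, by linarith [hρ t], by linarith [hρ t]⟩)
  have hloc : ∀ t ∈ Icc (0 : ℝ) 2, ∃ i, IsTriv ob (t - δ) (t + δ) (S i) := by
    intro t ht
    obtain ⟨i, hi⟩ := hleb t ht
    rw [Real.ball_eq_Ioo] at hi
    exact ⟨i, (hS i).mono hi⟩
  obtain ⟨i₀, hi₀⟩ := hloc 0 ⟨le_rfl, by norm_num⟩
  -- The trivialization is extended to the right by `δ` at a time, and the gluing keeps the fibre `Q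
  -- i₀` of the leftmost one.
  have hstep : ∀ j : ℕ, (j : ℝ) * δ ≤ 2 → ∃ T : ℝ × Q i₀ → N, IsTriv ob (-δ) ((j + 1) * δ) T := by
    intro j
    induction j with
    | zero =>
      intro _
      refine ⟨S i₀, hi₀.mono ?_⟩
      simp
    | succ j ih =>
      intro hj
      push_cast at hj
      obtain ⟨T₁, hT₁⟩ := ih (by linarith)
      have hj0 : 0 ≤ (j : ℝ) * δ := by positivity
      obtain ⟨i, hi⟩ := hloc ((j + 1) * δ) ⟨by positivity, hj⟩
      obtain ⟨T, hT, -⟩ := hT₁.glue (c := (j + 1) * δ - δ) (d := (j + 1) * δ + δ)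
        (by linarith) (by linarith) (by linarith) hi
      refine ⟨T, hT.mono (Ioo_subset_Ioo le_rfl ?_)⟩
      push_cast
      linarith
  set j := ⌊2 / δ⌋₊
  have hj1 : (j : ℝ) * δ ≤ 2 := by
    have := Nat.floor_le (a := 2 / δ) (by positivity)
    rwa [le_div_iff₀ hδ] at this
  have hj2 : 2 < ((j : ℝ) + 1) * δ := by
    have := Nat.lt_floor_add_one (2 / δ)
    rwa [div_lt_iff₀ hδ] at this
  obtain ⟨T, hT⟩ := hstep j hj1
  refine ⟨Q i₀, iT i₀, iC i₀, iM i₀, T, min δ (1 / 4), by positivity, min_le_right _ _,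
    hT.mono (Ioo_subset_Ioo ?_ ?_)⟩
  · have := min_le_left δ (1 / 4)
    linarith
  · have := min_le_right δ (1 / 4)
    linarith

theorem contMDiff_perm_zpow {P : Type u} [TopologicalSpace P]
    [ChartedSpace (EuclideanSpace ℝ (Fin (2 * (n + 1)))) P] {Φ : Equiv.Perm P}
    (h : ContMDiff (𝓡 (2 * (n + 1))) (𝓡 (2 * (n + 1))) ∞ Φ)
    (h' : ContMDiff (𝓡 (2 * (n + 1))) (𝓡 (2 * (n + 1))) ∞ Φ.symm) (m : ℤ) :
    ContMDiff (𝓡 (2 * (n + 1))) (𝓡 (2 * (n + 1))) ∞ (Φ ^ m : Equiv.Perm P) := by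
  have hnat : ∀ (Ψ : Equiv.Perm P), ContMDiff (𝓡 (2 * (n + 1))) (𝓡 (2 * (n + 1))) ∞ Ψ →
      ∀ j : ℕ, ContMDiff (𝓡 (2 * (n + 1))) (𝓡 (2 * (n + 1))) ∞ (Ψ ^ j : Equiv.Perm P) := by
    intro Ψ hΨ j
    induction j with
    | zero => exact contMDiff_id
    | succ j ih =>
      rw [pow_succ, Equiv.Perm.coe_mul]
      exact ih.comp hΨ
  rcases m.eq_nat_or_neg with ⟨j, rfl | rfl⟩
  · rw [zpow_natCast]
    exact hnat Φ h j
  · rw [zpow_neg, zpow_natCast, ← inv_pow]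
    have hinv := hnat Φ⁻¹ h'
    exact hinv j

/-- The complement of the binding is a mapping torus. -/
theorem exists_isMappingTorus (ob : OpenBook n N B) : ∃ (P : Type u) (_ : TopologicalSpace P)
    (_ : ChartedSpace (EuclideanSpace ℝ (Fin (2 * (n + 1)))) P)
    (_ : IsManifold (𝓡 (2 * (n + 1))) ∞ P) (Φ : Equiv.Perm P) (q : ℝ × P → N),
    ob.IsMappingTorus Φ q := by
  obtain ⟨P, iT, iC, iM, T₀, δ, hδ, hδ4, hT₀⟩ := exists_isTriv_long ob
  have hshift := hT₀.shift (c := 1) (by simpa using circ_int 1)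
  obtain ⟨T, hT, c₁, c₂, hc₁, hc₁₂, hc₂, hTl, φ, hφ, hφ', hTr⟩ :=
    hT₀.glue (by linarith) (by linarith) (by linarith) hshift
  -- Beyond the overlap `T (t + 1, p)` is `T₀ (t, φ p)`, so the monodromy in the convention `(t, p)
  -- ∼ (t + 1, Φ p)` is the inverse of `φ`.
  set Φ : Equiv.Perm P := φ.symm with hΦ
  have hper : ∀ t : ℝ, 1 / 4 < t → t < 3 / 4 → ∀ p, T (t + 1, Φ p) = T (t, p) := by
    intro t ht ht' p
    rw [hTr (t + 1) (by linarith), hTl t (by linarith)]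
    simp [hΦ]
  have hmemT : ∀ t : ℝ, 1 / 4 < t → t < 7 / 4 → t ∈ Ioo (-δ) (1 + δ + 1) := fun t h h' =>
    ⟨by linarith, by linarith⟩
  -- The time is shifted into `[1/2, 3/2)`, well inside the interval over which `T` is a
  -- trivialization.
  set q : ℝ × P → N := fun w => T (w.1 - ⌊w.1 - 1 / 2⌋, (Φ ^ (-⌊w.1 - 1 / 2⌋)) w.2) with hq
  -- The formula for `q` holds for every shift that lands in `(1/4, 7/4)`. This open window contains
  -- the fundamental interval, so `q` is a local diffeomorphism also where the floor jumps.
  have hqm : ∀ (m : ℤ) (t : ℝ) (p : P), 1 / 4 < t - m → t - m < 7 / 4 →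
      q (t, p) = T (t - m, (Φ ^ (-m)) p) := by
    intro m t p h1 h2
    set m₀ := ⌊t - 1 / 2⌋ with hm₀
    have l1 : (m₀ : ℝ) ≤ t - 1 / 2 := Int.floor_le _
    have l2 : t - 1 / 2 < m₀ + 1 := Int.lt_floor_add_one _
    have hqt : q (t, p) = T (t - m₀, (Φ ^ (-m₀)) p) := rfl
    have g1 : m < m₀ + 2 := by
      have : (m : ℝ) < m₀ + 2 := by linarith
      exact_mod_cast this
    have g2 : m₀ - 2 < m := by
      have : (m₀ : ℝ) - 2 < m := by linarith
      exact_mod_cast this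
    rw [hqt]
    obtain h | h | h : m = m₀ ∨ m = m₀ + 1 ∨ m₀ = m + 1 := by omega
    · rw [h]
    · have hm : (m : ℝ) = m₀ + 1 := by exact_mod_cast h
      have hp := hper (t - m) h1 (by linarith) ((Φ ^ (-m)) p)
      rw [← hp, ← Equiv.Perm.mul_apply, ← zpow_one_add]
      congr 2
      · rw [hm]; ring
      · congr 2
        omega
    · have hm : (m₀ : ℝ) = m + 1 := by exact_mod_cast h
      have hp := hper (t - m₀) (by linarith) (by linarith) ((Φ ^ (-m₀)) p)
      rw [← hp, ← Equiv.Perm.mul_apply, ← zpow_one_add]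
      congr 2
      · rw [hm]; ring
      · congr 2
        omega
  have hfl : ∀ t : ℝ, 1 / 4 < t - ⌊t - 1 / 2⌋ ∧ t - ⌊t - 1 / 2⌋ < 7 / 4 := by
    intro t
    have l1 := Int.floor_le (t - 1 / 2)
    have l2 := Int.lt_floor_add_one (t - 1 / 2)
    exact ⟨by linarith, by linarith⟩
  have hcirc : ∀ (t : ℝ) (m : ℤ), circ (t - m) = circ t := by
    intro t m
    exact circ_eq_iff.2 ⟨m, by ring⟩
  have hqθ : ∀ t p, ob.θ (q (t, p)) = circ t := by
    intro t p
    rw [hqm _ t p (hfl t).1 (hfl t).2, hT.θ_eq _ (hmemT _ (hfl t).1 (hfl t).2), hcirc]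
  have hqmem : ∀ t p, q (t, p) ∉ ob.binding := by
    intro t p
    rw [hqm _ t p (hfl t).1 (hfl t).2]
    exact hT.notMem _ (hmemT _ (hfl t).1 (hfl t).2) _
  have hqper : ∀ (t : ℝ) (m : ℤ) (p : P), q (t + m, (Φ ^ m) p) = q (t, p) := by
    intro t m p
    have e : t + m - ((⌊t - 1 / 2⌋ + m : ℤ) : ℝ) = t - ⌊t - 1 / 2⌋ := by push_cast; ring
    rw [hqm (⌊t - 1 / 2⌋ + m) (t + m) _ (by rw [e]; exact (hfl t).1) (by rw [e]; exact (hfl t).2),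
      hqm _ t p (hfl t).1 (hfl t).2, e, ← Equiv.Perm.mul_apply, ← zpow_add]
    congr 3
    ring_nf
  refine ⟨P, iT, iC, iM, Φ, q, hφ', hφ, ?_, ?_, ?_, hqθ⟩
  · rintro ⟨t, p⟩
    set m := ⌊t - 1 / 2⌋
    have hld : IsLocalDiffeomorphAt (𝓘(ℝ, ℝ).prod (𝓡 (2 * (n + 1))))
        (𝓘(ℝ, ℝ).prod (𝓡 (2 * (n + 1)))) ∞
        (fun w : ℝ × P => (w.1 - m, (Φ ^ (-m)) w.2)) (t, p) := by
      refine isLocalDiffeomorphAt_of_inverse (g := fun w : ℝ × P => (w.1 + m, (Φ ^ m) w.2))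
        (U := univ) (V := univ) (mem_univ _) isOpen_univ isOpen_univ (fun _ _ => mem_univ _)
        (fun _ _ => mem_univ _) ?_ ?_ ?_ ?_
      · intro w _
        refine Prod.ext (by simp) ?_
        change (Φ ^ m) ((Φ ^ (-m)) w.2) = w.2
        rw [← Equiv.Perm.mul_apply, ← zpow_add, add_neg_cancel, zpow_zero]
        rfl
      · intro w _
        refine Prod.ext (by simp) ?_
        change (Φ ^ (-m)) ((Φ ^ m) w.2) = w.2
        rw [← Equiv.Perm.mul_apply, ← zpow_add, neg_add_cancel, zpow_zero]
        rfl
      · exact (((contDiff_id.sub contDiff_const).contMDiff.comp contMDiff_fst).prodMk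
          ((contMDiff_perm_zpow hφ' hφ _).comp contMDiff_snd)).contMDiffOn
      · exact (((contDiff_id.add contDiff_const).contMDiff.comp contMDiff_fst).prodMk
          ((contMDiff_perm_zpow hφ' hφ _).comp contMDiff_snd)).contMDiffOn
    refine isLocalDiffeomorphAt_congr (hld.comp _ _
      (hT.localDiffeo _ (hmemT _ (hfl t).1 (hfl t).2) _)) ?_
    have : ∀ᶠ w : ℝ × P in 𝓝 (t, p), w.1 - (m : ℝ) ∈ Ioo (1 / 4 : ℝ) (7 / 4) := by
      have hc : ContinuousAt (fun w : ℝ × P => w.1 - (m : ℝ)) (t, p) := by fun_prop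
      exact hc.eventually (isOpen_Ioo.mem_nhds ⟨(hfl t).1, (hfl t).2⟩)
    filter_upwards [this] with w hw
    exact hqm m w.1 w.2 hw.1 hw.2
  · ext x
    constructor
    · rintro ⟨⟨t, p⟩, rfl⟩
      exact hqmem t p
    · intro hx
      obtain ⟨t, ht⟩ : ∃ t, circ t = ob.θ x := by
        refine ⟨Complex.arg (ob.θ x) / (2 * Real.pi), ?_⟩
        unfold circ
        rw [mul_div_cancel₀ _ (by positivity), Circle.exp_arg]
      obtain ⟨p, hp⟩ := hT.surj _ (hmemT _ (hfl t).1 (hfl t).2) x hx (by rw [hcirc, ht])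
      refine ⟨(t, (Φ ^ ⌊t - 1 / 2⌋) p), ?_⟩
      rw [hqm _ t _ (hfl t).1 (hfl t).2, ← Equiv.Perm.mul_apply, ← zpow_add, neg_add_cancel,
        zpow_zero]
      exact hp
  · intro t t' p p'
    constructor
    · intro h
      have hθ : circ t = circ t' := by rw [← hqθ t p, ← hqθ t' p', h]
      obtain ⟨m, rfl⟩ := circ_eq_iff.1 hθ
      refine ⟨m, rfl, ?_⟩
      have h2 : p' = (Φ ^ m) ((Φ ^ (-m)) p') := by
        rw [← Equiv.Perm.mul_apply, ← zpow_add, add_neg_cancel, zpow_zero]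
        rfl
      rw [h2, hqper, hqm _ t p (hfl t).1 (hfl t).2, hqm _ t _ (hfl t).1 (hfl t).2] at h
      have h3 := hT.inj _ (hmemT _ (hfl t).1 (hfl t).2) _ _ h
      have h4 := (Φ ^ (-⌊t - 1 / 2⌋)).injective h3
      rw [h2, ← h4]
    · rintro ⟨m, rfl, rfl⟩
      exact (hqper t m p).symm

end MappingTorusExistence

/-! ### The radial profile of the branched covering -/

section Profile

/-- A function equal to `rᵏ` for `0 ≤ r ≤ 1/4` and to `r` for `r ≥ 1/2`. -/
def profile (k : ℕ) (r : ℝ) : ℝ := r ^ k + Real.smoothTransition (4 * r - 1) * (r - r ^ k)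

variable {k : ℕ}

theorem contDiff_profile : ContDiff ℝ ∞ (profile k) := by
  unfold profile
  refine (contDiff_id.pow k).add (ContDiff.mul ?_ (contDiff_id.sub (contDiff_id.pow k)))
  exact Real.smoothTransition.contDiff.comp ((contDiff_const.mul contDiff_id).sub contDiff_const)

theorem profile_eq_pow {r : ℝ} (hr : r ≤ 1 / 4) : profile k r = r ^ k := by
  rw [profile, Real.smoothTransition.zero_of_nonpos (by linarith)]
  ring

theorem profile_eq_self {r : ℝ} (hr : 1 / 2 ≤ r) : profile k r = r := by
  rw [profile, Real.smoothTransition.one_of_one_le (by linarith)]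
  ring

theorem profile_zero (hk : 1 ≤ k) : profile k 0 = 0 := by
  rw [profile_eq_pow (by norm_num), zero_pow (by omega)]

theorem monotone_smoothTransition : Monotone Real.smoothTransition := by
  intro x y hxy
  rcases le_or_gt x 0 with hx | hx
  · rw [Real.smoothTransition.zero_of_nonpos hx]
    exact Real.smoothTransition.nonneg y
  rcases le_or_gt 1 y with hy | hy
  · rw [Real.smoothTransition.one_of_one_le hy]
    exact Real.smoothTransition.le_one x
  · unfold Real.smoothTransition
    have e : ∀ t : ℝ, 0 < t → t < 1 → 0 < expNegInvGlue t ∧ 0 < expNegInvGlue (1 - t) :=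
      fun t h0 h1 => ⟨expNegInvGlue.pos_of_pos h0, expNegInvGlue.pos_of_pos (by linarith)⟩
    have hm : Monotone expNegInvGlue := expNegInvGlue.monotone
    obtain ⟨p1, p2⟩ := e x hx (by linarith)
    obtain ⟨q1, q2⟩ := e y (by linarith) hy
    rw [div_le_div_iff₀ (by linarith) (by linarith)]
    have h1 := hm hxy
    have h2 := hm (show 1 - y ≤ 1 - x by linarith)
    nlinarith [mul_le_mul h1 h2 q2.le q1.le]

/-- For `r ≤ 1/2` the derivative is the convex combination `(1 - χ) k rᵏ⁻¹ + χ` plus `χ' (r - rᵏ)`,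
where the last term is nonnegative because `rᵏ ≤ r` and `χ` is monotone. -/
theorem deriv_profile_pos (hk : 1 ≤ k) {r : ℝ} (hr : 0 < r) : 0 < deriv (profile k) r := by
  rcases lt_or_ge (1 / 2) r with h | h
  · have : profile k =ᶠ[𝓝 r] id := by
      filter_upwards [isOpen_Ioi.mem_nhds h] with s hs
      exact profile_eq_self (le_of_lt hs)
    rw [this.deriv_eq]
    simp
  · set χ : ℝ → ℝ := fun r => Real.smoothTransition (4 * r - 1) with hχ
    have hχd : DifferentiableAt ℝ χ r := by
      refine ContDiffAt.differentiableAt (n := 1) ?_ one_ne_zero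
      exact (Real.smoothTransition.contDiff.comp
        ((contDiff_const.mul contDiff_id).sub contDiff_const)).contDiffAt
    have hχm : 0 ≤ deriv χ r := by
      refine Monotone.deriv_nonneg ?_
      intro x y hxy
      exact monotone_smoothTransition (by linarith)
    have hd : HasDerivAt (profile k) ((k : ℝ) * r ^ (k - 1) +
        (deriv χ r * (r - r ^ k) + χ r * (1 - (k : ℝ) * r ^ (k - 1)))) r := by
      have h1 := hasDerivAt_pow k r
      exact h1.add (hχd.hasDerivAt.mul ((hasDerivAt_id r).sub h1))
    rw [hd.deriv]
    have hχ0 : 0 ≤ χ r := Real.smoothTransition.nonneg _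
    have hχ1 : χ r ≤ 1 := Real.smoothTransition.le_one _
    have hp : 0 < (k : ℝ) * r ^ (k - 1) := by positivity
    have hrk : r ^ k ≤ r := by
      have := pow_le_pow_of_le_one hr.le (by linarith) hk
      simpa using this
    have h1 : 0 ≤ deriv χ r * (r - r ^ k) := mul_nonneg hχm (by linarith)
    rcases eq_or_lt_of_le hχ1 with h2 | h2
    · rw [h2]; linarith
    · have h3 : 0 < (1 - χ r) * ((k : ℝ) * r ^ (k - 1)) := mul_pos (by linarith) hp
      nlinarith

theorem strictMonoOn_profile (hk : 1 ≤ k) : StrictMonoOn (profile k) (Ici 0) := by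
  refine strictMonoOn_of_deriv_pos (convex_Ici 0) contDiff_profile.continuous.continuousOn ?_
  intro r hr
  rw [interior_Ici] at hr
  exact deriv_profile_pos hk hr

theorem profile_nonneg (hk : 1 ≤ k) {r : ℝ} (hr : 0 ≤ r) : 0 ≤ profile k r := by
  rw [← profile_zero hk]
  exact (strictMonoOn_profile hk).monotoneOn (mem_Ici.2 le_rfl) hr hr

theorem profile_pos (hk : 1 ≤ k) {r : ℝ} (hr : 0 < r) : 0 < profile k r := by
  rw [← profile_zero hk]
  exact strictMonoOn_profile hk (mem_Ici.2 le_rfl) hr.le hr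

theorem profile_lt_one_iff (hk : 1 ≤ k) {r : ℝ} (hr : 0 ≤ r) : profile k r < 1 ↔ r < 1 := by
  have h1 : profile k 1 = 1 := profile_eq_self (by norm_num)
  conv_lhs => rw [← h1]
  exact (strictMonoOn_profile hk).lt_iff_lt hr (mem_Ici.2 zero_le_one)

/-- The inverse of the profile is continuous. -/
theorem exists_profile_inverse (hk : 1 ≤ k) : ∃ ρ : ℝ → ℝ, Continuous ρ ∧ (∀ s, 0 ≤ ρ s) ∧
    (∀ r, 0 ≤ r → ρ (profile k r) = r) ∧ ∀ s, 0 ≤ s → profile k (ρ s) = s := by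
  -- A strictly increasing surjection of the half-line is an order isomorphism, and this gives
  -- continuity of the inverse.
  let e : NNReal → NNReal := fun r => ⟨profile k r, profile_nonneg hk r.2⟩
  have he : StrictMono e := fun a b hab => strictMonoOn_profile hk a.2 b.2 hab
  have hs : Function.Surjective e := by
    intro s
    have hM : (s : ℝ) ≤ profile k (s + 1) := by
      rw [profile_eq_self (by linarith [s.2])]
      linarith
    have h0 : profile k 0 ≤ s := by
      rw [profile_zero hk]
      exact s.2
    obtain ⟨r, hr, hrs⟩ := intermediate_value_Icc (f := profile k) (a := 0) (b := (s : ℝ) + 1)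
      (by linarith [s.2]) contDiff_profile.continuous.continuousOn ⟨h0, hM⟩
    exact ⟨⟨r, hr.1⟩, NNReal.eq hrs⟩
  let E := he.orderIsoOfSurjective e hs
  refine ⟨fun s => E.symm s.toNNReal, ?_, fun s => NNReal.coe_nonneg _, ?_, ?_⟩
  · exact NNReal.continuous_coe.comp (E.symm.continuous.comp continuous_real_toNNReal)
  · intro r hr
    have h1 : (profile k r).toNNReal = E ⟨r, hr⟩ :=
      NNReal.eq (Real.coe_toNNReal _ (profile_nonneg hk hr))
    have h2 : E.symm (profile k r).toNNReal = ⟨r, hr⟩ := by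
      rw [h1]
      exact E.symm_apply_apply _
    exact congrArg NNReal.toReal h2
  · intro s hs'
    have h1 : E (E.symm s.toNNReal) = s.toNNReal := OrderIso.apply_symm_apply _ _
    have h2 := congrArg NNReal.toReal h1
    rw [Real.coe_toNNReal s hs'] at h2
    exact h2

/-- The map `r exp(iφ) ↦ g(r) exp(ikφ)` of the plane. -/
def planeMap (k : ℕ) (z : ℂ) : ℂ := (profile k ‖z‖ : ℂ) * (z / (‖z‖ : ℂ)) ^ k

theorem planeMap_zero (hk : 1 ≤ k) : planeMap k 0 = 0 := by
  simp [planeMap, profile_zero hk]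

theorem norm_planeMap (hk : 1 ≤ k) (z : ℂ) : ‖planeMap k z‖ = profile k ‖z‖ := by
  rcases eq_or_ne z 0 with rfl | hz
  · simp [planeMap_zero hk, profile_zero hk]
  · have h1 : ‖z‖ ≠ 0 := norm_ne_zero_iff.2 hz
    have h2 : ‖z / (‖z‖ : ℂ)‖ = 1 := by
      rw [norm_div, Complex.norm_real, norm_norm, div_self h1]
    rw [planeMap, norm_mul, norm_pow, h2, one_pow, mul_one, Complex.norm_real,
      Real.norm_of_nonneg (profile_nonneg hk (norm_nonneg _))]

theorem planeMap_eq_pow (hk : 1 ≤ k) {z : ℂ} (hz : ‖z‖ ≤ 1 / 4) : planeMap k z = z ^ k := by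
  rcases eq_or_ne z 0 with rfl | h
  · rw [planeMap_zero hk, zero_pow (by omega)]
  · have h1 : (‖z‖ : ℂ) ≠ 0 := by exact_mod_cast norm_ne_zero_iff.2 h
    rw [planeMap, profile_eq_pow hz, div_pow]
    push_cast
    field_simp

theorem planeMap_eq_zero_iff (hk : 1 ≤ k) {z : ℂ} : planeMap k z = 0 ↔ z = 0 := by
  constructor
  · intro h
    by_contra hz
    have := norm_planeMap hk z
    rw [h, norm_zero] at this
    exact absurd this (profile_pos hk (norm_pos_iff.2 hz)).ne
  · rintro rfl
    exact planeMap_zero hk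

theorem planeMap_circle_mul (s : Circle) (z : ℂ) :
    planeMap k (s * z) = (s : ℂ) ^ k * planeMap k z := by
  simp only [planeMap, norm_mul, Circle.norm_coe, one_mul]
  rw [mul_div_assoc, mul_pow]
  ring

theorem planeMap_polar {r : ℝ} (hr : 0 ≤ r) (hk : 1 ≤ k) (s : Circle) :
    planeMap k (r * s) = (profile k r : ℂ) * (s : ℂ) ^ k := by
  rcases eq_or_lt_of_le hr with rfl | h
  · simp [planeMap_zero hk, profile_zero hk]
  · have h1 : ‖(r : ℂ) * s‖ = r := by
      rw [norm_mul, Circle.norm_coe, mul_one, Complex.norm_real, Real.norm_of_nonneg hr]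
    have h2 : (r : ℂ) ≠ 0 := by exact_mod_cast h.ne'
    rw [planeMap, h1]
    field_simp

theorem contDiffAt_planeMap {z : ℂ} (hz : z ≠ 0) : ContDiffAt ℝ ∞ (planeMap k) z := by
  have h1 : ContDiffAt ℝ ∞ (fun z : ℂ => ‖z‖) z := contDiffAt_norm ℝ hz
  have h2 : ContDiffAt ℝ ∞ (fun z : ℂ => (‖z‖ : ℂ)) z :=
    Complex.ofRealCLM.contDiff.contDiffAt.comp z h1
  have h3 : ContDiffAt ℝ ∞ (fun z : ℂ => (profile k ‖z‖ : ℂ)) z :=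
    Complex.ofRealCLM.contDiff.contDiffAt.comp z (contDiff_profile.contDiffAt.comp z h1)
  have h4 : (‖z‖ : ℂ) ≠ 0 := by exact_mod_cast norm_ne_zero_iff.2 hz
  have h5 : ContDiffAt ℝ ∞ (fun z : ℂ => z / (‖z‖ : ℂ)) z := by
    simp only [div_eq_mul_inv]
    exact contDiffAt_id.mul (h2.inv h4)
  exact h3.mul (h5.pow k)

theorem planeMap_eventuallyEq_pow (hk : 1 ≤ k) {z : ℂ} (hz : ‖z‖ < 1 / 4) :
    planeMap k =ᶠ[𝓝 z] fun w => w ^ k := by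
  filter_upwards [continuous_norm.continuousAt.eventually (isOpen_Iio.mem_nhds hz)] with w hw
  exact planeMap_eq_pow hk (le_of_lt hw)

/-- At the origin, where polar coordinates fail, the map is the polynomial `zᵏ`; the profile is `rᵏ`
near `0` for this reason. -/
theorem contDiff_planeMap (hk : 1 ≤ k) : ContDiff ℝ ∞ (planeMap k) := by
  rw [contDiff_iff_contDiffAt]
  intro z
  rcases eq_or_ne z 0 with rfl | hz
  · refine ContDiffAt.congr_of_eventuallyEq ?_ (planeMap_eventuallyEq_pow hk (by simp))
    exact contDiffAt_id.pow k
  · exact contDiffAt_planeMap hz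

/-- Differentiation along the logarithmic spiral `t ↦ z exp(tc)`: the modulus is scaled by `exp(t Re
c)` and the argument moves by `t Im c`, so the radial and the angular part separate. -/
theorem fderiv_planeMap_mul {z : ℂ} (hz : z ≠ 0) (c : ℂ) :
    fderiv ℝ (planeMap k) z (z * c) = (z / (‖z‖ : ℂ)) ^ k *
      ((deriv (profile k) ‖z‖ * (‖z‖ * c.re) : ℝ) + (k * c.im * profile k ‖z‖ : ℝ) * Complex.I) := by
  have hd : HasFDerivAt (planeMap k) (fderiv ℝ (planeMap k) z) (z * Complex.exp ((0 : ℝ) * c)) := by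
    simpa using ((contDiffAt_planeMap hz).differentiableAt (by simp)).hasFDerivAt
  have hcurve : HasDerivAt (fun t : ℝ => z * Complex.exp (t * c)) (z * c) 0 := by
    have h0 : HasDerivAt (fun t : ℝ => (t : ℂ) * c) (1 * c) 0 :=
      (Complex.ofRealCLM.hasDerivAt (x := 0)).mul_const c
    have h1 : HasDerivAt (fun t : ℝ => Complex.exp (t * c))
        (Complex.exp ((0 : ℝ) * c) * (1 * c)) 0 := HasDerivAt.cexp h0
    simpa using h1.const_mul z
  have h1 : HasDerivAt (fun t : ℝ => planeMap k (z * Complex.exp (t * c)))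
      (fderiv ℝ (planeMap k) z (z * c)) 0 :=
    HasFDerivAt.comp_hasDerivAt (f := fun t : ℝ => z * Complex.exp (t * c)) (0 : ℝ) hd hcurve
  have hnorm : ∀ t : ℝ, ‖z * Complex.exp (t * c)‖ = ‖z‖ * Real.exp (t * c.re) := by
    intro t
    rw [norm_mul, Complex.norm_exp]
    simp
  have h2 : (fun t : ℝ => planeMap k (z * Complex.exp (t * c))) = fun t : ℝ =>
      (z / (‖z‖ : ℂ)) ^ k * ((profile k (‖z‖ * Real.exp (t * c.re)) : ℂ) *
        Complex.exp (t * ((k * c.im : ℝ) * Complex.I))) := by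
    funext t
    have e0 : (‖z‖ : ℂ) ≠ 0 := by exact_mod_cast norm_ne_zero_iff.2 hz
    have e1 : Complex.exp (t * c) = (Real.exp (t * c.re) : ℂ) * Complex.exp (t * c.im * Complex.I) := by
      rw [Complex.ofReal_exp, ← Complex.exp_add]
      congr 1
      conv_lhs => rw [← Complex.re_add_im c]
      push_cast
      ring
    have e2 : (Real.exp (t * c.re) : ℂ) ≠ 0 := by exact_mod_cast (Real.exp_pos _).ne'
    have e3 : z * Complex.exp (t * c) / ((‖z‖ * Real.exp (t * c.re) : ℝ) : ℂ) =
        z / (‖z‖ : ℂ) * Complex.exp (t * c.im * Complex.I) := by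
      rw [e1, Complex.ofReal_mul]
      field_simp
    rw [planeMap, hnorm, e3, mul_pow, ← Complex.exp_nat_mul]
    rw [show (k : ℂ) * (t * c.im * Complex.I) = t * ((k * c.im : ℝ) * Complex.I) by push_cast; ring]
    ring
  have h3 : HasDerivAt (fun t : ℝ => profile k (‖z‖ * Real.exp (t * c.re)))
      (deriv (profile k) ‖z‖ * (‖z‖ * c.re)) 0 := by
    have hp : HasDerivAt (profile k) (deriv (profile k) ‖z‖) (‖z‖ * Real.exp (0 * c.re)) := by
      simpa using (contDiff_profile.differentiable (by simp) ‖z‖).hasDerivAt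
    have he : HasDerivAt (fun t : ℝ => ‖z‖ * Real.exp (t * c.re)) (‖z‖ * c.re) 0 := by
      have := (((hasDerivAt_id (0 : ℝ)).mul_const c.re).exp).const_mul ‖z‖
      simpa using this
    exact hp.comp (0 : ℝ) he
  have h4 : HasDerivAt (fun t : ℝ => Complex.exp (t * ((k * c.im : ℝ) * Complex.I)))
      ((k * c.im : ℝ) * Complex.I) 0 := by
    have h0 : HasDerivAt (fun t : ℝ => (t : ℂ) * ((k * c.im : ℝ) * Complex.I))
        (1 * ((k * c.im : ℝ) * Complex.I)) 0 := (Complex.ofRealCLM.hasDerivAt (x := 0)).mul_const _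
    have := HasDerivAt.cexp h0
    simpa using this
  have h5 := (h3.ofReal_comp.mul h4).const_mul ((z / (‖z‖ : ℂ)) ^ k)
  rw [h2] at h1
  rw [h1.unique h5]
  simp
  ring_nf
  simp

/-- The radial part of the differential is governed by `g'` and the angular part by `k g`. Both are
positive off the origin, so the inverse function theorem applies. -/
theorem isLocalDiffeomorphAt_planeMap (hk : 1 ≤ k) {z : ℂ} (hz : z ≠ 0) :
    IsLocalDiffeomorphAt 𝓘(ℝ, ℂ) 𝓘(ℝ, ℂ) ∞ (planeMap k) z := by
  have hinj : ∀ z : ℂ, z ≠ 0 → ∃ L : ℂ ≃L[ℝ] ℂ, HasFDerivAt (planeMap k) (L : ℂ →L[ℝ] ℂ) z := by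
    intro z hz
    have hi : Function.Injective (fderiv ℝ (planeMap k) z).toLinearMap := by
      rw [← LinearMap.ker_eq_bot, LinearMap.ker_eq_bot']
      intro v hv
      have hv' : fderiv ℝ (planeMap k) z (z * (v / z)) = 0 := by
        rw [mul_div_cancel₀ _ hz]
        exact hv
      have hr : 0 < ‖z‖ := norm_pos_iff.2 hz
      have hzn : (z / (‖z‖ : ℂ)) ^ k ≠ 0 :=
        pow_ne_zero _ (div_ne_zero hz (by exact_mod_cast hr.ne'))
      rw [fderiv_planeMap_mul hz] at hv'
      have h0 := (mul_eq_zero.1 hv').resolve_left hzn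
      have hre := congrArg Complex.re h0
      have him := congrArg Complex.im h0
      simp only [Complex.add_re, Complex.add_im, Complex.ofReal_re, Complex.ofReal_im,
        Complex.mul_re, Complex.mul_im, Complex.I_re, Complex.I_im, mul_zero, mul_one, sub_zero,
        add_zero, zero_add, Complex.zero_re, Complex.zero_im] at hre him
      have hre' : (v / z).re = 0 := by
        rcases mul_eq_zero.1 hre with h | h
        · exact absurd h (deriv_profile_pos hk hr).ne'
        · exact (mul_eq_zero.1 h).resolve_left hr.ne'
      have him' : (v / z).im = 0 := by
        rcases mul_eq_zero.1 him with h | h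
        · refine (mul_eq_zero.1 h).resolve_left ?_
          exact_mod_cast (by omega : k ≠ 0)
        · exact absurd h (profile_pos hk hr).ne'
      have : v / z = 0 := Complex.ext hre' him'
      exact (div_eq_zero_iff.1 this).resolve_right hz
    let L := (LinearEquiv.ofInjectiveEndo _ hi).toContinuousLinearEquiv
    refine ⟨L, ?_⟩
    have hL : (L : ℂ →L[ℝ] ℂ) = fderiv ℝ (planeMap k) z := by
      ext v
      rfl
    rw [hL]
    exact ((contDiffAt_planeMap hz).differentiableAt (by simp)).hasFDerivAt
  obtain ⟨L, hL⟩ := hinj z hz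
  let e := (contDiffAt_planeMap (k := k) hz).toOpenPartialHomeomorph (planeMap k) hL (by simp)
  have hez : z ∈ e.source := ContDiffAt.mem_toOpenPartialHomeomorph_source _ hL (by simp)
  have hcoe : (e : ℂ → ℂ) = planeMap k :=
    ContDiffAt.toOpenPartialHomeomorph_coe _ hL (by simp)
  -- Off the origin the differential is invertible everywhere, so after this restriction the inverse
  -- is smooth on its whole domain and not only at one point.
  have ho : IsOpen ({0}ᶜ : Set ℂ) := isOpen_compl_singleton
  let e' := e.restrOpen {0}ᶜ ho
  have hcoe' : (e' : ℂ → ℂ) = planeMap k := hcoe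
  have hsrc : e'.source = e.source ∩ {0}ᶜ := OpenPartialHomeomorph.restrOpen_source _ _ _
  refine isLocalDiffeomorphAt_of_inverse (g := e'.symm) (U := e'.source) (V := e'.target) ?_
    e'.open_source e'.open_target ?_ (fun y hy => e'.map_target hy) ?_ ?_
    (contDiff_planeMap hk).contMDiff.contMDiffOn ?_
  · rw [hsrc]
    exact ⟨hez, hz⟩
  · intro x hx
    rw [← hcoe']
    exact e'.map_source hx
  · intro x hx
    rw [← hcoe']
    exact e'.left_inv hx
  · intro y hy
    rw [← hcoe']
    exact e'.right_inv hy
  · rw [contMDiffOn_iff_contDiffOn]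
    intro y hy
    refine ContDiffAt.contDiffWithinAt ?_
    have hy0 : e'.symm y ≠ 0 := by
      have := e'.map_target hy
      rw [hsrc] at this
      exact this.2
    obtain ⟨L', hL'⟩ := hinj _ hy0
    exact e'.contDiffAt_symm hy (by rw [hcoe']; exact hL')
      (by rw [hcoe']; exact contDiffAt_planeMap hy0)

end Profile

/-! ### Manifolds modelled on manifolds -/

section Local

variable {E : Type*} [NormedAddCommGroup E] [NormedSpace ℝ E]
  {H : Type*} [TopologicalSpace H] {I : ModelWithCorners ℝ E H}
  {N M : Type*} [TopologicalSpace N] [cN : ChartedSpace H N] [IsManifold I ∞ N]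
  [TopologicalSpace M] [cM : ChartedSpace N M]

/-- A space modelled on a manifold `N` with smooth transition maps is a manifold. -/
theorem isManifold_comp (h : ∀ e ∈ atlas N M, ∀ e' ∈ atlas N M,
      ContMDiffOn I I ∞ (fun y => e' (e.symm y)) (e.symm.trans e').source) :
    @IsManifold ℝ _ E _ _ H _ I ∞ M _ (ChartedSpace.comp H N M) := by
  let _ := ChartedSpace.comp H N M
  refine isManifold_of_contDiffOn I ∞ M ?_
  rintro _ _ ⟨e, he, c, hc, rfl⟩ ⟨e', he', c', hc', rfl⟩
  have hcm := IsManifold.subset_maximalAtlas (I := I) (n := ∞) hc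
  have hcm' := IsManifold.subset_maximalAtlas (I := I) (n := ∞) hc'
  have h1 := contMDiffOn_symm_of_mem_maximalAtlas hcm
  have h2 := contMDiffOn_of_mem_maximalAtlas hcm'
  rw [← contMDiffOn_iff_contDiffOn]
  intro x hx
  obtain ⟨⟨⟨hx1, hx2⟩, hx3, hx4⟩, hx5⟩ := hx
  have k0 : ContMDiffWithinAt 𝓘(ℝ, E) I ∞ I.symm (range I) x :=
    I.contMDiffOn_symm x hx5
  have k1 : ContMDiffAt I I ∞ c.symm (I.symm x) := h1.contMDiffAt (c.open_target.mem_nhds hx1)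
  have k2 : ContMDiffAt I I ∞ (fun y => e' (e.symm y)) (c.symm (I.symm x)) :=
    (h e he e' he').contMDiffAt ((e.symm.trans e').open_source.mem_nhds ⟨hx2, hx3⟩)
  have k3 : ContMDiffAt I I ∞ c' (e' (e.symm (c.symm (I.symm x)))) :=
    h2.contMDiffAt (c'.open_source.mem_nhds hx4)
  have k5 : ContMDiff I 𝓘(ℝ, E) ∞ I := I.contMDiff
  have k6 : ContMDiffAt I I ∞ (fun y => e' (e.symm (c.symm y))) (I.symm x) := k2.comp _ k1
  have k7 : ContMDiffAt I I ∞ (fun y => c' (e' (e.symm (c.symm y)))) (I.symm x) :=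
    ContMDiffAt.comp (g := c') (I.symm x) k3 k6
  have k4 := k5.contMDiffAt.comp _ k7
  exact (ContMDiffAt.comp_contMDiffWithinAt x k4 k0).mono inter_subset_right

/-- The given local models are local diffeomorphisms. -/
theorem contMDiffOn_localModel (h : ∀ e ∈ atlas N M, ∀ e' ∈ atlas N M,
      ContMDiffOn I I ∞ (fun y => e' (e.symm y)) (e.symm.trans e').source)
    {e : OpenPartialHomeomorph M N} (he : e ∈ atlas N M) :
    @ContMDiffOn ℝ _ E _ _ H _ I M _ (ChartedSpace.comp H N M) E _ _ H _ I N _ _ ∞ e e.source ∧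
    @ContMDiffOn ℝ _ E _ _ H _ I N _ _ E _ _ H _ I M _ (ChartedSpace.comp H N M) ∞ e.symm
      e.target := by
  let _ := ChartedSpace.comp H N M
  have : IsManifold I ∞ M := isManifold_comp h
  constructor
  · intro x hx
    refine ContMDiffAt.contMDiffWithinAt ?_
    -- The chart of `M` at `x` is the local model `c` followed by a chart `d` of `N`. Hence `e` is
    -- this chart, then `d⁻¹`, then the transition `e ∘ c⁻¹`.
    set c : OpenPartialHomeomorph M N := chartAt N x with hc
    set d := chartAt H (c x) with hd
    have hch : chartAt H x = c.trans d := rfl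
    have k1 : ContMDiffAt I I ∞ (c.trans d) x := by
      rw [← hch]
      exact contMDiffOn_chart.contMDiffAt ((chartAt H x).open_source.mem_nhds (mem_chart_source H x))
    have hcx : x ∈ c.source := mem_chart_source N x
    have hdx : c x ∈ d.source := mem_chart_source H (c x)
    have k2 : ContMDiffAt I I ∞ d.symm (d (c x)) :=
      contMDiffOn_chart_symm.contMDiffAt (d.open_target.mem_nhds (d.map_source hdx))
    have k3 : ContMDiffAt I I ∞ (fun y => e (c.symm y)) (c x) := by
      refine (h c (chart_mem_atlas N x) e he).contMDiffAt
        ((c.symm.trans e).open_source.mem_nhds ⟨c.map_source hcx, ?_⟩)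
      change c.symm (c x) ∈ e.source
      rw [c.left_inv hcx]
      exact hx
    have k4 : ContMDiffAt I I ∞ (fun y => e (c.symm y)) (d.symm (d (c x))) := by
      rw [d.left_inv hdx]
      exact k3
    refine ((k4.comp _ k2).comp x k1).congr_of_eventuallyEq ?_
    filter_upwards [(c.trans d).open_source.mem_nhds (by rw [← hch]; exact mem_chart_source H x)]
      with y hy
    change e y = e (c.symm (d.symm (d (c y))))
    have hy2 : c y ∈ d.source := hy.2
    rw [d.left_inv hy2, c.left_inv hy.1]
  · intro y hy
    refine ContMDiffAt.contMDiffWithinAt ?_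
    set x := e.symm y with hx
    set c : OpenPartialHomeomorph M N := chartAt N x with hc
    set d := chartAt H (c x) with hd
    have hch : chartAt H x = c.trans d := rfl
    have hcx : x ∈ c.source := mem_chart_source N x
    have hdx : c x ∈ d.source := mem_chart_source H (c x)
    have hxs : x ∈ (c.trans d).source := by rw [← hch]; exact mem_chart_source H x
    have k1 : ContMDiffAt I I ∞ (c.trans d).symm ((c.trans d) x) := by
      rw [← hch]
      exact contMDiffOn_chart_symm.contMDiffAt
        ((chartAt H x).open_target.mem_nhds (mem_chart_target H x))
    have k2 : ContMDiffAt I I ∞ d (c x) :=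
      contMDiffOn_chart.contMDiffAt (d.open_source.mem_nhds hdx)
    have k3 : ContMDiffAt I I ∞ (fun y => c (e.symm y)) y :=
      (h e he c (chart_mem_atlas N x)).contMDiffAt
        ((e.symm.trans c).open_source.mem_nhds ⟨hy, hcx⟩)
    refine (k1.comp y (k2.comp y k3)).congr_of_eventuallyEq ?_
    have hcont : ContinuousAt e.symm y := e.symm.continuousAt hy
    filter_upwards [hcont.eventually ((c.trans d).open_source.mem_nhds hxs)] with z hz
    exact ((c.trans d).left_inv hz).symm

end Local

/-! ### The inverse of the profile -/

section Root

variable {k : ℕ} [NeZero k]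

/-- The inverse of `profile k` on `[0, ∞)`. -/
def invProfile (k : ℕ) [NeZero k] : ℝ → ℝ := (exists_profile_inverse (k := k) NeZero.one_le).choose

theorem continuous_invProfile : Continuous (invProfile k) :=
  (exists_profile_inverse (k := k) NeZero.one_le).choose_spec.1

theorem invProfile_nonneg (s : ℝ) : 0 ≤ invProfile k s :=
  (exists_profile_inverse (k := k) NeZero.one_le).choose_spec.2.1 s

theorem invProfile_profile {r : ℝ} (hr : 0 ≤ r) : invProfile k (profile k r) = r :=
  (exists_profile_inverse (k := k) NeZero.one_le).choose_spec.2.2.1 r hr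

theorem profile_invProfile {s : ℝ} (hs : 0 ≤ s) : profile k (invProfile k s) = s :=
  (exists_profile_inverse (k := k) NeZero.one_le).choose_spec.2.2.2 s hs

theorem exists_circ_eq (s : Circle) : ∃ t, circ t = s := by
  refine ⟨Complex.arg s / (2 * Real.pi), ?_⟩
  rw [circ, mul_div_cancel₀ _ (by positivity)]
  exact Circle.exp_arg s

/-- Under `circ` the power map is multiplication by `k` on the line. -/
theorem isLocalDiffeomorphAt_circle_pow (s : Circle) :
    IsLocalDiffeomorphAt (𝓡 1) (𝓡 1) ∞ (fun s : Circle => s ^ k) s := by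
  obtain ⟨t, rfl⟩ := exists_circ_eq s
  obtain ⟨Φ, ht, hΦ⟩ := isLocalDiffeomorphAt_circ t
  have hmem : circ t ∈ Φ.target := by
    rw [hΦ ht]
    exact Φ.map_source' ht
  have h1 := PartialDiffeomorph.isLocalDiffeomorphAt _ _ _ Φ.symm hmem
  have h2 := (h1.comp _ _ (isLocalDiffeomorphAt_mul_const (k : ℝ)
    (by exact_mod_cast NeZero.ne k) _)).comp _ _ (isLocalDiffeomorphAt_circ _)
  refine isLocalDiffeomorphAt_congr h2 ?_
  filter_upwards [Φ.open_target.mem_nhds hmem] with c hc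
  change c ^ k = circ (k * Φ.symm c)
  rw [← circ_pow]
  congr 1
  have := hΦ (Φ.map_target' hc)
  exact ((this).trans (Φ.right_inv' hc)).symm

theorem planeMap_surjective : Function.Surjective (planeMap k) := by
  intro c
  rcases eq_or_ne c 0 with rfl | hc
  · exact ⟨0, planeMap_zero NeZero.one_le⟩
  · have hn : (‖c‖ : ℂ) ≠ 0 := by exact_mod_cast norm_ne_zero_iff.2 hc
    have h1 : ‖c / (‖c‖ : ℂ)‖ = 1 := by
      rw [norm_div, Complex.norm_real, norm_norm, div_self (norm_ne_zero_iff.2 hc)]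
    obtain ⟨t, ht⟩ := exists_circ_eq ⟨c / (‖c‖ : ℂ), mem_sphere_zero_iff_norm.2 h1⟩
    refine ⟨invProfile k ‖c‖ * (circ (t / k) : Circle), ?_⟩
    rw [planeMap_polar (invProfile_nonneg _) NeZero.one_le, profile_invProfile (norm_nonneg _),
      ← Circle.coe_pow, circ_pow, mul_div_cancel₀ _ (by exact_mod_cast NeZero.ne k), ht]
    change (‖c‖ : ℂ) * (c / (‖c‖ : ℂ)) = c
    field_simp

end Root

/-! ### The disk coordinate of an open book -/

namespace OpenBook

variable {n : ℕ} {N B : Type u}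
  [TopologicalSpace N] [ChartedSpace (EuclideanSpace ℝ (Fin (2 * (n + 1) + 1))) N]
  [TopologicalSpace B] [ChartedSpace (EuclideanSpace ℝ (Fin (2 * n + 1))) B]
  (ob : OpenBook n N B)

section Tube

variable {ob}

theorem mem_tube_source {z : ℂ} (hz : ‖z‖ < 1) (b : B) : (z, b) ∈ ob.tube.source := by
  rw [ob.tube_source]
  exact ⟨mem_ball_zero_iff.2 hz, mem_univ _⟩

theorem tube_mem_target {z : ℂ} (hz : ‖z‖ < 1) (b : B) : ob.tube (z, b) ∈ ob.tube.target :=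
  ob.tube.map_source' (mem_tube_source hz b)

theorem tube_symm_tube {z : ℂ} (hz : ‖z‖ < 1) (b : B) : ob.tube.symm (ob.tube (z, b)) = (z, b) :=
  ob.tube.left_inv' (mem_tube_source hz b)

theorem exists_eq_tube {x : N} (hx : x ∈ ob.tube.target) :
    ∃ (z : ℂ) (b : B), ‖z‖ < 1 ∧ ob.tube (z, b) = x := by
  have h := ob.tube.map_target' hx
  rw [ob.tube_source] at h
  exact ⟨(ob.tube.symm x).1, (ob.tube.symm x).2, mem_ball_zero_iff.1 h.1, ob.tube.right_inv' hx⟩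

theorem tube_injective {z z' : ℂ} {b b' : B} (hz : ‖z‖ < 1) (hz' : ‖z'‖ < 1)
    (h : ob.tube (z, b) = ob.tube (z', b')) : z = z' ∧ b = b' := by
  have := congrArg ob.tube.symm h
  rw [tube_symm_tube hz, tube_symm_tube hz'] at this
  exact Prod.mk.inj this

theorem tube_mem_binding_iff {z : ℂ} (hz : ‖z‖ < 1) (b : B) :
    ob.tube (z, b) ∈ ob.binding ↔ z = 0 := by
  constructor
  · rintro ⟨b', hb'⟩
    exact (tube_injective (by simp) hz hb').1.symm
  · rintro rfl
    exact ⟨b, rfl⟩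

theorem binding_subset_target : ob.binding ⊆ ob.tube.target := by
  rintro _ ⟨b, rfl⟩
  exact tube_mem_target (by simp) b

theorem contMDiffAt_tube {z : ℂ} (hz : ‖z‖ < 1) (b : B) :
    ContMDiffAt (𝓘(ℝ, ℂ).prod (𝓡 (2 * n + 1))) (𝓡 (2 * (n + 1) + 1)) ∞ ob.tube (z, b) :=
  ob.tube.contMDiffOn_toFun.contMDiffAt (ob.tube.open_source.mem_nhds (mem_tube_source hz b))

theorem contMDiffAt_tube_symm {x : N} (hx : x ∈ ob.tube.target) :
    ContMDiffAt (𝓡 (2 * (n + 1) + 1)) (𝓘(ℝ, ℂ).prod (𝓡 (2 * n + 1))) ∞ ob.tube.symm x :=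
  ob.tube.contMDiffOn_invFun.contMDiffAt (ob.tube.open_target.mem_nhds hx)

theorem continuous_incl : Continuous ob.incl := by
  rw [continuous_iff_continuousAt]
  intro b
  exact ContinuousAt.comp (f := fun b : B => ((0 : ℂ), b)) (g := ob.tube)
    (contMDiffAt_tube (by simp) b).continuousAt (by fun_prop)

theorem isClosed_binding [CompactSpace B] [T2Space N] : IsClosed ob.binding :=
  (isCompact_range continuous_incl).isClosed

end Tube

open Classical in
/-- The disk coordinate in the neighbourhood of the binding, extended by `θ`. -/
def proj (x : N) : ℂ := if x ∈ ob.tube.target then (ob.tube.symm x).1 else ob.θ x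

variable {ob}

theorem proj_of_mem {x : N} (hx : x ∈ ob.tube.target) : ob.proj x = (ob.tube.symm x).1 := if_pos hx

theorem proj_of_notMem {x : N} (hx : x ∉ ob.tube.target) : ob.proj x = ob.θ x := if_neg hx

theorem proj_tube {z : ℂ} (hz : ‖z‖ < 1) (b : B) : ob.proj (ob.tube (z, b)) = z := by
  rw [proj_of_mem (tube_mem_target hz b), tube_symm_tube hz]

theorem norm_proj_lt_one_iff {x : N} : ‖ob.proj x‖ < 1 ↔ x ∈ ob.tube.target := by
  constructor
  · intro h
    by_contra hx
    rw [proj_of_notMem hx, Circle.norm_coe] at h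
    exact lt_irrefl _ h
  · intro hx
    obtain ⟨z, b, hz, rfl⟩ := exists_eq_tube hx
    rwa [proj_tube hz]

theorem norm_proj_le_one (x : N) : ‖ob.proj x‖ ≤ 1 := by
  by_cases hx : x ∈ ob.tube.target
  · exact (norm_proj_lt_one_iff.2 hx).le
  · rw [proj_of_notMem hx, Circle.norm_coe]

theorem proj_eq_zero_iff {x : N} : ob.proj x = 0 ↔ x ∈ ob.binding := by
  constructor
  · intro h
    have hx : x ∈ ob.tube.target := norm_proj_lt_one_iff.1 (by rw [h]; simp)
    obtain ⟨z, b, hz, rfl⟩ := exists_eq_tube hx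
    rw [proj_tube hz] at h
    exact (tube_mem_binding_iff hz b).2 h
  · rintro ⟨b, rfl⟩
    exact proj_tube (by simp) b

theorem proj_eq_norm_mul {x : N} (hx : x ∉ ob.binding) : ob.proj x = (‖ob.proj x‖ : ℂ) * ob.θ x := by
  by_cases h : x ∈ ob.tube.target
  · obtain ⟨z, b, hz, rfl⟩ := exists_eq_tube h
    have hz0 : z ≠ 0 := fun h0 => hx ((tube_mem_binding_iff hz b).2 h0)
    have hn : (‖z‖ : ℂ) ≠ 0 := by exact_mod_cast norm_ne_zero_iff.2 hz0
    rw [proj_tube hz, ob.θ_tube z b hz0 hz]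
    field_simp
  · rw [proj_of_notMem h, Circle.norm_coe]
    simp

theorem continuousAt_proj_of_mem {x : N} (hx : x ∈ ob.tube.target) : ContinuousAt ob.proj x := by
  have h1 : ContinuousAt (fun y => (ob.tube.symm y).1) x :=
    continuous_fst.continuousAt.comp (contMDiffAt_tube_symm hx).continuousAt
  refine h1.congr ?_
  filter_upwards [ob.tube.open_target.mem_nhds hx] with y hy
  exact (proj_of_mem hy).symm

theorem θ_contMDiffAt [CompactSpace B] [T2Space N] {x : N} (hx : x ∉ ob.binding) :
    ContMDiffAt (𝓡 (2 * (n + 1) + 1)) (𝓡 1) ∞ ob.θ x :=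
  ob.θ_smooth.contMDiffAt (isClosed_binding.isOpen_compl.mem_nhds hx)

/-- The modulus must tend to `1` at the edge of the tube. As `B` is compact, every smaller closed
tube is compact, hence closed in `N`, and so avoids a neighbourhood of each point outside the tube.
-/
theorem continuous_norm_proj [CompactSpace B] [T2Space N] : Continuous fun x => ‖ob.proj x‖ := by
  rw [continuous_iff_continuousAt]
  intro x
  by_cases hx : x ∈ ob.tube.target
  · exact (continuousAt_proj_of_mem hx).norm
  · have h1 : ‖ob.proj x‖ = 1 := by rw [proj_of_notMem hx, Circle.norm_coe]
    change Tendsto _ _ (𝓝 ‖ob.proj x‖)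
    rw [h1]
    refine tendsto_order.2 ⟨fun c hc => ?_, fun c hc => ?_⟩
    · have hsub : Metric.closedBall (0 : ℂ) c ×ˢ (univ : Set B) ⊆ ob.tube.source := by
        rw [ob.tube_source]
        exact prod_mono (Metric.closedBall_subset_ball hc) subset_rfl
      have hK : IsCompact (ob.tube '' (Metric.closedBall (0 : ℂ) c ×ˢ (univ : Set B))) :=
        ((isCompact_closedBall 0 c).prod isCompact_univ).image_of_continuousOn
          (ob.tube.contMDiffOn_toFun.continuousOn.mono hsub)
      have hxK : x ∉ ob.tube '' (Metric.closedBall (0 : ℂ) c ×ˢ (univ : Set B)) := by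
        rintro ⟨p, hp, rfl⟩
        exact hx (ob.tube.map_source' (hsub hp))
      filter_upwards [hK.isClosed.isOpen_compl.mem_nhds hxK] with y hy
      by_contra hcy
      rw [not_lt] at hcy
      have hyt : y ∈ ob.tube.target := norm_proj_lt_one_iff.1 (hcy.trans_lt hc)
      obtain ⟨z, b, hz, rfl⟩ := exists_eq_tube hyt
      rw [proj_tube hz] at hcy
      exact hy ⟨(z, b), ⟨mem_closedBall_zero_iff.2 hcy, mem_univ _⟩, rfl⟩
    · exact Eventually.of_forall fun y => (norm_proj_le_one y).trans_lt hc

/-- Off the binding the disk coordinate is its modulus times `θ`, and both are continuous. -/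
theorem continuous_proj [CompactSpace B] [T2Space N] : Continuous ob.proj := by
  rw [continuous_iff_continuousAt]
  intro x
  by_cases hx : x ∈ ob.tube.target
  · exact continuousAt_proj_of_mem hx
  · have hxb : x ∉ ob.binding := fun h => hx (binding_subset_target h)
    have h1 : ContinuousAt (fun x => (‖ob.proj x‖ : ℂ) * ob.θ x) x :=
      (Complex.continuous_ofReal.continuousAt.comp continuous_norm_proj.continuousAt).mul
        (contMDiff_coe_circle.continuous.continuousAt.comp (θ_contMDiffAt hxb).continuousAt)
    refine h1.congr ?_
    filter_upwards [isClosed_binding.isOpen_compl.mem_nhds hxb] with y hy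
    exact (proj_eq_norm_mul hy).symm

/-! ### The branched covering -/

/-- The pull-back of `r exp(iφ) ↦ g(r) exp(ikφ)` under the disk coordinate. -/
def Cover (ob : OpenBook n N B) (k : ℕ) : Type u := {p : N × ℂ // planeMap k p.2 = ob.proj p.1}

instance (k : ℕ) : TopologicalSpace (ob.Cover k) := instTopologicalSpaceSubtype

instance (k : ℕ) [T2Space N] : T2Space (ob.Cover k) := inferInstanceAs (T2Space (Subtype _))

namespace Cover

variable {k : ℕ}

/-- The covering map. -/
def pr (m : ob.Cover k) : N := m.1.1

/-- The `k`-th root of the disk coordinate. -/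
def rt (m : ob.Cover k) : ℂ := m.1.2

theorem spec (m : ob.Cover k) : planeMap k m.rt = ob.proj m.pr := m.2

theorem ext' {m m' : ob.Cover k} (h : m.pr = m'.pr) (h' : m.rt = m'.rt) : m = m' :=
  Subtype.ext (Prod.ext h h')

theorem continuous_pr : Continuous (pr : ob.Cover k → N) := continuous_fst.comp continuous_subtype_val

theorem continuous_rt : Continuous (rt : ob.Cover k → ℂ) := continuous_snd.comp continuous_subtype_val

theorem continuousAt_iff {X : Type*} [TopologicalSpace X] {h : X → ob.Cover k} {a : X} :
    ContinuousAt h a ↔ ContinuousAt (fun x => (h x).pr) a ∧ ContinuousAt (fun x => (h x).rt) a := by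
  constructor
  · exact fun hh => ⟨continuous_pr.continuousAt.comp hh, continuous_rt.continuousAt.comp hh⟩
  · rintro ⟨h1, h2⟩
    exact Topology.IsInducing.subtypeVal.continuousAt_iff.2 (h1.prodMk h2)

variable [NeZero k]

theorem norm_proj_pr (m : ob.Cover k) : ‖ob.proj m.pr‖ = profile k ‖m.rt‖ := by
  rw [← m.spec, norm_planeMap NeZero.one_le]

/-- The profile fixes `1`, so the roots in the open unit disk are exactly those over the tube. -/
theorem norm_rt_lt_one_iff (m : ob.Cover k) : ‖m.rt‖ < 1 ↔ m.pr ∈ ob.tube.target := by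
  rw [← norm_proj_lt_one_iff, norm_proj_pr, profile_lt_one_iff NeZero.one_le (norm_nonneg _)]

theorem norm_rt_le_one (m : ob.Cover k) : ‖m.rt‖ ≤ 1 := by
  by_contra h
  rw [not_le] at h
  have h1 := norm_proj_le_one (ob := ob) m.pr
  rw [norm_proj_pr, profile_eq_self (by linarith)] at h1
  linarith

theorem rt_eq_zero_iff (m : ob.Cover k) : m.rt = 0 ↔ m.pr ∈ ob.binding := by
  rw [← proj_eq_zero_iff, ← m.spec, planeMap_eq_zero_iff NeZero.one_le]

theorem norm_rt (m : ob.Cover k) : ‖m.rt‖ = invProfile k ‖ob.proj m.pr‖ := by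
  rw [norm_proj_pr, invProfile_profile (norm_nonneg _)]

theorem pr_surjective : Function.Surjective (pr : ob.Cover k → N) := by
  intro x
  obtain ⟨w, hw⟩ := planeMap_surjective (k := k) (ob.proj x)
  exact ⟨⟨(x, w), hw⟩, rfl⟩

/-- Roots have modulus at most `1`, so the fibre product is a closed subset of `N` times the closed
unit disk. -/
instance [CompactSpace N] [CompactSpace B] [T2Space N] : CompactSpace (ob.Cover k) := by
  have hcl : IsClosed {p : N × ℂ | planeMap k p.2 = ob.proj p.1} :=
    isClosed_eq ((contDiff_planeMap NeZero.one_le).continuous.comp continuous_snd)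
      (continuous_proj.comp continuous_fst)
  have hc : IsCompact {p : N × ℂ | planeMap k p.2 = ob.proj p.1} := by
    refine IsCompact.of_isClosed_subset (isCompact_univ.prod (isCompact_closedBall (0 : ℂ) 1)) hcl ?_
    intro p hp
    exact ⟨mem_univ _, mem_closedBall_zero_iff.2 (norm_rt_le_one (ob := ob) (k := k) ⟨p, hp⟩)⟩
  exact isCompact_iff_compactSpace.1 hc

/-- When `w` is not a root of the disk coordinate of `x`, some other point over `x` serves as a
default value; thus `point` is total and always lies over `x`. -/
theorem exists_point (x : N) (w : ℂ) :
    ∃ m : ob.Cover k, m.pr = x ∧ (planeMap k w = ob.proj x → m.rt = w) := by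
  by_cases h : planeMap k w = ob.proj x
  · exact ⟨⟨(x, w), h⟩, rfl, fun _ => rfl⟩
  · obtain ⟨m, hm⟩ := pr_surjective (ob := ob) (k := k) x
    exact ⟨m, hm, fun hw => absurd hw h⟩

/-- The point over `x` with root `w`. -/
def point (x : N) (w : ℂ) : ob.Cover k := (exists_point x w).choose

theorem pr_point (x : N) (w : ℂ) : (point x w : ob.Cover k).pr = x :=
  (exists_point x w).choose_spec.1

theorem rt_point {x : N} {w : ℂ} (h : planeMap k w = ob.proj x) :
    (point x w : ob.Cover k).rt = w :=
  (exists_point x w).choose_spec.2 h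

theorem point_pr_rt (m : ob.Cover k) : point m.pr m.rt = m :=
  ext' (pr_point _ _) (rt_point m.spec)

end Cover

end OpenBook

/-! ### The smooth structure of the branched covering. -/

namespace OpenBook

variable {n : ℕ} {N B : Type u}
  [TopologicalSpace N] [ChartedSpace (EuclideanSpace ℝ (Fin (2 * (n + 1) + 1))) N]
  [TopologicalSpace B] [ChartedSpace (EuclideanSpace ℝ (Fin (2 * n + 1))) B]
  {ob : OpenBook n N B} {k : ℕ}

namespace Cover

/-- The map `(z, b) ↦ (S z, b)` in the tube. -/
def tubePower (ob : OpenBook n N B) (k : ℕ) (y : N) : N :=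
  ob.tube (planeMap k (ob.tube.symm y).1, (ob.tube.symm y).2)

theorem tubePower_tube {z : ℂ} (hz : ‖z‖ < 1) (b : B) :
    tubePower ob k (ob.tube (z, b)) = ob.tube (planeMap k z, b) := by
  rw [tubePower, tube_symm_tube hz]

theorem planeMap_branch {Ψ : PartialDiffeomorph 𝓘(ℝ, ℂ) 𝓘(ℝ, ℂ) ℂ ℂ ∞}
    (hΨ : EqOn (planeMap k) Ψ Ψ.source) {c : ℂ} (hc : c ∈ Ψ.target) :
    planeMap k (Ψ.symm c) = c :=
  (hΨ (Ψ.map_target' hc)).trans (Ψ.right_inv' hc)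

variable [NeZero k]

theorem norm_planeMap_lt_one {z : ℂ} (hz : ‖z‖ < 1) : ‖planeMap k z‖ < 1 := by
  rw [norm_planeMap NeZero.one_le]
  exact (profile_lt_one_iff NeZero.one_le (norm_nonneg _)).2 hz

theorem norm_tube_symm_lt {y : N} (hy : y ∈ ob.tube.target) : ‖(ob.tube.symm y).1‖ < 1 := by
  obtain ⟨z, b, hz, rfl⟩ := exists_eq_tube hy
  rwa [tube_symm_tube hz]

theorem tube_tube_symm {y : N} (hy : y ∈ ob.tube.target) :
    ob.tube ((ob.tube.symm y).1, (ob.tube.symm y).2) = y := ob.tube.right_inv' hy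

theorem contMDiffAt_tubePower {y : N} (hy : y ∈ ob.tube.target) :
    ContMDiffAt (𝓡 (2 * (n + 1) + 1)) (𝓡 (2 * (n + 1) + 1)) ∞ (tubePower ob k) y := by
  have h1 := contMDiffAt_tube_symm hy
  have h2 : ContMDiffAt (𝓡 (2 * (n + 1) + 1)) (𝓘(ℝ, ℂ).prod (𝓡 (2 * n + 1))) ∞
      (fun y => (planeMap k (ob.tube.symm y).1, (ob.tube.symm y).2)) y :=
    ContMDiffAt.prodMk
      ((contDiff_planeMap NeZero.one_le).contMDiff.contMDiffAt.comp y
        (contMDiffAt_fst.comp y h1)) (contMDiffAt_snd.comp y h1)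
  exact ContMDiffAt.comp (g := ob.tube) y
    (contMDiffAt_tube (norm_planeMap_lt_one (norm_tube_symm_lt hy)) _) h2

/-- The point of the covering over the tube with disk coordinate the one of `y`. -/
def ofTube (y : N) : ob.Cover k := point (tubePower ob k y) (ob.tube.symm y).1

/-- The coordinate `(w, b) ∈ 𝔻² × B` over the tube, as a point of the tube. -/
def toTube (m : ob.Cover k) : N := ob.tube (m.rt, (ob.tube.symm m.pr).2)

theorem pr_ofTube (y : N) : (ofTube y : ob.Cover k).pr = tubePower ob k y := pr_point _ _

theorem rt_ofTube {y : N} (hy : y ∈ ob.tube.target) :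
    (ofTube y : ob.Cover k).rt = (ob.tube.symm y).1 := by
  refine rt_point ?_
  rw [tubePower, proj_tube (norm_planeMap_lt_one (norm_tube_symm_lt hy))]

theorem tubePower_mem {y : N} (hy : y ∈ ob.tube.target) : tubePower ob k y ∈ ob.tube.target :=
  tube_mem_target (norm_planeMap_lt_one (norm_tube_symm_lt hy)) _

theorem toTube_mem {m : ob.Cover k} (hm : m.pr ∈ ob.tube.target) : m.toTube ∈ ob.tube.target :=
  tube_mem_target ((norm_rt_lt_one_iff m).2 hm) _

theorem tube_symm_toTube {m : ob.Cover k} (hm : m.pr ∈ ob.tube.target) :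
    ob.tube.symm m.toTube = (m.rt, (ob.tube.symm m.pr).2) :=
  tube_symm_tube ((norm_rt_lt_one_iff m).2 hm) _

theorem tubePower_toTube {m : ob.Cover k} (hm : m.pr ∈ ob.tube.target) :
    tubePower ob k m.toTube = m.pr := by
  rw [tubePower, tube_symm_toTube hm]
  dsimp only
  rw [m.spec, proj_of_mem hm, tube_tube_symm hm]

theorem ofTube_toTube {m : ob.Cover k} (hm : m.pr ∈ ob.tube.target) : ofTube m.toTube = m := by
  refine ext' ?_ ?_
  · rw [pr_ofTube, tubePower_toTube hm]
  · rw [rt_ofTube (toTube_mem hm), tube_symm_toTube hm]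

theorem toTube_ofTube {y : N} (hy : y ∈ ob.tube.target) : (ofTube y : ob.Cover k).toTube = y := by
  rw [toTube, rt_ofTube hy, pr_ofTube, tubePower,
    tube_symm_tube (norm_planeMap_lt_one (norm_tube_symm_lt hy)), tube_tube_symm hy]

/-- The local model over the tube. -/
def tubeModel (ob : OpenBook n N B) (k : ℕ) [NeZero k] : OpenPartialHomeomorph (ob.Cover k) N where
  toFun := toTube
  invFun := ofTube
  source := pr ⁻¹' ob.tube.target
  target := ob.tube.target
  map_source' _ hm := toTube_mem hm
  map_target' y hy := by
    change (ofTube y : ob.Cover k).pr ∈ ob.tube.target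
    rw [pr_ofTube]
    exact tubePower_mem hy
  left_inv' _ hm := ofTube_toTube hm
  right_inv' _ hy := toTube_ofTube hy
  open_source := ob.tube.open_target.preimage continuous_pr
  open_target := ob.tube.open_target
  continuousOn_toFun m hm := by
    refine ContinuousAt.continuousWithinAt ?_
    have h1 : ContinuousAt (fun m : ob.Cover k => (ob.tube.symm m.pr).2) m :=
      continuousAt_snd.comp
        (ContinuousAt.comp (g := ob.tube.symm) (contMDiffAt_tube_symm hm).continuousAt
          continuous_pr.continuousAt)
    exact ContinuousAt.comp (g := ob.tube)
      (contMDiffAt_tube ((norm_rt_lt_one_iff m).2 hm) _).continuousAt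
      (continuous_rt.continuousAt.prodMk h1)
  continuousOn_invFun y hy := by
    refine ContinuousAt.continuousWithinAt (continuousAt_iff.2 ⟨?_, ?_⟩)
    · simp only [pr_ofTube]
      exact (contMDiffAt_tubePower hy).continuousAt
    · refine (continuousAt_fst.comp (contMDiffAt_tube_symm hy).continuousAt).congr ?_
      filter_upwards [ob.tube.open_target.mem_nhds hy] with z hz
      exact (rt_ofTube hz).symm

variable [CompactSpace B] [T2Space N]

/-- The covering map, as a local model over the inverse of a branch of the root. -/
def branchModel (ob : OpenBook n N B) (k : ℕ) [NeZero k] (Ψ : PartialDiffeomorph 𝓘(ℝ, ℂ) 𝓘(ℝ, ℂ) ℂ ℂ ∞)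
    (hΨ : EqOn (planeMap k) Ψ Ψ.source) : OpenPartialHomeomorph (ob.Cover k) N where
  toFun := pr
  invFun x := point x (Ψ.symm (ob.proj x))
  source := rt ⁻¹' Ψ.source
  target := ob.proj ⁻¹' Ψ.target
  map_source' m hm := by
    change ob.proj m.pr ∈ Ψ.target
    rw [← m.spec, hΨ hm]
    exact Ψ.map_source' hm
  map_target' x hx := by
    change (point x _ : ob.Cover k).rt ∈ Ψ.source
    have h1 : Ψ.symm (ob.proj x) ∈ Ψ.source := Ψ.map_target' hx
    rw [rt_point (planeMap_branch hΨ hx)]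
    exact h1
  left_inv' m hm := by
    have h1 : Ψ.symm (ob.proj m.pr) = m.rt := by
      rw [← m.spec, hΨ hm]
      exact Ψ.left_inv' hm
    rw [h1]
    exact point_pr_rt m
  right_inv' x _ := pr_point _ _
  open_source := Ψ.open_source.preimage continuous_rt
  open_target := Ψ.open_target.preimage continuous_proj
  continuousOn_toFun := continuous_pr.continuousOn
  continuousOn_invFun x hx := by
    refine ContinuousAt.continuousWithinAt (continuousAt_iff.2 ⟨?_, ?_⟩)
    · simp only [pr_point]
      exact continuousAt_id
    · have h1 : ContinuousAt (fun x => Ψ.symm (ob.proj x)) x :=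
        ContinuousAt.comp (g := Ψ.symm)
          (Ψ.contMDiffOn_invFun.contMDiffAt (Ψ.open_target.mem_nhds hx)).continuousAt
          continuous_proj.continuousAt
      refine h1.congr ?_
      filter_upwards [(Ψ.open_target.preimage continuous_proj).mem_nhds hx] with y hy
      exact (rt_point (planeMap_branch hΨ hy)).symm

/-- The covering is modelled on `N`: by the coordinates (root, `b`), read as a point of the tube,
where the root vanishes, and by the projection itself elsewhere, on the domain of a local inverse of
the plane map. At `m.rt = 0` only the first kind is available. -/
instance : ChartedSpace N (ob.Cover k) where
  atlas := {e | e = tubeModel ob k ∨ ∃ Ψ hΨ, e = branchModel ob k Ψ hΨ}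
  chartAt m := open Classical in
    if h : m.rt = 0 then tubeModel ob k
    else branchModel ob k (isLocalDiffeomorphAt_planeMap (k := k) NeZero.one_le h).choose
      (isLocalDiffeomorphAt_planeMap (k := k) NeZero.one_le h).choose_spec.2
  mem_chart_source m := by
    split_ifs with h
    · exact binding_subset_target ((rt_eq_zero_iff m).1 h)
    · exact (isLocalDiffeomorphAt_planeMap (k := k) NeZero.one_le h).choose_spec.1
  chart_mem_atlas m := by
    split_ifs with h
    · exact Or.inl rfl
    · exact Or.inr ⟨_, _, rfl⟩

instance : ChartedSpace (EuclideanSpace ℝ (Fin (2 * (n + 1) + 1))) (ob.Cover k) :=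
  ChartedSpace.comp _ N _

/-- Two models of the same kind differ by the identity. Between the two kinds, the change is the
plane map on the disk factor of the tube, or a branch of its inverse. -/
theorem contMDiffOn_transition : ∀ e ∈ atlas N (ob.Cover k), ∀ e' ∈ atlas N (ob.Cover k),
    ContMDiffOn (𝓡 (2 * (n + 1) + 1)) (𝓡 (2 * (n + 1) + 1)) ∞ (fun y => e' (e.symm y))
      (e.symm.trans e').source := by
  rintro e (rfl | ⟨Ψ, hΨ, rfl⟩) e' (rfl | ⟨Ψ', hΨ', rfl⟩)
  · refine contMDiffOn_id.congr fun y hy => ?_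
    exact toTube_ofTube hy.1
  · intro y hy
    refine ContMDiffAt.contMDiffWithinAt ?_
    refine (contMDiffAt_tubePower (k := k) hy.1).congr_of_eventuallyEq
      (Eventually.of_forall fun z => ?_)
    exact pr_ofTube z
  · intro x hx
    refine ContMDiffAt.contMDiffWithinAt ?_
    have hx1 : ob.proj x ∈ Ψ.target := hx.1
    have hx2 : x ∈ ob.tube.target := by
      have : (point x (Ψ.symm (ob.proj x)) : ob.Cover k).pr ∈ ob.tube.target := hx.2
      rwa [pr_point] at this
    have hn : ‖Ψ.symm (ob.tube.symm x).1‖ < 1 := by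
      have h1 : (point x (Ψ.symm (ob.proj x)) : ob.Cover k).rt = Ψ.symm (ob.proj x) :=
        rt_point (planeMap_branch hΨ hx1)
      rw [← proj_of_mem hx2, ← h1, norm_rt_lt_one_iff, pr_point]
      exact hx2
    have h1 := contMDiffAt_tube_symm hx2
    have hx1' : (ob.tube.symm x).1 ∈ Ψ.target := by rwa [← proj_of_mem hx2]
    have h2 : ContMDiffAt (𝓡 (2 * (n + 1) + 1)) (𝓘(ℝ, ℂ).prod (𝓡 (2 * n + 1))) ∞
        (fun y => (Ψ.symm (ob.tube.symm y).1, (ob.tube.symm y).2)) x :=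
      ContMDiffAt.prodMk
        (ContMDiffAt.comp (g := Ψ.symm) x
          (Ψ.contMDiffOn_invFun.contMDiffAt (Ψ.open_target.mem_nhds hx1'))
          (contMDiffAt_fst.comp x h1)) (contMDiffAt_snd.comp x h1)
    refine (ContMDiffAt.comp (g := ob.tube) x (contMDiffAt_tube hn _) h2).congr_of_eventuallyEq ?_
    filter_upwards [ob.tube.open_target.mem_nhds hx2,
      (Ψ.open_target.preimage continuous_proj).mem_nhds hx1] with y hy1 hy2
    change ob.tube ((point y (Ψ.symm (ob.proj y)) : ob.Cover k).rt,
      (ob.tube.symm (point y (Ψ.symm (ob.proj y)) : ob.Cover k).pr).2) = _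
    rw [pr_point, rt_point (planeMap_branch hΨ hy2), proj_of_mem hy1]
    rfl
  · refine contMDiffOn_id.congr fun y hy => ?_
    exact pr_point _ _

variable [IsManifold (𝓡 (2 * (n + 1) + 1)) ∞ N]

instance : IsManifold (𝓡 (2 * (n + 1) + 1)) ∞ (ob.Cover k) := isManifold_comp contMDiffOn_transition

theorem contMDiffAt_toTube {m : ob.Cover k} (hm : m.pr ∈ ob.tube.target) :
    ContMDiffAt (𝓡 (2 * (n + 1) + 1)) (𝓡 (2 * (n + 1) + 1)) ∞ (toTube : ob.Cover k → N) m :=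
  (contMDiffOn_localModel contMDiffOn_transition (Or.inl rfl)).1.contMDiffAt
    ((tubeModel ob k).open_source.mem_nhds hm)

theorem contMDiffAt_ofTube {y : N} (hy : y ∈ ob.tube.target) :
    ContMDiffAt (𝓡 (2 * (n + 1) + 1)) (𝓡 (2 * (n + 1) + 1)) ∞ (ofTube : N → ob.Cover k) y :=
  (contMDiffOn_localModel contMDiffOn_transition (Or.inl rfl)).2.contMDiffAt
    (ob.tube.open_target.mem_nhds hy)

/-- The covering map is a local diffeomorphism off the binding. -/
theorem isLocalDiffeomorphAt_pr {m : ob.Cover k} (hm : m.pr ∉ ob.binding) :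
    IsLocalDiffeomorphAt (𝓡 (2 * (n + 1) + 1)) (𝓡 (2 * (n + 1) + 1)) ∞ (pr : ob.Cover k → N) m := by
  have h0 : m.rt ≠ 0 := fun h => hm ((rt_eq_zero_iff m).1 h)
  obtain ⟨Ψ, hs, hΨ⟩ := isLocalDiffeomorphAt_planeMap (k := k) NeZero.one_le h0
  let e := branchModel ob k Ψ hΨ
  have h := contMDiffOn_localModel contMDiffOn_transition
    (e := e) (Or.inr ⟨Ψ, hΨ, rfl⟩)
  exact isLocalDiffeomorphAt_of_inverse (g := e.symm) (U := e.source) (V := e.target) hs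
    e.open_source e.open_target (fun _ hx => e.map_source hx) (fun _ hy => e.map_target hy)
    (fun _ hx => e.left_inv hx) (fun _ hy => e.right_inv hy) h.1 h.2

/-- Over the tube the projection is `tubePower` after the tube model, which takes care of the
binding; at all other points it is a local diffeomorphism. -/
theorem contMDiff_pr :
    ContMDiff (𝓡 (2 * (n + 1) + 1)) (𝓡 (2 * (n + 1) + 1)) ∞ (pr : ob.Cover k → N) := by
  intro m
  by_cases hm : m.pr ∈ ob.tube.target
  · refine ((contMDiffAt_tubePower (k := k) (toTube_mem hm)).comp m
      (contMDiffAt_toTube hm)).congr_of_eventuallyEq ?_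
    filter_upwards [(ob.tube.open_target.preimage continuous_pr).mem_nhds hm] with m' hm'
    exact (tubePower_toTube hm').symm
  · exact (isLocalDiffeomorphAt_pr fun h => hm (binding_subset_target h)).contMDiffAt

end Cover

end OpenBook

namespace OpenBook

variable {n : ℕ} {N B : Type u}
  [TopologicalSpace N] [ChartedSpace (EuclideanSpace ℝ (Fin (2 * (n + 1) + 1))) N]
  [TopologicalSpace B] [ChartedSpace (EuclideanSpace ℝ (Fin (2 * n + 1))) B]
  {ob : OpenBook n N B} {k : ℕ}

namespace Cover

/-! ### Polar coordinates of the covering -/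

/-- The argument of the root. -/
def angle (m : ob.Cover k) : Circle := Circle.exp (Complex.arg m.rt)

theorem rt_eq_norm_mul_angle (m : ob.Cover k) : m.rt = (‖m.rt‖ : ℂ) * m.angle := by
  rw [angle, Circle.coe_exp, Complex.norm_mul_exp_arg_mul_I]

theorem coe_angle {m : ob.Cover k} (h : m.rt ≠ 0) : (m.angle : ℂ) = m.rt / (‖m.rt‖ : ℂ) := by
  have hn : (‖m.rt‖ : ℂ) ≠ 0 := by exact_mod_cast norm_ne_zero_iff.2 h
  rw [eq_div_iff hn, mul_comm]
  exact (rt_eq_norm_mul_angle m).symm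

theorem continuousAt_angle {m : ob.Cover k} (h : m.rt ≠ 0) :
    ContinuousAt (angle : ob.Cover k → Circle) m := by
  refine Topology.IsInducing.subtypeVal.continuousAt_iff.2 ?_
  have hn : (‖m.rt‖ : ℂ) ≠ 0 := by exact_mod_cast norm_ne_zero_iff.2 h
  have h1 : ContinuousAt (fun m : ob.Cover k => m.rt / (‖m.rt‖ : ℂ)) m :=
    continuous_rt.continuousAt.div
      (Complex.continuous_ofReal.comp (continuous_norm.comp continuous_rt)).continuousAt hn
  refine h1.congr ?_
  filter_upwards [continuous_rt.continuousAt.eventually_ne h] with m' hm'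
  exact (coe_angle hm').symm

theorem angle_eq_of_rt {m : ob.Cover k} {r : ℝ} (hr : 0 < r) {s : Circle} (h : m.rt = r * s) :
    m.angle = s := by
  have hr' : (r : ℂ) ≠ 0 := by exact_mod_cast hr.ne'
  have hn : ‖m.rt‖ = r := by
    rw [h, norm_mul, Circle.norm_coe, mul_one, Complex.norm_real, Real.norm_of_nonneg hr.le]
  have h0 : m.rt ≠ 0 := by
    rw [← norm_ne_zero_iff, hn]
    exact hr.ne'
  apply Circle.ext
  rw [coe_angle h0, hn, h]
  field_simp

variable [NeZero k]

/-- These are the phases of the two sides of `planeMap k m.rt = ob.proj m.pr`, whose common modulus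
is positive. -/
theorem angle_pow {m : ob.Cover k} (hm : m.pr ∉ ob.binding) : m.angle ^ k = ob.θ m.pr := by
  have h0 : m.rt ≠ 0 := fun h => hm ((rt_eq_zero_iff m).1 h)
  have h1 := m.spec
  rw [rt_eq_norm_mul_angle, planeMap_polar (norm_nonneg _) NeZero.one_le, proj_eq_norm_mul hm,
    norm_proj_pr] at h1
  have h2 : (profile k ‖m.rt‖ : ℂ) ≠ 0 := by
    exact_mod_cast (profile_pos NeZero.one_le (norm_pos_iff.2 h0)).ne'
  apply Circle.ext
  rw [Circle.coe_pow]
  exact mul_left_cancel₀ h2 h1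

/-- The modulus of the root is a function of the base point. So base point and angle serve as polar
coordinates, subject off the binding to the single relation `angle_pow`. -/
theorem ext_angle {m m' : ob.Cover k} (h : m.pr = m'.pr) (ha : m.angle = m'.angle) : m = m' := by
  refine ext' h ?_
  rw [rt_eq_norm_mul_angle m, rt_eq_norm_mul_angle m', norm_rt, norm_rt, h, ha]

/-- The point over `x` with argument `s`. -/
def polar (x : N) (s : Circle) : ob.Cover k := point x (invProfile k ‖ob.proj x‖ * s)

theorem pr_polar (x : N) (s : Circle) : (polar x s : ob.Cover k).pr = x := pr_point _ _

theorem rt_polar {x : N} {s : Circle} (hx : x ∉ ob.binding) (hs : s ^ k = ob.θ x) :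
    (polar x s : ob.Cover k).rt = invProfile k ‖ob.proj x‖ * s := by
  refine rt_point ?_
  rw [planeMap_polar (invProfile_nonneg _) NeZero.one_le, profile_invProfile (norm_nonneg _),
    ← Circle.coe_pow, hs, ← proj_eq_norm_mul hx]

theorem angle_polar {x : N} {s : Circle} (hx : x ∉ ob.binding) (hs : s ^ k = ob.θ x) :
    (polar x s : ob.Cover k).angle = s := by
  refine angle_eq_of_rt (lt_of_le_of_ne (invProfile_nonneg _) fun h => ?_) (rt_polar hx hs)
  have h1 := profile_invProfile (k := k) (norm_nonneg (ob.proj x))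
  rw [← h, profile_zero NeZero.one_le] at h1
  exact hx (proj_eq_zero_iff.1 (norm_eq_zero.1 h1.symm))

theorem polar_pr_angle {m : ob.Cover k} (hm : m.pr ∉ ob.binding) : polar m.pr m.angle = m :=
  ext_angle (pr_polar _ _) (angle_polar hm (angle_pow hm))

variable [CompactSpace B] [T2Space N]

theorem continuousAt_polar {X : Type*} [TopologicalSpace X] {h : X → N} {σ : X → Circle} {a : X}
    (hh : ContinuousAt h a) (hσ : ContinuousAt σ a)
    (he : ∀ᶠ x in 𝓝 a, h x ∉ ob.binding ∧ σ x ^ k = ob.θ (h x)) :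
    ContinuousAt (fun x => (polar (h x) (σ x) : ob.Cover k)) a := by
  refine continuousAt_iff.2 ⟨?_, ?_⟩
  · simpa only [pr_polar] using hh
  · have h1 : ContinuousAt (fun x => (invProfile k ‖ob.proj (h x)‖ : ℂ) * σ x) a :=
      (ContinuousAt.comp (g := fun x => (invProfile k ‖ob.proj x‖ : ℂ))
        (Complex.continuous_ofReal.comp
          (continuous_invProfile.comp continuous_norm_proj)).continuousAt hh).mul
        (contMDiff_coe_circle.continuous.continuousAt.comp hσ)
    refine h1.congr ?_
    filter_upwards [he] with x hx
    exact (rt_polar hx.1 hx.2).symm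

variable [IsManifold (𝓡 (2 * (n + 1) + 1)) ∞ N]

/-- A continuous `k`-th root of a smooth map to the circle is smooth, because `s ↦ sᵏ` is a local
diffeomorphism. -/
theorem contMDiffAt_angle {m : ob.Cover k} (hm : m.pr ∉ ob.binding) :
    ContMDiffAt (𝓡 (2 * (n + 1) + 1)) (𝓡 1) ∞ (angle : ob.Cover k → Circle) m := by
  refine contMDiffAt_of_comp (isLocalDiffeomorphAt_circle_pow (k := k) m.angle)
    (continuousAt_angle fun h => hm ((rt_eq_zero_iff m).1 h)) ?_
  refine ((θ_contMDiffAt hm).comp m contMDiff_pr.contMDiffAt).congr_of_eventuallyEq ?_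
  filter_upwards [(isClosed_binding.isOpen_compl.preimage continuous_pr).mem_nhds hm] with m' hm'
  exact angle_pow hm'

/-! ### The open book of the covering -/

/-- The neighbourhood `𝔻² × B` of the binding of the covering. -/
def coverTube (ob : OpenBook n N B) (k : ℕ) [NeZero k] :
    PartialDiffeomorph (𝓘(ℝ, ℂ).prod (𝓡 (2 * n + 1))) (𝓡 (2 * (n + 1) + 1)) (ℂ × B) (ob.Cover k) ∞ :=
  partialDiffeoMk (fun p => ofTube (ob.tube p)) (fun m => ob.tube.symm m.toTube)
    (Metric.ball (0 : ℂ) 1 ×ˢ (univ : Set B)) (pr ⁻¹' ob.tube.target)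
    (Metric.isOpen_ball.prod isOpen_univ) (ob.tube.open_target.preimage continuous_pr)
    (fun p hp => by
      change (ofTube (ob.tube p) : ob.Cover k).pr ∈ ob.tube.target
      rw [pr_ofTube]
      exact tubePower_mem (tube_mem_target (mem_ball_zero_iff.1 hp.1) p.2))
    (fun m hm => by
      rw [tube_symm_toTube hm]
      exact ⟨mem_ball_zero_iff.2 ((norm_rt_lt_one_iff m).2 hm), mem_univ _⟩)
    (fun p hp => by
      rw [toTube_ofTube (tube_mem_target (mem_ball_zero_iff.1 hp.1) p.2)]
      exact tube_symm_tube (mem_ball_zero_iff.1 hp.1) p.2)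
    (fun m hm => by
      rw [tube_symm_toTube hm]
      exact ofTube_toTube hm)
    (fun p hp => ((contMDiffAt_ofTube (tube_mem_target (mem_ball_zero_iff.1 hp.1) p.2)).comp p
      (contMDiffAt_tube (mem_ball_zero_iff.1 hp.1) p.2)).contMDiffWithinAt)
    (fun m hm => (ContMDiffAt.comp (g := ob.tube.symm) m (contMDiffAt_tube_symm (toTube_mem hm))
      (contMDiffAt_toTube hm)).contMDiffWithinAt)

theorem pr_coverTube {z : ℂ} (hz : ‖z‖ < 1) (b : B) :
    (coverTube ob k (z, b)).pr = ob.tube (planeMap k z, b) :=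
  (pr_ofTube _).trans (tubePower_tube hz b)

theorem rt_coverTube {z : ℂ} (hz : ‖z‖ < 1) (b : B) : (coverTube ob k (z, b)).rt = z := by
  refine (rt_ofTube (tube_mem_target hz b)).trans ?_
  rw [tube_symm_tube hz]

theorem range_coverTube : (range fun b : B => coverTube ob k (0, b)) = pr ⁻¹' ob.binding := by
  ext m
  constructor
  · rintro ⟨b, rfl⟩
    change (coverTube ob k (0, b)).pr ∈ ob.binding
    rw [← rt_eq_zero_iff, rt_coverTube (by simp)]
  · intro hm
    have h0 := (rt_eq_zero_iff m).2 hm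
    obtain ⟨b, hb⟩ := hm
    refine ⟨b, ext' ?_ ?_⟩
    · dsimp only
      rw [pr_coverTube (by simp), planeMap_zero NeZero.one_le]
      exact hb
    · dsimp only
      rw [rt_coverTube (by simp), h0]

theorem angle_coverTube {z : ℂ} (hz0 : z ≠ 0) (hz : ‖z‖ < 1) (b : B) :
    ((coverTube ob k (z, b)).angle : ℂ) = z / (‖z‖ : ℂ) := by
  have h := rt_coverTube (ob := ob) (k := k) hz b
  rw [coe_angle (by rw [h]; exact hz0), h]

/-- A trivialization of `θ` at `sᵏ` is pulled back under `s ↦ sᵏ`: in polar coordinates, the page of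
the covering over `s` is the page of `N` over `sᵏ`. -/
theorem exists_trivialization (s : Circle) : ∃ (P : Type u) (_ : TopologicalSpace P)
    (_ : ChartedSpace (EuclideanSpace ℝ (Fin (2 * (n + 1)))) P)
    (_ : IsManifold (𝓡 (2 * (n + 1))) ∞ P)
    (T : PartialDiffeomorph ((𝓡 1).prod (𝓡 (2 * (n + 1)))) (𝓡 (2 * (n + 1) + 1))
      (Circle × P) (ob.Cover k) ∞) (V : Set Circle),
    IsOpen V ∧ s ∈ V ∧ T.source = V ×ˢ (univ : Set P) ∧
      T.target = {m | m.pr ∉ ob.binding ∧ m.angle ∈ V} ∧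
      ∀ q ∈ T.source, angle (T q) = q.1 := by
  obtain ⟨P, _, _, _, T, V, hV, hsV, hsrc, htgt, hT⟩ := ob.θ_bundle (s ^ k)
  have hpow : Continuous fun s : Circle => s ^ k := continuous_pow k
  have hmem : ∀ q ∈ ((fun s : Circle => s ^ k) ⁻¹' V) ×ˢ (univ : Set P),
      ((q.1 ^ k, q.2) : Circle × P) ∈ T.source := fun q hq => by
    rw [hsrc]
    exact ⟨hq.1, mem_univ _⟩
  have hnb : ∀ q ∈ ((fun s : Circle => s ^ k) ⁻¹' V) ×ˢ (univ : Set P),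
      T (q.1 ^ k, q.2) ∉ ob.binding ∧ q.1 ^ k = ob.θ (T (q.1 ^ k, q.2)) := fun q hq => by
    have h1 : T (q.1 ^ k, q.2) ∈ T.target := T.map_source' (hmem q hq)
    rw [htgt] at h1
    exact ⟨h1.1, (hT _ (hmem q hq)).symm⟩
  have htm : ∀ m ∈ {m : ob.Cover k | m.pr ∉ ob.binding ∧ m.angle ∈ (fun s : Circle => s ^ k) ⁻¹' V},
      m.pr ∈ T.target := fun m hm => by
    rw [htgt]
    refine ⟨hm.1, ?_⟩
    rw [← angle_pow hm.1]
    exact hm.2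
  have hTm : ∀ m ∈ {m : ob.Cover k | m.pr ∉ ob.binding ∧ m.angle ∈ (fun s : Circle => s ^ k) ⁻¹' V},
      T (m.angle ^ k, (T.symm m.pr).2) = m.pr := fun m hm => by
    have h1 : T (T.symm m.pr) = m.pr := T.right_inv' (htm m hm)
    have h2 : (T.symm m.pr).1 = m.angle ^ k := by
      rw [angle_pow hm.1, ← congrArg ob.θ h1]
      exact (hT _ (T.map_target' (htm m hm))).symm
    rw [← h2]
    exact h1
  have hUo : IsOpen (((fun s : Circle => s ^ k) ⁻¹' V) ×ˢ (univ : Set P)) :=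
    (hV.preimage hpow).prod isOpen_univ
  have hsm : ∀ q ∈ ((fun s : Circle => s ^ k) ⁻¹' V) ×ˢ (univ : Set P),
      ContMDiffAt ((𝓡 1).prod (𝓡 (2 * (n + 1)))) (𝓡 (2 * (n + 1) + 1)) ∞
        (fun q : Circle × P => T (q.1 ^ k, q.2)) q := fun q hq => by
    have h1 : ContMDiffAt ((𝓡 1).prod (𝓡 (2 * (n + 1)))) ((𝓡 1).prod (𝓡 (2 * (n + 1)))) ∞
        (fun q : Circle × P => (q.1 ^ k, q.2)) q :=
      ContMDiffAt.prodMk ((isLocalDiffeomorphAt_circle_pow (k := k) q.1).contMDiffAt.comp q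
        contMDiffAt_fst) contMDiffAt_snd
    exact ContMDiffAt.comp (g := T) q
      (T.contMDiffOn_toFun.contMDiffAt (T.open_source.mem_nhds (hmem q hq))) h1
  refine ⟨P, inferInstance, inferInstance, inferInstance,
    partialDiffeoMk (fun q => polar (T (q.1 ^ k, q.2)) q.1) (fun m => (m.angle, (T.symm m.pr).2))
      (((fun s : Circle => s ^ k) ⁻¹' V) ×ˢ (univ : Set P))
      {m | m.pr ∉ ob.binding ∧ m.angle ∈ (fun s : Circle => s ^ k) ⁻¹' V} hUo ?_ ?_ ?_ ?_ ?_ ?_ ?_,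
    (fun s : Circle => s ^ k) ⁻¹' V, hV.preimage hpow, hsV, rfl, rfl, ?_⟩
  · rw [isOpen_iff_mem_nhds]
    intro m hm
    have h0 : m.rt ≠ 0 := fun h => hm.1 ((rt_eq_zero_iff m).1 h)
    filter_upwards [(isClosed_binding.isOpen_compl.preimage continuous_pr).mem_nhds hm.1,
      (continuousAt_angle h0).eventually ((hV.preimage hpow).mem_nhds hm.2)] with m' h1 h2
    exact ⟨h1, h2⟩
  · intro q hq
    obtain ⟨h1, h2⟩ := hnb q hq
    refine ⟨?_, ?_⟩
    · rw [pr_polar]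
      exact h1
    · rw [angle_polar h1 h2]
      exact hq.1
  · intro m hm
    exact ⟨hm.2, mem_univ _⟩
  · intro q hq
    obtain ⟨h1, h2⟩ := hnb q hq
    refine Prod.ext (angle_polar h1 h2) ?_
    dsimp only
    rw [pr_polar]
    have : T.symm (T (q.1 ^ k, q.2)) = (q.1 ^ k, q.2) := T.left_inv' (hmem q hq)
    rw [this]
  · intro m hm
    dsimp only
    rw [hTm m hm]
    exact polar_pr_angle hm.1
  · intro q hq
    refine ContMDiffAt.contMDiffWithinAt ?_
    obtain ⟨h1, h2⟩ := hnb q hq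
    -- A continuous lift through the local diffeomorphism `pr` is smooth when its projection is.
    refine contMDiffAt_of_comp (f := pr) (isLocalDiffeomorphAt_pr ?_)
      (continuousAt_polar (hsm q hq).continuousAt continuousAt_fst ?_) ?_
    · rw [pr_polar]
      exact h1
    · filter_upwards [hUo.mem_nhds hq] with q' hq'
      exact hnb q' hq'
    · simp only [pr_polar]
      exact hsm q hq
  · intro m hm
    refine ContMDiffAt.contMDiffWithinAt (ContMDiffAt.prodMk (contMDiffAt_angle hm.1) ?_)
    exact contMDiffAt_snd.comp m (ContMDiffAt.comp (g := T.symm) m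
      (T.contMDiffOn_invFun.contMDiffAt (T.open_target.mem_nhds (htm m hm)))
      contMDiff_pr.contMDiffAt)
  · intro q hq
    obtain ⟨h1, h2⟩ := hnb q hq
    exact angle_polar h1 h2

end Cover

open Cover in
/-- The open book of the branched covering. -/
def coverBook (ob : OpenBook n N B) (k : ℕ) [NeZero k] [CompactSpace B] [T2Space N]
    [IsManifold (𝓡 (2 * (n + 1) + 1)) ∞ N] : OpenBook n (ob.Cover k) B where
  tube := coverTube ob k
  tube_source := rfl
  θ := angle
  θ_smooth := by
    rw [range_coverTube]
    intro m hm
    exact (contMDiffAt_angle hm).contMDiffWithinAt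
  θ_bundle := by
    rw [range_coverTube]
    exact exists_trivialization
  θ_tube z b hz0 hz := angle_coverTube hz0 hz b

end OpenBook

namespace OpenBook

variable {n : ℕ} {N B : Type u}
  [TopologicalSpace N] [ChartedSpace (EuclideanSpace ℝ (Fin (2 * (n + 1) + 1))) N]
  [TopologicalSpace B] [ChartedSpace (EuclideanSpace ℝ (Fin (2 * n + 1))) B]
  {ob : OpenBook n N B} {k : ℕ}

/-! ### The deck transformation -/

namespace Cover

theorem planeMap_rotate (m : ob.Cover k) {s : Circle} (hs : s ^ k = 1) :
    planeMap k (s * m.rt) = ob.proj m.pr := by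
  rw [planeMap_circle_mul, ← Circle.coe_pow, hs, Circle.coe_one, one_mul, m.spec]

variable [NeZero k]

/-- The rotation by a `k`-th root of unity. -/
def rotate (s : Circle) (m : ob.Cover k) : ob.Cover k := point m.pr (s * m.rt)

theorem pr_rotate (s : Circle) (m : ob.Cover k) : (rotate s m).pr = m.pr := pr_point _ _

theorem rt_rotate {s : Circle} (hs : s ^ k = 1) (m : ob.Cover k) : (rotate s m).rt = s * m.rt :=
  rt_point (planeMap_rotate m hs)

theorem rotate_rotate {s s' : Circle} (hs : s ^ k = 1) (hs' : s' ^ k = 1) (m : ob.Cover k) :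
    rotate s (rotate s' m) = rotate (s * s') m := by
  refine ext' ?_ ?_
  · rw [pr_rotate, pr_rotate, pr_rotate]
  · rw [rt_rotate hs, rt_rotate hs', rt_rotate (by rw [mul_pow, hs, hs', one_mul]), Circle.coe_mul,
      mul_assoc]

theorem rotate_one (m : ob.Cover k) : rotate 1 m = m := by
  refine ext' (pr_rotate _ _) ?_
  rw [rt_rotate (one_pow k)]
  simp

/-- The rotation as a permutation. -/
def deck (s : Circle) (hs : s ^ k = 1) : Equiv.Perm (ob.Cover k) where
  toFun := rotate s
  invFun := rotate s⁻¹
  left_inv m := by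
    rw [rotate_rotate (by rw [inv_pow, hs, inv_one]) hs, inv_mul_cancel, rotate_one]
  right_inv m := by
    rw [rotate_rotate hs (by rw [inv_pow, hs, inv_one]), mul_inv_cancel, rotate_one]

theorem deck_pow_apply {s : Circle} (hs : s ^ k = 1) (j : ℕ) (m : ob.Cover k) :
    (deck s hs ^ j) m = rotate (s ^ j) m := by
  induction j with
  | zero => rw [pow_zero, pow_zero, rotate_one]; rfl
  | succ j ih =>
    rw [pow_succ', Equiv.Perm.mul_apply, ih, pow_succ']
    exact rotate_rotate hs (by rw [← pow_mul, mul_comm, pow_mul, hs, one_pow]) m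

theorem angle_rotate {s : Circle} (hs : s ^ k = 1) {m : ob.Cover k} (hm : m.pr ∉ ob.binding) :
    (rotate s m).angle = s * m.angle := by
  have h0 : m.rt ≠ 0 := fun h => hm ((rt_eq_zero_iff m).1 h)
  refine angle_eq_of_rt (norm_pos_iff.2 h0) ?_
  rw [rt_rotate hs, Circle.coe_mul]
  conv_lhs => rw [rt_eq_norm_mul_angle m]
  ring

end Cover

/-! ### Charts near the binding -/

/-- The chart `ℂ × ℝ²ⁿ⁺¹` near a point of the binding, obtained from a chart of the binding. -/
def tubeChart (ob : OpenBook n N B) [IsManifold (𝓡 (2 * n + 1)) ∞ B] (b₀ : B) (r : ℝ) (hr : r ≤ 1) :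
    PartialDiffeomorph (𝓡 (2 * (n + 1) + 1)) 𝓘(ℝ, ℂ × EuclideanSpace ℝ (Fin (2 * n + 1))) N
      (ℂ × EuclideanSpace ℝ (Fin (2 * n + 1))) ∞ :=
  have hball : ∀ {z : ℂ}, z ∈ Metric.ball (0 : ℂ) r → ‖z‖ < 1 := fun hz =>
    (mem_ball_zero_iff.1 hz).trans_le hr
  have hpre : ∀ {p : ℂ × EuclideanSpace ℝ (Fin (2 * n + 1))},
      p ∈ Metric.ball (0 : ℂ) r ×ˢ (extChartAt (𝓡 (2 * n + 1)) b₀).target →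
      ob.tube.symm (ob.tube (p.1, (extChartAt (𝓡 (2 * n + 1)) b₀).symm p.2)) =
        (p.1, (extChartAt (𝓡 (2 * n + 1)) b₀).symm p.2) := fun hp => tube_symm_tube (hball hp.1) _
  partialDiffeoMk
    (fun x => ((ob.tube.symm x).1, extChartAt (𝓡 (2 * n + 1)) b₀ (ob.tube.symm x).2))
    (fun p => ob.tube (p.1, (extChartAt (𝓡 (2 * n + 1)) b₀).symm p.2))
    (ob.tube.target ∩
      ob.tube.symm ⁻¹' (Metric.ball (0 : ℂ) r ×ˢ (extChartAt (𝓡 (2 * n + 1)) b₀).source))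
    (Metric.ball (0 : ℂ) r ×ˢ (extChartAt (𝓡 (2 * n + 1)) b₀).target)
    (ob.tube.contMDiffOn_invFun.continuousOn.isOpen_inter_preimage ob.tube.open_target
      (Metric.isOpen_ball.prod (isOpen_extChartAt_source b₀)))
    (Metric.isOpen_ball.prod (isOpen_extChartAt_target b₀))
    (fun x hx => ⟨hx.2.1, (extChartAt (𝓡 (2 * n + 1)) b₀).map_source hx.2.2⟩)
    (fun p hp => by
      refine ⟨tube_mem_target (hball hp.1) _, ?_⟩
      rw [mem_preimage, hpre hp]
      exact ⟨hp.1, (extChartAt (𝓡 (2 * n + 1)) b₀).map_target hp.2⟩)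
    (fun x hx => by
      rw [(extChartAt (𝓡 (2 * n + 1)) b₀).left_inv hx.2.2]
      exact ob.tube.right_inv' hx.1)
    (fun p hp => by
      rw [hpre hp]
      exact Prod.ext rfl ((extChartAt (𝓡 (2 * n + 1)) b₀).right_inv hp.2))
    (fun x hx => by
      have h1 := contMDiffAt_tube_symm hx.1
      refine ContMDiffAt.contMDiffWithinAt (ContMDiffAt.prodMk_space (contMDiffAt_fst.comp x h1) ?_)
      refine ContMDiffAt.comp (g := extChartAt (𝓡 (2 * n + 1)) b₀) x ?_ (contMDiffAt_snd.comp x h1)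
      exact contMDiffAt_extChartAt' (by
        have := hx.2.2
        rwa [extChartAt_source] at this))
    (fun p hp => by
      have h1 : ContMDiffAt 𝓘(ℝ, ℂ × EuclideanSpace ℝ (Fin (2 * n + 1)))
          (𝓘(ℝ, ℂ).prod (𝓡 (2 * n + 1))) ∞
          (fun p => ((p.1 : ℂ), (extChartAt (𝓡 (2 * n + 1)) b₀).symm p.2)) p :=
        ContMDiffAt.prodMk contDiff_fst.contMDiff.contMDiffAt
          (ContMDiffAt.comp (g := (extChartAt (𝓡 (2 * n + 1)) b₀).symm) p
            ((contMDiffOn_extChartAt_symm b₀).contMDiffAt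
              ((isOpen_extChartAt_target b₀).mem_nhds hp.2))
            contDiff_snd.contMDiff.contMDiffAt)
      exact (ContMDiffAt.comp (g := ob.tube) p (contMDiffAt_tube (hball hp.1) _)
        h1).contMDiffWithinAt)

variable [NeZero k] [CompactSpace B] [T2Space N] [IsManifold (𝓡 (2 * (n + 1) + 1)) ∞ N]

open Cover

theorem binding_coverBook : (ob.coverBook k).binding = pr ⁻¹' ob.binding := range_coverTube

theorem coverBook_tube : (ob.coverBook k).tube = coverTube ob k := rfl

theorem pr_incl_coverBook (b : B) : ((ob.coverBook k).incl b).pr = ob.incl b := by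
  refine (pr_coverTube (by simp) b).trans ?_
  rw [planeMap_zero NeZero.one_le]
  rfl

/-- The complement of the binding of the covering is the mapping torus of the `k`-th power of the
monodromy. -/
theorem IsMappingTorus.cover {P : Type u} [TopologicalSpace P]
    [ChartedSpace (EuclideanSpace ℝ (Fin (2 * (n + 1)))) P] {Φ : Equiv.Perm P} {q : ℝ × P → N}
    (h : ob.IsMappingTorus Φ q) :
    (ob.coverBook k).IsMappingTorus (Φ ^ k) (fun w => polar (q (k * w.1, w.2)) (circ w.1)) := by
  have hk : (k : ℝ) ≠ 0 := by exact_mod_cast NeZero.ne k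
  have hnb : ∀ w : ℝ × P, q w ∉ ob.binding := fun w => by
    have : q w ∈ range q := mem_range_self w
    rwa [h.range_eq] at this
  have hθ : ∀ w : ℝ × P, circ w.1 ^ k = ob.θ (q (k * w.1, w.2)) := fun w => by
    rw [h.θ_eq, circ_pow]
    rfl
  have hld : ∀ w : ℝ × P, IsLocalDiffeomorphAt (𝓘(ℝ, ℝ).prod (𝓡 (2 * (n + 1))))
      (𝓡 (2 * (n + 1) + 1)) ∞ (fun w : ℝ × P => q (k * w.1, w.2)) w := fun w =>
    (isLocalDiffeomorphAt_prodMk_id w.2 (isLocalDiffeomorphAt_mul_const (k : ℝ) hk w.1)).comp _ _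
      (h.localDiffeo _)
  refine ⟨?_, ?_, ?_, ?_, ?_, ?_⟩
  · have := contMDiff_perm_zpow h.smooth h.smooth_symm k
    simpa using this
  · have := contMDiff_perm_zpow h.smooth h.smooth_symm (-k)
    simpa using this
  · intro w
    refine isLocalDiffeomorphAt_of_comp (f := pr) (isLocalDiffeomorphAt_pr ?_)
      (continuousAt_polar (hld w).contMDiffAt.continuousAt
        (continuous_circ.comp continuous_fst).continuousAt
        (Eventually.of_forall fun w => ⟨hnb _, hθ w⟩)) ?_
    · rw [pr_polar]
      exact hnb _
    · simp only [pr_polar]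
      exact hld w
  · rw [binding_coverBook]
    ext m
    constructor
    · rintro ⟨w, rfl⟩
      change (polar _ _ : ob.Cover k).pr ∉ ob.binding
      rw [pr_polar]
      exact hnb _
    · intro hm
      have hm' : m.pr ∈ range q := by
        rw [h.range_eq]
        exact hm
      obtain ⟨⟨t₀, p₀⟩, hq⟩ := hm'
      -- The angle of `m` prescribes the time `t`. By `angle_pow`, `k t` and `t₀` differ by an
      -- integer, which a power of `Φ` absorbs.
      obtain ⟨t, ht⟩ := exists_circ_eq m.angle
      have h1 : circ t₀ = circ (k * t) := by
        rw [← circ_pow, ht, angle_pow hm, ← hq, h.θ_eq]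
        rfl
      obtain ⟨j, hj⟩ := circ_eq_iff.1 h1
      refine ⟨(t, (Φ ^ j) p₀), ?_⟩
      dsimp only
      rw [← (h.eq_iff t₀ (k * t) p₀ _).2 ⟨j, hj, rfl⟩, hq, ht]
      exact polar_pr_angle hm
  · intro t t' p p'
    dsimp only
    constructor
    · intro he
      have h1 := congrArg pr he
      have h2 := congrArg angle he
      rw [pr_polar, pr_polar] at h1
      rw [angle_polar (hnb _) (hθ (t, p)), angle_polar (hnb _) (hθ (t', p'))] at h2
      obtain ⟨m, hm⟩ := circ_eq_iff.1 h2
      dsimp only at hm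
      obtain ⟨j, hj, hp⟩ := (h.eq_iff _ _ _ _).1 h1
      -- One turn of the angle upstairs is `k` turns in `N`; this is where the monodromy becomes
      -- `Φᵏ`.
      have hjm : j = k * m := by
        have : (j : ℝ) = k * m := by
          rw [hm] at hj
          linarith
        exact_mod_cast this
      refine ⟨m, hm, ?_⟩
      rw [hp, hjm, zpow_mul, zpow_natCast]
    · rintro ⟨m, hm, hp⟩
      have h1 : q (k * t, p) = q (k * t', p') := by
        refine (h.eq_iff _ _ _ _).2 ⟨k * m, ?_, ?_⟩
        · rw [hm]
          push_cast
          ring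
        · rw [hp, zpow_mul, zpow_natCast]
      rw [h1, circ_eq_iff.2 ⟨m, hm⟩]
  · intro t p
    exact angle_polar (hnb _) (hθ (t, p))

/-- Both points have angle `circ t`, and by the hypothesis at time `k t` they lie over the same
point. -/
theorem polar_eq_coverTube {p : ℝ → N} {b : B} {r : ℝ} (hr : 0 < r) (hr1 : r < 1)
    (h : ∀ t : ℝ, p t = ob.tube ((profile k r : ℂ) * (circ t : ℂ), b)) (t : ℝ) :
    (polar (p (k * t)) (circ t) : ob.Cover k) = coverTube ob k ((r : ℂ) * (circ t : ℂ), b) := by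
  have hn : ‖(r : ℂ) * (circ t : ℂ)‖ < 1 := by
    rwa [norm_mul, Circle.norm_coe, mul_one, Complex.norm_real, Real.norm_of_nonneg hr.le]
  have h0 : (r : ℂ) * (circ t : ℂ) ≠ 0 :=
    mul_ne_zero (by exact_mod_cast hr.ne') (Circle.coe_ne_zero _)
  have hp : p (k * t) = (coverTube ob k ((r : ℂ) * (circ t : ℂ), b)).pr := by
    rw [pr_coverTube hn, planeMap_polar hr.le NeZero.one_le, h, ← circ_pow, Circle.coe_pow]
  have hm : (coverTube ob k ((r : ℂ) * (circ t : ℂ), b)).pr ∉ ob.binding := by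
    rw [← rt_eq_zero_iff, rt_coverTube hn]
    exact h0
  have ha : (coverTube ob k ((r : ℂ) * (circ t : ℂ), b)).angle = circ t :=
    angle_eq_of_rt hr (rt_coverTube hn b)
  refine ext_angle ?_ ?_
  · rw [pr_polar, hp]
  · rw [hp, angle_polar hm (by rw [← angle_pow hm, ha]), ha]

namespace Cover

/-- Over the tube the rotation is linear in the root; elsewhere it is a continuous lift of the
projection through the projection. -/
theorem contMDiff_rotate {s : Circle} (hs : s ^ k = 1) :
    ContMDiff (𝓡 (2 * (n + 1) + 1)) (𝓡 (2 * (n + 1) + 1)) ∞ (rotate s : ob.Cover k → ob.Cover k) := by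
  intro m
  by_cases hm : m.pr ∈ ob.tube.target
  · have hm1 := (norm_rt_lt_one_iff m).2 hm
    have hsm : ‖(s : ℂ) * m.rt‖ < 1 := by rwa [norm_mul, Circle.norm_coe, one_mul]
    have h1 : ContMDiffAt (𝓡 (2 * (n + 1) + 1)) (𝓘(ℝ, ℂ).prod (𝓡 (2 * n + 1))) ∞
        (fun m : ob.Cover k => ob.tube.symm m.toTube) m :=
      ContMDiffAt.comp (g := ob.tube.symm) m (contMDiffAt_tube_symm (toTube_mem hm))
        (contMDiffAt_toTube hm)
    have h2 : ContMDiffAt (𝓡 (2 * (n + 1) + 1)) (𝓘(ℝ, ℂ).prod (𝓡 (2 * n + 1))) ∞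
        (fun m : ob.Cover k => ((s : ℂ) * (ob.tube.symm m.toTube).1, (ob.tube.symm m.toTube).2)) m :=
      ContMDiffAt.prodMk
        ((contDiff_const.mul contDiff_id : ContDiff ℝ ∞ fun z : ℂ => (s : ℂ) * z).contMDiff.contMDiffAt.comp
          m (contMDiffAt_fst.comp m h1)) (contMDiffAt_snd.comp m h1)
    have hval : ((s : ℂ) * (ob.tube.symm m.toTube).1, (ob.tube.symm m.toTube).2) ∈
        (coverTube ob k).source := by
      rw [tube_symm_toTube hm]
      exact ⟨mem_ball_zero_iff.2 hsm, mem_univ _⟩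
    have h3 := ContMDiffAt.comp (g := coverTube ob k) m
      ((coverTube ob k).contMDiffOn_toFun.contMDiffAt
        ((coverTube ob k).open_source.mem_nhds hval)) h2
    refine h3.congr_of_eventuallyEq ?_
    filter_upwards [(ob.tube.open_target.preimage continuous_pr).mem_nhds hm] with m' hm'
    have hm1' : ‖(s : ℂ) * m'.rt‖ < 1 := by
      rw [norm_mul, Circle.norm_coe, one_mul]
      exact (norm_rt_lt_one_iff m').2 hm'
    change rotate s m' = coverTube ob k ((s : ℂ) * (ob.tube.symm m'.toTube).1, (ob.tube.symm m'.toTube).2)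
    rw [tube_symm_toTube hm']
    refine ext' ?_ ?_
    · rw [pr_rotate, pr_coverTube hm1', planeMap_rotate m' hs, proj_of_mem hm']
      exact (tube_tube_symm hm').symm
    · rw [rt_rotate hs, rt_coverTube hm1']
  · have hb : m.pr ∉ ob.binding := fun h => hm (binding_subset_target h)
    refine contMDiffAt_of_comp (f := pr) (isLocalDiffeomorphAt_pr (by rwa [pr_rotate])) ?_ ?_
    · refine continuousAt_iff.2 ⟨?_, ?_⟩
      · simp only [pr_rotate]
        exact continuous_pr.continuousAt
      · simp only [rt_rotate hs]
        exact continuousAt_const.mul continuous_rt.continuousAt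
    · simp only [pr_rotate]
      exact contMDiff_pr.contMDiffAt

theorem circ_inv_pow : circ ((k : ℝ)⁻¹) ^ k = 1 := by
  rw [circ_pow, mul_inv_cancel₀ (by exact_mod_cast NeZero.ne k)]
  exact_mod_cast circ_int 1

variable [CompactSpace N] [IsManifold (𝓡 (2 * n + 1)) ∞ B]

/-- The deck group is generated by the rotation of the root through a `k`-th of a turn; off the
binding it shifts the angle, so its action is read off from `ext_angle`. The branch models and the
tube charts provide the local forms. -/
theorem isCyclicBranchedCover_pr :
    IsCyclicBranchedCover n k (pr : ob.Cover k → N) ob.binding where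
  smooth := contMDiff_pr
  surjective := pr_surjective
  covering := by
    refine IsCoveringMapOn.of_isLocalHomeomorphOn continuous_pr ?_
    intro m hm
    have h0 : m.rt ≠ 0 := fun h => hm ((rt_eq_zero_iff m).1 h)
    obtain ⟨Ψ, hs, hΨ⟩ := isLocalDiffeomorphAt_planeMap (k := k) NeZero.one_le h0
    exact ⟨branchModel ob k Ψ hΨ, hs, rfl⟩
  localDiffeo m := isLocalDiffeomorphAt_pr m.2
  cyclic := by
    have hk : (k : ℝ) ≠ 0 := by exact_mod_cast NeZero.ne k
    refine ⟨deck (circ (k : ℝ)⁻¹) circ_inv_pow, contMDiff_rotate circ_inv_pow, ?_, pr_rotate _, ?_, ?_⟩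
    · ext m
      rw [deck_pow_apply, circ_inv_pow, rotate_one]
      rfl
    · intro m hm j hj
      rw [deck_pow_apply] at hj
      have h1 : ((circ (k : ℝ)⁻¹) ^ j) ^ k = 1 := by
        rw [← pow_mul, mul_comm, pow_mul, circ_inv_pow, one_pow]
      have h2 := congrArg angle hj
      rw [angle_rotate h1 hm, mul_eq_right, circ_pow, ← circ_int 0] at h2
      obtain ⟨i, hi⟩ := circ_eq_iff.1 h2.symm
      have h3 : (j : ℝ) = k * i := by
        push_cast at hi
        field_simp at hi
        linarith
      have h4 : (j : ℤ) = k * i := by exact_mod_cast h3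
      exact Int.natCast_dvd_natCast.1 ⟨i, h4⟩
    · intro m m' hm hmm
      obtain ⟨t, ht⟩ := exists_circ_eq m.angle
      obtain ⟨t', ht'⟩ := exists_circ_eq m'.angle
      have h1 : circ (k * t) = circ (k * t') := by
        rw [← circ_pow, ← circ_pow, ht, ht', angle_pow hm, angle_pow (hmm ▸ hm), hmm]
      obtain ⟨i, hi⟩ := circ_eq_iff.1 h1
      have hk0 : (k : ℤ) ≠ 0 := by exact_mod_cast NeZero.ne k
      -- The two angles differ by `i / k` of a turn, so the residue of `i` modulo `k` is the
      -- exponent of the rotation.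
      obtain ⟨j, hj⟩ := Int.eq_ofNat_of_zero_le (Int.emod_nonneg i hk0)
      have h2 : ((circ (k : ℝ)⁻¹) ^ j) ^ k = 1 := by
        rw [← pow_mul, mul_comm, pow_mul, circ_inv_pow, one_pow]
      refine ⟨j, ?_⟩
      rw [deck_pow_apply]
      refine ext_angle (by rw [pr_rotate, hmm]) ?_
      rw [angle_rotate h2 hm, circ_pow, ← ht, ← ht', ← circ_add]
      refine circ_eq_iff.2 ⟨-(i / k), ?_⟩
      have h3 : (i : ℝ) = k * ((i / k : ℤ) : ℝ) + j := by
        have := Int.mul_ediv_add_emod i k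
        rw [hj] at this
        exact_mod_cast this.symm
      push_cast
      have h4 : (k : ℝ) * t' = k * (t + (k : ℝ)⁻¹ * j + ((i / k : ℤ) : ℝ)) := by
        rw [hi, h3]
        field_simp
        ring
      have h5 := mul_left_cancel₀ hk h4
      linarith
  branching := by
    intro m hm
    have h0 := (rt_eq_zero_iff m).2 hm
    obtain ⟨b, hb⟩ := hm
    have hmt : m.pr ∈ ob.tube.target := by
      rw [← hb]
      exact tube_mem_target (by simp) b
    have hsymm : ∀ {m : ob.Cover k}, m.pr ∈ ob.tube.target →
        (ob.coverBook k).tube.symm m = (m.rt, (ob.tube.symm m.pr).2) := fun h => tube_symm_toTube h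
    -- Up to radius `1/4` the plane map is exactly `zᵏ`.
    refine ⟨(ob.coverBook k).tubeChart b (1 / 4) (by norm_num), ob.tubeChart b 1 le_rfl, ?_, ?_, ?_, ?_⟩
    · refine ⟨hmt, ?_⟩
      rw [mem_preimage, hsymm hmt, h0, ← hb, incl, tube_symm_tube (by simp)]
      exact ⟨by simp, mem_extChartAt_source b⟩
    · rintro m' ⟨h1, h2⟩
      rw [mem_preimage, hsymm h1] at h2
      exact ⟨h1, mem_ball_zero_iff.2 (norm_tube_symm_lt h1), h2.2⟩
    · rintro y ⟨h1, h2⟩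
      rw [← proj_eq_zero_iff, proj_of_mem h1]
      rfl
    · rintro m' ⟨h1, h2⟩
      rw [mem_preimage, hsymm h1] at h2
      have h3 : ‖m'.rt‖ < 1 / 4 := mem_ball_zero_iff.1 h2.1
      have h4 : (ob.tube.symm m'.pr).1 = m'.rt ^ k := by
        rw [← proj_of_mem (show m'.pr ∈ ob.tube.target from h1), ← m'.spec, planeMap_eq_pow NeZero.one_le h3.le]
      refine Prod.ext ?_ ?_
      · change (ob.tube.symm m'.pr).1 = ((ob.coverBook k).tube.symm m').1 ^ k
        rw [hsymm h1, h4]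
      · change extChartAt (𝓡 (2 * n + 1)) b (ob.tube.symm m'.pr).2 =
          extChartAt (𝓡 (2 * n + 1)) b ((ob.coverBook k).tube.symm m').2
        rw [hsymm h1]

end Cover

end OpenBook

/-! ### Families of forms `a ∧ wⁿ` -/

section Families

theorem wedgePow_congr {V W : Type*} {n : ℕ} {a : V → ℝ} {w : V → V → ℝ} {a' : W → ℝ}
    {w' : W → W → ℝ} {v : Fin (2 * n + 1) → V} {v' : Fin (2 * n + 1) → W}
    (ha : ∀ i, a (v i) = a' (v' i)) (hw : ∀ i j, w (v i) (v j) = w' (v' i) (v' j)) :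
    wedgePow n a w v = wedgePow n a' w' v' := by
  simp only [wedgePow, ha, hw]

theorem pow2Form_congr {V W : Type*} {n : ℕ} {w : V → V → ℝ} {w' : W → W → ℝ}
    {v : Fin (2 * n) → V} {v' : Fin (2 * n) → W}
    (hw : ∀ i j, w (v i) (v j) = w' (v' i) (v' j)) : pow2Form n w v = pow2Form n w' v' := by
  simp only [pow2Form, hw]

theorem contDiffAt_wedgePow {X V : Type*} [NormedAddCommGroup X] [NormedSpace ℝ X] {n : ℕ}
    {r : WithTop ℕ∞} {a : X → V → ℝ} {w : X → V → V → ℝ} {v : Fin (2 * n + 1) → V} {x₀ : X}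
    (ha : ∀ i, ContDiffAt ℝ r (fun x => a x (v i)) x₀)
    (hw : ∀ i j, ContDiffAt ℝ r (fun x => w x (v i) (v j)) x₀) :
    ContDiffAt ℝ r (fun x => wedgePow n (a x) (w x) v) x₀ := by
  unfold wedgePow
  refine contDiffAt_const.mul (ContDiffAt.sum fun σ _ => contDiffAt_const.mul ?_)
  exact (ha _).mul (contDiffAt_prod fun i _ => hw _ _)

/-- Inserting two vectors into the first slots of an alternating form. -/
def insertTwo {V : Type*} [AddCommGroup V] [Module ℝ V] {m : ℕ} (A : V [⋀^Fin (m + 1 + 1)]→ₗ[ℝ] ℝ)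
    (u v : V) : V [⋀^Fin m]→ₗ[ℝ] ℝ := AlternatingMap.curryLeft (AlternatingMap.curryLeft A u) v

theorem insertTwo_apply {V : Type*} [AddCommGroup V] [Module ℝ V] {m : ℕ}
    (A : V [⋀^Fin (m + 1 + 1)]→ₗ[ℝ] ℝ) (u v : V) (e : Fin m → V) :
    insertTwo A u v e = A (Fin.cons u (Fin.cons v e)) := rfl

theorem insertTwo_self {V : Type*} [AddCommGroup V] [Module ℝ V] {m : ℕ}
    (A : V [⋀^Fin (m + 1 + 1)]→ₗ[ℝ] ℝ) (u : V) (e : Fin m → V) : insertTwo A u u e = 0 := by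
  rw [insertTwo_apply]
  exact A.map_eq_zero_of_eq _ (i := 0) (j := 1) rfl (by simp)

/-- A rotation and dilation in the first two slots. -/
theorem insertTwo_conformal {V : Type*} [AddCommGroup V] [Module ℝ V] {m : ℕ}
    (A : V [⋀^Fin (m + 1 + 1)]→ₗ[ℝ] ℝ) (u v : V) (e : Fin m → V) (s t : ℝ) :
    insertTwo A (s • u + t • v) (-t • u + s • v) e = (s ^ 2 + t ^ 2) * insertTwo A u v e := by
  have key : ∀ x y : V, insertTwo A x y e = -insertTwo A y x e := by
    intro x y
    have h := insertTwo_self A (x + y) e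
    have h1 := insertTwo_self A x e
    have h2 := insertTwo_self A y e
    simp only [insertTwo, map_add, AlternatingMap.curryLeft_add,
      LinearMap.add_apply, AlternatingMap.add_apply] at h h1 h2 ⊢
    linarith
  have h1 := insertTwo_self A u e
  have h2 := insertTwo_self A v e
  have h3 := key v u
  simp only [insertTwo, map_add, map_smul, AlternatingMap.curryLeft_add,
    AlternatingMap.curryLeft_smul, LinearMap.add_apply, LinearMap.smul_apply, AlternatingMap.add_apply, AlternatingMap.smul_apply,
    smul_eq_mul] at h1 h2 h3 ⊢
  rw [h1, h2, h3]
  ring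

/-- A function of `(x, ε)` that is nonnegative for `ε = 0` and has positive `ε`-derivative at one
point is positive nearby for `ε > 0`. -/
theorem exists_pos_of_deriv_pos {X : Type*} [NormedAddCommGroup X] [NormedSpace ℝ X]
    {G : X × ℝ → ℝ} {x₀ : X} (hG : ContDiffAt ℝ 1 G (x₀, 0)) {c : ℝ} (hc : 0 < c)
    (h0 : ∀ ε, G (x₀, ε) = c * ε) (hx : ∀ᶠ x in 𝓝 x₀, 0 ≤ G (x, 0)) :
    ∃ δ > 0, ∀ᶠ x in 𝓝 x₀, ∀ ε, 0 < ε → ε < δ → 0 < G (x, ε) := by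
  have hd0 : fderiv ℝ G (x₀, 0) (0, 1) = c := by
    have h1 : HasDerivAt (fun ε : ℝ => (x₀, ε)) ((0 : X), (1 : ℝ)) 0 :=
      (hasDerivAt_const _ _).prodMk (hasDerivAt_id _)
    have h2 := HasFDerivAt.comp_hasDerivAt (f := fun ε : ℝ => (x₀, ε)) (0 : ℝ)
      (hG.differentiableAt one_ne_zero).hasFDerivAt h1
    have h3 : HasDerivAt (fun ε : ℝ => G (x₀, ε)) c 0 := by
      simp only [h0]
      simpa using (hasDerivAt_id (0 : ℝ)).const_mul c
    exact h2.unique h3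
  have hcont : ContinuousAt (fun q => fderiv ℝ G q (0, 1)) (x₀, 0) :=
    (hG.fderiv_right (m := 0) (by simp)).continuousAt.clm_apply continuousAt_const
  have hpos : ∀ᶠ q in 𝓝 (x₀, (0 : ℝ)), 0 < fderiv ℝ G q (0, 1) :=
    hcont.eventually (lt_mem_nhds (hc.trans_eq hd0.symm))
  have hdiff : ∀ᶠ q in 𝓝 (x₀, (0 : ℝ)), DifferentiableAt ℝ G q := by
    filter_upwards [hG.eventually (by simp)] with q hq
    exact hq.differentiableAt one_ne_zero
  -- On a product neighbourhood the `ε`-derivative stays positive, so `G (x, ·)` increases strictly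
  -- from its nonnegative value at `0`.
  obtain ⟨U, hU, V, hV, hUV⟩ := mem_nhds_prod_iff.1 (hpos.and hdiff)
  obtain ⟨δ, hδ, hball⟩ := Metric.mem_nhds_iff.1 hV
  refine ⟨δ, hδ, ?_⟩
  filter_upwards [hU, hx] with x hxU hx0 ε hε hεδ
  have hmem : ∀ s ∈ Icc 0 ε, (x, s) ∈ {q | 0 < fderiv ℝ G q (0, 1) ∧ DifferentiableAt ℝ G q} :=
    fun s hs => hUV ⟨hxU, hball (by
      rw [Metric.mem_ball, Real.dist_eq, sub_zero, abs_of_nonneg hs.1]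
      exact hs.2.trans_lt hεδ)⟩
  have hder : ∀ s ∈ Icc 0 ε, HasDerivAt (fun s : ℝ => G (x, s)) (fderiv ℝ G (x, s) (0, 1)) s := by
    intro s hs
    have h1 : HasDerivAt (fun ε : ℝ => (x, ε)) ((0 : X), (1 : ℝ)) s :=
      (hasDerivAt_const _ _).prodMk (hasDerivAt_id _)
    exact HasFDerivAt.comp_hasDerivAt (f := fun ε : ℝ => (x, ε)) s (hmem s hs).2.hasFDerivAt h1
  have hmono : StrictMonoOn (fun s : ℝ => G (x, s)) (Icc 0 ε) := by
    refine strictMonoOn_of_deriv_pos (convex_Icc 0 ε)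
      (fun s hs => (hder s hs).continuousAt.continuousWithinAt) ?_
    intro s hs
    have hs' := interior_subset hs
    rw [(hder s hs').deriv]
    exact (hmem s hs').1
  exact hx0.trans_lt (hmono ⟨le_rfl, hε.le⟩ ⟨hε.le, le_rfl⟩ hε)

end Families

/-! ### A cut-off of the identity of the plane -/

section Cutoff

/-- The radial factor of the cut-off. -/
def cutoffFactor (z : ℂ) : ℝ := 1 - Real.smoothTransition (4 * ‖z‖ - 2)

/-- A smooth map of the plane equal to the identity for `|z| ≤ 1/2` and to `0` for `|z| ≥ 3/4`. -/
def cutoff (z : ℂ) : ℂ := cutoffFactor z * z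

theorem cutoff_eq_self {z : ℂ} (hz : ‖z‖ ≤ 1 / 2) : cutoff z = z := by
  rw [cutoff, cutoffFactor, Real.smoothTransition.zero_of_nonpos (by linarith)]
  simp

theorem cutoff_eq_zero {z : ℂ} (hz : 3 / 4 ≤ ‖z‖) : cutoff z = 0 := by
  rw [cutoff, cutoffFactor, Real.smoothTransition.one_of_one_le (by linarith)]
  simp

theorem contDiff_cutoff : ContDiff ℝ ∞ cutoff := by
  rw [contDiff_iff_contDiffAt]
  intro z
  rcases lt_or_ge ‖z‖ (1 / 2) with h | h
  · refine contDiffAt_id.congr_of_eventuallyEq ?_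
    filter_upwards [continuous_norm.continuousAt.eventually (isOpen_Iio.mem_nhds h)] with w hw
    exact cutoff_eq_self (le_of_lt hw)
  · have hz : z ≠ 0 := by
      rintro rfl
      rw [norm_zero] at h
      norm_num at h
    have h1 : ContDiffAt ℝ ∞ (fun z : ℂ => ‖z‖) z := contDiffAt_norm ℝ hz
    have h2 : ContDiffAt ℝ ∞ cutoffFactor z :=
      contDiffAt_const.sub (Real.smoothTransition.contDiffAt.comp z
        ((contDiffAt_const.mul h1).sub contDiffAt_const))
    exact (Complex.ofRealCLM.contDiff.contDiffAt.comp z h2).mul contDiffAt_id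

end Cutoff

namespace OpenBook

variable {n : ℕ} {N B : Type u}
  [TopologicalSpace N] [ChartedSpace (EuclideanSpace ℝ (Fin (2 * (n + 1) + 1))) N]
  [TopologicalSpace B] [ChartedSpace (EuclideanSpace ℝ (Fin (2 * n + 1))) B]
  {ob : OpenBook n N B} {k : ℕ}

namespace Cover

/-! ### The rotation form -/

/-- The real part of the cut-off root. -/
def rootRe (m : ob.Cover k) : ℝ := (cutoff m.rt).re

/-- The imaginary part of the cut-off root. -/
def rootIm (m : ob.Cover k) : ℝ := (cutoff m.rt).im

/-- The cut-off is radial, so the cut-off root stays on the real line spanned by the angle. -/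
theorem angle_re_mul_rootIm (m : ob.Cover k) :
    (m.angle : ℂ).re * m.rootIm = (m.angle : ℂ).im * m.rootRe := by
  have h : cutoff m.rt = ((cutoffFactor m.rt * ‖m.rt‖ : ℝ) : ℂ) * m.angle := by
    rw [cutoff, Complex.ofReal_mul, mul_assoc]
    exact congrArg _ (rt_eq_norm_mul_angle m)
  rw [rootIm, rootRe, h, Complex.re_ofReal_mul, Complex.im_ofReal_mul]
  ring

theorem angle_sq (m : ob.Cover k) : (m.angle : ℂ).re ^ 2 + (m.angle : ℂ).im ^ 2 = 1 := by
  have h := Circle.normSq_coe m.angle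
  rw [Complex.normSq_apply] at h
  linarith

variable [NeZero k]

theorem cutoff_rt_eventuallyEq_zero {m : ob.Cover k} (hm : m.pr ∉ ob.tube.target) :
    ∀ᶠ m' : ob.Cover k in 𝓝 m, cutoff m'.rt = 0 := by
  have h1 : 3 / 4 < ‖m.rt‖ := by
    have := mt (norm_rt_lt_one_iff m).1 hm
    linarith
  filter_upwards [(continuous_norm.comp continuous_rt).continuousAt.eventually
    (isOpen_Ioi.mem_nhds h1)] with m' hm'
  exact cutoff_eq_zero (le_of_lt hm')

variable [CompactSpace B] [T2Space N]

/-- The form `κ (x dy - y dx)`, where `x + iy` is the cut-off root. -/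
def rotForm (κ : ob.Cover k → ℝ) : OneForm (2 * (n + 1) + 1) (ob.Cover k) := fun m =>
  (funDiff (fun m => κ m * m.rootRe) rootIm : OneForm (2 * (n + 1) + 1) (ob.Cover k)) m +
    (-1 : ℝ) • (funDiff (fun m => κ m * m.rootIm) rootRe :
      OneForm (2 * (n + 1) + 1) (ob.Cover k)) m

theorem val_rotForm (κ : ob.Cover k → ℝ) (m : ob.Cover k)
    (u : EuclideanSpace ℝ (Fin (2 * (n + 1) + 1))) :
    (rotForm κ).val m u = κ m * (m.rootRe * mfd (𝓡 (2 * (n + 1) + 1)) 𝓘(ℝ, ℝ) rootIm m u -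
      m.rootIm * mfd (𝓡 (2 * (n + 1) + 1)) 𝓘(ℝ, ℝ) rootRe m u) := by
  change κ m * m.rootRe * mfd (𝓡 (2 * (n + 1) + 1)) 𝓘(ℝ, ℝ) rootIm m u +
    -1 * (κ m * m.rootIm * mfd (𝓡 (2 * (n + 1) + 1)) 𝓘(ℝ, ℝ) rootRe m u) = _
  ring

/-- A conformal change of the contact form can thus be absorbed into the coefficient `κ`, as
`Supports.cover` requires. -/
theorem rotForm_mul (κ h : ob.Cover k → ℝ) (m : ob.Cover k) :
    rotForm (fun m => h m * κ m) m = h m • rotForm κ m := by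
  ext u
  refine (val_rotForm _ m u).trans (Eq.trans ?_ (congrArg (fun c => h m * c) (val_rotForm κ m u)).symm)
  ring

theorem val_rotForm_of_rt_eq_zero (κ : ob.Cover k → ℝ) {m : ob.Cover k} (hm : m.rt = 0) :
    (rotForm κ).val m = 0 := by
  ext u
  rw [val_rotForm, rootRe, rootIm, hm, cutoff_eq_self (by simp)]
  simp

variable [IsManifold (𝓡 (2 * (n + 1) + 1)) ∞ N]

theorem contMDiffAt_rt {m : ob.Cover k} (hm : m.pr ∈ ob.tube.target) :
    ContMDiffAt (𝓡 (2 * (n + 1) + 1)) 𝓘(ℝ, ℂ) ∞ (rt : ob.Cover k → ℂ) m := by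
  have h1 : ContMDiffAt (𝓡 (2 * (n + 1) + 1)) 𝓘(ℝ, ℂ) ∞
      (fun m : ob.Cover k => (ob.tube.symm m.toTube).1) m :=
    contMDiffAt_fst.comp m (ContMDiffAt.comp (g := ob.tube.symm) m
      (contMDiffAt_tube_symm (toTube_mem hm)) (contMDiffAt_toTube hm))
  refine h1.congr_of_eventuallyEq ?_
  filter_upwards [(ob.tube.open_target.preimage continuous_pr).mem_nhds hm] with m' hm'
  rw [tube_symm_toTube hm']

/-- The cut-off root vanishes near every point that does not lie over the tube, so `κ` matters over
the tube only. -/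
theorem contMDiff_mul_rootRe {κ : ob.Cover k → ℝ} (hκ : ∀ m : ob.Cover k, m.pr ∈ ob.tube.target →
      ContMDiffAt (𝓡 (2 * (n + 1) + 1)) 𝓘(ℝ, ℝ) ∞ κ m) :
    ContMDiff (𝓡 (2 * (n + 1) + 1)) 𝓘(ℝ, ℝ) ∞ (fun m : ob.Cover k => κ m * m.rootRe) := by
  intro m
  by_cases hm : m.pr ∈ ob.tube.target
  · have h : ContDiff ℝ ∞ fun z : ℂ => (cutoff z).re := Complex.reCLM.contDiff.comp contDiff_cutoff
    exact (hκ m hm).mul (h.contMDiff.contMDiffAt.comp m (contMDiffAt_rt hm))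
  · refine (contMDiffAt_const (c := (0 : ℝ))).congr_of_eventuallyEq ?_
    filter_upwards [cutoff_rt_eventuallyEq_zero hm] with m' hm'
    rw [rootRe, hm', Complex.zero_re, mul_zero]

theorem contMDiff_mul_rootIm {κ : ob.Cover k → ℝ} (hκ : ∀ m : ob.Cover k, m.pr ∈ ob.tube.target →
      ContMDiffAt (𝓡 (2 * (n + 1) + 1)) 𝓘(ℝ, ℝ) ∞ κ m) :
    ContMDiff (𝓡 (2 * (n + 1) + 1)) 𝓘(ℝ, ℝ) ∞ (fun m : ob.Cover k => κ m * m.rootIm) := by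
  intro m
  by_cases hm : m.pr ∈ ob.tube.target
  · have h : ContDiff ℝ ∞ fun z : ℂ => (cutoff z).im := Complex.imCLM.contDiff.comp contDiff_cutoff
    exact (hκ m hm).mul (h.contMDiff.contMDiffAt.comp m (contMDiffAt_rt hm))
  · refine (contMDiffAt_const (c := (0 : ℝ))).congr_of_eventuallyEq ?_
    filter_upwards [cutoff_rt_eventuallyEq_zero hm] with m' hm'
    rw [rootIm, hm', Complex.zero_im, mul_zero]

theorem contMDiff_rootRe :
    ContMDiff (𝓡 (2 * (n + 1) + 1)) 𝓘(ℝ, ℝ) ∞ (rootRe : ob.Cover k → ℝ) := by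
  simpa only [one_mul] using contMDiff_mul_rootRe (ob := ob) (k := k) (κ := fun _ => 1)
    fun _ _ => contMDiffAt_const

theorem contMDiff_rootIm :
    ContMDiff (𝓡 (2 * (n + 1) + 1)) 𝓘(ℝ, ℝ) ∞ (rootIm : ob.Cover k → ℝ) := by
  simpa only [one_mul] using contMDiff_mul_rootIm (ob := ob) (k := k) (κ := fun _ => 1)
    fun _ _ => contMDiffAt_const

theorem smooth_rotForm {κ : ob.Cover k → ℝ} (hκ : ∀ m : ob.Cover k, m.pr ∈ ob.tube.target →
      ContMDiffAt (𝓡 (2 * (n + 1) + 1)) 𝓘(ℝ, ℝ) ∞ κ m) : (rotForm κ).Smooth :=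
  (smooth_funDiff (contMDiff_mul_rootRe hκ) contMDiff_rootIm).add_smul
    (smooth_funDiff (contMDiff_mul_rootIm hκ) contMDiff_rootRe) _

theorem extDBil_rotForm {κ : ob.Cover k → ℝ} (hκ : ∀ m : ob.Cover k, m.pr ∈ ob.tube.target →
      ContMDiffAt (𝓡 (2 * (n + 1) + 1)) 𝓘(ℝ, ℝ) ∞ κ m) (m : ob.Cover k)
    (u v : EuclideanSpace ℝ (Fin (2 * (n + 1) + 1))) :
    (rotForm κ).extDBil m u v =
      (mfd (𝓡 (2 * (n + 1) + 1)) 𝓘(ℝ, ℝ) (fun m => κ m * m.rootRe) m u *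
        mfd (𝓡 (2 * (n + 1) + 1)) 𝓘(ℝ, ℝ) rootIm m v -
      mfd (𝓡 (2 * (n + 1) + 1)) 𝓘(ℝ, ℝ) (fun m => κ m * m.rootRe) m v *
        mfd (𝓡 (2 * (n + 1) + 1)) 𝓘(ℝ, ℝ) rootIm m u) -
      (mfd (𝓡 (2 * (n + 1) + 1)) 𝓘(ℝ, ℝ) (fun m => κ m * m.rootIm) m u *
        mfd (𝓡 (2 * (n + 1) + 1)) 𝓘(ℝ, ℝ) rootRe m v -
      mfd (𝓡 (2 * (n + 1) + 1)) 𝓘(ℝ, ℝ) (fun m => κ m * m.rootIm) m v *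
        mfd (𝓡 (2 * (n + 1) + 1)) 𝓘(ℝ, ℝ) rootRe m u) := by
  refine (extDBil_add_smul (smooth_funDiff (contMDiff_mul_rootRe hκ) contMDiff_rootIm)
    (smooth_funDiff (contMDiff_mul_rootIm hκ) contMDiff_rootRe) (-1) m u v).trans ?_
  rw [extDBil_funDiff (contMDiff_mul_rootRe hκ) contMDiff_rootIm,
    extDBil_funDiff (contMDiff_mul_rootIm hκ) contMDiff_rootRe]
  ring

/-- Functions `φ + iψ` with values in `ℝ θ'` have differentials with values in `ℝ θ'` along the
pages. -/
theorem angle_re_mul_mfd {φ ψ : ob.Cover k → ℝ} {m : ob.Cover k} (hm : m.pr ∉ ob.binding)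
    (hφ : ContMDiff (𝓡 (2 * (n + 1) + 1)) 𝓘(ℝ, ℝ) ∞ φ)
    (hψ : ContMDiff (𝓡 (2 * (n + 1) + 1)) 𝓘(ℝ, ℝ) ∞ ψ)
    (h : ∀ m : ob.Cover k, (m.angle : ℂ).re * ψ m = (m.angle : ℂ).im * φ m)
    {u : EuclideanSpace ℝ (Fin (2 * (n + 1) + 1))}
    (hu : mfd (𝓡 (2 * (n + 1) + 1)) 𝓘(ℝ, ℂ) (fun m : ob.Cover k => (m.angle : ℂ)) m u = 0) :
    (m.angle : ℂ).re * mfd (𝓡 (2 * (n + 1) + 1)) 𝓘(ℝ, ℝ) ψ m u =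
      (m.angle : ℂ).im * mfd (𝓡 (2 * (n + 1) + 1)) 𝓘(ℝ, ℝ) φ m u := by
  have ha : MDifferentiableAt (𝓡 (2 * (n + 1) + 1)) 𝓘(ℝ, ℂ)
      (fun m : ob.Cover k => (m.angle : ℂ)) m :=
    (contMDiff_coe_circle.contMDiffAt.comp m (contMDiffAt_angle hm)).mdifferentiableAt (by simp)
  have hcomp : ∀ L : ℂ →L[ℝ] ℝ, MDifferentiableAt (𝓡 (2 * (n + 1) + 1)) 𝓘(ℝ, ℝ)
      (fun m : ob.Cover k => L (m.angle : ℂ)) m ∧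
      mfd (𝓡 (2 * (n + 1) + 1)) 𝓘(ℝ, ℝ) (fun m : ob.Cover k => L (m.angle : ℂ)) m u = 0 := by
    intro L
    have hL : MDifferentiableAt 𝓘(ℝ, ℂ) 𝓘(ℝ, ℝ) L (m.angle : ℂ) :=
      L.differentiableAt.mdifferentiableAt
    refine ⟨hL.comp m ha, ?_⟩
    rw [mfd_comp (f := fun m : ob.Cover k => (m.angle : ℂ)) hL ha, ContinuousLinearMap.comp_apply, hu, map_zero]
  have hprod : ∀ (L : ℂ →L[ℝ] ℝ) (ψ : ob.Cover k → ℝ)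
      (_ : ContMDiff (𝓡 (2 * (n + 1) + 1)) 𝓘(ℝ, ℝ) ∞ ψ),
      mfd (𝓡 (2 * (n + 1) + 1)) 𝓘(ℝ, ℝ) (fun m : ob.Cover k => L (m.angle : ℂ) * ψ m) m u =
        L (m.angle : ℂ) * mfd (𝓡 (2 * (n + 1) + 1)) 𝓘(ℝ, ℝ) ψ m u := by
    intro L ψ hψ
    have h1 : mfd (𝓡 (2 * (n + 1) + 1)) 𝓘(ℝ, ℝ) (fun m : ob.Cover k => L (m.angle : ℂ) * ψ m) m =
        L (m.angle : ℂ) • mfd (𝓡 (2 * (n + 1) + 1)) 𝓘(ℝ, ℝ) ψ m +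
          ψ m • mfd (𝓡 (2 * (n + 1) + 1)) 𝓘(ℝ, ℝ) (fun m : ob.Cover k => L (m.angle : ℂ)) m :=
      ((hcomp L).1.hasMFDerivAt.mul ((hψ m).mdifferentiableAt (by simp)).hasMFDerivAt).mfderiv
    rw [h1, add_apply, smul_apply, smul_apply, (hcomp L).2, smul_zero, add_zero, smul_eq_mul]
  -- The relation `h` is differentiated in the direction `u`, along which the angle is constant, so
  -- that only `ψ` and `φ` get differentiated.
  have h1 := hprod Complex.reCLM ψ hψ
  have h2 := hprod Complex.imCLM φ hφ
  simp only [Complex.reCLM_apply, Complex.imCLM_apply] at h1 h2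
  rw [← h1, ← h2]
  simp only [h]

/-- The rotation form and its differential vanish on the pages. -/
theorem extDBil_rotForm_page {κ : ob.Cover k → ℝ} (hκ : ∀ m : ob.Cover k, m.pr ∈ ob.tube.target →
      ContMDiffAt (𝓡 (2 * (n + 1) + 1)) 𝓘(ℝ, ℝ) ∞ κ m) {m : ob.Cover k} (hm : m.pr ∉ ob.binding)
    {u v : EuclideanSpace ℝ (Fin (2 * (n + 1) + 1))}
    (hu : mfd (𝓡 (2 * (n + 1) + 1)) 𝓘(ℝ, ℂ) (fun m : ob.Cover k => (m.angle : ℂ)) m u = 0)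
    (hv : mfd (𝓡 (2 * (n + 1) + 1)) 𝓘(ℝ, ℂ) (fun m : ob.Cover k => (m.angle : ℂ)) m v = 0) :
    (rotForm κ).extDBil m u v = 0 := by
  have hκ' : ∀ m : ob.Cover k, (m.angle : ℂ).re * (κ m * m.rootIm) =
      (m.angle : ℂ).im * (κ m * m.rootRe) := fun m => by
    linear_combination κ m * angle_re_mul_rootIm m
  have a1 := angle_re_mul_mfd hm (contMDiff_mul_rootRe hκ) (contMDiff_mul_rootIm hκ) hκ' hu
  have a2 := angle_re_mul_mfd hm (contMDiff_mul_rootRe hκ) (contMDiff_mul_rootIm hκ) hκ' hv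
  have b1 := angle_re_mul_mfd hm contMDiff_rootRe contMDiff_rootIm angle_re_mul_rootIm hu
  have b2 := angle_re_mul_mfd hm contMDiff_rootRe contMDiff_rootIm angle_re_mul_rootIm hv
  have hs := angle_sq m
  rw [extDBil_rotForm hκ]
  generalize (m.angle : ℂ).re = R at *
  generalize (m.angle : ℂ).im = J at *
  generalize mfd (𝓡 (2 * (n + 1) + 1)) 𝓘(ℝ, ℝ) (fun m : ob.Cover k => κ m * m.rootRe) m u = xu at *
  generalize mfd (𝓡 (2 * (n + 1) + 1)) 𝓘(ℝ, ℝ) (fun m : ob.Cover k => κ m * m.rootRe) m v = xv at *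
  generalize mfd (𝓡 (2 * (n + 1) + 1)) 𝓘(ℝ, ℝ) (fun m : ob.Cover k => κ m * m.rootIm) m u = yu at *
  generalize mfd (𝓡 (2 * (n + 1) + 1)) 𝓘(ℝ, ℝ) (fun m : ob.Cover k => κ m * m.rootIm) m v = yv at *
  generalize mfd (𝓡 (2 * (n + 1) + 1)) 𝓘(ℝ, ℝ) (rootRe : ob.Cover k → ℝ) m u = pu at *
  generalize mfd (𝓡 (2 * (n + 1) + 1)) 𝓘(ℝ, ℝ) (rootRe : ob.Cover k → ℝ) m v = pv at *
  generalize mfd (𝓡 (2 * (n + 1) + 1)) 𝓘(ℝ, ℝ) (rootIm : ob.Cover k → ℝ) m u = qu at *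
  generalize mfd (𝓡 (2 * (n + 1) + 1)) 𝓘(ℝ, ℝ) (rootIm : ob.Cover k → ℝ) m v = qv at *
  -- On page vectors the differentials of `κ (x + iy)` and of `x + iy` take values in the real line
  -- spanned by `R + iJ`; hence `d(κx) ∧ dy` and `d(κy) ∧ dx` agree there.
  by_cases hR : R = 0
  · have hJ : J ≠ 0 := by
      rintro rfl
      rw [hR] at hs
      norm_num at hs
    rw [hR] at a1 a2 b1 b2
    have e1 : xu = 0 := by simpa [hJ] using a1.symm
    have e2 : xv = 0 := by simpa [hJ] using a2.symm
    have e3 : pu = 0 := by simpa [hJ] using b1.symm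
    have e4 : pv = 0 := by simpa [hJ] using b2.symm
    rw [e1, e2, e3, e4]
    ring
  · have e1 : yu = J / R * xu := by field_simp; linarith
    have e2 : yv = J / R * xv := by field_simp; linarith
    have e3 : qu = J / R * pu := by field_simp; linarith
    have e4 : qv = J / R * pv := by field_simp; linarith
    rw [e1, e2, e3, e4]
    ring

end Cover

end OpenBook

/-! ### Differentials of local diffeomorphisms and of the radial projection. -/

section Differential

variable {E E' : Type*} [NormedAddCommGroup E] [NormedSpace ℝ E]
  [NormedAddCommGroup E'] [NormedSpace ℝ E']
  {H H' : Type*} [TopologicalSpace H] [TopologicalSpace H']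
  {I : ModelWithCorners ℝ E H} {J : ModelWithCorners ℝ E' H'}
  {X X' : Type*} [TopologicalSpace X] [ChartedSpace H X] [TopologicalSpace X'] [ChartedSpace H' X']

theorem mfd_bijective {f : X → X'} {x : X} (hf : IsLocalDiffeomorphAt I J ∞ f x) :
    Function.Bijective (mfd I J f x) :=
  (hf.mfderivToContinuousLinearEquiv (by simp)).bijective

/-- The radial projection is constant on rays. -/
theorem fderiv_div_norm {r : ℝ} (hr : 0 < r) (s : Circle) (c : ℝ) :
    fderiv ℝ (fun z : ℂ => z / (‖z‖ : ℂ)) (r * s) (c * s) = 0 := by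
  have hz : (r : ℂ) * s ≠ 0 := mul_ne_zero (by exact_mod_cast hr.ne') (Circle.coe_ne_zero _)
  have h4 : (‖(r : ℂ) * s‖ : ℂ) ≠ 0 := by exact_mod_cast norm_ne_zero_iff.2 hz
  have hd : DifferentiableAt ℝ (fun z : ℂ => z / (‖z‖ : ℂ)) (r * s) := by
    simp only [div_eq_mul_inv]
    exact differentiableAt_id.mul (DifferentiableAt.inv
      (Complex.ofRealCLM.differentiableAt.comp _ (differentiableAt_id.norm ℝ hz)) h4)
  have hcurve : HasDerivAt (fun t : ℝ => ((r + t * c : ℝ) : ℂ) * s) ((c : ℂ) * s) 0 := by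
    have h0 : HasDerivAt (fun t : ℝ => r + t * c) (1 * c) 0 :=
      ((hasDerivAt_id (0 : ℝ)).mul_const c).const_add r
    rw [one_mul] at h0
    exact h0.ofReal_comp.mul_const _
  have hd' : HasFDerivAt (fun z : ℂ => z / (‖z‖ : ℂ))
      (fderiv ℝ (fun z : ℂ => z / (‖z‖ : ℂ)) (r * s)) (((r + (0 : ℝ) * c : ℝ) : ℂ) * s) := by
    rw [zero_mul, add_zero]
    exact hd.hasFDerivAt
  have h1 := HasFDerivAt.comp_hasDerivAt (f := fun t : ℝ => ((r + t * c : ℝ) : ℂ) * s) (0 : ℝ)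
    hd' hcurve
  have h2 : (fun z : ℂ => z / (‖z‖ : ℂ)) ∘ (fun t : ℝ => ((r + t * c : ℝ) : ℂ) * s) =ᶠ[𝓝 0]
      fun _ => (s : ℂ) := by
    have hc : ContinuousAt (fun t : ℝ => r + t * c) 0 := by fun_prop
    have hp : ∀ᶠ t : ℝ in 𝓝 0, 0 < r + t * c := hc.eventually (lt_mem_nhds (by simpa using hr))
    filter_upwards [hp] with t ht
    have ht' : ((r + t * c : ℝ) : ℂ) ≠ 0 := by exact_mod_cast ht.ne'
    simp only [Function.comp_apply]
    rw [norm_mul, Circle.norm_coe, mul_one, Complex.norm_real, Real.norm_of_nonneg ht.le,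
      mul_div_cancel_left₀ _ ht']
  exact (h1.congr_of_eventuallyEq h2.symm).unique (hasDerivAt_const _ _)

end Differential

theorem eventually_norm_fst_lt {B : Type*} [TopologicalSpace B] {z : ℂ} (hz : ‖z‖ < 1) (b : B) :
    ∀ᶠ p : ℂ × B in 𝓝 (z, b), ‖p.1‖ < 1 :=
  (show ContinuousAt (fun p : ℂ × B => ‖p.1‖) (z, b) by fun_prop).eventually (gt_mem_nhds hz)

/-! ### The differential of the covering, its pages and its binding. -/

namespace OpenBook

variable {n : ℕ} {N B : Type u}
  [TopologicalSpace N] [ChartedSpace (EuclideanSpace ℝ (Fin (2 * (n + 1) + 1))) N]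
  [TopologicalSpace B] [ChartedSpace (EuclideanSpace ℝ (Fin (2 * n + 1))) B]
  {ob : OpenBook n N B} {k : ℕ}

theorem contMDiff_incl : ContMDiff (𝓡 (2 * n + 1)) (𝓡 (2 * (n + 1) + 1)) ∞ ob.incl := by
  intro b
  exact ContMDiffAt.comp (g := ob.tube) (f := fun b : B => ((0 : ℂ), b)) b
    (contMDiffAt_tube (by simp) b) (contMDiffAt_const.prodMk contMDiffAt_id)

variable [NeZero k] [CompactSpace B] [T2Space N] [IsManifold (𝓡 (2 * (n + 1) + 1)) ∞ N]

open Cover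

/-- The form `f^*α + εγ` and `α` have the same restriction to the binding. -/
theorem pullback_incl_cover (α : OneForm (2 * (n + 1) + 1) N) (κ : ob.Cover k → ℝ) (ε : ℝ) :
    (OneForm.pullback (ob.coverBook k).incl
      (fun m => (OneForm.pullback pr α : OneForm (2 * (n + 1) + 1) (ob.Cover k)) m +
        ε • rotForm κ m) : OneForm (2 * n + 1) B) = OneForm.pullback ob.incl α := by
  funext b
  have h0 : ((ob.coverBook k).incl b).rt = 0 := rt_coverTube (by simp) b
  have h1 : OneForm.val (fun m => (OneForm.pullback pr α :
      OneForm (2 * (n + 1) + 1) (ob.Cover k)) m + ε • rotForm κ m) ((ob.coverBook k).incl b) =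
      (OneForm.pullback pr α : OneForm (2 * (n + 1) + 1) (ob.Cover k)).val
        ((ob.coverBook k).incl b) := by
    have h2 : (rotForm κ).val ((ob.coverBook k).incl b) = 0 := val_rotForm_of_rt_eq_zero κ h0
    change (OneForm.pullback pr α : OneForm (2 * (n + 1) + 1) (ob.Cover k)).val _ +
      ε • (rotForm κ).val _ = _
    rw [h2, smul_zero, add_zero]
  have h3 : (fun b => ((ob.coverBook k).incl b).pr) = ob.incl := funext pr_incl_coverBook
  have key : OneForm.val (OneForm.pullback (ob.coverBook k).incl
      (fun m => (OneForm.pullback pr α : OneForm (2 * (n + 1) + 1) (ob.Cover k)) m +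
        ε • rotForm κ m) : OneForm (2 * n + 1) B) b =
      (OneForm.pullback ob.incl α : OneForm (2 * n + 1) B).val b := by
    rw [val_pullback, val_pullback, h1, val_pullback, ContinuousLinearMap.comp_assoc,
      ← mfd_comp (contMDiff_pr.contMDiffAt.mdifferentiableAt (by simp))
        (contMDiff_incl.contMDiffAt.mdifferentiableAt (by simp)), h3, pr_incl_coverBook]
  exact key

/-- The relation `angle_pow` is differentiated; since `s ↦ sᵏ` is a local diffeomorphism, `df`
matches the tangent spaces of the pages. -/
theorem mfd_angle_eq_zero_iff {m : ob.Cover k} (hm : m.pr ∉ ob.binding)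
    (u : EuclideanSpace ℝ (Fin (2 * (n + 1) + 1))) :
    mfd (𝓡 (2 * (n + 1) + 1)) (𝓡 1) (angle : ob.Cover k → Circle) m u = 0 ↔
      mfd (𝓡 (2 * (n + 1) + 1)) (𝓡 1) ob.θ m.pr
        (mfd (𝓡 (2 * (n + 1) + 1)) (𝓡 (2 * (n + 1) + 1)) pr m u) = 0 := by
  have hp := isLocalDiffeomorphAt_circle_pow (k := k) m.angle
  have h1 : (fun m : ob.Cover k => m.angle ^ k) =ᶠ[𝓝 m] fun m => ob.θ m.pr := by
    filter_upwards [(isClosed_binding.isOpen_compl.preimage continuous_pr).mem_nhds hm] with m' hm'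
    exact angle_pow hm'
  have h2 := mfd_congr (I := 𝓡 (2 * (n + 1) + 1)) (J := 𝓡 1) h1
  rw [mfd_comp (g := fun s : Circle => s ^ k) (hp.contMDiffAt.mdifferentiableAt (by simp))
    ((contMDiffAt_angle hm).mdifferentiableAt (by simp)),
    mfd_comp ((θ_contMDiffAt hm).mdifferentiableAt (by simp))
      (contMDiff_pr.contMDiffAt.mdifferentiableAt (by simp))] at h2
  have h3 := congrArg (fun L => L u) h2
  simp only [ContinuousLinearMap.comp_apply] at h3
  rw [← h3]
  exact (map_eq_zero_iff _ (mfd_bijective hp).1).symm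

theorem mfd_coe_angle {m : ob.Cover k} (hm : m.pr ∉ ob.binding)
    {u : EuclideanSpace ℝ (Fin (2 * (n + 1) + 1))}
    (hu : mfd (𝓡 (2 * (n + 1) + 1)) (𝓡 1) (angle : ob.Cover k → Circle) m u = 0) :
    mfd (𝓡 (2 * (n + 1) + 1)) 𝓘(ℝ, ℂ) (fun m : ob.Cover k => (m.angle : ℂ)) m u = 0 := by
  rw [mfd_comp (g := fun s : Circle => (s : ℂ))
    (contMDiff_coe_circle.contMDiffAt.mdifferentiableAt (by simp))
    ((contMDiffAt_angle hm).mdifferentiableAt (by simp)), ContinuousLinearMap.comp_apply, hu, map_zero]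

theorem contMDiffAt_coverTube {z : ℂ} (hz : ‖z‖ < 1) (b : B) :
    ContMDiffAt (𝓘(ℝ, ℂ).prod (𝓡 (2 * n + 1))) (𝓡 (2 * (n + 1) + 1)) ∞ (coverTube ob k) (z, b) :=
  contMDiffAt_tube (ob := ob.coverBook k) hz b

/-- The differential of the covering in the neighbourhoods of the bindings. -/
theorem mfd_pr_coverTube {z : ℂ} (hz : ‖z‖ < 1) (b : B) (w : ℂ)
    (e : EuclideanSpace ℝ (Fin (2 * n + 1))) :
    mfd (𝓡 (2 * (n + 1) + 1)) (𝓡 (2 * (n + 1) + 1)) pr (coverTube ob k (z, b))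
        (mfd (𝓘(ℝ, ℂ).prod (𝓡 (2 * n + 1))) (𝓡 (2 * (n + 1) + 1)) (coverTube ob k) (z, b) (w, e)) =
      mfd (𝓘(ℝ, ℂ).prod (𝓡 (2 * n + 1))) (𝓡 (2 * (n + 1) + 1)) ob.tube (planeMap k z, b)
        (fderiv ℝ (planeMap k) z w, e) := by
  have h1 : (fun p => (coverTube ob k p).pr) =ᶠ[𝓝 (z, b)]
      fun p => ob.tube (Prod.map (planeMap k) id p) := by
    filter_upwards [eventually_norm_fst_lt hz b] with p hp
    exact pr_coverTube hp p.2
  have h2 := mfd_congr (I := 𝓘(ℝ, ℂ).prod (𝓡 (2 * n + 1))) (J := 𝓡 (2 * (n + 1) + 1)) h1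
  have hS : MDifferentiableAt 𝓘(ℝ, ℂ) 𝓘(ℝ, ℂ) (planeMap k) z :=
    ((contDiff_planeMap NeZero.one_le).differentiable (by simp) z).mdifferentiableAt
  have hid : MDifferentiableAt (𝓡 (2 * n + 1)) (𝓡 (2 * n + 1)) (id : B → B) b := mdifferentiableAt_id
  have hP : MDifferentiableAt (𝓘(ℝ, ℂ).prod (𝓡 (2 * n + 1))) (𝓘(ℝ, ℂ).prod (𝓡 (2 * n + 1)))
      (Prod.map (planeMap k) (id : B → B)) (z, b) := hS.prodMap hid
  have hPd : mfd (𝓘(ℝ, ℂ).prod (𝓡 (2 * n + 1))) (𝓘(ℝ, ℂ).prod (𝓡 (2 * n + 1)))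
      (Prod.map (planeMap k) (id : B → B)) (z, b) (w, e) = (fderiv ℝ (planeMap k) z w, e) := by
    have := mfderiv_prodMap (p := (z, b)) hS hid
    unfold mfd
    rw [this, mfderiv_id, mfderiv_eq_fderiv]
    rfl
  rw [mfd_comp (contMDiff_pr.contMDiffAt.mdifferentiableAt (by simp))
    ((contMDiffAt_coverTube hz b).mdifferentiableAt (by simp)),
    mfd_comp (g := ob.tube) (f := Prod.map (planeMap k) (id : B → B))
      ((contMDiffAt_tube (norm_planeMap_lt_one hz) b).mdifferentiableAt
      (by simp)) hP] at h2
  have h3 := congrArg (fun L => L ((w, e) : ℂ × EuclideanSpace ℝ (Fin (2 * n + 1)))) h2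
  simp only [ContinuousLinearMap.comp_apply] at h3
  rw [hPd] at h3
  exact h3

/-- Radial vectors and vectors along the binding are tangent to the pages. -/
theorem mfd_coe_angle_coverTube {r : ℝ} (hr : 0 < r) (hr1 : r < 1) (s : Circle) (b : B) (c : ℝ)
    (e : EuclideanSpace ℝ (Fin (2 * n + 1))) :
    mfd (𝓡 (2 * (n + 1) + 1)) 𝓘(ℝ, ℂ) (fun m : ob.Cover k => (m.angle : ℂ))
      (coverTube ob k ((r : ℂ) * (s : ℂ), b))
        (mfd (𝓘(ℝ, ℂ).prod (𝓡 (2 * n + 1))) (𝓡 (2 * (n + 1) + 1)) (coverTube ob k)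
          ((r : ℂ) * (s : ℂ), b) ((c : ℂ) * s, e)) = 0 := by
  have hz0 : (r : ℂ) * s ≠ 0 := mul_ne_zero (by exact_mod_cast hr.ne') (Circle.coe_ne_zero _)
  have hz : ‖(r : ℂ) * s‖ < 1 := by
    rwa [norm_mul, Circle.norm_coe, mul_one, Complex.norm_real, Real.norm_of_nonneg hr.le]
  have hm : (coverTube ob k ((r : ℂ) * (s : ℂ), b)).pr ∉ ob.binding := by
    rw [← rt_eq_zero_iff, rt_coverTube hz]
    exact hz0
  have h1 : (fun p => ((coverTube ob k p).angle : ℂ)) =ᶠ[𝓝 ((r : ℂ) * (s : ℂ), b)]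
      fun p => p.1 / (‖p.1‖ : ℂ) := by
    filter_upwards [eventually_norm_fst_lt hz b, continuous_fst.continuousAt.eventually_ne hz0]
      with p hp hp0
    exact angle_coverTube hp0 hp p.2
  have h2 := mfd_congr (I := 𝓘(ℝ, ℂ).prod (𝓡 (2 * n + 1))) (J := 𝓘(ℝ, ℂ)) h1
  have h4 : (‖(r : ℂ) * s‖ : ℂ) ≠ 0 := by exact_mod_cast norm_ne_zero_iff.2 hz0
  have hd : DifferentiableAt ℝ (fun z : ℂ => z / (‖z‖ : ℂ)) (r * s) := by
    simp only [div_eq_mul_inv]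
    exact differentiableAt_id.mul (DifferentiableAt.inv
      (Complex.ofRealCLM.differentiableAt.comp _ (differentiableAt_id.norm ℝ hz0)) h4)
  rw [mfd_comp (g := fun m : ob.Cover k => (m.angle : ℂ))
    ((contMDiff_coe_circle.contMDiffAt.comp _ (contMDiffAt_angle hm)).mdifferentiableAt (by simp))
    ((contMDiffAt_coverTube hz b).mdifferentiableAt (by simp)),
    mfd_comp (g := fun z : ℂ => z / (‖z‖ : ℂ)) (f := Prod.fst) hd.mdifferentiableAt
      mdifferentiableAt_fst] at h2
  have h3 := congrArg (fun L => L (((c : ℂ) * s, e) : ℂ × EuclideanSpace ℝ (Fin (2 * n + 1)))) h2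
  simp only [ContinuousLinearMap.comp_apply] at h3
  have h5 : mfd (𝓘(ℝ, ℂ).prod (𝓡 (2 * n + 1))) 𝓘(ℝ, ℂ) (Prod.fst : ℂ × B → ℂ)
      ((r : ℂ) * (s : ℂ), b) ((c : ℂ) * s, e) = (c : ℂ) * s := by
    unfold mfd
    rw [mfderiv_fst]
    rfl
  rw [h5, mfd_eq_fderiv, fderiv_div_norm hr] at h3
  exact h3

end OpenBook

/-! ### Lifting adapted forms. -/

namespace OpenBook

variable {n : ℕ} {N B : Type u}
  [TopologicalSpace N] [ChartedSpace (EuclideanSpace ℝ (Fin (2 * (n + 1) + 1))) N]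
  [TopologicalSpace B] [ChartedSpace (EuclideanSpace ℝ (Fin (2 * n + 1))) B]
  {ob : OpenBook n N B} {k : ℕ}
  [NeZero k] [CompactSpace B] [T2Space N] [IsManifold (𝓡 (2 * (n + 1) + 1)) ∞ N]

open Cover

/-- The exterior derivative of `f^*α + εγ`. -/
theorem extDBil_cover {α : OneForm (2 * (n + 1) + 1) N} (hα : α.Smooth) {κ : ob.Cover k → ℝ}
    (hκ : ∀ m : ob.Cover k, m.pr ∈ ob.tube.target →
      ContMDiffAt (𝓡 (2 * (n + 1) + 1)) 𝓘(ℝ, ℝ) ∞ κ m) (ε : ℝ) (m : ob.Cover k)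
    (u v : EuclideanSpace ℝ (Fin (2 * (n + 1) + 1))) :
    OneForm.extDBil (fun m => (OneForm.pullback pr α : OneForm (2 * (n + 1) + 1) (ob.Cover k)) m +
        ε • rotForm κ m) m u v =
      α.extDBil m.pr (mfd (𝓡 (2 * (n + 1) + 1)) (𝓡 (2 * (n + 1) + 1)) pr m u)
        (mfd (𝓡 (2 * (n + 1) + 1)) (𝓡 (2 * (n + 1) + 1)) pr m v) + ε * (rotForm κ).extDBil m u v := by
  rw [extDBil_add_smul (hα.pullback contMDiff_pr) (smooth_rotForm hκ),
    extDBil_pullback hα contMDiff_pr.contMDiffAt]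

/-- If `α` is adapted to the open book, then `f^*α + εγ` is adapted to the open book of the covering
as soon as it is a contact form. -/
theorem IsAdapted.cover {α : OneForm (2 * (n + 1) + 1) N} (h : ob.IsAdapted α)
    {κ : ob.Cover k → ℝ} (hκ : ∀ m : ob.Cover k, m.pr ∈ ob.tube.target →
      ContMDiffAt (𝓡 (2 * (n + 1) + 1)) 𝓘(ℝ, ℝ) ∞ κ m) {ε : ℝ}
    (hc : IsContactForm (n + 1) (fun m =>
      (OneForm.pullback pr α : OneForm (2 * (n + 1) + 1) (ob.Cover k)) m + ε • rotForm κ m)) :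
    (ob.coverBook k).IsAdapted (fun m =>
      (OneForm.pullback pr α : OneForm (2 * (n + 1) + 1) (ob.Cover k)) m + ε • rotForm κ m) where
  contact := hc
  binding_contact := by
    rw [pullback_incl_cover]
    exact h.binding_contact
  page_symplectic m hm u hu hu0 := by
    rw [binding_coverBook] at hm
    have hb := mfd_bijective (isLocalDiffeomorphAt_pr hm)
    have hu' := (mfd_angle_eq_zero_iff hm u).1 hu
    have hu0' : mfd (𝓡 (2 * (n + 1) + 1)) (𝓡 (2 * (n + 1) + 1)) pr m u ≠ 0 := fun h0 =>
      hu0 (hb.1 (h0.trans (map_zero _).symm))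
    obtain ⟨v₀, hv₀, hne⟩ := h.page_symplectic m.pr hm _ hu' hu0'
    obtain ⟨v, rfl⟩ := hb.2 v₀
    have hv := (mfd_angle_eq_zero_iff hm v).2 hv₀
    refine ⟨v, hv, ?_⟩
    -- On pages `dγ` vanishes, so the exterior derivative of the perturbed form is there the
    -- pull-back of `dα`.
    have hd := extDBil_cover h.contact.smooth hκ ε m u v
    rw [extDBil_rotForm_page hκ hm (mfd_coe_angle hm hu) (mfd_coe_angle hm hv), mul_zero,
      add_zero] at hd
    exact fun h0 => hne (hd.symm.trans h0)
  boundary_orientation b e he s r hr hr1 := by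
    rw [pullback_incl_cover] at he
    have hz0 : (r : ℂ) * s ≠ 0 := mul_ne_zero (by exact_mod_cast hr.ne') (Circle.coe_ne_zero _)
    have hn : ‖(r : ℂ) * s‖ = r := by
      rw [norm_mul, Circle.norm_coe, mul_one, Complex.norm_real, Real.norm_of_nonneg hr.le]
    have hz : ‖(r : ℂ) * s‖ < 1 := by rwa [hn]
    have hm : (coverTube ob k ((r : ℂ) * (s : ℂ), b)).pr ∉ ob.binding := by
      rw [← rt_eq_zero_iff, rt_coverTube hz]
      exact hz0
    have hS : planeMap k ((r : ℂ) * s) = (profile k r : ℂ) * ((s ^ k : Circle) : ℂ) := by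
      rw [planeMap_polar hr.le NeZero.one_le, Circle.coe_pow]
    have hg0 := profile_pos (k := k) NeZero.one_le hr
    have hg1 := (profile_lt_one_iff (k := k) NeZero.one_le hr.le).2 hr1
    have hbo := h.boundary_orientation b e he (s ^ k) (profile k r) hg0 hg1
    -- The outward radial vector at radius `r` goes to the one at radius `g(r)`, scaled by `g'(r) >
    -- 0`. Thus the frame is pushed forward to a frame with the same orientation.
    have hder : fderiv ℝ (planeMap k) ((r : ℂ) * s) (-(s : ℂ)) =
        deriv (profile k) r • (-((s ^ k : Circle) : ℂ)) := by
      have hr' : (r : ℂ) ≠ 0 := by exact_mod_cast hr.ne'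
      have e1 : -(s : ℂ) = ((r : ℂ) * s) * ((-r⁻¹ : ℝ) : ℂ) := by
        push_cast
        field_simp
      have e2 : (r : ℂ) * s / (r : ℂ) = s := by field_simp
      rw [e1, fderiv_planeMap_mul hz0, hn, e2, Complex.ofReal_re, Complex.ofReal_im, Circle.coe_pow,
        Complex.real_smul]
      have e3 : deriv (profile k) r * (r * -r⁻¹) = -deriv (profile k) r := by field_simp
      rw [e3]
      push_cast
      ring
    set X₀ : EuclideanSpace ℝ (Fin (2 * (n + 1) + 1)) :=
      mfd (𝓘(ℝ, ℂ).prod (𝓡 (2 * n + 1))) (𝓡 (2 * (n + 1) + 1)) ob.tube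
        ((profile k r : ℂ) * ((s ^ k : Circle) : ℂ), b)
        ((-((s ^ k : Circle) : ℂ), 0) : ℂ × EuclideanSpace ℝ (Fin (2 * n + 1))) with hX₀
    set Y : Fin (2 * n + 1) → EuclideanSpace ℝ (Fin (2 * (n + 1) + 1)) := fun i =>
      mfd (𝓘(ℝ, ℂ).prod (𝓡 (2 * n + 1))) (𝓡 (2 * (n + 1) + 1)) ob.tube
        ((profile k r : ℂ) * ((s ^ k : Circle) : ℂ), b)
        ((0, e i) : ℂ × EuclideanSpace ℝ (Fin (2 * n + 1))) with hY
    have hbo' : 0 < pow2Form (n + 1) (fun x y => α.extDBil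
        (ob.tube ((profile k r : ℂ) * ((s ^ k : Circle) : ℂ), b)) x y)
        (Fin.cons X₀ Y : Fin (2 * n + 1 + 1) → _) := hbo
    have hpos := mul_pos (deriv_profile_pos (k := k) NeZero.one_le hr) hbo'
    rw [← pow2Form_smul_head] at hpos
    refine hpos.trans_eq ?_
    set X' : EuclideanSpace ℝ (Fin (2 * (n + 1) + 1)) :=
      mfd (𝓘(ℝ, ℂ).prod (𝓡 (2 * n + 1))) (𝓡 (2 * (n + 1) + 1)) (coverTube ob k)
        ((r : ℂ) * (s : ℂ), b) ((-(s : ℂ), 0) : ℂ × EuclideanSpace ℝ (Fin (2 * n + 1))) with hX'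
    set Y' : Fin (2 * n + 1) → EuclideanSpace ℝ (Fin (2 * (n + 1) + 1)) := fun i =>
      mfd (𝓘(ℝ, ℂ).prod (𝓡 (2 * n + 1))) (𝓡 (2 * (n + 1) + 1)) (coverTube ob k)
        ((r : ℂ) * (s : ℂ), b) ((0, e i) : ℂ × EuclideanSpace ℝ (Fin (2 * n + 1))) with hY'
    have hpage : ∀ i : Fin (2 * n + 1 + 1), mfd (𝓡 (2 * (n + 1) + 1)) 𝓘(ℝ, ℂ)
        (fun m : ob.Cover k => (m.angle : ℂ)) (coverTube ob k ((r : ℂ) * (s : ℂ), b))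
        ((Fin.cons X' Y' : Fin (2 * n + 1 + 1) → EuclideanSpace ℝ (Fin (2 * (n + 1) + 1))) i) = 0 := by
      intro i
      refine Fin.cases ?_ (fun i => ?_) i
      · have := mfd_coe_angle_coverTube (ob := ob) (k := k) hr hr1 s b (-1) 0
        simpa [hX'] using this
      · have := mfd_coe_angle_coverTube (ob := ob) (k := k) hr hr1 s b 0 (e i)
        simpa [hY'] using this
    have hpush : ∀ i : Fin (2 * n + 1 + 1), mfd (𝓡 (2 * (n + 1) + 1)) (𝓡 (2 * (n + 1) + 1)) pr
        (coverTube ob k ((r : ℂ) * (s : ℂ), b))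
        ((Fin.cons X' Y' : Fin (2 * n + 1 + 1) → EuclideanSpace ℝ (Fin (2 * (n + 1) + 1))) i) =
        (Fin.cons (deriv (profile k) r • X₀) Y :
          Fin (2 * n + 1 + 1) → EuclideanSpace ℝ (Fin (2 * (n + 1) + 1))) i := by
      intro i
      refine Fin.cases ?_ (fun i => ?_) i
      · rw [Fin.cons_zero, Fin.cons_zero, hX', mfd_pr_coverTube hz, hS, hder, hX₀, ← map_smul,
          Prod.smul_mk, smul_zero]
      · rw [Fin.cons_succ, Fin.cons_succ]
        refine (mfd_pr_coverTube hz b 0 (e i)).trans ?_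
        rw [hS, map_zero]
    refine (pow2Form_congr (V := EuclideanSpace ℝ (Fin (2 * (n + 1) + 1))) fun i j => ?_).symm
    refine (extDBil_cover h.contact.smooth hκ ε (coverTube ob k ((r : ℂ) * (s : ℂ), b)) _ _).trans ?_
    have p1 := hpage i
    have p2 := hpage j
    have q1 := hpush i
    have q2 := hpush j
    refine (congrArg₂ (· + ·) ?_ (congrArg (ε * ·) (extDBil_rotForm_page hκ hm p1 p2))).trans
      ((congrArg _ (mul_zero ε)).trans (add_zero _))
    have hpt : (coverTube ob k ((r : ℂ) * (s : ℂ), b)).pr =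
        ob.tube ((profile k r : ℂ) * ((s ^ k : Circle) : ℂ), b) := by
      rw [pr_coverTube hz, hS]
    rw [← hpt]
    exact congrArg₂ (fun x y => α.extDBil (coverTube ob k ((r : ℂ) * (s : ℂ), b)).pr x y) q1 q2

end OpenBook

/-! ### Contact forms with the same kernel -/

section Conformal

variable {n : ℕ} {Z : Type*} [TopologicalSpace Z]
  [ChartedSpace (EuclideanSpace ℝ (Fin (2 * n + 1))) Z]

theorem IsContactForm.exists_val_ne_zero {α : OneForm (2 * n + 1) Z} (hα : IsContactForm n α) (x : Z) :
    ∃ v, α.val x v ≠ 0 := by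
  by_contra! h
  obtain ⟨v, hv⟩ := hα.vol_ne_zero x
  refine hv ?_
  have hzero : ∀ u, α x u = 0 := h
  simp [contactVol, wedgePow, hzero]

/-- Contact forms with the same kernel differ by a smooth conformal factor. -/
theorem exists_conformal_factor [IsManifold (𝓡 (2 * n + 1)) ∞ Z] {α α' : OneForm (2 * n + 1) Z}
    (hα : IsContactForm n α) (hα' : IsContactForm n α')
    (hker : ∀ (x : Z) (v : TangentSpace (𝓡 (2 * n + 1)) x), α' x v = 0 ↔ α x v = 0) :
    ∃ h : Z → ℝ, ContMDiff (𝓡 (2 * n + 1)) 𝓘(ℝ, ℝ) ∞ h ∧ (∀ x, h x ≠ 0) ∧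
      ∀ x, α x = h x • α' x := by
  have hker' : ∀ x v, α'.val x v = 0 ↔ α.val x v = 0 := hker
  have hex : ∀ x, ∃ c : ℝ, c ≠ 0 ∧ ∀ u, α.val x u = c * α'.val x u := by
    intro x
    obtain ⟨v, hv⟩ := hα'.exists_val_ne_zero x
    refine ⟨α.val x v / α'.val x v, div_ne_zero (fun h => hv ((hker' x v).2 h)) hv, fun u => ?_⟩
    -- Subtracting a multiple of `v` moves `u` into the common kernel, which fixes the ratio of the
    -- two forms.
    have h1 : α'.val x (u - (α'.val x u / α'.val x v) • v) = 0 := by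
      rw [map_sub, map_smul, smul_eq_mul]
      field_simp
      ring
    have h2 := (hker' x _).1 h1
    rw [map_sub, map_smul, smul_eq_mul] at h2
    field_simp at h2 ⊢
    linarith
  choose h h0 hh using hex
  refine ⟨h, ?_, h0, fun x => ContinuousLinearMap.ext (hh x)⟩
  intro x₀
  obtain ⟨v, hv⟩ := hα'.exists_val_ne_zero x₀
  have hx := mem_extChartAt_target (I := 𝓡 (2 * n + 1)) x₀
  have ha := (hα.smooth.contDiffAt_inChart x₀ hx).clm_apply (contDiffAt_const (c := v))
  have ha' := (hα'.smooth.contDiffAt_inChart x₀ hx).clm_apply (contDiffAt_const (c := v))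
  have hne : OneForm.inChart α' x₀ (extChartAt (𝓡 (2 * n + 1)) x₀ x₀) v ≠ 0 := by
    rw [inChart_eq_pullVec, pullVec, mfd_extChartAt_symm_self, extChartAt_to_inv]
    exact hv
  have hdiv := ha.div ha' hne
  have hcomp := hdiv.contMDiffAt.comp x₀ (contMDiffAt_extChartAt (I := 𝓡 (2 * n + 1)) (x := x₀))
  refine hcomp.congr_of_eventuallyEq ?_
  have hne' : ∀ᶠ x in 𝓝 x₀, OneForm.inChart α' x₀ (extChartAt (𝓡 (2 * n + 1)) x₀ x) v ≠ 0 :=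
    ContinuousAt.eventually_ne (ContinuousAt.comp (f := extChartAt (𝓡 (2 * n + 1)) x₀)
      (g := fun y => OneForm.inChart α' x₀ y v) ha'.continuousAt (continuousAt_extChartAt x₀)) hne
  filter_upwards [hne', extChartAt_source_mem_nhds (I := 𝓡 (2 * n + 1)) x₀] with x hx1 hx2
  have hxx : (extChartAt (𝓡 (2 * n + 1)) x₀).symm (extChartAt (𝓡 (2 * n + 1)) x₀ x) = x :=
    (extChartAt (𝓡 (2 * n + 1)) x₀).left_inv hx2
  have hval : OneForm.inChart α x₀ (extChartAt (𝓡 (2 * n + 1)) x₀ x) v =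
      h x * OneForm.inChart α' x₀ (extChartAt (𝓡 (2 * n + 1)) x₀ x) v := by
    rw [inChart_eq_pullVec, inChart_eq_pullVec]
    unfold pullVec
    rw [hxx]
    exact hh x _
  change h x = OneForm.inChart α x₀ (extChartAt (𝓡 (2 * n + 1)) x₀ x) v /
    OneForm.inChart α' x₀ (extChartAt (𝓡 (2 * n + 1)) x₀ x) v
  rw [hval]
  field_simp

end Conformal

/-! ### Frames near the binding -/

section Frame

/-- The frame `∂_x, ∂_y, e` of `ℂ × E`. -/
def diskFrame {E : Type*} [Zero E] {m : ℕ} (e : Fin m → E) : Fin (m + 1 + 1) → ℂ × E :=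
  Fin.cons (1, 0) (Fin.cons (Complex.I, 0) fun i => (0, e i))

theorem linearIndependent_diskFrame {E : Type*} [AddCommGroup E] [Module ℝ E] {m : ℕ}
    {e : Fin m → E} (he : LinearIndependent ℝ e) : LinearIndependent ℝ (diskFrame e) := by
  unfold diskFrame
  rw [linearIndependent_finCons, linearIndependent_finCons]
  refine ⟨⟨?_, ?_⟩, ?_⟩
  · exact he.map' (LinearMap.inr ℝ ℂ E) (LinearMap.ker_eq_bot.2 LinearMap.inr_injective)
  · intro h
    have hle : Submodule.span ℝ (range fun i => ((0 : ℂ), e i)) ≤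
        LinearMap.ker (LinearMap.fst ℝ ℂ E) := by
      rw [Submodule.span_le]
      rintro _ ⟨i, rfl⟩
      simp
    simpa using hle h
  · intro h
    have hle : Submodule.span ℝ (range (Fin.cons (Complex.I, 0) fun i => ((0 : ℂ), e i))) ≤
        LinearMap.ker (Complex.reLm.comp (LinearMap.fst ℝ ℂ E)) := by
      rw [Submodule.span_le]
      rintro _ ⟨i, rfl⟩
      refine Fin.cases ?_ (fun i => ?_) i <;> simp
    simpa using hle h

theorem map_diskFrame {E F : Type*} [AddCommGroup E] [Module ℝ E] [AddCommGroup F] [Module ℝ F]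
    {m : ℕ} (L : ℂ × E → F) (e : Fin m → E) : (fun i => L (diskFrame e i)) =
      (Fin.cons (L (1, 0)) (Fin.cons (L (Complex.I, 0)) fun i => L (0, e i)) :
        Fin (m + 1 + 1) → F) := by
  funext i
  refine Fin.cases rfl (fun i => ?_) i
  exact Fin.cases rfl (fun i => rfl) i

end Frame

/-! ### Parametrizing a neighbourhood of the binding. -/

namespace OpenBook

variable {n : ℕ} {N B : Type u}
  [TopologicalSpace N] [ChartedSpace (EuclideanSpace ℝ (Fin (2 * (n + 1) + 1))) N]
  [TopologicalSpace B] [ChartedSpace (EuclideanSpace ℝ (Fin (2 * n + 1))) B]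
  {ob : OpenBook n N B}

theorem isLocalDiffeomorphAt_tube {z : ℂ} (hz : ‖z‖ < 1) (b : B) :
    IsLocalDiffeomorphAt (𝓘(ℝ, ℂ).prod (𝓡 (2 * n + 1))) (𝓡 (2 * (n + 1) + 1)) ∞ ob.tube (z, b) :=
  PartialDiffeomorph.isLocalDiffeomorphAt _ _ _ ob.tube (mem_tube_source hz b)

/-- The inverse of the chart `tubeChart`. -/
def tubeParam (ob : OpenBook n N B) (b₀ : B) (p : ℂ × EuclideanSpace ℝ (Fin (2 * n + 1))) : N :=
  ob.tube (p.1, (extChartAt (𝓡 (2 * n + 1)) b₀).symm p.2)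

theorem mfd_incl (b : B) (e : EuclideanSpace ℝ (Fin (2 * n + 1))) :
    mfd (𝓡 (2 * n + 1)) (𝓡 (2 * (n + 1) + 1)) ob.incl b e =
      mfd (𝓘(ℝ, ℂ).prod (𝓡 (2 * n + 1))) (𝓡 (2 * (n + 1) + 1)) ob.tube (0, b) (0, e) := by
  have h1 : mfd (𝓡 (2 * n + 1)) (𝓡 (2 * (n + 1) + 1)) ob.incl b =
      (mfd (𝓘(ℝ, ℂ).prod (𝓡 (2 * n + 1))) (𝓡 (2 * (n + 1) + 1)) ob.tube (0, b)).comp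
        (mfd (𝓡 (2 * n + 1)) (𝓘(ℝ, ℂ).prod (𝓡 (2 * n + 1))) (fun b : B => ((0 : ℂ), b)) b) :=
    mfd_comp (g := ob.tube) (f := fun b : B => ((0 : ℂ), b))
      ((contMDiffAt_tube (by simp) b).mdifferentiableAt (by simp))
      (mdifferentiableAt_const.prodMk mdifferentiableAt_id)
  have h2 : mfd (𝓡 (2 * n + 1)) (𝓘(ℝ, ℂ).prod (𝓡 (2 * n + 1))) (fun b : B => ((0 : ℂ), b)) b e =
      (0, e) := by
    have hc : MDifferentiableAt (𝓡 (2 * n + 1)) 𝓘(ℝ, ℂ) (fun _ : B => (0 : ℂ)) b :=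
      mdifferentiableAt_const
    have hi : MDifferentiableAt (𝓡 (2 * n + 1)) (𝓡 (2 * n + 1)) (fun b : B => b) b :=
      mdifferentiableAt_id
    have h3 : mfd (𝓡 (2 * n + 1)) 𝓘(ℝ, ℂ) (fun _ : B => (0 : ℂ)) b = 0 := mfderiv_const
    have h4 : mfd (𝓡 (2 * n + 1)) (𝓘(ℝ, ℂ).prod (𝓡 (2 * n + 1))) (fun b : B => ((0 : ℂ), b)) b =
        (mfd (𝓡 (2 * n + 1)) 𝓘(ℝ, ℂ) (fun _ : B => (0 : ℂ)) b).prod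
          (mfd (𝓡 (2 * n + 1)) (𝓡 (2 * n + 1)) (fun b : B => b) b) := mfderiv_prodMk hc hi
    rw [h4, h3, mfd_id]
    rfl
  rw [h1, ContinuousLinearMap.comp_apply, h2]

theorem eventually_tubeParam (b₀ : B) :
    ∀ᶠ p : ℂ × EuclideanSpace ℝ (Fin (2 * n + 1)) in
      𝓝 ((0 : ℂ), extChartAt (𝓡 (2 * n + 1)) b₀ b₀),
      ‖p.1‖ < 1 / 4 ∧ p.2 ∈ (extChartAt (𝓡 (2 * n + 1)) b₀).target := by
  have h1 : ∀ᶠ p : ℂ × EuclideanSpace ℝ (Fin (2 * n + 1)) in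
      𝓝 ((0 : ℂ), extChartAt (𝓡 (2 * n + 1)) b₀ b₀), ‖p.1‖ < 1 / 4 :=
    (show ContinuousAt (fun p : ℂ × EuclideanSpace ℝ (Fin (2 * n + 1)) => ‖p.1‖) _ by
      fun_prop).eventually (gt_mem_nhds (by simp))
  exact h1.and (continuousAt_snd.eventually
    ((isOpen_extChartAt_target b₀).mem_nhds (mem_extChartAt_target b₀)))

variable [IsManifold (𝓡 (2 * n + 1)) ∞ B]

theorem contMDiffAt_tubeParam {b₀ : B} {p : ℂ × EuclideanSpace ℝ (Fin (2 * n + 1))}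
    (hp : ‖p.1‖ < 1) (hp' : p.2 ∈ (extChartAt (𝓡 (2 * n + 1)) b₀).target) :
    ContMDiffAt 𝓘(ℝ, ℂ × EuclideanSpace ℝ (Fin (2 * n + 1))) (𝓡 (2 * (n + 1) + 1)) ∞
      (ob.tubeParam b₀) p :=
  (ob.tubeChart b₀ 1 le_rfl).contMDiffOn_invFun.contMDiffAt
    ((ob.tubeChart b₀ 1 le_rfl).open_target.mem_nhds ⟨mem_ball_zero_iff.2 hp, hp'⟩)

theorem mfd_tubeParam {b₀ : B} {p : ℂ × EuclideanSpace ℝ (Fin (2 * n + 1))}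
    (hp : ‖p.1‖ < 1) (hp' : p.2 ∈ (extChartAt (𝓡 (2 * n + 1)) b₀).target)
    (w : ℂ) (e : EuclideanSpace ℝ (Fin (2 * n + 1))) :
    mfd 𝓘(ℝ, ℂ × EuclideanSpace ℝ (Fin (2 * n + 1))) (𝓡 (2 * (n + 1) + 1)) (ob.tubeParam b₀) p (w, e) =
      mfd (𝓘(ℝ, ℂ).prod (𝓡 (2 * n + 1))) (𝓡 (2 * (n + 1) + 1)) ob.tube
        (p.1, (extChartAt (𝓡 (2 * n + 1)) b₀).symm p.2)
        (w, mfd 𝓘(ℝ, EuclideanSpace ℝ (Fin (2 * n + 1))) (𝓡 (2 * n + 1))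
          (extChartAt (𝓡 (2 * n + 1)) b₀).symm p.2 e) := by
  have hf : MDifferentiableAt 𝓘(ℝ, ℂ × EuclideanSpace ℝ (Fin (2 * n + 1))) 𝓘(ℝ, ℂ)
      (fun p : ℂ × EuclideanSpace ℝ (Fin (2 * n + 1)) => p.1) p :=
    differentiableAt_fst.mdifferentiableAt
  have hs : MDifferentiableAt 𝓘(ℝ, ℂ × EuclideanSpace ℝ (Fin (2 * n + 1)))
      𝓘(ℝ, EuclideanSpace ℝ (Fin (2 * n + 1)))
      (fun p : ℂ × EuclideanSpace ℝ (Fin (2 * n + 1)) => p.2) p :=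
    differentiableAt_snd.mdifferentiableAt
  have hc := mdifferentiableAt_extChartAt_symm b₀ hp'
  have hcs : MDifferentiableAt 𝓘(ℝ, ℂ × EuclideanSpace ℝ (Fin (2 * n + 1))) (𝓡 (2 * n + 1))
      (fun p : ℂ × EuclideanSpace ℝ (Fin (2 * n + 1)) => (extChartAt (𝓡 (2 * n + 1)) b₀).symm p.2)
      p := MDifferentiableAt.comp p hc hs
  have h1 : mfd 𝓘(ℝ, ℂ × EuclideanSpace ℝ (Fin (2 * n + 1))) (𝓡 (2 * (n + 1) + 1))
      (ob.tubeParam b₀) p = (mfd (𝓘(ℝ, ℂ).prod (𝓡 (2 * n + 1))) (𝓡 (2 * (n + 1) + 1)) ob.tube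
        (p.1, (extChartAt (𝓡 (2 * n + 1)) b₀).symm p.2)).comp
        (mfd 𝓘(ℝ, ℂ × EuclideanSpace ℝ (Fin (2 * n + 1))) (𝓘(ℝ, ℂ).prod (𝓡 (2 * n + 1)))
          (fun p : ℂ × EuclideanSpace ℝ (Fin (2 * n + 1)) =>
            (p.1, (extChartAt (𝓡 (2 * n + 1)) b₀).symm p.2)) p) :=
    mfd_comp (g := ob.tube) ((contMDiffAt_tube hp _).mdifferentiableAt (by simp)) (hf.prodMk hcs)
  have h2 : mfd 𝓘(ℝ, ℂ × EuclideanSpace ℝ (Fin (2 * n + 1))) (𝓘(ℝ, ℂ).prod (𝓡 (2 * n + 1)))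
      (fun p : ℂ × EuclideanSpace ℝ (Fin (2 * n + 1)) =>
        (p.1, (extChartAt (𝓡 (2 * n + 1)) b₀).symm p.2)) p (w, e) =
      (mfd 𝓘(ℝ, ℂ × EuclideanSpace ℝ (Fin (2 * n + 1))) 𝓘(ℝ, ℂ)
        (fun p : ℂ × EuclideanSpace ℝ (Fin (2 * n + 1)) => p.1) p (w, e),
       mfd 𝓘(ℝ, ℂ × EuclideanSpace ℝ (Fin (2 * n + 1))) (𝓡 (2 * n + 1))
        (fun p : ℂ × EuclideanSpace ℝ (Fin (2 * n + 1)) =>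
          (extChartAt (𝓡 (2 * n + 1)) b₀).symm p.2) p (w, e)) := by
    unfold mfd
    rw [mfderiv_prodMk hf hcs]
    rfl
  have h3 : fderiv ℝ (fun p : ℂ × EuclideanSpace ℝ (Fin (2 * n + 1)) => p.1) p =
      ContinuousLinearMap.fst ℝ _ _ := fderiv_fst
  have h4 : fderiv ℝ (fun p : ℂ × EuclideanSpace ℝ (Fin (2 * n + 1)) => p.2) p =
      ContinuousLinearMap.snd ℝ _ _ := fderiv_snd
  rw [h1, ContinuousLinearMap.comp_apply, h2, mfd_comp hc hs, mfd_eq_fderiv, mfd_eq_fderiv, h3, h4]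
  rfl

end OpenBook

/-! ### Families of contact forms in a parametrization -/

section Family

variable {n : ℕ} {Z : Type*} [TopologicalSpace Z]
  [ChartedSpace (EuclideanSpace ℝ (Fin (2 * n + 1))) Z]
  {E : Type*} [NormedAddCommGroup E] [NormedSpace ℝ E]

theorem contDiffAt_extDVec {a : E → E →L[ℝ] ℝ} {y : E} (ha : ContDiffAt ℝ ∞ a y) (u v : E) :
    ContDiffAt ℝ ∞ (fun y => extDVec a y u v) y := by
  have h := ha.fderiv_right (m := ∞) (by simp)
  exact ((h.clm_apply contDiffAt_const).clm_apply contDiffAt_const).sub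
    ((h.clm_apply contDiffAt_const).clm_apply contDiffAt_const)

/-- `β ∧ (dβ)ⁿ` for `β = α + ε α'`, in a parametrization `p`, as a function of the parameter and
of `ε`. -/
def familyVol (α α' : OneForm (2 * n + 1) Z) (p : E → Z) (v : Fin (2 * n + 1) → E) (q : E × ℝ) : ℝ :=
  wedgePow n (fun u => pullVec α p q.1 u + q.2 * pullVec α' p q.1 u)
    (fun u u' => extDVec (pullVec α p) q.1 u u' + q.2 * extDVec (pullVec α' p) q.1 u u') v

variable [IsManifold (𝓡 (2 * n + 1)) ∞ Z] {α α' : OneForm (2 * n + 1) Z}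

theorem contDiffAt_familyVol (hα : α.Smooth) (hα' : α'.Smooth) {p : E → Z} {y : E}
    (hp : ContMDiffAt 𝓘(ℝ, E) (𝓡 (2 * n + 1)) ∞ p y) (v : Fin (2 * n + 1) → E) (ε : ℝ) :
    ContDiffAt ℝ ∞ (familyVol α α' p v) (y, ε) := by
  have h1 := hα.contDiffAt_pullVec hp
  have h2 := hα'.contDiffAt_pullVec hp
  have hf : ContDiffAt ℝ ∞ (fun q : E × ℝ => q.1) (y, ε) := contDiffAt_fst
  have hs : ContDiffAt ℝ ∞ (fun q : E × ℝ => q.2) (y, ε) := contDiffAt_snd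
  refine contDiffAt_wedgePow (fun i => ?_) (fun i j => ?_)
  · exact (ContDiffAt.comp (g := fun y => pullVec α p y (v i)) (f := Prod.fst) (y, ε)
      (h1.clm_apply contDiffAt_const) hf).add (hs.mul
        (ContDiffAt.comp (g := fun y => pullVec α' p y (v i)) (f := Prod.fst) (y, ε)
          (h2.clm_apply contDiffAt_const) hf))
  · exact (ContDiffAt.comp (g := fun y => extDVec (pullVec α p) y (v i) (v j)) (f := Prod.fst) (y, ε)
      (contDiffAt_extDVec h1 _ _) hf).add (hs.mul
        (ContDiffAt.comp (g := fun y => extDVec (pullVec α' p) y (v i) (v j)) (f := Prod.fst) (y, ε)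
          (contDiffAt_extDVec h2 _ _) hf))

/-- The volume is expressed through pull-backs to a vector space, where it depends smoothly on the
parameter and on `ε` jointly (`contDiffAt_familyVol`). -/
theorem contactVol_add_smul (hα : α.Smooth) (hα' : α'.Smooth) {p : E → Z} {y : E}
    (hp : ContMDiffAt 𝓘(ℝ, E) (𝓡 (2 * n + 1)) ∞ p y) (v : Fin (2 * n + 1) → E) (ε : ℝ) :
    contactVol n (fun x => α x + ε • α' x) (p y)
        (fun i => mfd 𝓘(ℝ, E) (𝓡 (2 * n + 1)) p y (v i)) = familyVol α α' p v (y, ε) := by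
  refine wedgePow_congr (fun i => rfl) (fun i j => ?_)
  refine (extDBil_add_smul hα hα' ε (p y) _ _).trans ?_
  rw [extDVec_pullVec hα hp, extDVec_pullVec hα' hp]

theorem contactVol_eq_familyVol (hα : α.Smooth) {p : E → Z} {y : E}
    (hp : ContMDiffAt 𝓘(ℝ, E) (𝓡 (2 * n + 1)) ∞ p y) (v : Fin (2 * n + 1) → E) :
    contactVol n α (p y) (fun i => mfd 𝓘(ℝ, E) (𝓡 (2 * n + 1)) p y (v i)) =
      familyVol α α' p v (y, 0) := by
  refine wedgePow_congr (fun i => ?_) (fun i j => ?_)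
  · change _ = pullVec α p y (v i) + 0 * _
    rw [zero_mul, add_zero]
    rfl
  · change _ = extDVec (pullVec α p) y (v i) (v j) + 0 * _
    rw [zero_mul, add_zero, extDVec_pullVec hα hp]
    rfl

theorem continuousAt_contactVol (hα : α.Smooth) {p : E → Z} {y : E}
    (hp : ∀ᶠ z in 𝓝 y, ContMDiffAt 𝓘(ℝ, E) (𝓡 (2 * n + 1)) ∞ p z) (v : Fin (2 * n + 1) → E) :
    ContinuousAt (fun y => contactVol n α (p y)
      (fun i => mfd 𝓘(ℝ, E) (𝓡 (2 * n + 1)) p y (v i))) y := by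
  have h1 : ContinuousAt (fun y => familyVol α α p v (y, 0)) y :=
    ContinuousAt.comp (g := familyVol α α p v) (f := fun y => (y, (0 : ℝ)))
      (contDiffAt_familyVol hα hα hp.self_of_nhds v 0).continuousAt (by fun_prop)
  exact h1.congr (hp.mono fun z hz => (contactVol_eq_familyVol hα hz v).symm)

/-- The contact condition is stable at points where it holds for `ε = 0`. -/
theorem exists_contactVol_ne_zero_of_ne_zero (hα : α.Smooth) (hα' : α'.Smooth) {x₀ : Z}
    (h : ∃ v, contactVol n α x₀ v ≠ 0) :
    ∃ δ > 0, ∀ᶠ x in 𝓝 x₀, ∀ ε : ℝ, 0 < ε → ε < δ →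
      ∃ v, contactVol n (fun x => α x + ε • α' x) x v ≠ 0 := by
  obtain ⟨v, hv⟩ : ∃ v : Fin (2 * n + 1) → EuclideanSpace ℝ (Fin (2 * n + 1)),
    contactVol n α x₀ v ≠ 0 := h
  have hx := mem_extChartAt_target (I := 𝓡 (2 * n + 1)) x₀
  have hp := contMDiffAt_extChartAt_symm x₀ hx
  have h0 : familyVol α α' (extChartAt (𝓡 (2 * n + 1)) x₀).symm v
      (extChartAt (𝓡 (2 * n + 1)) x₀ x₀, 0) ≠ 0 := by
    have h2 := contactVol_eq_familyVol (α' := α') hα hp v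
    rw [mfd_extChartAt_symm_self, extChartAt_to_inv] at h2
    exact h2.symm.trans_ne hv
  have h1 := (contDiffAt_familyVol hα hα' hp v 0).continuousAt.eventually_ne h0
  obtain ⟨U, hU, V, hV, hUV⟩ := mem_nhds_prod_iff.1 h1
  obtain ⟨δ, hδ, hball⟩ := Metric.mem_nhds_iff.1 hV
  refine ⟨δ, hδ, ?_⟩
  filter_upwards [(continuousAt_extChartAt (I := 𝓡 (2 * n + 1)) x₀).eventually hU,
    extChartAt_source_mem_nhds (I := 𝓡 (2 * n + 1)) x₀] with x hxU hxs ε hε hεδ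
  have h2 := hUV (mk_mem_prod hxU (hball (show ε ∈ Metric.ball (0 : ℝ) δ by
    rwa [mem_ball_zero_iff, Real.norm_of_nonneg hε.le])))
  have hxt := (extChartAt (𝓡 (2 * n + 1)) x₀).map_source hxs
  have h3 := contactVol_add_smul hα hα' (contMDiffAt_extChartAt_symm x₀ hxt) v ε
  rw [(extChartAt (𝓡 (2 * n + 1)) x₀).left_inv hxs] at h3
  exact ⟨_, h3.trans_ne h2⟩

end Family

/-! ### The orientation of the normal disks -/

theorem injective_mfd_extChartAt_symm {d : ℕ} {X : Type*} [TopologicalSpace X]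
    [ChartedSpace (EuclideanSpace ℝ (Fin d)) X] [IsManifold (𝓡 d) ∞ X] (x : X)
    {y : EuclideanSpace ℝ (Fin d)} (hy : y ∈ (extChartAt (𝓡 d) x).target) :
    Function.Injective (mfd 𝓘(ℝ, EuclideanSpace ℝ (Fin d)) (𝓡 d) (extChartAt (𝓡 d) x).symm y) := by
  refine (mfd_bijective (isLocalDiffeomorphAt_of_inverse (g := extChartAt (𝓡 d) x) hy
    (isOpen_extChartAt_target x) (isOpen_extChartAt_source (I := 𝓡 d) x)
    (fun y hy => (extChartAt (𝓡 d) x).map_target hy)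
    (fun z hz => (extChartAt (𝓡 d) x).map_source hz)
    (fun y hy => (extChartAt (𝓡 d) x).right_inv hy)
    (fun z hz => (extChartAt (𝓡 d) x).left_inv hz)
    (contMDiffOn_extChartAt_symm x) ?_)).injective
  rw [extChartAt_source]
  exact contMDiffOn_extChartAt

/-- The form `α ∧ (dα)ⁿ` as an alternating form. -/
def contactAlt {n : ℕ} {Z : Type*} [TopologicalSpace Z]
    [ChartedSpace (EuclideanSpace ℝ (Fin (2 * n + 1))) Z] (α : OneForm (2 * n + 1) Z) (x : Z) :
    EuclideanSpace ℝ (Fin (2 * n + 1)) [⋀^Fin (2 * n + 1)]→ₗ[ℝ] ℝ :=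
  wedgePowAlt n (α.val x).toLinearMap (α.extDBil x)

theorem contactAlt_apply {n : ℕ} {Z : Type*} [TopologicalSpace Z]
    [ChartedSpace (EuclideanSpace ℝ (Fin (2 * n + 1))) Z] (α : OneForm (2 * n + 1) Z) (x : Z)
    (v : Fin (2 * n + 1) → EuclideanSpace ℝ (Fin (2 * n + 1))) :
    contactAlt α x v = contactVol n α x v := wedgePowAlt_apply _ _ _ _

theorem linearIndependent_of_contactVol_ne_zero {n : ℕ} {Z : Type*} [TopologicalSpace Z]
    [ChartedSpace (EuclideanSpace ℝ (Fin (2 * n + 1))) Z] {α : OneForm (2 * n + 1) Z} {x : Z}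
    {v : Fin (2 * n + 1) → EuclideanSpace ℝ (Fin (2 * n + 1))} (h : contactVol n α x v ≠ 0) :
    LinearIndependent ℝ v :=
  wedgePow_ne_zero_linearIndependent n (α.val x).toLinearMap (α.extDBil x) v h

theorem contactVol_ne_zero_of_linearIndependent {n : ℕ} {Z : Type*} [TopologicalSpace Z]
    [ChartedSpace (EuclideanSpace ℝ (Fin (2 * n + 1))) Z] {α : OneForm (2 * n + 1) Z}
    (hα : IsContactForm n α) (x : Z)
    {v : Fin (2 * n + 1) → EuclideanSpace ℝ (Fin (2 * n + 1))} (hv : LinearIndependent ℝ v) :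
    contactVol n α x v ≠ 0 :=
  wedgePow_ne_zero_of_linearIndependent n (by simp) (α.val x).toLinearMap (α.extDBil x)
    (hα.vol_ne_zero x) v hv

/-- The standard frame of Euclidean space. -/
def stdFrame (m : ℕ) (i : Fin m) : EuclideanSpace ℝ (Fin m) := EuclideanSpace.basisFun (Fin m) ℝ i

theorem linearIndependent_stdFrame (m : ℕ) : LinearIndependent ℝ (stdFrame m) := by
  have h := (EuclideanSpace.basisFun (Fin m) ℝ).toBasis.linearIndependent
  rwa [OrthonormalBasis.coe_toBasis] at h

namespace OpenBook

variable {n : ℕ} {N B : Type u}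
  [TopologicalSpace N] [ChartedSpace (EuclideanSpace ℝ (Fin (2 * (n + 1) + 1))) N]
  [TopologicalSpace B] [ChartedSpace (EuclideanSpace ℝ (Fin (2 * n + 1))) B]
  {ob : OpenBook n N B}

/-- `α ∧ (dα)ⁿ⁺¹` on the frame `∂_x, ∂_y, e` along the binding. -/
def tubeVol (ob : OpenBook n N B) (α : OneForm (2 * (n + 1) + 1) N) (b : B)
    (e : Fin (2 * n + 1) → EuclideanSpace ℝ (Fin (2 * n + 1))) : ℝ :=
  contactVol (n + 1) α (ob.incl b) fun i : Fin (2 * n + 1 + 1 + 1) =>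
    mfd (𝓘(ℝ, ℂ).prod (𝓡 (2 * n + 1))) (𝓡 (2 * (n + 1) + 1)) ob.tube (0, b) (diskFrame e i)

/-- The product of `α ∧ (dα)ⁿ⁺¹` and of the volume form of the binding. Its sign compares the
orientation of the ambient manifold with the product orientation of the disk and the binding. -/
def orientPairing (ob : OpenBook n N B) (α : OneForm (2 * (n + 1) + 1) N) (b : B)
    (e : Fin (2 * n + 1) → EuclideanSpace ℝ (Fin (2 * n + 1))) : ℝ :=
  contactVol n (OneForm.pullback ob.incl α : OneForm (2 * n + 1) B) b e * ob.tubeVol α b e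

theorem exists_tubeVol_alternating (α : OneForm (2 * (n + 1) + 1) N) (b : B) :
    ∃ A : EuclideanSpace ℝ (Fin (2 * n + 1)) [⋀^Fin (2 * n + 1)]→ₗ[ℝ] ℝ,
      ∀ e, A e = ob.tubeVol α b e := by
  set D := mfd (𝓘(ℝ, ℂ).prod (𝓡 (2 * n + 1))) (𝓡 (2 * (n + 1) + 1)) ob.tube (0, b)
  refine ⟨(insertTwo (m := 2 * n + 1) (contactAlt (n := n + 1) α (ob.incl b))
    (D (1, 0)) (D (Complex.I, 0))).compLinearMap
      (D.toLinearMap.comp (LinearMap.inr ℝ ℂ (EuclideanSpace ℝ (Fin (2 * n + 1))))), fun e => ?_⟩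
  rw [AlternatingMap.compLinearMap_apply, insertTwo_apply]
  refine (contactAlt_apply (n := n + 1) α (ob.incl b) _).trans ?_
  unfold tubeVol
  rw [map_diskFrame D e]
  rfl

/-- The two factors of the pairing are alternating forms of top degree on the binding, hence
proportional, so the product of two pairings is a square. -/
theorem orientPairing_mul_nonneg (α : OneForm (2 * (n + 1) + 1) N) (b : B)
    (e e' : Fin (2 * n + 1) → EuclideanSpace ℝ (Fin (2 * n + 1))) :
    0 ≤ ob.orientPairing α b e * ob.orientPairing α b e' := by
  obtain ⟨A, hA⟩ := exists_tubeVol_alternating (ob := ob) α b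
  have h := alternating_top_mul_comm (by simp) A
    (contactAlt (OneForm.pullback ob.incl α : OneForm (2 * n + 1) B) b) e e'
  rw [contactAlt_apply, contactAlt_apply, hA, hA] at h
  have h2 := sq_nonneg (ob.tubeVol α b e *
    contactVol n (OneForm.pullback ob.incl α : OneForm (2 * n + 1) B) b e')
  rw [sq] at h2
  nth_rewrite 2 [h] at h2
  unfold orientPairing
  linarith

theorem tubeVol_ne_zero {α : OneForm (2 * (n + 1) + 1) N} (hα : IsContactForm (n + 1) α) (b : B)
    {e : Fin (2 * n + 1) → EuclideanSpace ℝ (Fin (2 * n + 1))} (he : LinearIndependent ℝ e) :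
    ob.tubeVol α b e ≠ 0 := by
  refine contactVol_ne_zero_of_linearIndependent hα (ob.incl b) ?_
  exact (linearIndependent_diskFrame he).map' (mfd (𝓘(ℝ, ℂ).prod (𝓡 (2 * n + 1)))
    (𝓡 (2 * (n + 1) + 1)) ob.tube (0, b)).toLinearMap
      (LinearMap.ker_eq_bot.2 (mfd_bijective (isLocalDiffeomorphAt_tube (by simp) b)).injective)

variable [IsManifold (𝓡 (2 * n + 1)) ∞ B]

theorem mfd_tubeParam_diskFrame {b₀ : B} {p : ℂ × EuclideanSpace ℝ (Fin (2 * n + 1))}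
    (hp : ‖p.1‖ < 1) (hp' : p.2 ∈ (extChartAt (𝓡 (2 * n + 1)) b₀).target)
    (e : Fin (2 * n + 1) → EuclideanSpace ℝ (Fin (2 * n + 1))) (i : Fin (2 * n + 1 + 1 + 1)) :
    mfd 𝓘(ℝ, ℂ × EuclideanSpace ℝ (Fin (2 * n + 1))) (𝓡 (2 * (n + 1) + 1)) (ob.tubeParam b₀) p
        (diskFrame e i) =
      mfd (𝓘(ℝ, ℂ).prod (𝓡 (2 * n + 1))) (𝓡 (2 * (n + 1) + 1)) ob.tube
        (p.1, (extChartAt (𝓡 (2 * n + 1)) b₀).symm p.2)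
        (diskFrame (fun j => mfd 𝓘(ℝ, EuclideanSpace ℝ (Fin (2 * n + 1))) (𝓡 (2 * n + 1))
          (extChartAt (𝓡 (2 * n + 1)) b₀).symm p.2 (e j)) i) := by
  refine Fin.cases ?_ (fun i => Fin.cases ?_ (fun i => ?_) i) i
  · refine (mfd_tubeParam hp hp' 1 0).trans ?_
    rw [map_zero]
    rfl
  · refine (mfd_tubeParam hp hp' Complex.I 0).trans ?_
    rw [map_zero]
    rfl
  · exact mfd_tubeParam hp hp' 0 (e i)

variable [IsManifold (𝓡 (2 * (n + 1) + 1)) ∞ N]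

/-- The comparison of orientations is locally constant along the binding. -/
theorem exists_orientation {α : OneForm (2 * (n + 1) + 1) N} (hα : IsContactForm (n + 1) α)
    (hB : IsContactForm n (OneForm.pullback ob.incl α : OneForm (2 * n + 1) B)) :
    ∃ η : B → ℝ, ContMDiff (𝓡 (2 * n + 1)) 𝓘(ℝ, ℝ) ∞ η ∧
      ∀ b e, LinearIndependent ℝ e → 0 < η b * ob.orientPairing α b e := by
  set e₀ := stdFrame (2 * n + 1)
  have hind : LinearIndependent ℝ e₀ := linearIndependent_stdFrame _
  have hne : ∀ b e, LinearIndependent ℝ e → ob.orientPairing α b e ≠ 0 := fun b e he =>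
    mul_ne_zero (contactVol_ne_zero_of_linearIndependent hB b he) (tubeVol_ne_zero hα b he)
  -- The sign on one frame is the sign on every frame, so it can be read off from `e₀`.
  have hpos : ∀ b e, LinearIndependent ℝ e →
      0 < SignType.sign (ob.orientPairing α b e₀) * ob.orientPairing α b e := by
    intro b e he
    have h := lt_of_le_of_ne (orientPairing_mul_nonneg (ob := ob) α b e₀ e)
      (mul_ne_zero (hne b e₀ hind) (hne b e he)).symm
    rcases lt_or_gt_of_ne (hne b e₀ hind) with h1 | h1
    · rw [sign_neg h1]
      have := neg_of_mul_pos_right h h1.le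
      simpa using this
    · rw [sign_pos h1]
      simpa using pos_of_mul_pos_right h h1.le
  refine ⟨fun b => SignType.sign (ob.orientPairing α b e₀), fun b₀ => ?_, hpos⟩
  set c := extChartAt (𝓡 (2 * n + 1)) b₀
  have hy : c b₀ ∈ c.target := mem_extChartAt_target b₀
  -- The standard frame at `b` refers to the preferred chart at `b` and need not vary continuously
  -- with `b`. Continuity is therefore shown for the frame of the single chart at `b₀`, and the two
  -- signs agree by `hpos`.
  set F : EuclideanSpace ℝ (Fin (2 * n + 1)) → ℝ := fun y => ob.orientPairing α (c.symm y)
    (fun i => mfd 𝓘(ℝ, EuclideanSpace ℝ (Fin (2 * n + 1))) (𝓡 (2 * n + 1)) c.symm y (e₀ i))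
  have hF : ContinuousAt F (c b₀) := by
    refine (continuousAt_contactVol (p := c.symm) (y := c b₀) hB.smooth
      (Filter.Eventually.mono ((isOpen_extChartAt_target b₀).mem_nhds hy) fun z hz =>
        contMDiffAt_extChartAt_symm b₀ hz) e₀).mul ?_
    have h1 := continuousAt_contactVol (n := n + 1) (p := ob.tubeParam b₀) (y := (0, c b₀))
      hα.smooth ((eventually_tubeParam b₀).mono fun p hp =>
        contMDiffAt_tubeParam (hp.1.trans (by norm_num)) hp.2) (diskFrame e₀)
    have h2 := ContinuousAt.comp (f := fun y : EuclideanSpace ℝ (Fin (2 * n + 1)) => ((0 : ℂ), y))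
      (x := c b₀) h1 (by fun_prop)
    refine h2.congr (Filter.Eventually.mono ((isOpen_extChartAt_target b₀).mem_nhds hy) ?_)
    intro y hy
    refine congrArg (contactVol (n + 1) α (ob.incl (c.symm y))) (funext fun i => ?_)
    exact mfd_tubeParam_diskFrame (p := (0, y)) (by simp) hy e₀ i
  have hFne : F (c b₀) ≠ 0 := hne _ _ (hind.map' (mfd 𝓘(ℝ, EuclideanSpace ℝ (Fin (2 * n + 1)))
    (𝓡 (2 * n + 1)) c.symm (c b₀)).toLinearMap
      (LinearMap.ker_eq_bot.2 (injective_mfd_extChartAt_symm b₀ hy)))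
  have hs : ∀ y ∈ c.target, SignType.sign (F y) =
      SignType.sign (ob.orientPairing α (c.symm y) e₀) := by
    intro y hy
    have h := hpos (c.symm y) _ (hind.map' (mfd 𝓘(ℝ, EuclideanSpace ℝ (Fin (2 * n + 1)))
      (𝓡 (2 * n + 1)) c.symm y).toLinearMap
        (LinearMap.ker_eq_bot.2 (injective_mfd_extChartAt_symm b₀ hy)))
    change 0 < _ * F y at h
    rcases lt_or_gt_of_ne (hne (c.symm y) e₀ hind) with h1 | h1
    · rw [sign_neg h1] at h ⊢
      exact sign_neg (by simpa using h)
    · rw [sign_pos h1] at h ⊢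
      exact sign_pos (by simpa using h)
  have hev : ∀ᶠ y in 𝓝 (c b₀), SignType.sign (F y) = SignType.sign (F (c b₀)) :=
    ((continuousAt_sign_of_ne_zero hFne).comp hF).eventually
      (discreteTopology_iff_forall_isOpen.1 inferInstance {SignType.sign (F (c b₀))} |>.mem_nhds rfl)
  refine (contMDiffAt_const (c := (SignType.sign (F (c b₀)) : ℝ))).congr_of_eventuallyEq ?_
  filter_upwards [(continuousAt_extChartAt (I := 𝓡 (2 * n + 1)) b₀).eventually hev,
    extChartAt_source_mem_nhds (I := 𝓡 (2 * n + 1)) b₀] with b hb hbs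
  have h := hs (c b) (c.map_source hbs)
  rw [c.left_inv hbs, hb] at h
  rw [h]

end OpenBook

theorem contactVol_pullback {n : ℕ} {Y Z : Type*} [TopologicalSpace Y]
    [ChartedSpace (EuclideanSpace ℝ (Fin (2 * n + 1))) Y] [IsManifold (𝓡 (2 * n + 1)) ∞ Y]
    [TopologicalSpace Z] [ChartedSpace (EuclideanSpace ℝ (Fin (2 * n + 1))) Z]
    [IsManifold (𝓡 (2 * n + 1)) ∞ Z] {α : OneForm (2 * n + 1) Z} (hα : α.Smooth) {f : Y → Z} {x : Y}
    (hf : ContMDiffAt (𝓡 (2 * n + 1)) (𝓡 (2 * n + 1)) ∞ f x)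
    (v : Fin (2 * n + 1) → EuclideanSpace ℝ (Fin (2 * n + 1))) :
    contactVol n (OneForm.pullback f α : OneForm (2 * n + 1) Y) x v =
      contactVol n α (f x) (fun i => mfd (𝓡 (2 * n + 1)) (𝓡 (2 * n + 1)) f x (v i)) :=
  wedgePow_congr (fun _ => rfl) (fun i j => extDBil_pullback hα hf (v i) (v j))

theorem fderiv_planeMap_of_norm_lt {k : ℕ} (hk : 1 ≤ k) {z : ℂ} (hz : ‖z‖ < 1 / 4) (w : ℂ) :
    fderiv ℝ (planeMap k) z w = k * z ^ (k - 1) * w := by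
  rw [(planeMap_eventuallyEq_pow hk hz).fderiv_eq,
    ((hasDerivAt_pow k z).hasFDerivAt.restrictScalars ℝ).fderiv]
  simp [mul_comm]

namespace OpenBook

variable {n : ℕ} {N B : Type u}
  [TopologicalSpace N] [ChartedSpace (EuclideanSpace ℝ (Fin (2 * (n + 1) + 1))) N]
  [TopologicalSpace B] [ChartedSpace (EuclideanSpace ℝ (Fin (2 * n + 1))) B]
  {ob : OpenBook n N B} {k : ℕ}

theorem mfd_tube_slice {z : ℂ} (hz : ‖z‖ < 1) (b : B) (w : ℂ) :
    mfd 𝓘(ℝ, ℂ) (𝓡 (2 * (n + 1) + 1)) (fun z : ℂ => ob.tube (z, b)) z w =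
      mfd (𝓘(ℝ, ℂ).prod (𝓡 (2 * n + 1))) (𝓡 (2 * (n + 1) + 1)) ob.tube (z, b) (w, 0) := by
  have hi : MDifferentiableAt 𝓘(ℝ, ℂ) 𝓘(ℝ, ℂ) (fun z : ℂ => z) z := mdifferentiableAt_id
  have hc : MDifferentiableAt 𝓘(ℝ, ℂ) (𝓡 (2 * n + 1)) (fun _ : ℂ => b) z :=
    mdifferentiableAt_const
  have h3 : mfd 𝓘(ℝ, ℂ) (𝓡 (2 * n + 1)) (fun _ : ℂ => b) z = 0 := mfderiv_const
  have h4 : mfd 𝓘(ℝ, ℂ) (𝓘(ℝ, ℂ).prod (𝓡 (2 * n + 1))) (fun z : ℂ => (z, b)) z =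
      (mfd 𝓘(ℝ, ℂ) 𝓘(ℝ, ℂ) (fun z : ℂ => z) z).prod
        (mfd 𝓘(ℝ, ℂ) (𝓡 (2 * n + 1)) (fun _ : ℂ => b) z) := mfderiv_prodMk hi hc
  have h2 : mfd 𝓘(ℝ, ℂ) (𝓘(ℝ, ℂ).prod (𝓡 (2 * n + 1))) (fun z : ℂ => (z, b)) z w = (w, 0) := by
    rw [h4, h3, mfd_id]
    rfl
  have h1 : mfd 𝓘(ℝ, ℂ) (𝓡 (2 * (n + 1) + 1)) (fun z : ℂ => ob.tube (z, b)) z =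
      (mfd (𝓘(ℝ, ℂ).prod (𝓡 (2 * n + 1))) (𝓡 (2 * (n + 1) + 1)) ob.tube (z, b)).comp
        (mfd 𝓘(ℝ, ℂ) (𝓘(ℝ, ℂ).prod (𝓡 (2 * n + 1))) (fun z : ℂ => (z, b)) z) :=
    mfd_comp (g := ob.tube) (f := fun z : ℂ => (z, b))
      ((contMDiffAt_tube hz b).mdifferentiableAt (by simp)) (hi.prodMk hc)
  rw [h1, ContinuousLinearMap.comp_apply, h2]

variable [NeZero k] [CompactSpace B] [T2Space N] [IsManifold (𝓡 (2 * (n + 1) + 1)) ∞ N]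

open Cover

/-! ### The form near the binding -/

theorem mfd_incl_eq_zero {φ : ob.Cover k → ℝ} (hφ : ContMDiff (𝓡 (2 * (n + 1) + 1)) 𝓘(ℝ, ℝ) ∞ φ)
    (h0 : ∀ b, φ ((ob.coverBook k).incl b) = 0) (b : B) (e : EuclideanSpace ℝ (Fin (2 * n + 1))) :
    mfd (𝓡 (2 * (n + 1) + 1)) 𝓘(ℝ, ℝ) φ ((ob.coverBook k).incl b)
      (mfd (𝓡 (2 * n + 1)) (𝓡 (2 * (n + 1) + 1)) (ob.coverBook k).incl b e) = 0 := by
  rw [← ContinuousLinearMap.comp_apply, ← mfd_comp (hφ.contMDiffAt.mdifferentiableAt (by simp))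
    (contMDiff_incl.contMDiffAt.mdifferentiableAt (by simp)), funext h0]
  have : mfd (𝓡 (2 * n + 1)) 𝓘(ℝ, ℝ) (fun _ : B => (0 : ℝ)) b = 0 := mfderiv_const
  rw [this]
  rfl

theorem rt_incl_coverBook (b : B) : ((ob.coverBook k).incl b).rt = 0 := rt_coverTube (by simp) b

theorem rootRe_incl_coverBook (b : B) : ((ob.coverBook k).incl b).rootRe = 0 := by
  rw [rootRe, rt_incl_coverBook, cutoff_eq_self (by simp), Complex.zero_re]

theorem rootIm_incl_coverBook (b : B) : ((ob.coverBook k).incl b).rootIm = 0 := by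
  rw [rootIm, rt_incl_coverBook, cutoff_eq_self (by simp), Complex.zero_im]

variable {κ : ob.Cover k → ℝ}

/-- The functions `κx`, `κy`, `x`, `y` that make up `γ` all vanish on the binding, so their
differentials kill the vectors tangent to it. -/
theorem extDBil_rotForm_incl (hκ : ∀ m : ob.Cover k, m.pr ∈ ob.tube.target →
      ContMDiffAt (𝓡 (2 * (n + 1) + 1)) 𝓘(ℝ, ℝ) ∞ κ m) (b : B)
    (u : EuclideanSpace ℝ (Fin (2 * (n + 1) + 1))) (e : EuclideanSpace ℝ (Fin (2 * n + 1))) :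
    (rotForm κ).extDBil ((ob.coverBook k).incl b) u
      (mfd (𝓡 (2 * n + 1)) (𝓡 (2 * (n + 1) + 1)) (ob.coverBook k).incl b e) = 0 := by
  rw [extDBil_rotForm hκ, mfd_incl_eq_zero (contMDiff_mul_rootRe hκ)
    (fun b => by rw [rootRe_incl_coverBook, mul_zero]),
    mfd_incl_eq_zero (contMDiff_mul_rootIm hκ) (fun b => by rw [rootIm_incl_coverBook, mul_zero]),
    mfd_incl_eq_zero contMDiff_rootRe rootRe_incl_coverBook,
    mfd_incl_eq_zero contMDiff_rootIm rootIm_incl_coverBook]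
  ring

theorem mfd_coverTube_slice {φ : ob.Cover k → ℝ} {b : B}
    (hφ : ContMDiff (𝓡 (2 * (n + 1) + 1)) 𝓘(ℝ, ℝ) ∞ φ) {L : ℂ →L[ℝ] ℝ}
    (h : ∀ z : ℂ, ‖z‖ < 1 / 2 → φ (coverTube ob k (z, b)) = L z) (w : ℂ) :
    mfd (𝓡 (2 * (n + 1) + 1)) 𝓘(ℝ, ℝ) φ (coverTube ob k (0, b))
      (mfd (𝓘(ℝ, ℂ).prod (𝓡 (2 * n + 1))) (𝓡 (2 * (n + 1) + 1)) (coverTube ob k) (0, b) (w, 0)) =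
      L w := by
  have hz : ‖(0 : ℂ)‖ < 1 := by simp
  have h1 := mfd_tube_slice (ob := ob.coverBook k) hz b w
  have hd : MDifferentiableAt 𝓘(ℝ, ℂ) (𝓡 (2 * (n + 1) + 1)) (fun z : ℂ => coverTube ob k (z, b)) 0 :=
    (ContMDiffAt.comp (g := coverTube ob k) (f := fun z : ℂ => (z, b)) (0 : ℂ)
      (contMDiffAt_coverTube hz b) (contMDiffAt_id.prodMk contMDiffAt_const)).mdifferentiableAt
        (by simp)
  have h2 := mfd_comp (g := φ) (f := fun z : ℂ => coverTube ob k (z, b)) (x := (0 : ℂ))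
    (hφ.contMDiffAt.mdifferentiableAt (by simp)) hd
  have h3 : (fun z : ℂ => φ (coverTube ob k (z, b))) =ᶠ[𝓝 0] L := by
    filter_upwards [continuous_norm.continuousAt.eventually
      (gt_mem_nhds (show ‖(0 : ℂ)‖ < 1 / 2 by simp))] with z hz
    exact h z hz
  rw [mfd_congr h3, mfd_eq_fderiv, L.fderiv] at h2
  rw [h2]
  exact (congrArg _ h1).symm

/-- On the normal disk, near its center, the cut-off root is `z` itself and `κ` is constant, so `γ`
is there `c (x dy - y dx)`. -/
theorem extDBil_rotForm_disk (hκ : ∀ m : ob.Cover k, m.pr ∈ ob.tube.target →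
      ContMDiffAt (𝓡 (2 * (n + 1) + 1)) 𝓘(ℝ, ℝ) ∞ κ m) {b : B} {c : ℝ}
    (hc : ∀ z : ℂ, ‖z‖ < 1 → κ (coverTube ob k (z, b)) = c) :
    (rotForm κ).extDBil ((ob.coverBook k).incl b)
      (mfd (𝓘(ℝ, ℂ).prod (𝓡 (2 * n + 1))) (𝓡 (2 * (n + 1) + 1)) (ob.coverBook k).tube (0, b) (1, 0))
      (mfd (𝓘(ℝ, ℂ).prod (𝓡 (2 * n + 1))) (𝓡 (2 * (n + 1) + 1)) (ob.coverBook k).tube (0, b)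
        (Complex.I, 0)) = 2 * c := by
  have hlt : ∀ z : ℂ, ‖z‖ < 1 / 2 → ‖z‖ < 1 := fun z hz => hz.trans (by norm_num)
  have hRe : ∀ z : ℂ, ‖z‖ < 1 / 2 → (coverTube ob k (z, b)).rootRe = Complex.reCLM z := by
    intro z hz
    rw [rootRe, rt_coverTube (hlt z hz), cutoff_eq_self hz.le, Complex.reCLM_apply]
  have hIm : ∀ z : ℂ, ‖z‖ < 1 / 2 → (coverTube ob k (z, b)).rootIm = Complex.imCLM z := by
    intro z hz
    rw [rootIm, rt_coverTube (hlt z hz), cutoff_eq_self hz.le, Complex.imCLM_apply]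
  have h1 := mfd_coverTube_slice (b := b) (contMDiff_mul_rootRe hκ) (L := c • Complex.reCLM)
    (fun z hz => by rw [hRe z hz, hc z (hlt z hz)]; rfl)
  have h2 := mfd_coverTube_slice (b := b) (contMDiff_mul_rootIm hκ) (L := c • Complex.imCLM)
    (fun z hz => by rw [hIm z hz, hc z (hlt z hz)]; rfl)
  have h3 := mfd_coverTube_slice (b := b) contMDiff_rootRe hRe
  have h4 := mfd_coverTube_slice (b := b) contMDiff_rootIm hIm
  refine (extDBil_rotForm hκ (coverTube ob k (0, b)) _ _).trans ?_
  rw [coverBook_tube, h1, h1, h2, h2, h3, h3, h4, h4]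
  simp
  ring

/-- `β ∧ (dβ)ⁿ⁺¹` along the binding, for `β = f^*α + εγ`, on two vectors in the kernel of `df`
followed by vectors tangent to the binding. -/
theorem contactVol_cover_binding {α : OneForm (2 * (n + 1) + 1) N} (hα : α.Smooth)
    [IsManifold (𝓡 (2 * n + 1)) ∞ B]
    (hκ : ∀ m : ob.Cover k, m.pr ∈ ob.tube.target →
      ContMDiffAt (𝓡 (2 * (n + 1) + 1)) 𝓘(ℝ, ℝ) ∞ κ m) (ε : ℝ) (b : B)
    {u v : EuclideanSpace ℝ (Fin (2 * (n + 1) + 1))}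
    (hu : mfd (𝓡 (2 * (n + 1) + 1)) (𝓡 (2 * (n + 1) + 1)) pr ((ob.coverBook k).incl b) u = 0)
    (e : Fin (2 * n + 1) → EuclideanSpace ℝ (Fin (2 * n + 1))) :
    contactVol (n + 1) (fun m => (OneForm.pullback pr α : OneForm (2 * (n + 1) + 1) (ob.Cover k)) m +
        ε • rotForm κ m) ((ob.coverBook k).incl b)
      (Fin.cons u (Fin.cons v fun i => mfd (𝓡 (2 * n + 1)) (𝓡 (2 * (n + 1) + 1))
        (ob.coverBook k).incl b (e i)) : Fin (2 * n + 1 + 1 + 1) → _) =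
    (n + 1) * (ε * (rotForm κ).extDBil ((ob.coverBook k).incl b) u v *
      contactVol n (OneForm.pullback ob.incl α : OneForm (2 * n + 1) B) b e) := by
  set β : OneForm (2 * (n + 1) + 1) (ob.Cover k) := fun m =>
    (OneForm.pullback pr α : OneForm (2 * (n + 1) + 1) (ob.Cover k)) m + ε • rotForm κ m with hβ
  have hβs : β.Smooth := (hα.pullback contMDiff_pr).add_smul (smooth_rotForm hκ) ε
  have hbil := extDBil_cover hα hκ ε ((ob.coverBook k).incl b)
  -- At the binding `γ` vanishes and `df` kills `u`. So `u` lies in the kernel of `β` and is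
  -- `dβ`-orthogonal to the binding, as `wedgePow_split` requires.
  have hval : β.val ((ob.coverBook k).incl b) u = 0 := by
    have h1 : (rotForm κ).val ((ob.coverBook k).incl b) = 0 :=
      val_rotForm_of_rt_eq_zero κ (rt_incl_coverBook b)
    have h2 : β.val ((ob.coverBook k).incl b) u = α.val _ (mfd (𝓡 (2 * (n + 1) + 1))
      (𝓡 (2 * (n + 1) + 1)) pr ((ob.coverBook k).incl b) u) +
        ε * (rotForm κ).val ((ob.coverBook k).incl b) u := rfl
    rw [h2, h1, hu, map_zero]
    simp
  have hui : ∀ i, β.extDBil ((ob.coverBook k).incl b) u (mfd (𝓡 (2 * n + 1)) (𝓡 (2 * (n + 1) + 1))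
      (ob.coverBook k).incl b (e i)) = 0 := by
    intro i
    rw [hbil, hu, extDBil_rotForm_incl hκ, map_zero]
    simp
  have huv : β.extDBil ((ob.coverBook k).incl b) u v =
      ε * (rotForm κ).extDBil ((ob.coverBook k).incl b) u v := by
    rw [hbil, hu, map_zero]
    simp
  refine (wedgePow_split n (fun u => β.val ((ob.coverBook k).incl b) u)
    (fun u v => β.extDBil ((ob.coverBook k).incl b) u v) (extDBil_swap β _) u v _ hval hui).trans ?_
  rw [huv, ← pullback_incl_cover α κ ε]
  congr 2
  exact wedgePow_congr (fun _ => rfl)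
    (fun i j => (extDBil_pullback hβs contMDiff_incl.contMDiffAt (e i) (e j)).symm)

end OpenBook

namespace OpenBook

variable {n : ℕ} {N B : Type u}
  [TopologicalSpace N] [ChartedSpace (EuclideanSpace ℝ (Fin (2 * (n + 1) + 1))) N]
  [TopologicalSpace B] [ChartedSpace (EuclideanSpace ℝ (Fin (2 * n + 1))) B]
  {ob : OpenBook n N B} {k : ℕ}
  [NeZero k] [CompactSpace B] [T2Space N] [IsManifold (𝓡 (2 * (n + 1) + 1)) ∞ N]

open Cover

/-! ### The contact condition on the branched covering -/

theorem exists_contactVol_pullback_ne_zero {α : OneForm (2 * (n + 1) + 1) N}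
    (hα : IsContactForm (n + 1) α) {m : ob.Cover k} (hm : Function.Surjective
      (mfd (𝓡 (2 * (n + 1) + 1)) (𝓡 (2 * (n + 1) + 1)) (pr : ob.Cover k → N) m)) :
    ∃ v, contactVol (n + 1) (OneForm.pullback pr α : OneForm (2 * (n + 1) + 1) (ob.Cover k)) m v ≠ 0 := by
  obtain ⟨v, hv⟩ := hα.vol_ne_zero m.pr
  choose w hw using fun i => hm (v i)
  refine ⟨w, ?_⟩
  have h := contactVol_pullback hα.smooth (f := (pr : ob.Cover k → N)) (x := m)
    contMDiff_pr.contMDiffAt w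
  rw [funext hw] at h
  exact h.trans_ne hv

/-- The case `k = 1` is separate: `df` is then invertible along the binding, so `f^*α` itself is
contact there and the argument by the `ε`-derivative is neither needed nor available. -/
theorem mfd_pr_surjective_of_eq_one (hk : k = 1) (b : B) : Function.Surjective
    (mfd (𝓡 (2 * (n + 1) + 1)) (𝓡 (2 * (n + 1) + 1)) (pr : ob.Cover k → N)
      ((ob.coverBook k).incl b)) := by
  intro v
  have hz : ‖planeMap k 0‖ < 1 := norm_planeMap_lt_one (by simp)
  have h1 := (mfd_bijective (isLocalDiffeomorphAt_tube (ob := ob) hz b)).surjective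
  have hpr := pr_coverTube (ob := ob) (k := k) (z := 0) (by simp) b
  obtain ⟨⟨w, e⟩, he⟩ := h1 v
  refine ⟨mfd (𝓘(ℝ, ℂ).prod (𝓡 (2 * n + 1))) (𝓡 (2 * (n + 1) + 1)) (coverTube ob k) (0, b) (w, e), ?_⟩
  refine (mfd_pr_coverTube (by simp) b w e).trans (Eq.trans ?_ he)
  rw [fderiv_planeMap_of_norm_lt NeZero.one_le (by simp)]
  simp [hk]

/-- The pull-back of the volume form near the binding. -/
theorem contactVol_pullback_disk {α : OneForm (2 * (n + 1) + 1) N} (hα : α.Smooth) {z : ℂ}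
    (hz : ‖z‖ < 1 / 4) (b : B) (e : Fin (2 * n + 1) → EuclideanSpace ℝ (Fin (2 * n + 1))) :
    contactVol (n + 1) (OneForm.pullback pr α : OneForm (2 * (n + 1) + 1) (ob.Cover k))
        (coverTube ob k (z, b)) (fun i : Fin (2 * n + 1 + 1 + 1) =>
          mfd (𝓘(ℝ, ℂ).prod (𝓡 (2 * n + 1))) (𝓡 (2 * (n + 1) + 1)) (coverTube ob k) (z, b)
            (diskFrame e i)) =
      ‖(k * z ^ (k - 1) : ℂ)‖ ^ 2 * contactVol (n + 1) α (ob.tube (planeMap k z, b))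
        (fun i : Fin (2 * n + 1 + 1 + 1) => mfd (𝓘(ℝ, ℂ).prod (𝓡 (2 * n + 1)))
          (𝓡 (2 * (n + 1) + 1)) ob.tube (planeMap k z, b) (diskFrame e i)) := by
  have hz1 : ‖z‖ < 1 := hz.trans (by norm_num)
  set D := mfd (𝓘(ℝ, ℂ).prod (𝓡 (2 * n + 1))) (𝓡 (2 * (n + 1) + 1)) ob.tube (planeMap k z, b) with hD
  -- Here the differential of the plane map is multiplication by `c`; it rotates and dilates the
  -- first two vectors and multiplies areas by `‖c‖²`.
  set c : ℂ := k * z ^ (k - 1)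
  have hd : ∀ w : ℂ, fderiv ℝ (planeMap k) z w = c * w :=
    fderiv_planeMap_of_norm_lt NeZero.one_le hz
  have hframe : (fun i : Fin (2 * n + 1 + 1 + 1) =>
      mfd (𝓡 (2 * (n + 1) + 1)) (𝓡 (2 * (n + 1) + 1)) pr (coverTube ob k (z, b))
        (mfd (𝓘(ℝ, ℂ).prod (𝓡 (2 * n + 1))) (𝓡 (2 * (n + 1) + 1)) (coverTube ob k) (z, b)
          (diskFrame e i))) = (Fin.cons (c.re • D (1, 0) + c.im • D (Complex.I, 0))
      (Fin.cons (-c.im • D (1, 0) + c.re • D (Complex.I, 0)) fun i => D (0, e i)) :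
        Fin (2 * n + 1 + 1 + 1) → _) := by
    funext i
    refine Fin.cases ?_ (fun i => Fin.cases ?_ (fun i => ?_) i) i
    · refine (mfd_pr_coverTube hz1 b 1 0).trans ?_
      rw [hd, Fin.cons_zero, ← map_smul, ← map_smul, ← map_add]
      refine congrArg D (Prod.ext ?_ (by simp))
      apply Complex.ext <;> simp
    · refine (mfd_pr_coverTube hz1 b Complex.I 0).trans ?_
      rw [hd, Fin.cons_succ, Fin.cons_zero, ← map_smul, ← map_smul, ← map_add]
      refine congrArg D (Prod.ext ?_ (by simp))
      apply Complex.ext <;> simp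
    · refine (mfd_pr_coverTube hz1 b 0 (e i)).trans ?_
      rw [hd, mul_zero]
      rfl
  have h1 := insertTwo_conformal (m := 2 * n + 1)
    (contactAlt (n := n + 1) α (ob.tube (planeMap k z, b))) (D (1, 0)) (D (Complex.I, 0))
    (fun i => D (0, e i)) c.re c.im
  rw [insertTwo_apply, insertTwo_apply] at h1
  have h2 : ‖c‖ ^ 2 = c.re ^ 2 + c.im ^ 2 := by
    rw [← Complex.normSq_eq_norm_sq, Complex.normSq_apply]
    ring
  rw [← h2] at h1
  have h3 := contactVol_pullback hα (contMDiff_pr (ob := ob) (k := k)).contMDiffAt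
    (x := coverTube ob k (z, b)) (fun i : Fin (2 * n + 1 + 1 + 1) =>
      mfd (𝓘(ℝ, ℂ).prod (𝓡 (2 * n + 1))) (𝓡 (2 * (n + 1) + 1)) (coverTube ob k) (z, b)
        (diskFrame e i))
  refine h3.trans ((contactAlt_apply (n := n + 1) α _ _).symm.trans ?_)
  refine (congrArg (contactAlt (n := n + 1) α _) hframe).trans ?_
  rw [pr_coverTube hz1 b]
  refine h1.trans (congrArg _ (Eq.trans ?_ (contactAlt_apply (n := n + 1) α _ _)))
  exact congrArg (contactAlt (n := n + 1) α _) (map_diskFrame D e).symm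

variable [IsManifold (𝓡 (2 * n + 1)) ∞ B]

/-- Let `G (x, ε)` be the volume of the perturbed form on a coordinate frame. For `ε = 0` it is `‖k
zᵏ⁻¹‖²` times the volume of `α` at the image point, so `σ G` is nonnegative near the center. At the
center itself, where `df` kills the disk because `k ≥ 2`, it is linear in `ε`, and by `hpos` the
slope of `σ G` is positive. So `exists_pos_of_deriv_pos` applies to `σ G`. -/
theorem exists_contact_near_binding {α : OneForm (2 * (n + 1) + 1) N}
    (hα : IsContactForm (n + 1) α) {κ : ob.Cover k → ℝ}
    (hκ : ∀ m : ob.Cover k, m.pr ∈ ob.tube.target →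
      ContMDiffAt (𝓡 (2 * (n + 1) + 1)) 𝓘(ℝ, ℝ) ∞ κ m) (hk : 2 ≤ k) {b₀ : B} {c : ℝ}
    (hc : ∀ z : ℂ, ‖z‖ < 1 → κ (coverTube ob k (z, b₀)) = c)
    (hpos : 0 < c * ob.orientPairing α b₀ (stdFrame _)) :
    ∃ δ > 0, ∀ᶠ m in 𝓝 ((ob.coverBook k).incl b₀), ∀ ε : ℝ, 0 < ε → ε < δ →
      ∃ v, contactVol (n + 1) (fun m =>
        (OneForm.pullback pr α : OneForm (2 * (n + 1) + 1) (ob.Cover k)) m + ε • rotForm κ m) m v ≠ 0 := by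
  set e₀ := stdFrame (2 * n + 1)
  set ch := extChartAt (𝓡 (2 * n + 1)) b₀
  set x₀ : ℂ × EuclideanSpace ℝ (Fin (2 * n + 1)) := (0, ch b₀) with hx₀
  set p := (ob.coverBook k).tubeParam b₀ with hp
  set F : Fin (2 * (n + 1) + 1) → ℂ × EuclideanSpace ℝ (Fin (2 * n + 1)) :=
    (diskFrame e₀ : Fin (2 * n + 1 + 1 + 1) → _)
  set β₀ : OneForm (2 * (n + 1) + 1) (ob.Cover k) := OneForm.pullback pr α
  have hβ₀ : β₀.Smooth := hα.smooth.pullback contMDiff_pr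
  have hγ := smooth_rotForm hκ
  have hev := eventually_tubeParam (n := n) b₀
  have hps : ∀ᶠ x in 𝓝 x₀, ContMDiffAt 𝓘(ℝ, ℂ × EuclideanSpace ℝ (Fin (2 * n + 1)))
      (𝓡 (2 * (n + 1) + 1)) ∞ p x :=
    hev.mono fun x hx => contMDiffAt_tubeParam (hx.1.trans (by norm_num)) hx.2
  set G := familyVol (n := n + 1) β₀ (rotForm κ) p F with hG
  set σ := ob.tubeVol α b₀ e₀ with hσ
  have hsymm : ch.symm (ch b₀) = b₀ := extChartAt_to_inv b₀
  have hmem : ch b₀ ∈ ch.target := mem_extChartAt_target b₀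
  -- the derivative in `ε` at the center
  have h0 : ∀ ε, G (x₀, ε) = (n + 1) * (ε * (2 * c) *
      contactVol n (OneForm.pullback ob.incl α : OneForm (2 * n + 1) B) b₀ e₀) := by
    intro ε
    have hu : mfd (𝓡 (2 * (n + 1) + 1)) (𝓡 (2 * (n + 1) + 1)) pr ((ob.coverBook k).incl b₀)
        (mfd (𝓘(ℝ, ℂ).prod (𝓡 (2 * n + 1))) (𝓡 (2 * (n + 1) + 1)) (ob.coverBook k).tube (0, b₀)
          (1, 0)) = 0 := by
      refine (mfd_pr_coverTube (by simp) b₀ 1 0).trans ?_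
      rw [fderiv_planeMap_of_norm_lt NeZero.one_le (by simp), zero_pow (by omega), mul_zero,
        zero_mul, Prod.mk_zero_zero, map_zero]
    have h1 := contactVol_cover_binding hα.smooth hκ ε b₀ hu (v := mfd (𝓘(ℝ, ℂ).prod
      (𝓡 (2 * n + 1))) (𝓡 (2 * (n + 1) + 1)) (ob.coverBook k).tube (0, b₀) (Complex.I, 0)) e₀
    rw [extDBil_rotForm_disk hκ hc] at h1
    rw [← h1, hG, ← contactVol_add_smul (n := n + 1) hβ₀ hγ hps.self_of_nhds F ε]
    refine (contactAlt_apply (n := n + 1) _ _ _).symm.trans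
      (Eq.trans ?_ (contactAlt_apply (n := n + 1) _ _ _))
    have hpt : p x₀ = (ob.coverBook k).incl b₀ :=
      congrArg (fun b => (ob.coverBook k).tube (0, b)) hsymm
    rw [hpt]
    refine congrArg (contactAlt (n := n + 1) _ _) ?_
    have h2 := map_diskFrame (mfd (𝓘(ℝ, ℂ).prod (𝓡 (2 * n + 1))) (𝓡 (2 * (n + 1) + 1))
      (ob.coverBook k).tube (0, b₀)) e₀
    simp only [← mfd_incl] at h2
    refine Eq.trans ?_ h2
    funext i
    refine (mfd_tubeParam_diskFrame (ob := ob.coverBook k) (p := x₀) (by simp [hx₀]) hmem e₀ i).trans ?_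
    have h3 : mfd 𝓘(ℝ, EuclideanSpace ℝ (Fin (2 * n + 1))) (𝓡 (2 * n + 1)) ch.symm x₀.2 =
      ContinuousLinearMap.id ℝ _ := mfd_extChartAt_symm_self b₀
    rw [h3]
    change mfd _ _ (ob.coverBook k).tube (0, ch.symm (ch b₀)) (diskFrame e₀ i) = _
    rw [hsymm]
  -- the sign for `ε = 0`
  have hx : ∀ᶠ x in 𝓝 x₀, 0 ≤ σ * G (x, 0) := by
    set V : ℂ × EuclideanSpace ℝ (Fin (2 * n + 1)) → ℝ := fun y =>
      contactVol (n + 1) α (ob.tubeParam b₀ y) fun i => mfd 𝓘(ℝ, ℂ × EuclideanSpace ℝ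
        (Fin (2 * n + 1))) (𝓡 (2 * (n + 1) + 1)) (ob.tubeParam b₀) y (F i)
    have hV : ∀ y : ℂ × EuclideanSpace ℝ (Fin (2 * n + 1)), ‖y.1‖ < 1 → y.2 ∈ ch.target →
        V y = contactVol (n + 1) α (ob.tube (y.1, ch.symm y.2)) (fun i : Fin (2 * n + 1 + 1 + 1) =>
          mfd (𝓘(ℝ, ℂ).prod (𝓡 (2 * n + 1))) (𝓡 (2 * (n + 1) + 1)) ob.tube (y.1, ch.symm y.2)
            (diskFrame (fun j => mfd 𝓘(ℝ, EuclideanSpace ℝ (Fin (2 * n + 1))) (𝓡 (2 * n + 1))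
              ch.symm y.2 (e₀ j)) i)) := by
      intro y hy1 hy2
      exact congrArg (contactVol (n + 1) α (ob.tubeParam b₀ y))
        (funext fun i => mfd_tubeParam_diskFrame hy1 hy2 e₀ i)
    have hVc : ContinuousAt V x₀ := continuousAt_contactVol (n := n + 1) hα.smooth
      (hev.mono fun x hx => contMDiffAt_tubeParam (hx.1.trans (by norm_num)) hx.2) F
    have hV0 : V x₀ = σ := by
      rw [hV x₀ (by simp [hx₀]) hmem]
      have h3 : mfd 𝓘(ℝ, EuclideanSpace ℝ (Fin (2 * n + 1))) (𝓡 (2 * n + 1)) ch.symm x₀.2 =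
        ContinuousLinearMap.id ℝ _ := mfd_extChartAt_symm_self b₀
      rw [h3]
      change contactVol (n + 1) α (ob.tube (0, ch.symm (ch b₀))) (fun i : Fin (2 * n + 1 + 1 + 1) =>
        mfd (𝓘(ℝ, ℂ).prod (𝓡 (2 * n + 1))) (𝓡 (2 * (n + 1) + 1)) ob.tube (0, ch.symm (ch b₀))
          (diskFrame e₀ i)) = _
      rw [hsymm]
      rfl
    have hσ0 : σ ≠ 0 := by
      intro h
      rw [orientPairing, ← hσ, h] at hpos
      simp at hpos
    have hTc : Tendsto (fun x : ℂ × EuclideanSpace ℝ (Fin (2 * n + 1)) => (planeMap k x.1, x.2))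
        (𝓝 x₀) (𝓝 x₀) := by
      have h1 : ContinuousAt (fun x : ℂ × EuclideanSpace ℝ (Fin (2 * n + 1)) =>
          (planeMap k x.1, x.2)) x₀ :=
        (((contDiff_planeMap NeZero.one_le).continuous.comp continuous_fst).prodMk
          continuous_snd).continuousAt
      have h2 : (planeMap k x₀.1, x₀.2) = x₀ := by rw [hx₀, planeMap_zero NeZero.one_le]
      rw [ContinuousAt, h2] at h1
      exact h1
    have hVpos : ∀ᶠ y in 𝓝 x₀, 0 < σ * V y := by
      refine (continuousAt_const.mul hVc).eventually (lt_mem_nhds ?_)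
      change 0 < σ * V x₀
      rw [hV0]
      exact mul_self_pos.2 hσ0
    filter_upwards [hTc.eventually hVpos, hev, hps] with x hxV hx1 hx2
    have hlt : ‖x.1‖ < 1 := hx1.1.trans (by norm_num)
    have h1 : G (x, 0) = ‖(k * x.1 ^ (k - 1) : ℂ)‖ ^ 2 * V (planeMap k x.1, x.2) := by
      rw [hV (planeMap k x.1, x.2) (norm_planeMap_lt_one hlt) hx1.2]
      refine Eq.trans ?_ (contactVol_pullback_disk hα.smooth hx1.1 (ch.symm x.2) _)
      refine (contactVol_eq_familyVol hβ₀ hx2 F).symm.trans ?_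
      exact congrArg (contactVol (n + 1) β₀ (p x))
        (funext fun i => mfd_tubeParam_diskFrame (ob := ob.coverBook k) hlt hx1.2 e₀ i)
    rw [h1]
    nlinarith [mul_nonneg (sq_nonneg ‖(k * x.1 ^ (k - 1) : ℂ)‖) hxV.le]
  have hGs : ContDiffAt ℝ 1 (fun q => σ * G q) (x₀, 0) :=
    contDiffAt_const.mul ((contDiffAt_familyVol hβ₀ hγ hps.self_of_nhds F 0).of_le
      (by exact_mod_cast le_top))
  obtain ⟨δ, hδ, hpos'⟩ := exists_pos_of_deriv_pos (G := fun q => σ * G q) hGs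
    (c := 2 * (n + 1) * (c * ob.orientPairing α b₀ e₀)) (by positivity)
    (fun ε => by
      rw [h0, orientPairing, ← hσ]
      ring) hx
  refine ⟨δ, hδ, ?_⟩
  set ψ := (ob.coverBook k).tubeChart b₀ 1 le_rfl
  have hsrc : (ob.coverBook k).incl b₀ ∈ ψ.source := by
    refine ⟨tube_mem_target (by simp) b₀, ?_⟩
    rw [mem_preimage, incl, tube_symm_tube (by simp)]
    exact ⟨by simp, mem_extChartAt_source b₀⟩
  have hψ0 : ψ ((ob.coverBook k).incl b₀) = x₀ := by
    change (((ob.coverBook k).tube.symm ((ob.coverBook k).tube (0, b₀))).1,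
      ch ((ob.coverBook k).tube.symm ((ob.coverBook k).tube (0, b₀))).2) = x₀
    rw [tube_symm_tube (by simp)]
  have hψc : ContinuousAt ψ ((ob.coverBook k).incl b₀) :=
    (ψ.contMDiffOn_toFun.contMDiffAt (ψ.open_source.mem_nhds hsrc)).continuousAt
  have hψc' : Tendsto ψ (𝓝 ((ob.coverBook k).incl b₀)) (𝓝 x₀) := hψ0 ▸ hψc
  filter_upwards [hψc'.eventually hpos', hψc'.eventually hps, ψ.open_source.mem_nhds hsrc]
    with m hm1 hm2 hm3 ε hε hεδ
  have h2 := contactVol_add_smul (n := n + 1) hβ₀ hγ hm2 F ε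
  have h3 : p (ψ m) = m := ψ.left_inv' hm3
  rw [h3] at h2
  refine ⟨_, h2.trans_ne fun h => ?_⟩
  have h4 := hm1 ε hε hεδ
  change 0 < σ * G (ψ m, ε) at h4
  rw [hG, h, mul_zero] at h4
  exact lt_irrefl _ h4

end OpenBook

/-! ### The contact condition on the whole covering, and the sign of `dγ`. -/

namespace OpenBook

variable {n : ℕ} {N B : Type u}
  [TopologicalSpace N] [ChartedSpace (EuclideanSpace ℝ (Fin (2 * (n + 1) + 1))) N]
  [TopologicalSpace B] [ChartedSpace (EuclideanSpace ℝ (Fin (2 * n + 1))) B]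
  {ob : OpenBook n N B} {k : ℕ}

/-- Points of the binding are limits of points off it, along a radius of the normal disk, so that
orientations can be compared in the limit. -/
theorem neBot_compl_binding (b : B) : (𝓝[ob.bindingᶜ] (ob.incl b)).NeBot := by
  rw [← mem_closure_iff_nhdsWithin_neBot]
  have h1 : Tendsto (fun t : ℝ => ob.tube ((t : ℂ), b)) (𝓝[>] 0) (𝓝 (ob.incl b)) := by
    have h2 : ContinuousAt (fun t : ℝ => ob.tube ((t : ℂ), b)) 0 :=
      ContinuousAt.comp (g := ob.tube) (f := fun t : ℝ => ((t : ℂ), b))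
        (contMDiffAt_tube (by simp) b).continuousAt (by fun_prop)
    have h3 := h2.tendsto
    rw [Complex.ofReal_zero] at h3
    exact h3.mono_left nhdsWithin_le_nhds
  refine mem_closure_of_tendsto h1 ?_
  filter_upwards [Ioo_mem_nhdsGT (show (0 : ℝ) < 1 by norm_num)] with t ht
  have hn : ‖(t : ℂ)‖ < 1 := by
    rw [Complex.norm_real, Real.norm_of_nonneg ht.1.le]
    exact ht.2
  rw [mem_compl_iff, tube_mem_binding_iff hn]
  exact_mod_cast ht.1.ne'

variable [NeZero k]

open Cover

/-- The extension of a function on the binding to its neighbourhood in the branched covering. -/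
def coverExtend (η : B → ℝ) (m : ob.Cover k) : ℝ := η (ob.tube.symm m.pr).2

theorem coverExtend_coverTube [CompactSpace B] [T2Space N] [IsManifold (𝓡 (2 * (n + 1) + 1)) ∞ N]
    (η : B → ℝ) {z : ℂ} (hz : ‖z‖ < 1) (b : B) :
    coverExtend η (coverTube ob k (z, b)) = η b := by
  rw [coverExtend, pr_coverTube hz, tube_symm_tube (norm_planeMap_lt_one hz)]

variable [CompactSpace B] [T2Space N] [IsManifold (𝓡 (2 * (n + 1) + 1)) ∞ N]

theorem contMDiffAt_coverExtend {η : B → ℝ} (hη : ContMDiff (𝓡 (2 * n + 1)) 𝓘(ℝ, ℝ) ∞ η)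
    (m : ob.Cover k) (hm : m.pr ∈ ob.tube.target) :
    ContMDiffAt (𝓡 (2 * (n + 1) + 1)) 𝓘(ℝ, ℝ) ∞ (coverExtend η : ob.Cover k → ℝ) m :=
  hη.contMDiffAt.comp m (contMDiffAt_snd.comp m (ContMDiffAt.comp (g := ob.tube.symm) m
    (contMDiffAt_tube_symm hm) contMDiff_pr.contMDiffAt))

variable [IsManifold (𝓡 (2 * n + 1)) ∞ B]

/-- The forms `f^*α + εγ` are contact forms for small `ε`. -/
theorem exists_isContactForm_cover [CompactSpace N] {α : OneForm (2 * (n + 1) + 1) N}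
    (hα : IsContactForm (n + 1) α) {η : B → ℝ} (hη : ContMDiff (𝓡 (2 * n + 1)) 𝓘(ℝ, ℝ) ∞ η)
    (hpos : ∀ b, 0 < η b * ob.orientPairing α b (stdFrame _)) :
    ∃ ε₀ : ℝ, 0 < ε₀ ∧ ∀ ε : ℝ, 0 < ε → ε < ε₀ → IsContactForm (n + 1) (fun m =>
      (OneForm.pullback pr α : OneForm (2 * (n + 1) + 1) (ob.Cover k)) m +
        ε • rotForm (coverExtend η) m) := by
  have hκ := contMDiffAt_coverExtend (ob := ob) (k := k) hη
  have hβ₀ : OneForm.Smooth (OneForm.pullback pr α : OneForm (2 * (n + 1) + 1) (ob.Cover k)) :=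
    hα.smooth.pullback contMDiff_pr
  have hγ := smooth_rotForm hκ
  have hloc : ∀ m : ob.Cover k, ∃ δ > 0, ∀ᶠ m' in 𝓝 m, ∀ ε : ℝ, 0 < ε → ε < δ →
      ∃ v, contactVol (n + 1) (fun m =>
        (OneForm.pullback pr α : OneForm (2 * (n + 1) + 1) (ob.Cover k)) m +
          ε • rotForm (coverExtend η) m) m' v ≠ 0 := by
    intro m
    by_cases hm : m.pr ∈ ob.binding
    · have hm' : m ∈ (ob.coverBook k).binding := by
        rw [binding_coverBook]
        exact hm
      obtain ⟨b, rfl⟩ := hm'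
      rcases eq_or_ne k 1 with hk | hk
      · exact exists_contactVol_ne_zero_of_ne_zero hβ₀ hγ
          (exists_contactVol_pullback_ne_zero hα (mfd_pr_surjective_of_eq_one hk b))
      · have : 1 ≤ k := NeZero.one_le
        exact exists_contact_near_binding hα hκ (by omega)
          (fun z hz => coverExtend_coverTube η hz b) (hpos b)
    · exact exists_contactVol_ne_zero_of_ne_zero hβ₀ hγ
        (exists_contactVol_pullback_ne_zero hα (mfd_bijective (isLocalDiffeomorphAt_pr hm)).surjective)
  -- Compactness turns the local bounds on `ε` into a single one.
  obtain ⟨δ, hδ, h⟩ := isCompact_univ.induction_on (p := fun s : Set (ob.Cover k) =>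
      ∃ δ : ℝ, 0 < δ ∧ ∀ m ∈ s, ∀ ε : ℝ, 0 < ε → ε < δ → ∃ v, contactVol (n + 1) (fun m =>
        (OneForm.pullback pr α : OneForm (2 * (n + 1) + 1) (ob.Cover k)) m +
          ε • rotForm (coverExtend η) m) m v ≠ 0)
    ⟨1, one_pos, fun m hm => hm.elim⟩
    (fun s t hst ⟨δ, hδ, h⟩ => ⟨δ, hδ, fun m hm => h m (hst hm)⟩)
    (fun s t ⟨δ, hδ, h⟩ ⟨δ', hδ', h'⟩ => ⟨min δ δ', lt_min hδ hδ', fun m hm ε hε hεδ => by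
      rcases hm with hm | hm
      · exact h m hm ε hε (hεδ.trans_le (min_le_left _ _))
      · exact h' m hm ε hε (hεδ.trans_le (min_le_right _ _))⟩)
    (fun m _ => by
      obtain ⟨δ, hδ, h⟩ := hloc m
      exact ⟨_, mem_nhdsWithin_of_mem_nhds h, δ, hδ, fun m' hm' => hm'⟩)
  exact ⟨δ, hδ, fun ε hε hεδ =>
    ⟨hβ₀.add_smul hγ ε, fun m => h m (mem_univ m) ε hε hεδ⟩⟩

/-- Off the binding the frame is positive for `f^*α`, and the volume of `f^*α + sγ` has no zero for
`0 < s < ε₀`, so it stays positive. In the limit it is nonnegative at the binding, hence positive by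
the contact condition. By `contactVol_cover_binding` its value there is a positive multiple of
`dγ(u, v)`. -/
theorem extDBil_rotForm_pos {α : OneForm (2 * (n + 1) + 1) N}
    (hα : IsContactForm (n + 1) α) {κ : ob.Cover k → ℝ}
    (hκ : ∀ m : ob.Cover k, m.pr ∈ ob.tube.target →
      ContMDiffAt (𝓡 (2 * (n + 1) + 1)) 𝓘(ℝ, ℝ) ∞ κ m) {ε₀ : ℝ} (hε₀ : 0 < ε₀)
    (hc : ∀ ε : ℝ, 0 < ε → ε < ε₀ → IsContactForm (n + 1) (fun m =>
      (OneForm.pullback pr α : OneForm (2 * (n + 1) + 1) (ob.Cover k)) m + ε • rotForm κ m))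
    {b : B} {u v : EuclideanSpace ℝ (Fin (2 * (n + 1) + 1))}
    {e : Fin (2 * n + 1) → EuclideanSpace ℝ (Fin (2 * n + 1))}
    (hu : mfd (𝓡 (2 * (n + 1) + 1)) (𝓡 (2 * (n + 1) + 1)) pr ((ob.coverBook k).incl b) u = 0)
    (he : 0 < contactVol n (OneForm.pullback ob.incl α : OneForm (2 * n + 1) B) b e)
    (hframe : ∀ᶠ y in 𝓝[(ob.coverBook k).bindingᶜ] ((ob.coverBook k).incl b),
      0 < contactVol (n + 1) (OneForm.pullback pr α : OneForm (2 * (n + 1) + 1) (ob.Cover k)) y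
        (fun i : Fin (2 * n + 1 + 1 + 1) => mfd 𝓘(ℝ, EuclideanSpace ℝ (Fin (2 * (n + 1) + 1)))
          (𝓡 (2 * (n + 1) + 1)) (extChartAt (𝓡 (2 * (n + 1) + 1)) ((ob.coverBook k).incl b)).symm
          (extChartAt (𝓡 (2 * (n + 1) + 1)) ((ob.coverBook k).incl b) y)
          ((Fin.cons u (Fin.cons v fun i => mfd (𝓡 (2 * n + 1)) (𝓡 (2 * (n + 1) + 1))
            (ob.coverBook k).incl b (e i)) : Fin (2 * n + 1 + 1 + 1) → _) i))) :
    0 < (rotForm κ).extDBil ((ob.coverBook k).incl b) u v := by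
  set x := (ob.coverBook k).incl b with hx
  have hβ₀ : OneForm.Smooth (OneForm.pullback pr α : OneForm (2 * (n + 1) + 1) (ob.Cover k)) :=
    hα.smooth.pullback contMDiff_pr
  have hγ := smooth_rotForm hκ
  set F : Fin (2 * (n + 1) + 1) → EuclideanSpace ℝ (Fin (2 * (n + 1) + 1)) :=
    (Fin.cons u (Fin.cons v fun i => mfd (𝓡 (2 * n + 1)) (𝓡 (2 * (n + 1) + 1))
      (ob.coverBook k).incl b (e i)) : Fin (2 * n + 1 + 1 + 1) → _) with hF
  set ch := extChartAt (𝓡 (2 * (n + 1) + 1)) x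
  set G := familyVol (n := n + 1) (OneForm.pullback pr α : OneForm (2 * (n + 1) + 1) (ob.Cover k))
    (rotForm κ) ch.symm F with hG
  have hvol : ∀ y ∈ ch.source, ∀ ε, contactAlt (n := n + 1) (fun m =>
      (OneForm.pullback pr α : OneForm (2 * (n + 1) + 1) (ob.Cover k)) m + ε • rotForm κ m) y
        (fun i => mfd 𝓘(ℝ, EuclideanSpace ℝ (Fin (2 * (n + 1) + 1))) (𝓡 (2 * (n + 1) + 1)) ch.symm
          (ch y) (F i)) = G (ch y, ε) := by
    intro y hy ε
    have h := contactVol_add_smul hβ₀ hγ (contMDiffAt_extChartAt_symm x (ch.map_source hy)) F ε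
    rw [← contactAlt_apply, ch.left_inv hy] at h
    exact h
  have hvol0 : ∀ y ∈ ch.source, contactAlt (n := n + 1)
      (OneForm.pullback pr α : OneForm (2 * (n + 1) + 1) (ob.Cover k)) y
        (fun i => mfd 𝓘(ℝ, EuclideanSpace ℝ (Fin (2 * (n + 1) + 1))) (𝓡 (2 * (n + 1) + 1)) ch.symm
          (ch y) (F i)) = G (ch y, 0) := by
    intro y hy
    have h := contactVol_eq_familyVol (α' := rotForm κ) hβ₀
      (contMDiffAt_extChartAt_symm x (ch.map_source hy)) F
    rw [← contactAlt_apply, ch.left_inv hy] at h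
    exact h
  have hpos0 : ∀ᶠ y in 𝓝[(ob.coverBook k).bindingᶜ] x, 0 < G (ch y, 0) := by
    filter_upwards [hframe, mem_nhdsWithin_of_mem_nhds
      (extChartAt_source_mem_nhds (I := 𝓡 (2 * (n + 1) + 1)) x)] with y hy1 hy2
    rw [← hvol0 y hy2, contactAlt_apply]
    exact hy1
  have hpos : ∀ ε, 0 < ε → ε < ε₀ → ∀ᶠ y in 𝓝[(ob.coverBook k).bindingᶜ] x, 0 < G (ch y, ε) := by
    intro ε hε hεε
    filter_upwards [hpos0, mem_nhdsWithin_of_mem_nhds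
      (extChartAt_source_mem_nhds (I := 𝓡 (2 * (n + 1) + 1)) x)] with y hy1 hy2
    have hcont : Continuous fun s : ℝ => G (ch y, s) := by
      rw [continuous_iff_continuousAt]
      intro s
      exact ContinuousAt.comp (g := G) (f := fun s : ℝ => (ch y, s))
        (contDiffAt_familyVol hβ₀ hγ (contMDiffAt_extChartAt_symm x (ch.map_source hy2))
          F s).continuousAt (by fun_prop)
    have hind := linearIndependent_of_contactVol_ne_zero
      (((contactAlt_apply _ _ _).symm.trans (hvol0 y hy2)).trans_ne hy1.ne')
    by_contra! hle
    obtain ⟨s, hs, hs0⟩ := intermediate_value_Icc' hε.le hcont.continuousOn ⟨hle, hy1.le⟩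
    have hs1 : 0 < s := lt_of_le_of_ne hs.1 fun h => hy1.ne' (h ▸ hs0)
    refine contactVol_ne_zero_of_linearIndependent (hc s hs1 (hs.2.trans_lt hεε)) y hind ?_
    rw [← contactAlt_apply, hvol y hy2]
    exact hs0
  have hne := neBot_compl_binding (ob := ob.coverBook k) b
  obtain ⟨y, hy, hys⟩ := (hpos0.and (mem_nhdsWithin_of_mem_nhds
      (extChartAt_source_mem_nhds (I := 𝓡 (2 * (n + 1) + 1)) x))).exists
  -- For `k ≥ 2` the volume of `f^*α` vanishes at the binding, so independence of the frame is read
  -- off at a nearby point.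
  have hFind : LinearIndependent ℝ F := (linearIndependent_of_contactVol_ne_zero
    (((contactAlt_apply _ _ _).symm.trans (hvol0 y hys)).trans_ne hy.ne')).of_comp
      (mfd 𝓘(ℝ, EuclideanSpace ℝ (Fin (2 * (n + 1) + 1))) (𝓡 (2 * (n + 1) + 1)) ch.symm
          (ch y)).toLinearMap
  set ε := ε₀ / 2
  have hε : 0 < ε := by positivity
  have hεε : ε < ε₀ := half_lt_self hε₀
  have hxs : x ∈ ch.source := mem_extChartAt_source x
  have hGx : G (ch x, ε) = contactVol (n + 1) (fun m =>
      (OneForm.pullback pr α : OneForm (2 * (n + 1) + 1) (ob.Cover k)) m + ε • rotForm κ m) x F := by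
    rw [← hvol x hxs ε, ← contactAlt_apply, mfd_extChartAt_symm_self]
    rfl
  have hge : 0 ≤ G (ch x, ε) := by
    have hcont : ContinuousAt (fun y => G (ch y, ε)) x :=
      ContinuousAt.comp (g := G) (f := fun y => (ch y, ε))
        (contDiffAt_familyVol hβ₀ hγ (contMDiffAt_extChartAt_symm x (ch.map_source hxs))
          F ε).continuousAt ((continuousAt_extChartAt x).prodMk continuousAt_const)
    exact ge_of_tendsto (hcont.tendsto.mono_left nhdsWithin_le_nhds)
      ((hpos ε hε hεε).mono fun y hy => hy.le)
  have hgt : 0 < G (ch x, ε) := lt_of_le_of_ne hge (by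
    rw [hGx]
    exact (contactVol_ne_zero_of_linearIndependent (hc ε hε hεε) x hFind).symm)
  rw [hGx, hF, contactVol_cover_binding hα.smooth hκ ε b hu e] at hgt
  by_contra! hle
  have : ε * (rotForm κ).extDBil x u v *
      contactVol n (OneForm.pullback ob.incl α : OneForm (2 * n + 1) B) b e ≤ 0 :=
    mul_nonpos_of_nonpos_of_nonneg (mul_nonpos_of_nonneg_of_nonpos hε.le hle) he.le
  nlinarith

/-- The positivity of `dγ` on the kernel of `df`. -/
theorem isPositiveOnKer_rotForm {α : OneForm (2 * (n + 1) + 1) N}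
    (hα : IsContactForm (n + 1) α) {κ : ob.Cover k → ℝ}
    (hκ : ∀ m : ob.Cover k, m.pr ∈ ob.tube.target →
      ContMDiffAt (𝓡 (2 * (n + 1) + 1)) 𝓘(ℝ, ℝ) ∞ κ m) {ε₀ : ℝ} (hε₀ : 0 < ε₀)
    (hc : ∀ ε : ℝ, 0 < ε → ε < ε₀ → IsContactForm (n + 1) (fun m =>
      (OneForm.pullback pr α : OneForm (2 * (n + 1) + 1) (ob.Cover k)) m + ε • rotForm κ m)) :
    IsPositiveOnKer (pr : ob.Cover k → N) α (ob.coverBook k) (rotForm κ) := by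
  intro b u v e hu _ he hframe
  have h0 : (fun m => (OneForm.pullback pr α : OneForm (2 * (n + 1) + 1) (ob.Cover k)) m +
      (0 : ℝ) • rotForm κ m) = OneForm.pullback pr α := by
    funext m
    rw [zero_smul, add_zero]
  -- With `ε = 0` this identifies the orientation of the branching locus by `f^*α` with that of `B`
  -- by `α`.
  have h1 := pullback_incl_cover α κ 0
  rw [h0] at h1
  rw [h1] at he
  exact extDBil_rotForm_pos hα hκ hε₀ hc hu he hframe

end OpenBook

/-! ### Supported contact structures. -/

namespace OpenBook

variable {n : ℕ} {N B : Type u}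
  [TopologicalSpace N] [ChartedSpace (EuclideanSpace ℝ (Fin (2 * (n + 1) + 1))) N]
  [IsManifold (𝓡 (2 * (n + 1) + 1)) ∞ N]
  [TopologicalSpace B] [ChartedSpace (EuclideanSpace ℝ (Fin (2 * n + 1))) B]
  {ob : OpenBook n N B} {k : ℕ}

/-- Two contact forms with the same kernel differ by a nowhere vanishing function. Its sign is not
controlled, and only `h ≠ 0` is used. -/
theorem Supports.exists_isAdapted {α : OneForm (2 * (n + 1) + 1) N} (h : ob.Supports α)
    (hα : IsContactForm (n + 1) α) : ∃ (α' : OneForm (2 * (n + 1) + 1) N) (h : N → ℝ),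
      ob.IsAdapted α' ∧ ContMDiff (𝓡 (2 * (n + 1) + 1)) 𝓘(ℝ, ℝ) ∞ h ∧ (∀ x, h x ≠ 0) ∧
        ∀ x, α x = h x • α' x := by
  obtain ⟨α', hα', hker⟩ := h
  obtain ⟨h, hsmooth, hne, heq⟩ := exists_conformal_factor hα hα'.contact hker
  exact ⟨α', h, hα', hsmooth, hne, heq⟩

/-- A form defining a supported contact structure restricts to a contact form on the binding. -/
theorem Supports.binding_contact [IsManifold (𝓡 (2 * n + 1)) ∞ B]
    {α : OneForm (2 * (n + 1) + 1) N} (h : ob.Supports α) (hα : IsContactForm (n + 1) α) :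
    IsContactForm n (OneForm.pullback ob.incl α : OneForm (2 * n + 1) B) := by
  obtain ⟨α', h, hα', hh, h0, heq⟩ := h.exists_isAdapted hα
  have h1 := hα'.binding_contact.smul (h := fun b => h (ob.incl b)) (hh.comp contMDiff_incl)
    (fun b => h0 _)
  have h2 : (OneForm.pullback ob.incl α : OneForm (2 * n + 1) B) =
      fun b => h (ob.incl b) • (OneForm.pullback ob.incl α' : OneForm (2 * n + 1) B) b := by
    funext b
    unfold OneForm.pullback
    rw [heq]
    rfl
  rw [h2]
  exact h1

variable [NeZero k] [CompactSpace B] [T2Space N]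

open Cover

/-- The contact structure of the contact branched covering is supported by the lifted open book. -/
theorem Supports.cover {α : OneForm (2 * (n + 1) + 1) N} (h : ob.Supports α)
    (hα : IsContactForm (n + 1) α) {κ : ob.Cover k → ℝ}
    (hκ : ∀ m : ob.Cover k, m.pr ∈ ob.tube.target →
      ContMDiffAt (𝓡 (2 * (n + 1) + 1)) 𝓘(ℝ, ℝ) ∞ κ m) {ε : ℝ}
    (hc : IsContactForm (n + 1) (fun m =>
      (OneForm.pullback pr α : OneForm (2 * (n + 1) + 1) (ob.Cover k)) m + ε • rotForm κ m)) :
    (ob.coverBook k).Supports (fun m =>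
      (OneForm.pullback pr α : OneForm (2 * (n + 1) + 1) (ob.Cover k)) m + ε • rotForm κ m) := by
  obtain ⟨α', h, hα', hh, h0, heq⟩ := h.exists_isAdapted hα
  have hg : ContMDiff (𝓡 (2 * (n + 1) + 1)) 𝓘(ℝ, ℝ) ∞ (fun m : ob.Cover k => (h m.pr)⁻¹) := by
    intro m
    have h1 : ContMDiffAt 𝓘(ℝ, ℝ) 𝓘(ℝ, ℝ) ∞ (fun t : ℝ => t⁻¹) (h m.pr) :=
      (contDiffAt_inv ℝ (h0 m.pr)).contMDiffAt
    exact h1.comp m ((hh.comp contMDiff_pr).contMDiffAt)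
  have hg0 : ∀ m : ob.Cover k, (h m.pr)⁻¹ ≠ 0 := fun m => inv_ne_zero (h0 _)
  -- Division by `h ∘ f` gives a form of the same shape for the adapted `α'`, with coefficient `κ /
  -- h`. The sign of that coefficient does not matter: `IsAdapted.cover` asks only for the contact
  -- condition, which survives the division.
  have hforms : (fun m => (h m.pr)⁻¹ •
      ((OneForm.pullback pr α : OneForm (2 * (n + 1) + 1) (ob.Cover k)) m + ε • rotForm κ m)) =
      fun m => (OneForm.pullback pr α' : OneForm (2 * (n + 1) + 1) (ob.Cover k)) m +
        ε • rotForm (fun m => (h m.pr)⁻¹ * κ m) m := by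
    funext m
    have h1 : (OneForm.pullback pr α : OneForm (2 * (n + 1) + 1) (ob.Cover k)) m =
        h m.pr • (OneForm.pullback pr α' : OneForm (2 * (n + 1) + 1) (ob.Cover k)) m := by
      unfold OneForm.pullback
      rw [heq]
      rfl
    rw [rotForm_mul, h1, smul_add, smul_smul, inv_mul_cancel₀ (h0 _), one_smul, smul_comm]
  have hc' := hc.smul hg hg0
  rw [hforms] at hc'
  refine ⟨_, hα'.cover (κ := fun m => (h m.pr)⁻¹ * κ m)
    (fun m hm => hg.contMDiffAt.mul (hκ m hm)) hc', fun m v => ?_⟩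
  have h2 := congrFun hforms m
  rw [← h2]
  change (h m.pr)⁻¹ * _ = 0 ↔ _
  rw [mul_eq_zero, or_iff_right (hg0 m)]
  rfl

end OpenBook

end ContactOpenBook

end

/-! ### Assembly of the theorem. -/

theorem mainTheorem3 (n k : ℕ) (hk : 1 ≤ k) (N B : Type u)
    [TopologicalSpace N] [ChartedSpace (EuclideanSpace ℝ (Fin (2 * (n + 1) + 1))) N]
    [IsManifold (𝓡 (2 * (n + 1) + 1)) ∞ N] [CompactSpace N] [T2Space N]
    [TopologicalSpace B] [ChartedSpace (EuclideanSpace ℝ (Fin (2 * n + 1))) B]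
    [IsManifold (𝓡 (2 * n + 1)) ∞ B] [CompactSpace B] [T2Space B]
    (ob : ContactOpenBook.OpenBook n N B)
    (α : ContactOpenBook.OneForm (2 * (n + 1) + 1) N)
    (hα : ContactOpenBook.IsContactForm (n + 1) α) (hsupp : ob.Supports α) :
    -- the complement of the binding is the mapping torus of some diffeomorphism
    (∃ (P : Type u) (_ : TopologicalSpace P)
      (_ : ChartedSpace (EuclideanSpace ℝ (Fin (2 * (n + 1)))) P)
      (_ : IsManifold (𝓡 (2 * (n + 1))) ∞ P) (Φ : Equiv.Perm P) (q : ℝ × P → N),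
      ob.IsMappingTorus Φ q) ∧
    -- the branched covering, with the open book on it
    ∃ (M : Type u) (_ : TopologicalSpace M)
      (_ : ChartedSpace (EuclideanSpace ℝ (Fin (2 * (n + 1) + 1))) M)
      (_ : IsManifold (𝓡 (2 * (n + 1) + 1)) ∞ M) (_ : CompactSpace M) (_ : T2Space M)
      (f : M → N) (obM : ContactOpenBook.OpenBook n M B) (g : ℝ → ℝ),
      ContactOpenBook.IsCyclicBranchedCover n k f ob.binding ∧
      obM.binding = f ⁻¹' ob.binding ∧
      (∀ x, x ∉ obM.binding → obM.θ x ^ k = ob.θ (f x)) ∧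
      -- near the binding, `M` is `𝔻² × B` and `f` is `(r exp(iφ), b) ↦ (g(r) exp(ikφ), b)`
      (ContDiff ℝ ∞ g ∧ StrictMonoOn g (Ici 0) ∧ (∀ᶠ r in 𝓝[≥] (0 : ℝ), g r = r ^ k) ∧
        (∃ δ : ℝ, δ < 1 ∧ ∀ r, δ < r → g r = r) ∧
        ∀ (z : ℂ) (b : B), ‖z‖ < 1 →
          f (obM.tube (z, b)) = ob.tube ((g ‖z‖ : ℂ) * (z / (‖z‖ : ℂ)) ^ k, b)) ∧
      -- off the binding, if `N` is the mapping torus of `Φ`, then `M` is the one of `Φ ^ k`, with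
      -- `f [t, p] = [k t, p]`, and `𝔻² × B` is glued in along the corresponding points
      (∀ (P : Type u) [TopologicalSpace P]
        [ChartedSpace (EuclideanSpace ℝ (Fin (2 * (n + 1)))) P]
        [IsManifold (𝓡 (2 * (n + 1))) ∞ P] (Φ : Equiv.Perm P) (q : ℝ × P → N),
        ob.IsMappingTorus Φ q → ∃ q' : ℝ × P → M,
          obM.IsMappingTorus (Φ ^ k) q' ∧
          (∀ (t : ℝ) (p : P), f (q' (t, p)) = q (k * t, p)) ∧
          ∀ (p : P) (b : B) (r : ℝ), 0 < r → r < 1 →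
            (∀ t : ℝ, q (t, p) =
              ob.tube ((g r : ℂ) * (Circle.exp (2 * Real.pi * t) : ℂ), b)) →
            ∀ t : ℝ, q' (t, p) =
              obM.tube ((r : ℂ) * (Circle.exp (2 * Real.pi * t) : ℂ), b)) ∧
      -- the contact structure of the contact branched covering is supported by the open book
      ∃ γ : ContactOpenBook.OneForm (2 * (n + 1) + 1) M,
        ContactOpenBook.OneForm.Smooth γ ∧
        ContactOpenBook.IsPositiveOnKer f α obM γ ∧
        ∃ ε₀ : ℝ, 0 < ε₀ ∧ ∀ ε : ℝ, 0 < ε → ε < ε₀ →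
          ContactOpenBook.IsContactForm (n + 1)
            (fun x => ContactOpenBook.OneForm.pullback f α x + ε • γ x) ∧
          obM.Supports (fun x => ContactOpenBook.OneForm.pullback f α x + ε • γ x) ∧
          (ob.IsAdapted α →
            obM.IsAdapted (fun x => ContactOpenBook.OneForm.pullback f α x + ε • γ x)) := by
  have : NeZero k := ⟨by omega⟩
  -- `η` carries the sign that the coefficient of `x dy - y dx` must have along the binding; it
  -- becomes the `κ` of the rotation form, extended over the tube.
  obtain ⟨η, hη, hpos⟩ :=
    ContactOpenBook.OpenBook.exists_orientation hα (hsupp.binding_contact hα)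
  obtain ⟨ε₀, hε₀, hc⟩ := ContactOpenBook.OpenBook.exists_isContactForm_cover (k := k) hα hη
    fun b => hpos b _ (ContactOpenBook.linearIndependent_stdFrame _)
  have hκ := ContactOpenBook.OpenBook.contMDiffAt_coverExtend (ob := ob) (k := k) hη
  refine ⟨ContactOpenBook.exists_isMappingTorus ob, ob.Cover k, inferInstance, inferInstance,
    inferInstance, inferInstance, inferInstance, ContactOpenBook.OpenBook.Cover.pr, ob.coverBook k,
    ContactOpenBook.profile k, ContactOpenBook.OpenBook.Cover.isCyclicBranchedCover_pr,
    ContactOpenBook.OpenBook.binding_coverBook, ?_, ⟨ContactOpenBook.contDiff_profile,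
      ContactOpenBook.strictMonoOn_profile hk, ?_, ⟨1 / 2, by norm_num, fun r hr =>
        ContactOpenBook.profile_eq_self hr.le⟩, fun z b hz =>
        ContactOpenBook.OpenBook.Cover.pr_coverTube hz b⟩, ?_,
    ContactOpenBook.OpenBook.Cover.rotForm (ContactOpenBook.OpenBook.coverExtend η),
    ContactOpenBook.OpenBook.Cover.smooth_rotForm hκ,
    ContactOpenBook.OpenBook.isPositiveOnKer_rotForm hα hκ hε₀ hc, ε₀, hε₀, fun ε hε hεε =>
      ⟨hc ε hε hεε, hsupp.cover hα hκ (hc ε hε hεε), fun had => had.cover hκ (hc ε hε hεε)⟩⟩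
  · intro m hm
    rw [ContactOpenBook.OpenBook.binding_coverBook] at hm
    exact ContactOpenBook.OpenBook.Cover.angle_pow hm
  · filter_upwards [mem_nhdsWithin_of_mem_nhds
      (Iic_mem_nhds (show (0 : ℝ) < 1 / 4 by norm_num))] with r hr
    exact ContactOpenBook.profile_eq_pow hr
  · intro P _ _ _ Φ q hq
    exact ⟨_, hq.cover, fun t p => ContactOpenBook.OpenBook.Cover.pr_polar _ _,
      fun p b r hr hr1 h t => ContactOpenBook.OpenBook.polar_eq_coverTube hr hr1 h t⟩
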